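/- **Notation.** Let $\operatorname{Im}\tau,\operatorname{Im}\sigma>0$, $\theta(z,\tau)=-\sum_{n\in\mathbb Z+1/2}e^{\pi i(n^2\tau+n(2z+1))}$ (with $\theta'$ its derivative in $z$), and $$\Omega_{a}(t,\tau,\sigma)=\prod_{j,k=0}^\infty\frac{(1-e^{2\pi i(t-a+j\tau+k\sigma)})(1-e^{2\pi i(-t-a+(j+1)\tau+(k+1)\sigma)})}{(1-e^{2\pi i(t+a+j\tau+k\sigma)})(1-e^{2\pi i(-t+a+(j+1)\tau+(k+1)\sigma)})}.$$ For $\operatorname{Im}\eta>0$ put $$u(\lambda,\mu,\tau,\sigma,\eta)=e^{-\frac{\pi i\lambda\mu}{2\eta}}\int_0^1\Omega_{2\eta}(t,\tau,\sigma)\frac{\theta(\lambda+t,\tau)\,\theta(\mu+t,\sigma)}{\theta(t-2\eta,\tau)\,\theta(t-2\eta,\sigma)}\,dt ,$$ and define $u$ for all other $\eta$ with $4\eta+r+m\tau+n\sigma\ne0$ ($r\in\mathbb Z$, $m,n\in\mathbb Z_{\ge0}$) by analytic continuation in $\eta$. Let $$Q(\mu,\sigma,\eta)=\frac{\theta(4\eta,\sigma)\,\theta'(0,\sigma)}{\theta(\mu-2\eta,\sigma)\,\theta(\mu+2\eta,\sigma)}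 .$$ For an integer $\kappa\ge4$, an integer $l$ with $2\le l\le\kappa-2$, and $\operatorname{Im}\eta<0$, the $l$-th hypergeometric theta function of level $\kappa+2$ is $\Delta_{l,\kappa}(\lambda,\tau,\eta)=\widetilde\Delta_{l,\kappa}(\lambda,\tau,\eta)-\widetilde\Delta_{l,\kappa}(-\lambda,\tau,\eta)$, where $$\widetilde\Delta_{l,\kappa}(\lambda,\tau,\eta)=\sum_{j\in2\kappa\mathbb Z+l}u(\lambda,2\eta j,\tau,-2\eta\kappa,\eta)\,Q(2\eta j,-2\eta\kappa,\eta)\,e^{\pi i\frac{\tau+4\eta}{2\kappa}j^2}.$$ **Theorem.** Let $\kappa\ge4$ be an integer, $\operatorname{Im}\tau>0$, $\operatorname{Im}\eta<0$, and assume $j\tau+4\eta\notin\mathbb Z$ for all $j=1,2,\dots$. Let $2\le l\le\kappa-2$. Then for every $\lambda\in\mathbb C$ the series $\widetilde\Delta_{l,\kappa}(\lambda,\tau,\eta)$ converges absolutely, and the following hold for all $\lambda\in\mathbb C$. (i) $\Delta_{l,\kappa}(\lambda,\tau+1,\eta)=e^{\frac{\pi i}{2\kappa}l^2}\,\Delta_{l,\kappa}(\lambda,\tau,\eta)$.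 (ii) If $\operatorname{Im}(\eta/\tau)<0$, then $$C^-(\tau,\eta)\,e^{-\frac{\pi i}{2\tau}(\kappa+2)\lambda^2}\,\Delta_{l,\kappa}\!\left(\frac\lambda\tau,-\frac1\tau,\frac\eta\tau\right)=\sum_{j=2}^{\kappa-2}\Delta_{j,\kappa}(\lambda,\tau,\eta)\,S^-_{j,l}(\tau,\eta).$$ (iii) If $\operatorname{Im}(\eta/\tau)>0$, then $$C^+(\tau,\eta)\,e^{-\frac{\pi i}{2\tau}(\kappa+2)\lambda^2}\,\Delta_{l,\kappa}\!\left(\frac\lambda\tau,-\frac1\tau,-\frac\eta\tau\right)=\sum_{j=2}^{\kappa-2}\Delta_{j,\kappa}(\lambda,\tau,\eta)\,S^+_{j,l}(\tau,\eta).$$ Here, with upper signs for $+$ and lower signs for $-$, $$S^{\pm}_{j,l}(\tau,\eta)=Q\!\left(\tfrac l\kappa,\mp\tfrac{\tau}{2\eta\kappa},\pm\tfrac1{2\kappa}\right)\left(u\!\left(\tfrac j\kappa,-\tfrac l\kappa,\tfrac1{2\eta\kappa},\mp\tfrac\tau{2\eta\kappa},\pm\tfrac1{2\kappa}\right)-u\!\left(\tfrac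 j\kappa,\tfrac l\kappa,\tfrac1{2\eta\kappa},\mp\tfrac\tau{2\eta\kappa},\pm\tfrac1{2\kappa}\right)\right),$$ $$C^{\pm}(\tau,\eta)=\pm2\pi i\,\sqrt{\frac{2\kappa i}{\tau}}\;\exp\!\left(\pi i\frac{2\eta}{\kappa}+\frac{\pi i}{\tau}4\eta^2\Bigl(1\pm\frac1{2\eta\kappa}\Bigr)+\frac{\pi i}{6\kappa\tau}\,\psi(\mp\tau,\pm2\eta\kappa)\right),$$ $$\psi(\tau,p)=2\,(8\eta^2+\tau^2+p^2-3p+3\tau+3\tau p+1),$$ and the square root is the one with positive real part. -/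

import Mathlib

namespace HypTheta

noncomputable section

open Complex

/-- Jacobi's first theta function
`θ(z, τ) = - ∑_{n ∈ ℤ + 1/2} exp (π i (n² τ + n (2 z + 1)))`. -/
def theta (z τ : ℂ) : ℂ :=
  -∑' n : ℤ, exp (Real.pi * I *
    (((n : ℂ) + 1 / 2) ^ 2 * τ + ((n : ℂ) + 1 / 2) * (2 * z + 1)))

/-- The phase function `Ω_a(t, τ, σ)`, a double infinite product over `j, k ≥ 0`. -/
def Omega (a t τ σ : ℂ) : ℂ :=
  ∏' p : ℕ × ℕ,
    ((1 - exp (2 * Real.pi * I * (t - a + p.1 * τ + p.2 * σ))) *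
      (1 - exp (2 * Real.pi * I * (-t - a + (p.1 + 1) * τ + (p.2 + 1) * σ)))) /
    ((1 - exp (2 * Real.pi * I * (t + a + p.1 * τ + p.2 * σ))) *
      (1 - exp (2 * Real.pi * I * (-t + a + (p.1 + 1) * τ + (p.2 + 1) * σ))))

/-- The integrand of the elliptic hypergeometric integral. -/
def integrand (lam mu τ σ η t : ℂ) : ℂ :=
  Omega (2 * η) t τ σ * (theta (lam + t) τ * theta (mu + t) σ) /
    (theta (t - 2 * η) τ * theta (t - 2 * η) σ)

/-- The elliptic hypergeometric integral over `[0, 1]`, which is the value of `u` as long as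
`Im η > 0`. -/
def uUpper (lam mu τ σ η : ℂ) : ℂ :=
  exp (-(Real.pi * I * lam * mu) / (2 * η)) *
    ∫ t in (0 : ℝ)..1, integrand lam mu τ σ η (t : ℂ)

/-- The values of `η` at which `u` may have poles: `4 η + l + m τ + n σ = 0` with `l ∈ ℤ` and
`m, n ∈ ℤ_{≥ 0}`. -/
def polarSet (τ σ : ℂ) : Set ℂ :=
  {η | ∃ (l : ℤ) (m n : ℕ), 4 * η + l + m * τ + n * σ = 0}

/-- `F` is the analytic continuation in `η` of the hypergeometric integral from the upper half
plane to the complement of the polar set. -/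
def IsContinuation (lam mu τ σ : ℂ) (F : ℂ → ℂ) : Prop :=
  AnalyticOnNhd ℂ F (polarSet τ σ)ᶜ ∧ ∀ η : ℂ, 0 < η.im → F η = uUpper lam mu τ σ η

/-- The elliptic hypergeometric function `u(λ, μ, τ, σ, η)`, for `Im τ, Im σ > 0` and `η` outside
the polar set: the analytic continuation of the hypergeometric integral. Its values there are
determined by `IsContinuation`, see `IsContinuation.eqOn`. -/
def u (lam mu τ σ η : ℂ) : ℂ :=
  Classical.epsilon (IsContinuation lam mu τ σ) η

/-- `Q(μ, σ, η) = θ(4η, σ) θ'(0, σ) / (θ(μ - 2η, σ) θ(μ + 2η, σ))`. -/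
def Q (mu σ η : ℂ) : ℂ :=
  theta (4 * η) σ * deriv (fun z => theta z σ) 0 /
    (theta (mu - 2 * η) σ * theta (mu + 2 * η) σ)

/-- The `j`-th term `u(λ, 2ηj, τ, -2ηκ, η) Q(2ηj, -2ηκ, η) exp (π i (τ + 4η) j² / (2κ))`. -/
def term (κ j : ℤ) (lam τ η : ℂ) : ℂ :=
  u lam (2 * η * j) τ (-2 * η * κ) η * Q (2 * η * j) (-2 * η * κ) η *
    exp (Real.pi * I * ((τ + 4 * η) / (2 * κ)) * (j : ℂ) ^ 2)

/-- The non-symmetric hypergeometric theta function: the sum of the terms over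
`j ∈ 2κℤ + l`. -/
def DeltaTilde (l κ : ℤ) (lam τ η : ℂ) : ℂ :=
  ∑' m : ℤ, term κ (2 * κ * m + l) lam τ η

/-- The `l`-th hypergeometric theta function of level `κ + 2`. -/
def Delta (l κ : ℤ) (lam τ η : ℂ) : ℂ :=
  DeltaTilde l κ lam τ η - DeltaTilde l κ (-lam) τ η

/-- `ψ(τ, p)`, with its dependence on `η` made explicit. -/
def psi (τ p η : ℂ) : ℂ :=
  2 * (8 * η ^ 2 + τ ^ 2 + p ^ 2 - 3 * p + 3 * τ + 3 * τ * p + 1)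

/-- The constant `C⁻(τ, η)`; the power `1/2` is the principal square root, which has positive
real part here. -/
def CMinus (κ : ℤ) (τ η : ℂ) : ℂ :=
  -(2 * Real.pi * I) * (2 * κ * I / τ) ^ (1 / 2 : ℂ) *
    exp (Real.pi * I * (2 * η / κ) +
      Real.pi * I / τ * (4 * η ^ 2) * (1 - 1 / (2 * η * κ)) +
      Real.pi * I / (6 * κ * τ) * psi τ (-2 * η * κ) η)

/-- The constant `C⁺(τ, η)`; the power `1/2` is the principal square root, which has positive
real part here. -/
def CPlus (κ : ℤ) (τ η : ℂ) : ℂ :=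
  2 * Real.pi * I * (2 * κ * I / τ) ^ (1 / 2 : ℂ) *
    exp (Real.pi * I * (2 * η / κ) +
      Real.pi * I / τ * (4 * η ^ 2) * (1 + 1 / (2 * η * κ)) +
      Real.pi * I / (6 * κ * τ) * psi (-τ) (2 * η * κ) η)

/-- The matrix `S⁻_{j,l}(τ, η)`. -/
def SMinus (κ j l : ℤ) (τ η : ℂ) : ℂ :=
  Q (l / κ) (τ / (2 * η * κ)) (-1 / (2 * κ)) *
    (u (j / κ) (-(l / κ)) (1 / (2 * η * κ)) (τ / (2 * η * κ)) (-1 / (2 * κ)) -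
      u (j / κ) (l / κ) (1 / (2 * η * κ)) (τ / (2 * η * κ)) (-1 / (2 * κ)))

/-- The matrix `S⁺_{j,l}(τ, η)`. -/
def SPlus (κ j l : ℤ) (τ η : ℂ) : ℂ :=
  Q (l / κ) (-(τ / (2 * η * κ))) (1 / (2 * κ)) *
    (u (j / κ) (-(l / κ)) (1 / (2 * η * κ)) (-(τ / (2 * η * κ))) (1 / (2 * κ)) -
      u (j / κ) (l / κ) (1 / (2 * η * κ)) (-(τ / (2 * η * κ))) (1 / (2 * κ)))

/-- The polar set is countable. -/
theorem polarSet_countable (τ σ : ℂ) : (polarSet τ σ).Countable := by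
  refine (Set.countable_range
    (fun p : ℤ × ℕ × ℕ => -((p.1 : ℂ) + p.2.1 * τ + p.2.2 * σ) / 4)).mono ?_
  rintro η ⟨l, m, n, h⟩
  refine ⟨(l, m, n), ?_⟩
  simp only
  linear_combination (-1 / 4 : ℂ) * h

/-- The continuation is unique, so that `u` is well defined off the polar set. -/
theorem IsContinuation.eqOn {lam mu τ σ : ℂ} (hτ : 0 < τ.im) (hσ : 0 < σ.im) {F G : ℂ → ℂ}
    (hF : IsContinuation lam mu τ σ F) (hG : IsContinuation lam mu τ σ G) :
    Set.EqOn F G (polarSet τ σ)ᶜ := by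
  have hconn : IsPreconnected (polarSet τ σ)ᶜ :=
    ((polarSet_countable τ σ).isPathConnected_compl_of_one_lt_rank
      (by simp)).isConnected.isPreconnected
  have hI : I ∈ (polarSet τ σ)ᶜ := by
    rintro ⟨l, m, n, h⟩
    have h' := congrArg Complex.im h
    simp at h'
    have h1 : 0 ≤ (m : ℝ) * τ.im := by positivity
    have h2 : 0 ≤ (n : ℝ) * σ.im := by positivity
    linarith
  refine hF.1.eqOn_of_preconnected_of_eventuallyEq hG.1 hconn hI ?_
  have hopen : {z : ℂ | 0 < z.im} ∈ nhds I :=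
    (isOpen_lt continuous_const Complex.continuous_im).mem_nhds (by simp)
  filter_upwards [hopen] with z hz
  rw [hF.2 z hz, hG.2 z hz]

end

end HypTheta

/-!
For `Im a > 0`, `a = 2η`, the function `u` is the integral of `K = Γ(a + t) Γ(a - t)` times two theta
functions, `Γ` the elliptic gamma function. For other `a` finitely many poles of `K` are split off
by a Bézout identity and integrated over another line (`regInt`, `u_eq_regInt`).

The heart is a product formula (`regInt_mul_regInt`). `Q` times the integral with periods `(τ, σ)`
times the one with periods `(-1/σ, -τ/σ)` is a difference of two double integrals against the
Kronecker function plus one integral with periods `(-1/τ, σ/τ)`. It rests on the Weierstrass identity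
(`theta_mul_Q`), the jump of an integral when its path crosses the pole of the Kronecker function
(`krDouble_sub`), and the modular identity of `Γ` (`modN_eq`). It is proved for `a` in three half
planes and continued.

For `σ = -κa` and `ν = ja` the double integrals telescope in `j` (`product_progression`); the terms
next to multiples of `κ` have poles and are treated in pairs (`tendsto_terms_add`, `dblX_sub_dblX`).
Jacobi's transformation sums the single integrals to the function at `-1/τ` (`Q_mul_tsum_polyX`).
This gives (ii) for `η` in an open set near `0` (`transformation_of_sumRegion`), and by the identity
theorem in `η` on the whole cone (`transformation_minus`). Complex conjugation gives (iii)
(`transformation_plus`), and `u` is invariant under `τ ↦ τ + 1`, which gives (i)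
(`Delta_tau_add_one`).
-/

namespace HypTheta

noncomputable section

open Complex Set Filter Topology
open scoped Real

local notation "HolOn" => DifferentiableOn ℂ

local notation "expπ" x:max => exp (π * I * x)

/-! ### Exponentials, segments and primitives -/

/-- The normalised exponential `e(z) = exp (2 π i z)`. -/
def ex (z : ℂ) : ℂ := exp (2 * π * I * z)

lemma ex_add (z w : ℂ) : ex (z + w) = ex z * ex w := by rw [ex, ex, ex, ← exp_add]; ring_nf

lemma ex_neg (z : ℂ) : ex (-z) = (ex z)⁻¹ := by rw [ex, ex, ← exp_neg]; ring_nf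

lemma ex_ne_zero (z : ℂ) : ex z ≠ 0 := exp_ne_zero _

@[simp] lemma ex_zero : ex 0 = 1 := by simp [ex]

@[simp] lemma ex_int (n : ℤ) : ex n = 1 := by
  rw [ex, show 2 * (π : ℂ) * I * n = n * (2 * π * I) by ring]
  exact exp_int_mul_two_pi_mul_I n

@[simp] lemma ex_one : ex 1 = 1 := by simpa using ex_int 1

lemma ex_add_one (z : ℂ) : ex (z + 1) = ex z := by simp [ex_add]

lemma ex_add_int (z : ℂ) (n : ℤ) : ex (z + n) = ex z := by simp [ex_add]

lemma norm_ex (z : ℂ) : ‖ex z‖ = Real.exp (-(2 * π * z.im)) := by rw [ex, norm_exp]; simp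

lemma ex_eq_one_iff {z : ℂ} : ex z = 1 ↔ ∃ n : ℤ, z = n := by
  rw [ex, exp_eq_one_iff]
  have h : (2 * (π : ℂ) * I) ≠ 0 := by simp [Real.pi_ne_zero]
  constructor
  · rintro ⟨n, hn⟩
    exact ⟨n, mul_left_cancel₀ h (by rw [hn]; ring)⟩
  · rintro ⟨n, rfl⟩
    exact ⟨n, by ring⟩

lemma ex_ne_one_of_im_pos {z : ℂ} (h : 0 < z.im) : ex z ≠ 1 := by
  intro h1
  obtain ⟨n, rfl⟩ := ex_eq_one_iff.1 h1
  simp at h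

@[fun_prop] theorem differentiable_ex : Differentiable ℂ ex := by unfold ex; fun_prop

@[fun_prop] theorem continuous_ex : Continuous ex := differentiable_ex.continuous

lemma _root_.DifferentiableOn.ex {f : ℂ → ℂ} {s : Set ℂ} (hf : HolOn f s) :
    HolOn (fun z => ex (f z)) s := differentiable_ex.comp_differentiableOn hf

/-- The integral of `f` over the segment from `z` to `w`. -/
def segInt (f : ℂ → ℂ) (z w : ℂ) : ℂ := (w - z) * ∫ s in (0 : ℝ)..1, f (z + s * (w - z))

lemma exists_primitive {f : ℂ → ℂ} {U : Set ℂ} (hU : IsOpen U) (hc : Convex ℝ U)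
    (hf : HolOn f U) : ∃ G : ℂ → ℂ, ∀ z ∈ U, HasDerivAt G (f z) z := by
  obtain ⟨G, hG⟩ := hc.exists_forall_hasDerivWithinAt hf
  exact ⟨G, fun z hz => (hG z hz).hasDerivAt (hU.mem_nhds hz)⟩

lemma segment_param_mem {U : Set ℂ} (hc : Convex ℝ U) {z w : ℂ} (hz : z ∈ U) (hw : w ∈ U)
    {s : ℝ} (hs : s ∈ Icc (0 : ℝ) 1) : z + s * (w - z) ∈ U := by
  have := hc.add_smul_sub_mem hz hw hs
  simpa using this

lemma segInt_eq_sub {f G : ℂ → ℂ} {U : Set ℂ} (hc : Convex ℝ U)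
    (hf : ContinuousOn f U) (hG : ∀ z ∈ U, HasDerivAt G (f z) z) {z w : ℂ}
    (hz : z ∈ U) (hw : w ∈ U) : segInt f z w = G w - G z := by
  have h1 : ∀ s ∈ uIcc (0 : ℝ) 1, HasDerivAt (fun s : ℝ => G (z + s * (w - z)))
      (f (z + s * (w - z)) * (w - z)) s := by
    intro s hs
    rw [uIcc_of_le zero_le_one] at hs
    have h2 : HasDerivAt (fun s : ℝ => z + (s : ℂ) * (w - z)) (w - z) s := by
      simpa using ((ofRealCLM.hasDerivAt (x := s)).mul_const (w - z)).const_add z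
    exact (hG _ (segment_param_mem hc hz hw hs)).comp s h2
  have h3 : ContinuousOn (fun s : ℝ => f (z + s * (w - z)) * (w - z)) (uIcc 0 1) := by
    refine ContinuousOn.mul (hf.comp (by fun_prop) ?_) continuousOn_const
    intro s hs
    rw [uIcc_of_le zero_le_one] at hs
    exact segment_param_mem hc hz hw hs
  have h4 := intervalIntegral.integral_eq_sub_of_hasDerivAt h1 h3.intervalIntegrable
  rw [intervalIntegral.integral_mul_const] at h4
  rw [segInt, mul_comm, h4]
  simp

lemma segInt_add_segInt {f : ℂ → ℂ} {U : Set ℂ} (hU : IsOpen U) (hc : Convex ℝ U)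
    (hf : HolOn f U) {x y z : ℂ} (hx : x ∈ U) (hy : y ∈ U) (hz : z ∈ U) :
    segInt f x y + segInt f y z = segInt f x z := by
  obtain ⟨G, hG⟩ := exists_primitive hU hc hf
  rw [segInt_eq_sub hc hf.continuousOn hG hx hy, segInt_eq_sub hc hf.continuousOn hG hy hz,
    segInt_eq_sub hc hf.continuousOn hG hx hz]
  ring

/-- How the integral of a quasi-periodic holomorphic function over a period segment depends on the
base point. -/
lemma segInt_period_sub {f : ℂ → ℂ} {U : Set ℂ} (hU : IsOpen U) (hc : Convex ℝ U)
    (hf : HolOn f U) {ω m : ℂ} (hω : ∀ z ∈ U, z + ω ∈ U)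
    (hm : ∀ z ∈ U, f (z + ω) = m * f z) {b b' : ℂ} (hb : b ∈ U) (hb' : b' ∈ U) :
    segInt f b (b + ω) - segInt f b' (b' + ω) = (m - 1) * segInt f b' b := by
  obtain ⟨G, hG⟩ := exists_primitive hU hc hf
  have hconst : ∀ z ∈ U, HasDerivAt (fun z => G (z + ω) - m * G z) 0 z := by
    intro z hz
    have h1 : HasDerivAt (fun z => G (z + ω)) (f (z + ω)) z := by
      simpa using (hG _ (hω z hz)).comp_add_const z ω
    have := h1.sub ((hG z hz).const_mul m)
    rwa [hm z hz, sub_self] at this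
  have h2 : G (b + ω) - m * G b = G (b' + ω) - m * G b' := by
    refine hU.is_const_of_deriv_eq_zero (f := fun z => G (z + ω) - m * G z) hc.isPreconnected
      (fun z hz => (hconst z hz).differentiableAt.differentiableWithinAt)
      (fun z hz => ?_) hb hb'
    simpa using (hconst z hz).deriv
  rw [segInt_eq_sub hc hf.continuousOn hG hb (hω b hb),
    segInt_eq_sub hc hf.continuousOn hG hb' (hω b' hb'),
    segInt_eq_sub hc hf.continuousOn hG hb' hb]
  linear_combination h2

/-- The horizontal strip `α < Im z < β`. -/
def strip (α β : ℝ) : Set ℂ := {z | α < z.im ∧ z.im < β}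

lemma isOpen_strip (α β : ℝ) : IsOpen (strip α β) :=
  (isOpen_lt continuous_const continuous_im).inter (isOpen_lt continuous_im continuous_const)

lemma convex_strip (α β : ℝ) : Convex ℝ (strip α β) :=
  (convex_halfSpace_im_gt α).inter (convex_halfSpace_im_lt β)

lemma strip_add_real {α β : ℝ} {z : ℂ} (hz : z ∈ strip α β) (x : ℝ) : z + x ∈ strip α β := by
  simpa [strip] using hz

lemma strip_add_one {α β : ℝ} {z : ℂ} (hz : z ∈ strip α β) : z + 1 ∈ strip α β := by
  simpa [strip] using hz

/-- The integral of `f` over the horizontal segment from `c` to `c + 1`. -/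
def lineInt (f : ℂ → ℂ) (c : ℂ) : ℂ := ∫ x in (0 : ℝ)..1, f (c + x)

lemma lineInt_eq_segInt (f : ℂ → ℂ) (c : ℂ) : lineInt f c = segInt f c (c + 1) := by
  simp [lineInt, segInt]

lemma lineInt_congr_base {f : ℂ → ℂ} {α β : ℝ} (hf : HolOn f (strip α β))
    (hp : ∀ z ∈ strip α β, f (z + 1) = f z) {c c' : ℂ} (hc : c ∈ strip α β)
    (hc' : c' ∈ strip α β) : lineInt f c = lineInt f c' := by
  have := segInt_period_sub (isOpen_strip α β) (convex_strip α β) hf (ω := 1) (m := 1)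
    (fun z hz => strip_add_one hz) (fun z hz => by rw [hp z hz, one_mul]) hc hc'
  rw [lineInt_eq_segInt, lineInt_eq_segInt]
  linear_combination this

/-! ### Fourier series of periodic holomorphic functions -/

/-- The `n`-th Fourier coefficient of a 1-periodic function, computed on the line through `c`. -/
def fourierC (f : ℂ → ℂ) (c : ℂ) (n : ℤ) : ℂ := lineInt (fun z => f z * ex (-(n * z))) c

lemma fourierC_congr_base {f : ℂ → ℂ} {α β : ℝ} (hf : HolOn f (strip α β))
    (hp : ∀ z ∈ strip α β, f (z + 1) = f z) {c c' : ℂ} (hc : c ∈ strip α β)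
    (hc' : c' ∈ strip α β) (n : ℤ) : fourierC f c n = fourierC f c' n := by
  refine lineInt_congr_base (hf.fun_mul (Differentiable.differentiableOn (by fun_prop)))
    (fun z hz => ?_) hc hc'
  rw [hp z hz, show -((n : ℂ) * (z + 1)) = -(n * z) + ((-n : ℤ) : ℂ) by push_cast; ring, ex_add_int]

lemma continuousOn_line {f : ℂ → ℂ} {α β : ℝ} (hf : ContinuousOn f (strip α β)) {c : ℂ}
    (hc : c ∈ strip α β) : Continuous fun x : ℝ => f (c + x) :=
  hf.comp_continuous (by fun_prop) fun x => strip_add_real hc x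

lemma norm_lineInt_le {f : ℂ → ℂ} {c : ℂ} {M : ℝ} (h : ∀ x ∈ Icc (0 : ℝ) 1, ‖f (c + x)‖ ≤ M) :
    ‖lineInt f c‖ ≤ M := by
  have := intervalIntegral.norm_integral_le_of_norm_le_const (a := (0 : ℝ)) (b := 1)
    (f := fun x : ℝ => f (c + x)) (C := M) (fun x hx => by
      rw [uIoc_of_le zero_le_one] at hx
      exact h x ⟨hx.1.le, hx.2⟩)
  simpa [lineInt] using this

lemma norm_fourierC_le {f : ℂ → ℂ} {c : ℂ} {M : ℝ}
    (h : ∀ x ∈ Icc (0 : ℝ) 1, ‖f (c + x)‖ ≤ M) (n : ℤ) :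
    ‖fourierC f c n‖ ≤ M * Real.exp (2 * π * (n * c.im)) := by
  refine norm_lineInt_le fun x hx => ?_
  rw [norm_mul, norm_ex]
  have : (-((n : ℂ) * (c + x))).im = -(n * c.im) := by simp
  rw [this, mul_neg, neg_neg]
  gcongr
  exact h x hx

lemma exists_bound_line {f : ℂ → ℂ} {α β : ℝ} (hf : ContinuousOn f (strip α β)) {c : ℂ}
    (hc : c ∈ strip α β) : ∃ M, 0 ≤ M ∧ ∀ x ∈ Icc (0 : ℝ) 1, ‖f (c + x)‖ ≤ M := by
  obtain ⟨M, hM⟩ := isCompact_Icc.exists_bound_of_continuousOn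
    (continuousOn_line hf hc).continuousOn (s := Icc (0 : ℝ) 1)
  exact ⟨M, (norm_nonneg _).trans (hM 0 (by simp)), hM⟩

/-- The two-sided geometric majorant used for all Fourier estimates. -/
lemma summable_exp_neg_abs {δ : ℝ} (hδ : 0 < δ) :
    Summable fun n : ℤ => Real.exp (-(δ * |(n : ℝ)|)) := by
  have h : Summable fun n : ℕ => Real.exp (-(δ * n)) := by
    have := summable_geometric_of_lt_one (Real.exp_pos (-δ)).le (by simpa using hδ)
    refine this.congr fun n => ?_
    rw [← Real.exp_nat_mul]; ring_nf
  refine Summable.of_nat_of_neg ?_ ?_ <;> simpa using h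

/-- Exponential decay of Fourier coefficients, in the form of a bound for each term of the Fourier
series that is uniform on a smaller strip. -/
lemma exists_fourierC_bound {f : ℂ → ℂ} {α β : ℝ} (hf : HolOn f (strip α β))
    (hp : ∀ z ∈ strip α β, f (z + 1) = f z) {c c₁ c₂ : ℂ} (hc : c ∈ strip α β)
    (h₁ : c₁ ∈ strip α β) (h₂ : c₂ ∈ strip α β) :
    ∃ M, 0 ≤ M ∧ ∀ n : ℤ, ‖fourierC f c n‖ ≤
      M * min (Real.exp (2 * π * (n * c₁.im))) (Real.exp (2 * π * (n * c₂.im))) := by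
  obtain ⟨M₁, h01, hM₁⟩ := exists_bound_line hf.continuousOn h₁
  obtain ⟨M₂, h02, hM₂⟩ := exists_bound_line hf.continuousOn h₂
  refine ⟨max M₁ M₂, by positivity, fun n => ?_⟩
  rw [mul_min_of_nonneg _ _ (by positivity)]
  refine le_min ?_ ?_
  · rw [fourierC_congr_base hf hp hc h₁]
    refine (norm_fourierC_le hM₁ n).trans ?_
    gcongr
    exact le_max_left _ _
  · rw [fourierC_congr_base hf hp hc h₂]
    refine (norm_fourierC_le hM₂ n).trans ?_
    gcongr
    exact le_max_right _ _

lemma min_exp_le {n : ℤ} {y δ : ℝ} :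
    min (Real.exp (2 * π * (n * (y - δ)))) (Real.exp (2 * π * (n * (y + δ)))) ≤
      Real.exp (2 * π * (n * y)) * Real.exp (-(2 * π * δ * |(n : ℝ)|)) := by
  rw [← Real.exp_add]
  rcases le_total 0 (n : ℝ) with h | h
  · refine (min_le_left _ _).trans (Real.exp_le_exp.2 ?_)
    rw [abs_of_nonneg h]
    apply le_of_eq; ring
  · refine (min_le_right _ _).trans (Real.exp_le_exp.2 ?_)
    rw [abs_of_nonpos h]
    apply le_of_eq; ring

lemma fourier_hasSum {f : ℂ → ℂ} {α β : ℝ} (hf : HolOn f (strip α β))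
    (hp : ∀ z ∈ strip α β, f (z + 1) = f z) {c z : ℂ} (hc : c ∈ strip α β)
    (hz : z ∈ strip α β) : HasSum (fun n : ℤ => fourierC f c n * ex (n * z)) (f z) := by
  have hcont := continuousOn_line hf.continuousOn hz
  have hper : Function.Periodic (fun x : ℝ => f (z + x)) 1 := fun x => by
    have := hp _ (strip_add_real hz x)
    simp only [ofReal_add, ofReal_one]
    rw [← add_assoc, this]
  let F : C(AddCircle (1 : ℝ), ℂ) := ⟨hper.lift, continuous_coinduced_dom.2 hcont⟩
  have hF : ∀ n : ℤ, fourierCoeff F n = fourierC f c n * ex (n * z) := by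
    intro n
    rw [fourierC_congr_base hf hp hc hz, fourierCoeff_eq_intervalIntegral F n 0, fourierC, lineInt,
      ← intervalIntegral.integral_mul_const]
    simp only [div_one, one_smul, zero_add]
    refine intervalIntegral.integral_congr fun x _ => ?_
    have h1 : F (x : AddCircle (1 : ℝ)) = f (z + x) := rfl
    simp only [h1, fourier_coe_apply, smul_eq_mul]
    rw [mul_assoc (f (z + x)), ← ex_add, mul_comm]
    congr 1
    rw [ex]
    congr 1
    push_cast
    ring
  have hsum : Summable (fourierCoeff F) := by
    obtain ⟨δ, hδ, h1, h2⟩ : ∃ δ > 0, α < z.im - δ ∧ z.im + δ < β := by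
      refine ⟨min (z.im - α) (β - z.im) / 2, ?_, ?_, ?_⟩
      · have := hz.1; have := hz.2
        exact half_pos (lt_min (by linarith) (by linarith))
      · have := min_le_left (z.im - α) (β - z.im)
        have := hz.1
        linarith
      · have := min_le_right (z.im - α) (β - z.im)
        have := hz.2
        linarith
    obtain ⟨M, hM, hb⟩ := exists_fourierC_bound hf hp hc (c₁ := z - δ * I) (c₂ := z + δ * I)
      (by simp only [strip, Set.mem_ofPred_eq]; simp; constructor <;> linarith)
      (by simp only [strip, Set.mem_ofPred_eq]; simp; constructor <;> linarith)
    refine Summable.of_norm_bounded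
      ((summable_exp_neg_abs (δ := 2 * π * δ) (by positivity)).mul_left M) fun n => ?_
    rw [hF, norm_mul, norm_ex]
    have h3 := hb n
    simp only [sub_im, add_im, mul_im, ofReal_re, I_im, mul_one, ofReal_im, I_re, mul_zero,
      add_zero] at h3
    have h4 := h3.trans (mul_le_mul_of_nonneg_left min_exp_le hM)
    refine (mul_le_mul_of_nonneg_right h4 (Real.exp_pos _).le).trans (le_of_eq ?_)
    have h5 : ((n : ℂ) * z).im = n * z.im := by simp
    rw [h5, mul_assoc, mul_right_comm, ← Real.exp_add]
    simp
  have := has_pointwise_sum_fourier_series_of_summable hsum ((0 : ℝ) : AddCircle (1 : ℝ))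
  have h0 : F ((0 : ℝ) : AddCircle (1 : ℝ)) = f z := by
    change f (z + ((0 : ℝ) : ℂ)) = f z
    simp
  rw [h0] at this
  simpa [hF] using this

/-! ### Holomorphic dependence on parameters -/

lemma differentiableOn_intervalIntegral {f : ℂ → ℝ → ℂ} {V : Set ℂ} (hV : IsOpen V)
    (hc : ContinuousOn (fun p : ℂ × ℝ => f p.1 p.2) (V ×ˢ Icc (0 : ℝ) 1))
    (hd : ∀ x ∈ Icc (0 : ℝ) 1, HolOn (fun w => f w x) V) :
    HolOn (fun w => ∫ x in (0 : ℝ)..1, f w x) V := by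
  intro w₀ hw₀
  obtain ⟨r, hr, hball⟩ : ∃ r > 0, Metric.closedBall w₀ (2 * r) ⊆ V := by
    obtain ⟨ε, hε, h⟩ := Metric.isOpen_iff.1 hV w₀ hw₀
    exact ⟨ε / 4, by positivity, (Metric.closedBall_subset_ball (by linarith)).trans h⟩
  have hK : IsCompact (Metric.closedBall w₀ (2 * r) ×ˢ Icc (0 : ℝ) 1) :=
    (isCompact_closedBall _ _).prod isCompact_Icc
  obtain ⟨M, hM⟩ := hK.exists_bound_of_continuousOn (hc.mono (Set.prod_mono hball subset_rfl))
  have hline : ∀ w ∈ V, ContinuousOn (fun x => f w x) (Icc 0 1) := fun w hw =>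
    hc.comp (f := fun x : ℝ => (w, x)) (by fun_prop) fun x hx => ⟨hw, hx⟩
  have hmeas : ∀ w ∈ V, MeasureTheory.AEStronglyMeasurable (f w)
      (MeasureTheory.volume.restrict (uIoc (0 : ℝ) 1)) := fun w hw => by
    rw [uIoc_of_le zero_le_one]
    exact ((hline w hw).mono Ioc_subset_Icc_self).aestronglyMeasurable measurableSet_Ioc
  have hder : ∀ x ∈ Icc (0 : ℝ) 1, ∀ w ∈ V, HasDerivAt (fun w => f w x)
      (deriv (fun w => f w x) w) w := fun x hx w hw =>
    ((hd x hx).differentiableAt (hV.mem_nhds hw)).hasDerivAt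
  have hsub : ∀ w ∈ Metric.ball w₀ r, Metric.closedBall w r ⊆ Metric.closedBall w₀ (2 * r) := by
    intro w hw
    refine Metric.closedBall_subset_closedBall' ?_
    rw [Metric.mem_ball] at hw
    linarith
  have hbound : ∀ x ∈ Icc (0 : ℝ) 1, ∀ w ∈ Metric.ball w₀ r,
      ‖deriv (fun w => f w x) w‖ ≤ M / r := by
    intro x hx w hw
    refine Complex.norm_deriv_le_of_forall_mem_sphere_norm_le hr ?_ fun z hz => ?_
    · exact ((hd x hx).mono ((hsub w hw).trans hball)).diffContOnCl_ball subset_rfl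
    · exact hM (z, x) ⟨hsub w hw (Metric.sphere_subset_closedBall hz), hx⟩
  have hmeas' : MeasureTheory.AEStronglyMeasurable (fun x => deriv (fun w => f w x) w₀)
      (MeasureTheory.volume.restrict (uIoc (0 : ℝ) 1)) := by
    have hu : Tendsto (fun n : ℕ => ((r / (n + 1) : ℝ) : ℂ)) atTop (𝓝[≠] 0) := by
      refine tendsto_nhdsWithin_iff.2 ⟨?_, Eventually.of_forall fun n => ?_⟩
      · have := tendsto_one_div_add_atTop_nhds_zero_nat (𝕜 := ℝ)
        have h2 := (this.const_mul r).ofReal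
        simpa only [mul_one_div, mul_zero, ofReal_zero] using h2
      · have : (r / (n + 1) : ℝ) ≠ 0 := by positivity
        exact ofReal_ne_zero.2 this
    refine aestronglyMeasurable_of_tendsto_ae atTop
      (f := fun (n : ℕ) x => ((r / (n + 1) : ℝ) : ℂ)⁻¹ •
        (f (w₀ + ((r / (n + 1) : ℝ) : ℂ)) x - f w₀ x)) (fun n => ?_) ?_
    · refine ((hmeas _ (hball ?_)).sub (hmeas _ hw₀)).const_smul ((r / (n + 1) : ℝ) : ℂ)⁻¹
      rw [Metric.mem_closedBall, dist_eq_norm, add_sub_cancel_left, norm_real, Real.norm_eq_abs,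
        abs_of_pos (by positivity)]
      have : r / (n + 1) ≤ r := div_le_self hr.le (by linarith [(n.cast_nonneg : (0 : ℝ) ≤ n)])
      linarith
    · refine (MeasureTheory.ae_restrict_iff' measurableSet_uIoc).2 (Eventually.of_forall
        fun x hx => ?_)
      rw [uIoc_of_le zero_le_one] at hx
      exact (hasDerivAt_iff_tendsto_slope_zero.1 (hder x ⟨hx.1.le, hx.2⟩ w₀ hw₀)).comp hu
  have h := intervalIntegral.hasDerivAt_integral_of_dominated_loc_of_deriv_le
    (μ := MeasureTheory.volume) (a := (0 : ℝ)) (b := 1)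
    (F := f) (F' := fun w x => deriv (fun w => f w x) w) (x₀ := w₀) (s := Metric.ball w₀ r)
    (bound := fun _ => M / r) (Metric.ball_mem_nhds w₀ hr)
    (by filter_upwards [hV.mem_nhds hw₀] with w hw using hmeas w hw)
    ((hline w₀ hw₀).intervalIntegrable_of_Icc zero_le_one) hmeas'
    (Eventually.of_forall fun x hx w hw => by
      rw [uIoc_of_le zero_le_one] at hx
      exact hbound x ⟨hx.1.le, hx.2⟩ w hw)
    intervalIntegrable_const
    (Eventually.of_forall fun x hx w hw => by
      rw [uIoc_of_le zero_le_one] at hx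
      refine hder x ⟨hx.1.le, hx.2⟩ w (hball ?_)
      exact Metric.ball_subset_closedBall.trans
        (Metric.closedBall_subset_closedBall (by linarith)) hw)
  exact h.2.differentiableAt.differentiableWithinAt

/-! ### Convex open sets minus countable sets -/

/-- Removing a countable set from a convex open subset of `ℂ` leaves it connected. -/
lemma isPreconnected_diff_countable {U s : Set ℂ} (hU : IsOpen U) (hc : Convex ℝ U)
    (hs : s.Countable) : IsPreconnected (U \ s) := by
  refine isPreconnected_of_forall_pair fun a ha b hb => ?_
  rcases eq_or_ne a b with rfl | hab
  · exact ⟨{a}, by simpa using ha, by simp, by simp, isPreconnected_singleton⟩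
  let c := (2 : ℝ)⁻¹ • (a + b)
  let x := (2 : ℝ)⁻¹ • (b - a)
  have Ia : c - x = a := by simp only [c, x]; module
  have Ib : c + x = b := by simp only [c, x]; module
  have x_ne_zero : x ≠ 0 := by simpa [x] using sub_ne_zero.2 hab.symm
  have hcU : c ∈ U := by
    have := hc ha.1 hb.1 (a := (2 : ℝ)⁻¹) (b := (2 : ℝ)⁻¹) (by norm_num) (by norm_num) (by norm_num)
    simpa [c, smul_add] using this
  obtain ⟨y, hy⟩ : ∃ y, LinearIndependent ℝ ![x, y] :=
    exists_linearIndependent_pair_of_one_lt_rank (by simp) x_ne_zero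
  have A : ∀ x' : ℂ, LinearIndependent ℝ ![x', y] → c + x' ∉ s →
      {t : ℝ | (segment ℝ (c + x') (c + t • y) ∩ s).Nonempty}.Countable := fun x' hy hn => by
    apply countable_ofPred_nonempty_of_disjoint _ (fun t ↦ inter_subset_right) hs
    intro t t' htt'
    apply disjoint_iff_inter_eq_empty.2
    have N : {c + x'} ∩ s = ∅ := by simpa only [singleton_inter_eq_empty] using hn
    rw [inter_assoc, inter_comm s, inter_assoc, inter_self, ← inter_assoc, ← subset_empty_iff, ← N]
    apply inter_subset_inter_left
    apply Eq.subset
    apply segment_inter_eq_endpoint_of_linearIndependent_of_ne hy htt'.symm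
  have hy' : LinearIndependent ℝ ![-x, y] := by
    convert! hy.units_smul ![-1, 1]
    simp [← List.ofFn_inj]
  have hopen : {t : ℝ | c + t • y ∈ U} ∈ 𝓝 (0 : ℝ) := by
    have hcont : ContinuousAt (fun t : ℝ => c + t • y) 0 := by fun_prop
    exact hcont.preimage_mem_nhds (by simpa using hU.mem_nhds hcU)
  obtain ⟨t, ht, htU⟩ := (((A x hy (Ib ▸ hb.2)).union (A (-x) hy' (by
    rw [← sub_eq_add_neg, Ia]; exact ha.2))).dense_compl ℝ).inter_nhds_nonempty hopen
  simp only [compl_union, mem_inter_iff, mem_compl_iff, mem_ofPred_eq, not_nonempty_iff_eq_empty,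
    ← sub_eq_add_neg] at ht htU
  have hsub : ∀ p ∈ U, segment ℝ p (c + t • y) ∩ s = ∅ → segment ℝ p (c + t • y) ⊆ U \ s :=
    fun p hp h z hz => ⟨hc.segment_subset hp htU hz, fun hzs =>
      (Set.eq_empty_iff_forall_notMem.1 h z) ⟨hz, hzs⟩⟩
  refine ⟨segment ℝ (c + x) (c + t • y) ∪ segment ℝ (c - x) (c + t • y),
    union_subset (hsub _ (Ib ▸ hb.1) ht.1) (hsub _ (Ia ▸ ha.1) ht.2), ?_, ?_, ?_⟩
  · right; rw [Ia]; exact left_mem_segment ℝ _ _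
  · left; rw [Ib]; exact left_mem_segment ℝ _ _
  · exact IsPreconnected.union (c + t • y) (right_mem_segment ℝ _ _) (right_mem_segment ℝ _ _)
      (convex_segment _ _).isPreconnected (convex_segment _ _).isPreconnected

/-- The identity theorem on a convex open set minus a countable closed set. -/
lemma eqOn_diff_countable {U s : Set ℂ} (hU : IsOpen U) (hc : Convex ℝ U) (hs : s.Countable)
    (hUs : IsOpen (U \ s)) {f g : ℂ → ℂ} (hf : HolOn f (U \ s))
    (hg : HolOn g (U \ s)) {V : Set ℂ} (hV : IsOpen V) (hVne : (V ∩ U).Nonempty)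
    (h : ∀ z ∈ V ∩ (U \ s), f z = g z) : EqOn f g (U \ s) := by
  obtain ⟨z₀, hz₀⟩ : ((V ∩ U) ∩ sᶜ).Nonempty :=
    (hs.dense_compl ℝ).inter_open_nonempty _ (hV.inter hU) hVne
  refine (hf.analyticOnNhd hUs).eqOn_of_preconnected_of_eventuallyEq (hg.analyticOnNhd hUs)
    (isPreconnected_diff_countable hU hc hs) (z₀ := z₀) ⟨hz₀.1.2, hz₀.2⟩ ?_
  filter_upwards [(hV.inter hUs).mem_nhds ⟨hz₀.1.1, hz₀.1.2, hz₀.2⟩] with z hz using h z hz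

/-- The `p`-th term `e(z + p₁ τ + p₂ σ)` of the double geometric array behind the double
infinite products. -/
def lat (z τ σ : ℂ) (p : ℕ × ℕ) : ℂ := ex (z + p.1 * τ + p.2 * σ)

lemma norm_lat_le {A b c : ℝ} {z τ σ : ℂ} (hz : A ≤ z.im) (hτ : b ≤ τ.im) (hσ : c ≤ σ.im)
    (p : ℕ × ℕ) : ‖lat z τ σ p‖ ≤ Real.exp (-(2 * π * A)) *
      (Real.exp (-(2 * π * b)) ^ p.1 * Real.exp (-(2 * π * c)) ^ p.2) := by
  rw [lat, norm_ex, ← Real.exp_nat_mul, ← Real.exp_nat_mul, ← Real.exp_add, ← Real.exp_add,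
    Real.exp_le_exp]
  have h1 : (z + p.1 * τ + p.2 * σ).im = z.im + p.1 * τ.im + p.2 * σ.im := by simp
  rw [h1]
  have h2 : (p.1 : ℝ) * b ≤ p.1 * τ.im := by gcongr
  have h3 : (p.2 : ℝ) * c ≤ p.2 * σ.im := by gcongr
  have := mul_le_mul_of_nonneg_left (add_le_add (add_le_add hz h2) h3) (by positivity : 0 ≤ 2 * π)
  linarith

lemma summable_lat_bound (A : ℝ) {b c : ℝ} (hb : 0 < b) (hc : 0 < c) :
    Summable fun p : ℕ × ℕ => Real.exp (-(2 * π * A)) *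
      (Real.exp (-(2 * π * b)) ^ p.1 * Real.exp (-(2 * π * c)) ^ p.2) := by
  have h : ∀ x : ℝ, 0 < x → Summable fun n : ℕ => Real.exp (-(2 * π * x)) ^ n := fun x hx =>
    summable_geometric_of_lt_one (Real.exp_pos _).le
      (by rw [Real.exp_lt_one_iff]; have := Real.pi_pos; nlinarith [mul_pos this hx])
  exact ((h b hb).mul_of_nonneg (h c hc) (fun _ => by positivity) fun _ => by positivity).mul_left _

lemma summable_lat (z : ℂ) {τ σ : ℂ} (hτ : 0 < τ.im) (hσ : 0 < σ.im) {χ : ℕ × ℕ → ℂ}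
    (hχ : ∀ p, ‖χ p‖ ≤ 1) : Summable fun p => ‖χ p * lat z τ σ p‖ := by
  refine (summable_lat_bound z.im hτ hσ).of_nonneg_of_le (fun _ => norm_nonneg _) fun p => ?_
  rw [norm_mul]
  calc ‖χ p‖ * ‖lat z τ σ p‖ ≤ 1 * ‖lat z τ σ p‖ := by gcongr; exact hχ p
    _ ≤ _ := by rw [one_mul]; exact norm_lat_le le_rfl le_rfl le_rfl p

/-- The double product `∏ (1 - χ(p) e(z + p₁ τ + p₂ σ))`. The weight `χ` is used to select a
subset of the factors. -/
def dprod (χ : ℕ × ℕ → ℂ) (z τ σ : ℂ) : ℂ := ∏' p : ℕ × ℕ, (1 - χ p * lat z τ σ p)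

lemma multipliable_dprod (z : ℂ) {τ σ : ℂ} (hτ : 0 < τ.im) (hσ : 0 < σ.im) {χ : ℕ × ℕ → ℂ}
    (hχ : ∀ p, ‖χ p‖ ≤ 1) : Multipliable fun p => 1 - χ p * lat z τ σ p := by
  simp only [sub_eq_add_neg]
  exact multipliable_one_add_of_summable (by simpa using summable_lat z hτ hσ hχ)

lemma dprod_ne_zero {z τ σ : ℂ} (hτ : 0 < τ.im) (hσ : 0 < σ.im) {χ : ℕ × ℕ → ℂ}
    (hχ : ∀ p, ‖χ p‖ ≤ 1) (h : ∀ p, χ p * lat z τ σ p ≠ 1) : dprod χ z τ σ ≠ 0 := by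
  simp only [dprod, sub_eq_add_neg]
  exact tprod_one_add_ne_zero_of_summable
    (fun p => by rw [← sub_eq_add_neg]; exact sub_ne_zero.2 (h p).symm)
    (by simpa using summable_lat z hτ hσ hχ)

lemma dprod_congr {χ χ' : ℕ × ℕ → ℂ} {z τ σ z' τ' σ' : ℂ}
    (h : ∀ p, χ p * lat z τ σ p = χ' p * lat z' τ' σ' p) : dprod χ z τ σ = dprod χ' z' τ' σ' :=
  tprod_congr fun p => by rw [h]

lemma dprod_mul {z τ σ : ℂ} (hτ : 0 < τ.im) (hσ : 0 < σ.im) {χ χ₁ χ₂ : ℕ × ℕ → ℂ}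
    (h₁ : ∀ p, ‖χ₁ p‖ ≤ 1) (h₂ : ∀ p, ‖χ₂ p‖ ≤ 1) (hadd : ∀ p, χ p = χ₁ p + χ₂ p)
    (hmul : ∀ p, χ₁ p * χ₂ p = 0) : dprod χ z τ σ = dprod χ₁ z τ σ * dprod χ₂ z τ σ := by
  rw [dprod, dprod, dprod, ← (multipliable_dprod z hτ hσ h₁).tprod_mul (multipliable_dprod z hτ hσ h₂)]
  refine tprod_congr fun p => ?_
  rw [hadd]
  linear_combination (-(lat z τ σ p) ^ 2) * hmul p

/-- Reindexing of a double product along an injection which shifts the argument. -/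
lemma dprod_reindex {g : ℕ × ℕ → ℕ × ℕ} (hg : Function.Injective g) {χ : ℕ × ℕ → ℂ}
    (hχ : ∀ p, χ p ≠ 0 → p ∈ range g) {z τ σ z' τ' σ' : ℂ}
    (h : ∀ p, lat z τ σ (g p) = lat z' τ' σ' p) :
    dprod χ z τ σ = dprod (χ ∘ g) z' τ' σ' := by
  rw [dprod, dprod, ← hg.tprod_eq]
  · exact tprod_congr fun p => by rw [h]; rfl
  · intro p hp
    refine hχ p fun h0 => hp ?_
    simp [h0]

lemma hasProdLocallyUniformlyOn_dprod {α : Type*} [TopologicalSpace α] [LocallyCompactSpace α]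
    {χ : ℕ × ℕ → ℂ} (hχ : ∀ p, ‖χ p‖ ≤ 1) {z τ σ : α → ℂ} {V : Set α} (hV : IsOpen V)
    (hz : ContinuousOn z V) (hτ : ContinuousOn τ V) (hσ : ContinuousOn σ V)
    {A b c : ℝ} (hb : 0 < b) (hc : 0 < c) (hzA : ∀ w ∈ V, A ≤ (z w).im)
    (hτb : ∀ w ∈ V, b ≤ (τ w).im) (hσc : ∀ w ∈ V, c ≤ (σ w).im) :
    HasProdLocallyUniformlyOn (fun p w => 1 + -(χ p * lat (z w) (τ w) (σ w) p))
      (fun w => ∏' p, (1 + -(χ p * lat (z w) (τ w) (σ w) p))) V := by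
  refine (summable_lat_bound A hb hc).hasProdLocallyUniformlyOn_one_add hV
    (.of_forall fun p w hw => ?_) fun p => ?_
  · rw [norm_neg, norm_mul]
    calc ‖χ p‖ * ‖lat (z w) (τ w) (σ w) p‖ ≤ 1 * ‖lat (z w) (τ w) (σ w) p‖ := by gcongr; exact hχ p
      _ ≤ _ := by
        rw [one_mul]
        exact norm_lat_le (hzA w hw) (hτb w hw) (hσc w hw) p
  · unfold lat
    refine (continuousOn_const.mul (continuous_ex.comp_continuousOn ?_)).neg
    exact (hz.add (continuousOn_const.mul hτ)).add (continuousOn_const.mul hσ)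

lemma exists_nhds_dprod {α : Type*} [TopologicalSpace α] {z τ σ : α → ℂ} {V : Set α}
    (hV : IsOpen V) (hz : ContinuousOn z V) (hτ : ContinuousOn τ V) (hσ : ContinuousOn σ V)
    {w₀ : α} (hw : w₀ ∈ V) (h1 : 0 < (τ w₀).im) (h2 : 0 < (σ w₀).im) :
    ∃ V' ⊆ V, IsOpen V' ∧ w₀ ∈ V' ∧ (∀ w ∈ V', (z w₀).im - 1 ≤ (z w).im) ∧
      (∀ w ∈ V', (τ w₀).im / 2 ≤ (τ w).im) ∧ ∀ w ∈ V', (σ w₀).im / 2 ≤ (σ w).im := by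
  have hc : ∀ f : α → ℂ, ContinuousOn f V → ∀ m < (f w₀).im, ∀ᶠ w in 𝓝 w₀, m ≤ (f w).im := by
    intro f hf m hm
    have := (continuous_im.continuousAt.comp (hf.continuousAt (hV.mem_nhds hw))).eventually
      (lt_mem_nhds hm)
    exact this.mono fun w hw => le_of_lt hw
  obtain ⟨t, ht, hto, hwt⟩ := eventually_nhds_iff.1 ((hV.eventually_mem hw).and
    ((hc z hz ((z w₀).im - 1) (by linarith)).and ((hc τ hτ ((τ w₀).im / 2) (by linarith)).and
      (hc σ hσ ((σ w₀).im / 2) (by linarith)))))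
  exact ⟨t, fun w hw => (ht w hw).1, hto, hwt, fun w hw => (ht w hw).2.1,
    fun w hw => (ht w hw).2.2.1, fun w hw => (ht w hw).2.2.2⟩

lemma continuousOn_dprod {χ : ℕ × ℕ → ℂ} (hχ : ∀ p, ‖χ p‖ ≤ 1) :
    ContinuousOn (fun q : ℂ × ℂ × ℂ => dprod χ q.1 q.2.1 q.2.2)
      {q | 0 < q.2.1.im ∧ 0 < q.2.2.im} := by
  rintro w₀ ⟨h1, h2⟩
  obtain ⟨V, -, hV, hw, hA, hb, hc⟩ := exists_nhds_dprod (α := ℂ × ℂ × ℂ) isOpen_univ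
    (z := fun q => q.1) (τ := fun q => q.2.1) (σ := fun q => q.2.2) (by fun_prop) (by fun_prop)
    (by fun_prop) (mem_univ w₀) h1 h2
  have := hasProdLocallyUniformlyOn_dprod hχ hV (z := fun q : ℂ × ℂ × ℂ => q.1)
    (τ := fun q => q.2.1) (σ := fun q => q.2.2) (by fun_prop) (by fun_prop) (by fun_prop)
    (half_pos h1) (half_pos h2) hA hb hc
  have h3 : ContinuousOn (fun q : ℂ × ℂ × ℂ => dprod χ q.1 q.2.1 q.2.2) V := by
    simp only [dprod, sub_eq_add_neg]
    refine TendstoLocallyUniformlyOn.continuousOn this (.of_forall fun s => ?_)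
    refine continuousOn_finsetProd _ fun p _ => Continuous.continuousOn ?_
    unfold lat
    fun_prop
  exact (h3.continuousAt (hV.mem_nhds hw)).continuousWithinAt

lemma contOn_dprod {α : Type*} [TopologicalSpace α] {s : Set α} {χ : ℕ × ℕ → ℂ}
    (hχ : ∀ p, ‖χ p‖ ≤ 1) {z τ σ : α → ℂ} (hz : ContinuousOn z s) (hτ : ContinuousOn τ s)
    (hσ : ContinuousOn σ s) (h1 : ∀ x ∈ s, 0 < (τ x).im) (h2 : ∀ x ∈ s, 0 < (σ x).im) :
    ContinuousOn (fun x => HypTheta.dprod χ (z x) (τ x) (σ x)) s := by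
  have h := (continuousOn_dprod hχ).comp (f := fun x => (z x, τ x, σ x)) (s := s)
    (hz.prodMk (hτ.prodMk hσ)) fun x hx => ⟨h1 x hx, h2 x hx⟩
  exact h

lemma diffOn_dprod {χ : ℕ × ℕ → ℂ} (hχ : ∀ p, ‖χ p‖ ≤ 1) {V : Set ℂ} (hV : IsOpen V)
    {z τ σ : ℂ → ℂ} (hz : HolOn z V) (hτ : HolOn τ V)
    (hσ : HolOn σ V) (h1 : ∀ x ∈ V, 0 < (τ x).im) (h2 : ∀ x ∈ V, 0 < (σ x).im) :
    HolOn (fun w => dprod χ (z w) (τ w) (σ w)) V := by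
  intro w₀ hw₀
  obtain ⟨V', hsub, hV', hw, hA, hb, hc⟩ := exists_nhds_dprod hV hz.continuousOn hτ.continuousOn
    hσ.continuousOn hw₀ (h1 _ hw₀) (h2 _ hw₀)
  have hP := hasProdLocallyUniformlyOn_dprod hχ hV' (hz.continuousOn.mono hsub)
    (hτ.continuousOn.mono hsub) (hσ.continuousOn.mono hsub) (half_pos (h1 _ hw₀))
    (half_pos (h2 _ hw₀)) hA hb hc
  have h3 : HolOn (fun w => HypTheta.dprod χ (z w) (τ w) (σ w)) V' := by
    simp only [HypTheta.dprod, sub_eq_add_neg]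
    refine TendstoLocallyUniformlyOn.differentiableOn hP (.of_forall fun s => ?_) hV'
    refine DifferentiableOn.fun_finsetProd fun p _ => ?_
    unfold lat
    refine (((DifferentiableOn.ex ?_).const_mul _).neg).const_add _
    exact ((hz.mono hsub).add ((hτ.mono hsub).const_mul _)).add ((hσ.mono hsub).const_mul _)
  exact (h3.differentiableAt (hV'.mem_nhds hw)).differentiableWithinAt

/-- The double product `∏_{j,k ≥ 0} (1 - e(z + j τ + k σ))`. -/
def P (z τ σ : ℂ) : ℂ := dprod (fun _ => 1) z τ σ

/-- The weight selecting the first row. -/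
def rowWeight (p : ℕ × ℕ) : ℂ := if p.1 = 0 then 1 else 0

/-- The `q`-product `∏_{k ≥ 0} (1 - e(z + k σ))`, written as a double product with all rows but
the first one deleted, so that it inherits the regularity of the latter. -/
def P1 (z σ : ℂ) : ℂ := dprod rowWeight z I σ

lemma norm_rowWeight_le (p : ℕ × ℕ) : ‖rowWeight p‖ ≤ 1 := by unfold rowWeight; split_ifs <;> simp

lemma P1_eq (z σ τ : ℂ) : P1 z σ = dprod rowWeight z τ σ := by
  refine dprod_congr fun p => ?_
  unfold rowWeight lat
  split_ifs with h
  · simp [h]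
  · simp

lemma P1_eq_tprod (z σ : ℂ) : P1 z σ = ∏' k : ℕ, (1 - ex (z + k * σ)) := by
  have hg : Function.Injective fun k : ℕ => ((0, k) : ℕ × ℕ) := fun a b h => by simpa using h
  rw [P1, dprod, ← hg.tprod_eq]
  · refine tprod_congr fun k => ?_
    simp [rowWeight, lat]
  · rintro ⟨j, k⟩ hp
    rcases Nat.eq_zero_or_pos j with rfl | hj
    · exact ⟨k, rfl⟩
    · exact absurd (by simp [rowWeight, hj.ne']) hp

lemma P_succ (z : ℂ) {τ σ : ℂ} (hτ : 0 < τ.im) (hσ : 0 < σ.im) :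
    P z τ σ = P1 z σ * P (z + τ) τ σ := by
  rw [P1_eq z σ τ, P, dprod_mul hτ hσ (χ₁ := rowWeight) (χ₂ := fun p => 1 - rowWeight p)
    norm_rowWeight_le]
  · congr 1
    rw [dprod_reindex (g := fun p => (p.1 + 1, p.2)) (z' := z + τ) (τ' := τ) (σ' := σ)]
    · rw [P]; exact dprod_congr fun p => by simp [rowWeight]
    · rintro ⟨a, b⟩ ⟨c, d⟩ h; simpa using h
    · rintro ⟨j, k⟩ h
      rcases Nat.eq_zero_or_pos j with rfl | hj
      · simp [rowWeight] at h
      · exact ⟨(j - 1, k), by simp; omega⟩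
    · rintro ⟨j, k⟩
      simp only [lat]; congr 1; push_cast; ring
  · intro p; unfold rowWeight; split_ifs <;> simp
  · intro p; ring
  · intro p; unfold rowWeight; split_ifs <;> simp

lemma P_swap (z τ σ : ℂ) : P z τ σ = P z σ τ := by
  rw [P, dprod_reindex (g := Prod.swap) (z' := z) (τ' := σ) (σ' := τ) Prod.swap_injective]
  · rfl
  · intro p _; exact ⟨p.swap, Prod.swap_swap p⟩
  · intro p; simp only [lat]; congr 1; simp; ring

lemma P1_succ (z : ℂ) {σ : ℂ} (hσ : 0 < σ.im) : P1 z σ = (1 - ex z) * P1 (z + σ) σ := by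
  have hI : 0 < I.im := by simp
  have h0 : ∀ p : ℕ × ℕ, ‖(if p = (0, 0) then (1 : ℂ) else 0)‖ ≤ 1 := by intro p; split_ifs <;> simp
  rw [P1, dprod_mul hI hσ (χ₁ := fun p => if p = (0, 0) then 1 else 0)
    (χ₂ := fun p => if p = (0, 0) then 0 else rowWeight p) h0]
  · congr 1
    · rw [dprod, tprod_eq_mulSingle (0, 0)]
      · simp [lat]
      · intro p hp; simp [hp]
    · rw [dprod_reindex (g := fun p => (p.1, p.2 + 1)) (z' := z + σ) (τ' := I) (σ' := σ)]
      · rw [P1]; exact dprod_congr fun p => by simp [rowWeight]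
      · rintro ⟨a, b⟩ ⟨c, d⟩ h; simpa using h
      · rintro ⟨j, k⟩ h
        rcases Nat.eq_zero_or_pos k with rfl | hk
        · by_cases hj : j = 0 <;> simp [rowWeight, hj] at h
        · exact ⟨(j, k - 1), by simp; omega⟩
      · rintro ⟨j, k⟩
        simp only [lat]; congr 1; push_cast; ring
  · intro p; split_ifs; · simp
    · exact norm_rowWeight_le p
  · intro p; split_ifs with h
    · simp [h, rowWeight]
    · simp
  · intro p; split_ifs <;> simp

lemma dprod_add_int (χ : ℕ × ℕ → ℂ) (z τ σ : ℂ) (n : ℤ) : dprod χ (z + n) τ σ = dprod χ z τ σ :=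
  dprod_congr fun p => by
    rw [lat, lat, show z + n + p.1 * τ + p.2 * σ = z + p.1 * τ + p.2 * σ + (n : ℂ) by ring,
      ex_add_int]

lemma P_add_int (z τ σ : ℂ) (n : ℤ) : P (z + n) τ σ = P z τ σ := dprod_add_int ..

lemma P1_add_int (z σ : ℂ) (n : ℤ) : P1 (z + n) σ = P1 z σ := dprod_add_int ..

lemma P_ne_zero {z τ σ : ℂ} (hτ : 0 < τ.im) (hσ : 0 < σ.im)
    (h : ∀ (j k : ℕ) (n : ℤ), z + j * τ + k * σ ≠ n) : P z τ σ ≠ 0 :=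
  dprod_ne_zero hτ hσ (by simp) fun p hp => by
    rw [one_mul, lat, ex_eq_one_iff] at hp
    obtain ⟨n, hn⟩ := hp
    exact h _ _ n hn

lemma P_ne_zero_of_im {z τ σ : ℂ} (hτ : 0 < τ.im) (hσ : 0 < σ.im) (hz : 0 ≤ z.im)
    (h : ∀ n : ℤ, z ≠ n) : P z τ σ ≠ 0 := by
  refine P_ne_zero hτ hσ fun j k n hn => ?_
  have him := congrArg Complex.im hn
  simp at him
  have h1 : 0 ≤ (j : ℝ) * τ.im := by positivity
  have h2 : 0 ≤ (k : ℝ) * σ.im := by positivity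
  have hj : (j : ℝ) = 0 := by
    by_contra hj
    have : 0 < (j : ℝ) * τ.im := mul_pos (lt_of_le_of_ne (by positivity) (Ne.symm hj)) hτ
    linarith
  have hk : (k : ℝ) = 0 := by
    by_contra hk
    have : 0 < (k : ℝ) * σ.im := mul_pos (lt_of_le_of_ne (by positivity) (Ne.symm hk)) hσ
    linarith
  have hj' : j = 0 := by exact_mod_cast hj
  have hk' : k = 0 := by exact_mod_cast hk
  subst hj' hk'
  exact h n (by simpa using hn)

lemma P_ne_zero_of_pos {z τ σ : ℂ} (hτ : 0 < τ.im) (hσ : 0 < σ.im) (hz : 0 < z.im) : P z τ σ ≠ 0 :=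
  P_ne_zero_of_im hτ hσ hz.le fun n hn => by simp [hn] at hz

lemma P1_ne_zero {z σ : ℂ} (hσ : 0 < σ.im) (h : ∀ (k : ℕ) (n : ℤ), z + k * σ ≠ n) : P1 z σ ≠ 0 := by
  refine dprod_ne_zero (by simp) hσ norm_rowWeight_le fun p hp => ?_
  unfold rowWeight at hp
  split_ifs at hp with h0
  · rw [one_mul, lat, ex_eq_one_iff] at hp
    obtain ⟨n, hn⟩ := hp
    exact h p.2 n (by simpa [h0] using hn)
  · simp at hp

lemma P1_ne_zero_of_pos {z σ : ℂ} (hσ : 0 < σ.im) (hz : 0 < z.im) : P1 z σ ≠ 0 := by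
  refine P1_ne_zero hσ fun k n hn => ?_
  have him := congrArg Complex.im hn
  simp at him
  have : 0 ≤ (k : ℝ) * σ.im := by positivity
  linarith

lemma diffOn_P {V : Set ℂ} (hV : IsOpen V) {z τ σ : ℂ → ℂ} (hz : HolOn z V) (hτ : HolOn τ V)
    (hσ : HolOn σ V) (h1 : ∀ x ∈ V, 0 < (τ x).im) (h2 : ∀ x ∈ V, 0 < (σ x).im) :
    HolOn (fun w => P (z w) (τ w) (σ w)) V :=
  diffOn_dprod (by simp) hV hz hτ hσ h1 h2

lemma diffOn_P1 {V : Set ℂ} (hV : IsOpen V) {z σ : ℂ → ℂ} (hz : HolOn z V)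
    (hσ : HolOn σ V) (h2 : ∀ x ∈ V, 0 < (σ x).im) :
    HolOn (fun w => P1 (z w) (σ w)) V :=
  diffOn_dprod norm_rowWeight_le hV hz (differentiableOn_const _) hσ (by simp) h2

lemma differentiable_P {τ σ : ℂ} (hτ : 0 < τ.im) (hσ : 0 < σ.im) :
    Differentiable ℂ fun z => P z τ σ :=
  differentiableOn_univ.1 <| diffOn_P isOpen_univ differentiableOn_id
    (differentiableOn_const _) (differentiableOn_const _) (fun _ _ => hτ) fun _ _ => hσ

lemma differentiable_P1 {σ : ℂ} (hσ : 0 < σ.im) : Differentiable ℂ fun z => P1 z σ :=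
  differentiableOn_univ.1 <| diffOn_P1 isOpen_univ differentiableOn_id
    (differentiableOn_const _) fun _ _ => hσ

lemma contOn_P {α : Type*} [TopologicalSpace α] {s : Set α} {z τ σ : α → ℂ}
    (hz : ContinuousOn z s) (hτ : ContinuousOn τ s)
    (hσ : ContinuousOn σ s) (h1 : ∀ x ∈ s, 0 < (τ x).im) (h2 : ∀ x ∈ s, 0 < (σ x).im) :
    ContinuousOn (fun x => P (z x) (τ x) (σ x)) s := contOn_dprod (by simp) hz hτ hσ h1 h2

/-- The square of indices `j, k < N`. -/
def sq (N : ℕ) : Finset (ℕ × ℕ) := Finset.range N ×ˢ Finset.range N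

/-- The weight deleting the indices `j, k < N`. -/
def cutWeight (N : ℕ) (p : ℕ × ℕ) : ℂ := if p ∈ sq N then 0 else 1

/-- The product `P` without the factors with `j, k < N`. -/
def PCut (N : ℕ) (z τ σ : ℂ) : ℂ := dprod (cutWeight N) z τ σ

lemma norm_cutWeight_le (N : ℕ) (p : ℕ × ℕ) : ‖cutWeight N p‖ ≤ 1 := by
  unfold cutWeight; split_ifs <;> simp

lemma P_eq_cut (N : ℕ) (z : ℂ) {τ σ : ℂ} (hτ : 0 < τ.im) (hσ : 0 < σ.im) :
    P z τ σ = (∏ p ∈ sq N, (1 - lat z τ σ p)) * PCut N z τ σ := by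
  rw [P, dprod_mul hτ hσ (χ₁ := fun p => if p ∈ sq N then 1 else 0) (χ₂ := cutWeight N)
    (fun p => by split_ifs <;> simp) (norm_cutWeight_le N)]
  · rw [PCut]; congr 1
    rw [dprod, tprod_eq_prod (s := sq N)]
    · exact Finset.prod_congr rfl fun p hp => by simp [hp]
    · intro p hp; simp [hp]
  · intro p; unfold cutWeight; split_ifs <;> simp
  · intro p; unfold cutWeight; split_ifs <;> simp

lemma PCut_ne_zero {N : ℕ} {z τ σ : ℂ} (hτ : 0 < τ.im) (hσ : 0 < σ.im)
    (h1 : 0 < z.im + N * τ.im) (h2 : 0 < z.im + N * σ.im) : PCut N z τ σ ≠ 0 := by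
  refine dprod_ne_zero hτ hσ (norm_cutWeight_le N) fun p hp => ?_
  unfold cutWeight at hp
  split_ifs at hp with h
  · simp at hp
  · rw [one_mul] at hp
    refine ex_ne_one_of_im_pos ?_ hp
    simp only [add_im, mul_im, natCast_re, natCast_im, zero_mul, add_zero]
    simp only [sq, Finset.mem_product, Finset.mem_range, not_and_or, not_lt] at h
    have e1 : 0 ≤ (p.1 : ℝ) * τ.im := by positivity
    have e2 : 0 ≤ (p.2 : ℝ) * σ.im := by positivity
    rcases h with h | h
    · have : (N : ℝ) * τ.im ≤ p.1 * τ.im := by gcongr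
      linarith
    · have : (N : ℝ) * σ.im ≤ p.2 * σ.im := by gcongr
      linarith

/-- The modified theta function `θ₀(z; σ) = ∏_{k ≥ 0} (1 - e(z + kσ))(1 - e((k+1)σ - z))`. -/
def th0 (z σ : ℂ) : ℂ := P1 z σ * P1 (σ - z) σ

lemma th0_add_sigma (z : ℂ) {σ : ℂ} (hσ : 0 < σ.im) : th0 (z + σ) σ = -ex (-z) * th0 z σ := by
  have h1 := P1_succ z hσ
  have h2 := P1_succ (-z) hσ
  rw [th0, th0, show σ - (z + σ) = -z by ring, h2, h1, show -z + σ = σ - z by ring, ex_neg]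
  field_simp [ex_ne_zero z]
  ring

lemma th0_neg (z : ℂ) {σ : ℂ} (hσ : 0 < σ.im) : th0 (-z) σ = -ex (-z) * th0 z σ := by
  rw [← th0_add_sigma z hσ, th0, th0, show σ - -z = z + σ by ring, show σ - (z + σ) = -z by ring,
    mul_comm]

lemma th0_add_int (z σ : ℂ) (n : ℤ) : th0 (z + n) σ = th0 z σ := by
  rw [th0, th0, P1_add_int, show σ - (z + n) = σ - z + ((-n : ℤ) : ℂ) by push_cast; ring,
    P1_add_int]

lemma th0_add_one (z σ : ℂ) : th0 (z + 1) σ = th0 z σ := by simpa using th0_add_int z σ 1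

lemma differentiable_th0 {σ : ℂ} (hσ : 0 < σ.im) : Differentiable ℂ fun z => th0 z σ := by
  unfold th0
  exact (differentiable_P1 hσ).fun_mul ((differentiable_P1 hσ).comp (differentiable_id.const_sub σ))

lemma th0_ne_zero {z σ : ℂ} (hσ : 0 < σ.im) (h : ∀ m n : ℤ, z ≠ m + n * σ) : th0 z σ ≠ 0 := by
  refine mul_ne_zero (P1_ne_zero hσ fun k n hn => h n (-k) ?_)
    (P1_ne_zero hσ fun k n hn => h (-n) (k + 1) ?_)
  · push_cast; linear_combination hn
  · push_cast; linear_combination -hn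

/-! ### The theta function -/

lemma theta_eq_jacobi (z τ : ℂ) : theta z τ =
    -(expπ (τ / 4 + z + 1 / 2) * jacobiTheta₂ (z + 1 / 2 + τ / 2) τ) := by
  rw [theta, jacobiTheta₂, ← tsum_mul_left]
  congr 1
  refine tsum_congr fun n => ?_
  rw [jacobiTheta₂_term, ← exp_add]
  ring_nf

lemma theta_add_one (z τ : ℂ) : theta (z + 1) τ = -theta z τ := by
  rw [theta_eq_jacobi, theta_eq_jacobi, show z + 1 + 1 / 2 + τ / 2 = z + 1 / 2 + τ / 2 + 1 by ring,
    jacobiTheta₂_add_left, show (π : ℂ) * I * (τ / 4 + (z + 1) + 1 / 2) =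
      π * I * (τ / 4 + z + 1 / 2) + π * I by ring, exp_add, exp_pi_mul_I]
  ring

lemma theta_neg (z τ : ℂ) : theta (-z) τ = -theta z τ := by
  rw [theta_eq_jacobi, theta_eq_jacobi]
  have h1 : jacobiTheta₂ (-z + 1 / 2 + τ / 2) τ = jacobiTheta₂ (z - 1 / 2 - τ / 2) τ := by
    rw [← jacobiTheta₂_neg_left]; ring_nf
  have h2 := jacobiTheta₂_add_left' (z - 1 / 2 - τ / 2 + 1) τ
  rw [show z - 1 / 2 - τ / 2 + 1 + τ = z + 1 / 2 + τ / 2 by ring, jacobiTheta₂_add_left] at h2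
  rw [h1, h2, ← mul_assoc, ← exp_add]
  rw [show (π : ℂ) * I * (τ / 4 + z + 1 / 2) + -π * I * (τ + 2 * (z - 1 / 2 - τ / 2 + 1)) =
      π * I * (τ / 4 + -z + 1 / 2) + -(π * I) by ring, exp_add _ (-(π * I)),
    exp_neg, exp_pi_mul_I]
  ring

lemma theta_zero (τ : ℂ) : theta 0 τ = 0 := by
  have := theta_neg 0 τ
  rw [neg_zero] at this
  linear_combination this / 2

lemma theta_add_tau (z τ : ℂ) : theta (z + τ) τ = -exp (-(π * I * (τ + 2 * z))) * theta z τ := by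
  rw [theta_eq_jacobi, theta_eq_jacobi, show z + τ + 1 / 2 + τ / 2 = z + 1 / 2 + τ / 2 + τ by ring,
    jacobiTheta₂_add_left']
  have : expπ (τ / 4 + (z + τ) + 1 / 2) * exp (-π * I * (τ + 2 * (z + 1 / 2 + τ / 2))) =
      exp (-(π * I * (τ + 2 * z))) * -expπ (τ / 4 + z + 1 / 2) := by
    have e : exp (-(π * I)) = -1 := by rw [exp_neg, exp_pi_mul_I]; norm_num
    have e' : -expπ (τ / 4 + z + 1 / 2) =
        exp (-(π * I)) * expπ (τ / 4 + z + 1 / 2) := by rw [e]; ring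
    rw [e', ← exp_add, ← exp_add, ← exp_add]
    ring_nf
  linear_combination (-(jacobiTheta₂ (z + 1 / 2 + τ / 2) τ)) * this

lemma theta_modular (z : ℂ) {τ : ℂ} (hτ : 0 < τ.im) : theta (z / τ) (-1 / τ) =
    -I * (-I * τ) ^ (1 / 2 : ℂ) * exp (π * I * z ^ 2 / τ) * theta z τ := by
  have hτ0 : τ ≠ 0 := by rintro rfl; simp at hτ
  have hs : (-I * τ) ^ (1 / 2 : ℂ) ≠ 0 := by simp [hτ0]
  have h := jacobiTheta₂_functional_equation (z - 1 / 2 + τ / 2) τ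
  have h1 : jacobiTheta₂ (z + 1 / 2 + τ / 2) τ = jacobiTheta₂ (z - 1 / 2 + τ / 2) τ := by
    rw [← jacobiTheta₂_add_left (z - 1 / 2 + τ / 2)]; ring_nf
  have h2 : (z - 1 / 2 + τ / 2) / τ = z / τ + 1 / 2 + -1 / τ / 2 := by field_simp; ring
  rw [h2] at h
  rw [theta_eq_jacobi, theta_eq_jacobi, h1, h]
  have e : expπ (-1 / τ / 4 + z / τ + 1 / 2) = -I * exp (π * I * z ^ 2 / τ) *
      expπ (τ / 4 + z + 1 / 2) * exp (-π * I * (z - 1 / 2 + τ / 2) ^ 2 / τ) := by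
    have e1 : -I = exp (-(π * I / 2)) := by
      rw [exp_neg, show (π : ℂ) * I / 2 = π / 2 * I by ring, exp_pi_div_two_mul_I]
      simp
    rw [e1, ← exp_add, ← exp_add, ← exp_add]
    congr 1
    field_simp
    ring
  rw [e]
  field_simp

lemma continuousOn_theta : ContinuousOn (fun q : ℂ × ℂ => theta q.1 q.2) {q | 0 < q.2.im} := by
  intro q hq
  refine ContinuousAt.continuousWithinAt ?_
  have h : (fun q : ℂ × ℂ => theta q.1 q.2) = fun q : ℂ × ℂ =>
      -(expπ (q.2 / 4 + q.1 + 1 / 2) * jacobiTheta₂ (q.1 + 1 / 2 + q.2 / 2) q.2) := by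
    funext q; exact theta_eq_jacobi ..
  rw [h]
  refine (ContinuousAt.mul (by fun_prop) ?_).neg
  exact ContinuousAt.comp (f := fun q : ℂ × ℂ => (q.1 + 1 / 2 + q.2 / 2, q.2))
    (continuousAt_jacobiTheta₂ (q.1 + 1 / 2 + q.2 / 2) hq) (by fun_prop)

lemma contOn_theta {α : Type*} [TopologicalSpace α] {s : Set α} {z τ : α → ℂ}
    (hz : ContinuousOn z s) (hτ : ContinuousOn τ s) (h : ∀ x ∈ s, 0 < (τ x).im) :
    ContinuousOn (fun x => theta (z x) (τ x)) s := by
  have := continuousOn_theta.comp (f := fun x => (z x, τ x)) (s := s) (hz.prodMk hτ) h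
  exact this

lemma diffOn_jacobi {V : Set ℂ} (hV : IsOpen V) {z τ : ℂ → ℂ}
    (hz : HolOn z V) (hτ : HolOn τ V) (h : ∀ x ∈ V, 0 < (τ x).im) :
    HolOn (fun w => jacobiTheta₂ (z w) (τ w)) V := by
  intro w hw
  have h1 := (hasFDerivAt_jacobiTheta₂ (z w) (h w hw)).differentiableAt
  have h2 : DifferentiableAt ℂ (fun w => (z w, τ w)) w :=
    (hz.differentiableAt (hV.mem_nhds hw)).prodMk (hτ.differentiableAt (hV.mem_nhds hw))
  have h3 : DifferentiableAt ℂ ((fun p : ℂ × ℂ => jacobiTheta₂ p.1 p.2) ∘ fun w => (z w, τ w)) w :=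
    DifferentiableAt.comp w h1 h2
  exact h3.differentiableWithinAt

lemma diffOn_theta {V : Set ℂ} (hV : IsOpen V) {z τ : ℂ → ℂ}
    (hz : HolOn z V) (hτ : HolOn τ V) (h : ∀ x ∈ V, 0 < (τ x).im) :
    HolOn (fun w => theta (z w) (τ w)) V := by
  simp only [theta_eq_jacobi]
  refine (DifferentiableOn.fun_mul ?_ (diffOn_jacobi hV ?_ hτ h)).neg
  · exact DifferentiableOn.cexp ((((hτ.div_const 4).add hz).add_const _).const_mul _)
  · exact (hz.add_const _).add (hτ.div_const 2)

lemma differentiable_theta {τ : ℂ} (hτ : 0 < τ.im) : Differentiable ℂ fun z => theta z τ :=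
  differentiableOn_univ.1 <| diffOn_theta isOpen_univ differentiableOn_id
    (differentiableOn_const _) fun _ _ => hτ

/-! ### Functions with the quasi-periods of `θ₀` -/

lemma fourierC_quasi {f : ℂ → ℂ} {σ : ℂ} (hf : Differentiable ℂ f)
    (h1 : ∀ z, f (z + 1) = f z) (hs : ∀ z, f (z + σ) = -ex (-z) * f z) (n : ℤ) :
    fourierC f 0 (n + 1) = -ex (n * σ) * fourierC f 0 n := by
  have hmem : ∀ z : ℂ, z.im = 0 ∨ z = σ → z ∈ strip (-(|σ.im| + 1)) (|σ.im| + 1) := by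
    rintro z (h | rfl)
    · have := abs_nonneg σ.im
      simp only [strip, mem_ofPred_eq, h]
      constructor <;> linarith
    · have := abs_nonneg z.im
      simp only [strip, mem_ofPred_eq]
      constructor
      · linarith [neg_abs_le z.im]
      · linarith [le_abs_self z.im]
  have h := fourierC_congr_base hf.differentiableOn (fun z _ => h1 z) (hmem 0 (by simp))
    (hmem σ (by simp)) n
  rw [h, fourierC, fourierC, lineInt, lineInt, ← intervalIntegral.integral_const_mul]
  refine intervalIntegral.integral_congr fun x _ => ?_
  simp only [zero_add]
  rw [add_comm σ, hs, show -((n : ℂ) * (x + σ)) = -(n * x) + -(n * σ) by ring, ex_add,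
    show -(((n + 1 : ℤ) : ℂ) * x) = -(n * x) + -x by push_cast; ring, ex_add, ex_neg (n * σ)]
  field_simp [ex_ne_zero (n * σ)]

lemma quasi_unique {f g : ℂ → ℂ} {σ : ℂ} (hf : Differentiable ℂ f) (hg : Differentiable ℂ g)
    (hf1 : ∀ z, f (z + 1) = f z) (hfs : ∀ z, f (z + σ) = -ex (-z) * f z)
    (hg1 : ∀ z, g (z + 1) = g z) (hgs : ∀ z, g (z + σ) = -ex (-z) * g z) (z : ℂ) :
    fourierC g 0 0 * f z = fourierC f 0 0 * g z := by
  have key : ∀ n : ℤ, fourierC g 0 0 * fourierC f 0 n = fourierC f 0 0 * fourierC g 0 n := by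
    intro n
    induction n with
    | zero => ring
    | succ n ih =>
      rw [fourierC_quasi hf hf1 hfs, fourierC_quasi hg hg1 hgs]
      linear_combination (-ex ((n : ℤ) * σ)) * ih
    | pred n ih =>
      have e1 := fourierC_quasi hf hf1 hfs (-n - 1)
      have e2 := fourierC_quasi hg hg1 hgs (-n - 1)
      rw [sub_add_cancel] at e1 e2
      rw [e1, e2] at ih
      have := ex_ne_zero (((-n - 1 : ℤ) : ℂ) * σ)
      refine mul_left_cancel₀ (neg_ne_zero.2 this) ?_
      linear_combination ih
  have hm : ∀ w : ℂ, w.im = 0 ∨ w = z → w ∈ strip (-(|z.im| + 1)) (|z.im| + 1) := by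
    rintro w (h | rfl)
    · have := abs_nonneg z.im
      simp only [strip, mem_ofPred_eq, h]
      constructor <;> linarith
    · simp only [strip, mem_ofPred_eq]
      constructor
      · linarith [neg_abs_le w.im]
      · linarith [le_abs_self w.im]
  have hF := (fourier_hasSum hf.differentiableOn (fun z _ => hf1 z) (hm 0 (by simp))
    (hm z (by simp))).mul_left (fourierC g 0 0)
  have hG := (fourier_hasSum hg.differentiableOn (fun z _ => hg1 z) (hm 0 (by simp))
    (hm z (by simp))).mul_left (fourierC f 0 0)
  refine hF.unique (hG.congr_fun ?_)
  intro n
  linear_combination (ex (n * z)) * key n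

lemma th0_half_ne_zero {σ : ℂ} (hσ : 0 < σ.im) : th0 (1 / 2) σ ≠ 0 := by
  refine th0_ne_zero hσ fun m n h => ?_
  have him := congrArg Complex.im h
  have hre := congrArg Complex.re h
  simp at him hre
  rcases him with h0 | h0
  · subst h0
    simp at hre
    have h2 : ((2 * m : ℤ) : ℝ) = ((1 : ℤ) : ℝ) := by push_cast; linarith
    have h3 : 2 * m = 1 := by exact_mod_cast h2
    omega
  · exact hσ.ne' h0

/-- A quasi-periodic entire function is a multiple of `θ₀`. -/
lemma quasi_eq_mul_th0 {f : ℂ → ℂ} {σ : ℂ} (hσ : 0 < σ.im) (hf : Differentiable ℂ f)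
    (hf1 : ∀ z, f (z + 1) = f z) (hfs : ∀ z, f (z + σ) = -ex (-z) * f z) :
    ∃ c : ℂ, ∀ z, f z = c * th0 z σ := by
  have h := quasi_unique (differentiable_th0 hσ) (differentiable_th0 hσ) (fun z => th0_add_one z σ)
    (fun z => th0_add_sigma z hσ) (fun z => th0_add_one z σ) (fun z => th0_add_sigma z hσ)
  have h' := quasi_unique hf (differentiable_th0 hσ) hf1 hfs (fun z => th0_add_one z σ)
    (fun z => th0_add_sigma z hσ)
  by_cases h0 : fourierC (fun z => th0 z σ) 0 0 = 0
  · -- then `θ₀` would vanish identically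
    exfalso
    have h2 := quasi_unique (f := fun z => th0 z σ) (g := fun z => th0 z σ)
      (differentiable_th0 hσ) (differentiable_th0 hσ) (fun z => th0_add_one z σ)
      (fun z => th0_add_sigma z hσ) (fun z => th0_add_one z σ) (fun z => th0_add_sigma z hσ)
    have hall : ∀ n : ℤ, fourierC (fun z => th0 z σ) 0 n = 0 := by
      intro n
      have hr := fourierC_quasi (differentiable_th0 hσ) (fun z => th0_add_one z σ)
        (fun z => th0_add_sigma z hσ)
      induction n with
      | zero => exact h0
      | succ n ih => rw [hr, ih, mul_zero]
      | pred n ih =>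
        have e1 := hr (-n - 1)
        rw [sub_add_cancel, ih] at e1
        exact (mul_eq_zero.1 e1.symm).resolve_left (neg_ne_zero.2 (ex_ne_zero _))
    have hm : ∀ w : ℂ, w.im = 0 → w ∈ strip (-1) 1 := by intro w h; simp [strip, h]
    have hs := fourier_hasSum (differentiable_th0 hσ).differentiableOn (fun z _ => th0_add_one z σ)
      (hm 0 (by simp)) (hm (1 / 2) (by simp))
    simp only [hall, zero_mul] at hs
    exact th0_half_ne_zero hσ (hs.unique hasSum_zero)
  · exact ⟨fourierC f 0 0 / fourierC (fun z => th0 z σ) 0 0, fun z => by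
      rw [div_mul_eq_mul_div, eq_div_iff h0, ← h' z]; ring⟩

/-- The ratio `C(τ)` in `θ(z, τ) = C(τ) e^{-π i z} θ₀(z; τ)`, read off at `z = 1/2`. -/
def thC (τ : ℂ) : ℂ := I * theta (1 / 2) τ / th0 (1 / 2) τ

lemma theta_eq_th0 (z : ℂ) {τ : ℂ} (hτ : 0 < τ.im) :
    theta z τ = thC τ * exp (-(π * I * z)) * th0 z τ := by
  obtain ⟨c, hc⟩ := quasi_eq_mul_th0 (f := fun z => expπ z * theta z τ) hτ
    ((by fun_prop : Differentiable ℂ fun z : ℂ => expπ z).fun_mul (differentiable_theta hτ))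
    (fun z => by rw [theta_add_one, mul_add, mul_one, exp_add, exp_pi_mul_I]; ring)
    (fun z => by
      rw [theta_add_tau, ex, mul_add, exp_add, show -(π * I * (τ + 2 * z)) =
        -(π * I * τ) + 2 * π * I * -z by ring, exp_add, exp_neg]
      field_simp)
  have h2 := hc (1 / 2)
  have hI : expπ (1 / 2) = I := by
    rw [show (π : ℂ) * I * (1 / 2) = π / 2 * I by ring, exp_pi_div_two_mul_I]
  have hc' : c = thC τ := by rw [thC, eq_div_iff (th0_half_ne_zero hτ), ← h2, hI]
  rw [← hc', exp_neg, mul_right_comm, ← hc z]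
  field_simp

lemma thC_ne_zero {τ : ℂ} (hτ : 0 < τ.im) : thC τ ≠ 0 := by
  intro h
  have hJ : ∀ z, jacobiTheta₂ z τ = 0 := by
    intro z
    have := theta_eq_th0 (z - 1 / 2 - τ / 2) hτ
    rw [h, theta_eq_jacobi, zero_mul, zero_mul, neg_eq_zero, mul_eq_zero] at this
    have := this.resolve_left (exp_ne_zero _)
    rwa [show z - 1 / 2 - τ / 2 + 1 / 2 + τ / 2 = z by ring] at this
  -- the constant Fourier coefficient of the Jacobi theta function is `1`
  have hs := intervalIntegral.hasSum_intervalIntegral_of_summable_norm (a := (0 : ℝ)) (b := 1)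
    (f := fun n : ℤ => ⟨fun x : ℝ => jacobiTheta₂_term n x τ, by
      unfold jacobiTheta₂_term; fun_prop⟩) (by
      refine (summable_pow_mul_jacobiTheta₂_term_bound 0 hτ 0).of_nonneg_of_le
        (fun _ => norm_nonneg _) fun n => ?_
      rw [ContinuousMap.norm_le _ (by positivity)]
      intro x
      simpa using norm_jacobiTheta₂_term_le hτ (S := 0) (z := (x : ℂ)) (by simp) le_rfl n)
  simp only [ContinuousMap.coe_mk] at hs
  have h0 : (∫ x in (0 : ℝ)..1, ∑' n : ℤ, jacobiTheta₂_term n x τ) = 0 := by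
    have : ∀ x : ℝ, ∑' n : ℤ, jacobiTheta₂_term n x τ = 0 := fun x => hJ x
    simp [this]
  rw [h0] at hs
  have hn : ∀ n : ℤ, n ≠ 0 → ∫ x in (0 : ℝ)..1, jacobiTheta₂_term n x τ = 0 := by
    intro n hn
    have : ∀ x : ℝ, jacobiTheta₂_term n x τ =
        exp (2 * π * I * n * x) * exp (π * I * n ^ 2 * τ) := by
      intro x; rw [jacobiTheta₂_term, ← exp_add]
    simp only [this]
    rw [intervalIntegral.integral_mul_const, integral_exp_mul_complex (by simp [hn])]
    simp only [ofReal_one, mul_one, ofReal_zero, mul_zero, exp_zero]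
    rw [show 2 * (π : ℂ) * I * n = n * (2 * π * I) by ring, exp_int_mul_two_pi_mul_I]
    simp
  have h1 := hs.unique (hasSum_single 0 hn)
  simp [jacobiTheta₂_term] at h1

lemma theta_eq_zero_iff (z : ℂ) {τ : ℂ} (hτ : 0 < τ.im) : theta z τ = 0 ↔ th0 z τ = 0 := by
  rw [theta_eq_th0 z hτ]
  simp [thC_ne_zero hτ, exp_ne_zero]

lemma theta_ne_zero {z σ : ℂ} (hσ : 0 < σ.im) (h : ∀ m n : ℤ, z ≠ m + n * σ) :
    theta z σ ≠ 0 := fun h0 => th0_ne_zero hσ h ((theta_eq_zero_iff z hσ).1 h0)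

/-- `θ₀(z; σ) / (1 - e(z))`, which is regular and non-zero at `z = 0`. -/
def th1 (z σ : ℂ) : ℂ := P1 (z + σ) σ * P1 (σ - z) σ

lemma th0_eq_th1 (z : ℂ) {σ : ℂ} (hσ : 0 < σ.im) : th0 z σ = (1 - ex z) * th1 z σ := by
  rw [th0, th1, P1_succ z hσ]; ring

lemma differentiable_th1 {σ : ℂ} (hσ : 0 < σ.im) : Differentiable ℂ fun z => th1 z σ := by
  unfold th1
  exact ((differentiable_P1 hσ).comp (differentiable_id.add_const σ)).fun_mul
    ((differentiable_P1 hσ).comp (differentiable_id.const_sub σ))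

lemma th1_ne_zero {z σ : ℂ} (hσ : 0 < σ.im) (hz : |z.im| < σ.im) : th1 z σ ≠ 0 := by
  rw [abs_lt] at hz
  exact mul_ne_zero (P1_ne_zero_of_pos hσ (by simp; linarith))
    (P1_ne_zero_of_pos hσ (by simp; linarith))

lemma hasDerivAt_ex (z : ℂ) : HasDerivAt ex (2 * π * I * ex z) z := by
  have := ((hasDerivAt_id z).const_mul (2 * π * I)).cexp
  simp only [id, mul_one] at this
  rw [mul_comm]
  exact this

lemma hasDerivAt_th0_zero {σ : ℂ} (hσ : 0 < σ.im) :
    HasDerivAt (fun z => th0 z σ) (-(2 * π * I) * P1 σ σ ^ 2) 0 := by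
  have h1 : HasDerivAt (fun z => 1 - ex z) (-(2 * π * I * ex 0)) 0 := by
    simpa using (hasDerivAt_ex 0).const_sub 1
  have h2 := h1.fun_mul (differentiable_th1 hσ 0).hasDerivAt
  have h3 : (fun z => th0 z σ) = fun z => (1 - ex z) * th1 z σ := by funext z; exact th0_eq_th1 z hσ
  rw [h3]
  refine h2.congr_deriv ?_
  rw [ex_zero, th1, zero_add, sub_zero]
  ring

lemma deriv_theta_zero {σ : ℂ} (hσ : 0 < σ.im) :
    deriv (fun z => theta z σ) 0 = -(2 * π * I) * thC σ * P1 σ σ ^ 2 := by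
  have h3 : (fun z => theta z σ) = fun z => thC σ * exp (-(π * I * z)) * th0 z σ := by
    funext z; exact theta_eq_th0 z hσ
  have h1 : HasDerivAt (fun z : ℂ => thC σ * exp (-(π * I * z)))
      (thC σ * (exp (-(π * I * 0)) * -(π * I * 1))) 0 :=
    (((hasDerivAt_id (0 : ℂ)).const_mul (π * I : ℂ)).neg.cexp).const_mul _
  rw [h3, (h1.fun_mul (hasDerivAt_th0_zero hσ)).deriv]
  have : th0 0 σ = 0 := by rw [th0_eq_th1 0 hσ]; simp
  rw [this]; simp; ring

/-! ### Modular transformation of `θ₀` -/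

/-- The exponent in the modular transformation of `θ₀`. -/
def modB (z τ : ℂ) : ℂ := z ^ 2 / τ + z * (1 / τ - 1) + (τ + 1 / τ) / 6 - 1 / 2

lemma im_neg_one_div_pos {τ : ℂ} (hτ : 0 < τ.im) : 0 < (-1 / τ).im := by
  have hτ0 : τ ≠ 0 := by rintro rfl; simp at hτ
  rw [neg_div, one_div, neg_im, inv_im, neg_div, neg_neg]
  exact div_pos hτ (normSq_pos.2 hτ0)

lemma eta_eq_P1 (τ : ℂ) : ModularForm.eta τ = ex (τ / 24) * P1 τ τ := by
  rw [ModularForm.eta, P1_eq_tprod, Function.Periodic.qParam, ex]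
  congr 1
  · congr 1; push_cast; ring
  · refine tprod_congr fun n => ?_
    rw [ModularForm.eta_q_eq_cexp, ex]
    ring_nf

lemma P1_modular {τ : ℂ} (hτ : 0 < τ.im) : (ex (-1 / τ / 24) * P1 (-1 / τ) (-1 / τ)) ^ 2 =
    -I * τ * (ex (τ / 24) * P1 τ τ) ^ 2 := by
  have h := ModularForm.eta_comp_eq_csqrt_I_inv hτ
  simp only [Function.comp_apply, Pi.smul_apply, Pi.mul_apply, smul_eq_mul] at h
  rw [eta_eq_P1, eta_eq_P1] at h
  rw [h, mul_pow, mul_pow, inv_pow]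
  have hsq : ∀ z : ℂ, Complex.sqrt z ^ 2 = z := by
    intro z
    have := Complex.cpow_nat_inv_pow z two_ne_zero
    exact this
  rw [hsq, hsq]
  simp
  ring

lemma th0_modular (z : ℂ) {τ : ℂ} (hτ : 0 < τ.im) :
    th0 (z / τ) (-1 / τ) = exp (π * I * modB z τ) * th0 z τ := by
  have hτ0 : τ ≠ 0 := by rintro rfl; simp at hτ
  have hτ' := im_neg_one_div_pos hτ
  have hP := P1_ne_zero_of_pos hτ hτ
  have hB : Differentiable ℂ fun z => exp (-(π * I * modB z τ)) := by unfold modB; fun_prop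
  have hT : Differentiable ℂ fun z => th0 (z / τ) (-1 / τ) :=
    (differentiable_th0 hτ').comp (differentiable_id.div_const τ)
  obtain ⟨c, hc⟩ := quasi_eq_mul_th0
    (f := fun z => exp (-(π * I * modB z τ)) * th0 (z / τ) (-1 / τ)) hτ
    (hB.fun_mul hT)
    (fun z => by
      have h1 := th0_add_sigma (z / τ + 1 / τ) hτ'
      rw [show z / τ + 1 / τ + -1 / τ = z / τ by ring] at h1
      rw [h1, show (z + 1) / τ = z / τ + 1 / τ by ring, ex]
      have : exp (-(π * I * modB (z + 1) τ)) =
          exp (-(π * I * modB z τ)) * -exp (2 * π * I * -(z / τ + 1 / τ)) := by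
        have e : (-1 : ℂ) = exp (π * I) := exp_pi_mul_I.symm
        rw [← neg_one_mul (exp (2 * π * I * -(z / τ + 1 / τ))), e, ← exp_add, ← exp_add]
        congr 1
        unfold modB
        field_simp
        ring
      rw [this]; ring)
    (fun z => by
      rw [show (z + τ) / τ = z / τ + 1 by field_simp, th0_add_one, ex]
      have : exp (-(π * I * modB (z + τ) τ)) =
          -exp (2 * π * I * -z) * exp (-(π * I * modB z τ)) := by
        have e : -exp (2 * π * I * -z) = exp (-(π * I)) * exp (2 * π * I * -z) := by
          rw [exp_neg, exp_pi_mul_I]; norm_num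
        rw [e, ← exp_add, ← exp_add]
        congr 1
        unfold modB
        field_simp
        ring
      rw [this]; ring)
  have hd1 : HasDerivAt (fun z => th0 (z / τ) (-1 / τ))
      (-(2 * π * I) * P1 (-1 / τ) (-1 / τ) ^ 2 * (1 / τ)) 0 := by
    have h0 : HasDerivAt (fun z => th0 z (-1 / τ)) (-(2 * π * I) * P1 (-1 / τ) (-1 / τ) ^ 2)
        ((fun z : ℂ => z / τ) 0) := by simpa using hasDerivAt_th0_zero hτ'
    exact HasDerivAt.comp 0 h0 ((hasDerivAt_id (0 : ℂ)).div_const τ)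
  have h00 : th0 (0 / τ) (-1 / τ) = 0 := by rw [zero_div, th0_eq_th1 0 hτ']; simp
  have hd2 := (hB 0).hasDerivAt.fun_mul hd1
  have hd3 := (hasDerivAt_th0_zero hτ).const_mul c
  have hfun : (fun z => exp (-(π * I * modB z τ)) * th0 (z / τ) (-1 / τ)) =
      fun z => c * th0 z τ := by funext z; exact hc z
  rw [hfun] at hd2
  have heq := hd2.unique hd3
  rw [h00] at heq
  have hm := P1_modular hτ
  have hc1 : c = 1 := by
    have hpi : (π : ℂ) ≠ 0 := by simp [Real.pi_ne_zero]
    have e1 : exp (-(π * I * modB 0 τ)) * P1 (-1 / τ) (-1 / τ) ^ 2 = c * τ * P1 τ τ ^ 2 := by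
      have : (2 * (π : ℂ) * I) ≠ 0 := by simp [Real.pi_ne_zero]
      refine mul_left_cancel₀ this ?_
      have h1 : τ * (1 / τ) = 1 := by field_simp
      linear_combination (-τ) * heq - 2 * π * I * exp (-(π * I * modB 0 τ)) *
        P1 (-1 / τ) (-1 / τ) ^ 2 * h1
    have e2 : exp (-(π * I * modB 0 τ)) * ex (τ / 24) ^ 2 = I * ex (-1 / τ / 24) ^ 2 := by
      have e : I = exp (π / 2 * I) := exp_pi_div_two_mul_I.symm
      rw [ex, ex, ← exp_nat_mul, ← exp_nat_mul, e, ← exp_add, ← exp_add, ← e]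
      congr 1
      unfold modB
      field_simp
      ring
    have hx := ex_ne_zero (τ / 24)
    have hy := ex_ne_zero (-1 / τ / 24)
    rw [mul_pow, mul_pow] at hm
    have e3 : c * (τ * P1 τ τ ^ 2 * ex (τ / 24) ^ 2) = 1 * (τ * P1 τ τ ^ 2 * ex (τ / 24) ^ 2) := by
      calc c * (τ * P1 τ τ ^ 2 * ex (τ / 24) ^ 2) = (c * τ * P1 τ τ ^ 2) * ex (τ / 24) ^ 2 := by ring
        _ = P1 (-1 / τ) (-1 / τ) ^ 2 * (exp (-(π * I * modB 0 τ)) * ex (τ / 24) ^ 2) := by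
          rw [← e1]; ring
        _ = I * (ex (-1 / τ / 24) ^ 2 * P1 (-1 / τ) (-1 / τ) ^ 2) := by rw [e2]; ring
        _ = _ := by
          rw [hm]
          linear_combination (-τ * P1 τ τ ^ 2 * ex (τ / 24) ^ 2) * I_sq
    exact mul_right_cancel₀ (by positivity) e3
  have := hc z
  rw [hc1, one_mul] at this
  rw [← this, ← mul_assoc, ← exp_add]
  simp

/-- The modular transformation of the ratio between `θ` and `θ₀`. -/
lemma thC_modular {τ : ℂ} (hτ : 0 < τ.im) : thC (-1 / τ) =
    -I * (-I * τ) ^ (1 / 2 : ℂ) * exp (-(π * I * ((τ + 1 / τ) / 6 - 1 / 2))) * thC τ := by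
  have hτ0 : τ ≠ 0 := by rintro rfl; simp at hτ
  have h := theta_modular (1 / 2) hτ
  rw [theta_eq_th0 _ hτ, theta_eq_th0 _ (im_neg_one_div_pos hτ), th0_modular _ hτ] at h
  have h0 := th0_half_ne_zero hτ
  have e : exp (-(π * I * (1 / 2 / τ))) * exp (π * I * modB (1 / 2) τ) *
      exp (-(π * I * ((τ + 1 / τ) / 6 - 1 / 2))) =
      exp (π * I * (1 / 2) ^ 2 / τ) * exp (-(π * I * (1 / 2))) := by
    rw [← exp_add, ← exp_add, ← exp_add]
    congr 1
    unfold modB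
    field_simp
    ring
  have hne : exp (-(π * I * (1 / 2 / τ))) * exp (π * I * modB (1 / 2) τ) * th0 (1 / 2) τ ≠ 0 :=
    mul_ne_zero (mul_ne_zero (exp_ne_zero _) (exp_ne_zero _)) h0
  refine mul_right_cancel₀ hne ?_
  linear_combination h + (I * (-I * τ) ^ (1 / 2 : ℂ) * thC τ * th0 (1 / 2) τ) * e

/-! ### The Weierstrass identity -/

lemma tsum_int_mod {m : ℕ} [NeZero m] {f : ℤ → ℂ} (hf : Summable f) :
    ∑' n, f n = ∑ i : Fin m, ∑' k : ℤ, f (m * k + i) := by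
  have h1 := (Int.divModEquiv m).symm.tsum_eq f
  have h2 : Summable fun p : ℤ × Fin m => f ((Int.divModEquiv m).symm p) :=
    (Int.divModEquiv m).symm.summable_iff.2 hf
  have h3 : Summable fun p : Fin m × ℤ => f ((Int.divModEquiv m).symm p.swap) :=
    (Equiv.prodComm (Fin m) ℤ).summable_iff.2 h2
  rw [← h1, ← (Equiv.prodComm (Fin m) ℤ).tsum_eq]
  simp only [Equiv.prodComm_apply]
  rw [h3.tsum_prod, tsum_fintype]
  refine Finset.sum_congr rfl fun i _ => tsum_congr fun k => ?_
  simp [Int.divModEquiv]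
  congr 1
  ring

/-- One of the two theta series of the even and odd characteristic. -/
def thetaPair (r : ℤ) (x τ : ℂ) : ℂ :=
  ∑' k : ℤ, expπ ((2 * k + r) ^ 2 * τ / 2 + 2 * (2 * k + r) * x)

/-- The summand of `θ`. -/
def thetaTerm (z τ : ℂ) (n : ℤ) : ℂ := exp (π * I *
    (((n : ℂ) + 1 / 2) ^ 2 * τ + ((n : ℂ) + 1 / 2) * (2 * z + 1)))

lemma summable_thetaTerm (z : ℂ) {τ : ℂ} (hτ : 0 < τ.im) : Summable (thetaTerm z τ) := by
  have h := ((summable_jacobiTheta₂_term_iff (z + 1 / 2 + τ / 2) τ).2 hτ).mul_left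
    (expπ (τ / 4 + z + 1 / 2))
  refine h.congr fun n => ?_
  rw [thetaTerm, jacobiTheta₂_term, ← exp_add]
  ring_nf

/-- The pairs of summation indices are sorted by their difference, according to parity. -/
lemma theta_mul_theta (x y : ℂ) {τ : ℂ} (hτ : 0 < τ.im) : theta (x + y) τ * theta (x - y) τ =
      thetaPair 0 x τ * thetaPair 1 y τ - thetaPair 1 x τ * thetaPair 0 y τ := by
  have hx := (summable_thetaTerm (x + y) hτ).norm
  have hy := (summable_thetaTerm (x - y) hτ).norm
  have hxy := summable_mul_of_summable_norm hx hy
  let e : ℤ × ℤ ≃ ℤ × ℤ := ⟨fun p => (p.2 + p.1, p.2), fun p => (p.1 - p.2, p.2),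
    fun p => by simp, fun p => by simp⟩
  have h1 : theta (x + y) τ * theta (x - y) τ =
      ∑' p : ℤ × ℤ, thetaTerm (x + y) τ p.1 * thetaTerm (x - y) τ p.2 := by
    rw [← tsum_mul_tsum_of_summable_norm hx hy, theta, theta, neg_mul_neg]; rfl
  have h2 : Summable fun p : ℤ × ℤ => thetaTerm (x + y) τ (p.2 + p.1) * thetaTerm (x - y) τ p.2 :=
    e.summable_iff.2 hxy
  have h3 : theta (x + y) τ * theta (x - y) τ =
      ∑' s : ℤ, ∑' m : ℤ, thetaTerm (x + y) τ (m + s) * thetaTerm (x - y) τ m := by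
    rw [h1, ← e.tsum_eq, ← h2.tsum_prod]; rfl
  have h4 : Summable fun s : ℤ => ∑' m : ℤ, thetaTerm (x + y) τ (m + s) * thetaTerm (x - y) τ m :=
    h2.prod
  rw [h3, tsum_int_mod (m := 2) h4, Fin.sum_univ_two]
  have hterm : ∀ s m : ℤ, thetaTerm (x + y) τ (m + s) * thetaTerm (x - y) τ m =
      expπ (s ^ 2 * τ / 2 + 2 * s * y) *
        (expπ ((2 * m + s + 1) ^ 2 * τ / 2 + 2 * (2 * m + s + 1) * x) * expπ (2 * m + s + 1)) := by
    intro s m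
    rw [thetaTerm, thetaTerm, ← exp_add, ← exp_add, ← exp_add]
    push_cast
    ring_nf
  have heven : ∀ l : ℤ, ∑' m : ℤ, thetaTerm (x + y) τ (m + 2 * l) * thetaTerm (x - y) τ m =
      expπ ((2 * l + 0) ^ 2 * τ / 2 + 2 * (2 * l + 0) * y) * -thetaPair 1 x τ := by
    intro l
    rw [thetaPair, ← tsum_neg, ← tsum_mul_left]
    conv_rhs => rw [← (Equiv.addRight l).tsum_eq]
    refine tsum_congr fun m => ?_
    rw [hterm]
    have : expπ (2 * m + (2 * l : ℤ) + 1) = -1 := by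
      rw [show (π : ℂ) * I * (2 * m + (2 * l : ℤ) + 1) =
        ((m + l : ℤ) : ℂ) * (2 * π * I) + π * I by push_cast; ring, exp_add,
        exp_int_mul_two_pi_mul_I, exp_pi_mul_I, one_mul]
    rw [this]
    simp only [Equiv.coe_addRight]
    push_cast
    ring_nf
  have hodd : ∀ l : ℤ, ∑' m : ℤ, thetaTerm (x + y) τ (m + (2 * l + 1)) * thetaTerm (x - y) τ m =
      expπ ((2 * l + 1) ^ 2 * τ / 2 + 2 * (2 * l + 1) * y) * thetaPair 0 x τ := by
    intro l
    rw [thetaPair, ← tsum_mul_left]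
    conv_rhs => rw [← (Equiv.addRight (l + 1)).tsum_eq]
    refine tsum_congr fun m => ?_
    rw [hterm]
    have : expπ (2 * m + (2 * l + 1 : ℤ) + 1) = 1 := by
      rw [show (π : ℂ) * I * (2 * m + (2 * l + 1 : ℤ) + 1) =
        ((m + l + 1 : ℤ) : ℂ) * (2 * π * I) by push_cast; ring,
        exp_int_mul_two_pi_mul_I]
    rw [this]
    simp only [Equiv.coe_addRight]
    push_cast
    ring_nf
  simp only [Fin.val_zero, Fin.val_one, Nat.cast_ofNat, Nat.cast_zero, add_zero, Nat.cast_one]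
  rw [tsum_congr heven, tsum_congr hodd, tsum_mul_right, tsum_mul_right]
  have e0 : ∑' l : ℤ, expπ ((2 * l + 0) ^ 2 * τ / 2 + 2 * (2 * l + 0) * y) =
    thetaPair 0 y τ := by simp [thetaPair]
  have e1 : ∑' l : ℤ, expπ ((2 * l + 1) ^ 2 * τ / 2 + 2 * (2 * l + 1) * y) =
    thetaPair 1 y τ := by simp [thetaPair]
  rw [e0, e1]
  ring

/-- The three-term identity of Weierstrass, in the arrangement used for the kernels. -/
lemma theta_three_term (ν t y a : ℂ) {σ : ℂ} (hσ : 0 < σ.im) :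
    theta (ν + t) σ * theta (t - y) σ * theta (ν - y) σ * theta (2 * a) σ =
      theta (t + a) σ * theta (a - y) σ * theta (ν - a + (t - y)) σ * theta (ν + a) σ +
      theta (t - a) σ * theta (a + y) σ * theta (ν + a + (t - y)) σ * theta (ν - a) σ := by
  have key : ∀ x₁ x₂ x₃ x₄ : ℂ,
      theta (x₁ + x₂) σ * theta (x₁ - x₂) σ * (theta (x₃ + x₄) σ * theta (x₃ - x₄) σ) =
      theta (x₁ + x₃) σ * theta (x₁ - x₃) σ * (theta (x₂ + x₄) σ * theta (x₂ - x₄) σ) -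
      theta (x₁ + x₄) σ * theta (x₁ - x₄) σ * (theta (x₂ + x₃) σ * theta (x₂ - x₃) σ) := by
    intro x₁ x₂ x₃ x₄
    simp only [theta_mul_theta _ _ hσ]
    ring
  have h := key ((ν + 2 * t - y) / 2) ((ν + y) / 2) ((ν - y) / 2 + a) ((ν - y) / 2 - a)
  ring_nf at h ⊢
  have hn := theta_neg (y - a) σ
  rw [neg_sub, sub_eq_neg_add] at hn
  rw [hn]
  linear_combination h

/-! ### The Kronecker function -/

/-- The Kronecker function `θ'(0) θ(ω + w) / (θ(ω) θ(w))`. -/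
def kr (ω w σ : ℂ) : ℂ := deriv (fun z => theta z σ) 0 * theta (ω + w) σ / (theta ω σ * theta w σ)

/-- The Kronecker function multiplied by `1 - e(w)`, which removes the pole at `w = 0`. -/
def krH (ω w σ : ℂ) : ℂ := -(2 * π * I) * P1 σ σ ^ 2 * th0 (ω + w) σ / (th0 ω σ * th1 w σ)

lemma kr_eq (ω w : ℂ) {σ : ℂ} (hσ : 0 < σ.im) : kr ω w σ = krH ω w σ / (1 - ex w) := by
  have hC := thC_ne_zero hσ
  rw [kr, krH, deriv_theta_zero hσ, theta_eq_th0 (ω + w) hσ, theta_eq_th0 ω hσ, theta_eq_th0 w hσ,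
    th0_eq_th1 w hσ, mul_add, neg_add, exp_add]
  have h1 := exp_ne_zero (-(π * I * ω))
  have h2 := exp_ne_zero (-(π * I * w))
  have h3 : thC σ * thC σ * exp (-(π * I * ω)) * exp (-(π * I * w)) ≠ 0 := by simp [hC, h1, h2]
  rw [div_div]
  refine Eq.trans ?_ (mul_div_mul_left _ _ h3)
  congr 1 <;> ring

lemma kr_add_sigma (ω w σ : ℂ) : kr ω (w + σ) σ = ex (-ω) * kr ω w σ := by
  rw [kr, kr, ← add_assoc, theta_add_tau, theta_add_tau, ex,
    show -(π * I * (σ + 2 * (ω + w))) = 2 * π * I * -ω + -(π * I * (σ + 2 * w)) by ring, exp_add]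
  have := exp_ne_zero (-(π * I * (σ + 2 * w)))
  field_simp

lemma kr_add_one (ω w σ : ℂ) : kr ω (w + 1) σ = kr ω w σ := by
  rw [kr, kr, ← add_assoc, theta_add_one, theta_add_one, mul_neg, mul_neg, neg_div_neg_eq]

lemma krH_add_one (ω w σ : ℂ) : krH ω (w + 1) σ = krH ω w σ := by
  rw [krH, krH, ← add_assoc, th0_add_one]
  congr 2
  rw [th1, th1, show w + 1 + σ = w + σ + ((1 : ℤ) : ℂ) by push_cast; ring, P1_add_int,
    show σ - (w + 1) = σ - w + ((-1 : ℤ) : ℂ) by push_cast; ring, P1_add_int]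

lemma differentiableOn_krH (ω : ℂ) {σ : ℂ} (hσ : 0 < σ.im) (hω : th0 ω σ ≠ 0) :
    HolOn (fun w => krH ω w σ) (strip (-σ.im) σ.im) := by
  unfold krH
  refine DifferentiableOn.fun_div ?_ ?_ fun w hw => mul_ne_zero hω (th1_ne_zero hσ (abs_lt.2 hw))
  · exact (((differentiable_th0 hσ).comp (differentiable_id.const_add ω)).const_mul _).differentiableOn
  · exact ((differentiable_th1 hσ).const_mul _).differentiableOn

lemma differentiableOn_kr (ω : ℂ) {σ : ℂ} (hσ : 0 < σ.im) (hω : th0 ω σ ≠ 0) {U : Set ℂ}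
    (hU : U ⊆ strip (-σ.im) σ.im) (h0 : ∀ w ∈ U, ex w ≠ 1) :
    HolOn (fun w => kr ω w σ) U := by
  simp only [kr_eq ω _ hσ]
  exact ((differentiableOn_krH ω hσ hω).mono hU).fun_div
    ((differentiable_const _).sub differentiable_ex).differentiableOn
    fun w hw => sub_ne_zero.2 (h0 w hw).symm

lemma ex_ne_one_of_im {z : ℂ} (h : z.im ≠ 0) : ex z ≠ 1 := by
  intro h1
  obtain ⟨n, rfl⟩ := ex_eq_one_iff.1 h1
  simp at h

/-- The jump of the integral of `h(w) / (1 - e(w))` across its pole at `w = 0`. The Fourier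
coefficients of `h` are the differences of consecutive ones of the quotient, both below and above
the pole; the telescoping Fourier series of `h` at `0` evaluates the jump. -/
lemma lineInt_div_one_sub_ex_jump {h : ℂ → ℂ} {α β : ℝ} (hd : HolOn h (strip α β))
    (h1 : ∀ z ∈ strip α β, h (z + 1) = h z) {cm cp : ℂ} (hcm : cm ∈ strip α 0)
    (hcp : cp ∈ strip 0 β) :
    lineInt (fun w => h w / (1 - ex w)) cm - lineInt (fun w => h w / (1 - ex w)) cp = -h 0 := by
  have hα : α < 0 := hcm.1.trans hcm.2
  have hβ : 0 < β := hcp.1.trans hcp.2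
  set k : ℂ → ℂ := fun w => h w / (1 - ex w) with hk
  have hneg : strip α 0 ⊆ strip α β := fun z hz => ⟨hz.1, hz.2.trans hβ⟩
  have hpos : strip 0 β ⊆ strip α β := fun z hz => ⟨hα.trans hz.1, hz.2⟩
  have hkd : ∀ U ⊆ strip α β, (∀ w ∈ U, ex w ≠ 1) → HolOn k U := fun U hU h0 =>
    (hd.mono hU).fun_div ((differentiable_const _).sub differentiable_ex).differentiableOn
      fun w hw => sub_ne_zero.2 (h0 w hw).symm
  have kneg := hkd _ hneg fun w hw => ex_ne_one_of_im hw.2.ne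
  have kpos := hkd _ hpos fun w hw => ex_ne_one_of_im hw.1.ne'
  set c : ℤ → ℂ := fourierC k cm with hc
  set c' : ℤ → ℂ := fourierC k cp with hc'
  have hdiff : ∀ b : ℂ, ∀ α' β' : ℝ, b ∈ strip α' β' → HolOn k (strip α' β') →
      (∀ w ∈ strip α' β', ex w ≠ 1) → ∀ n : ℤ,
      fourierC h b n = fourierC k b n - fourierC k b (n - 1) := by
    intro b α' β' hb hkb h1 n
    have hcont := continuousOn_line hkb.continuousOn hb
    rw [fourierC, fourierC, fourierC, lineInt, lineInt, lineInt, ← intervalIntegral.integral_sub]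
    · refine intervalIntegral.integral_congr fun x _ => ?_
      have hne := sub_ne_zero.2 (h1 _ (strip_add_real hb x)).symm
      have : h (b + x) = k (b + x) * (1 - ex (b + x)) := by simp only [hk]; field_simp
      rw [this, show -(((n - 1 : ℤ) : ℂ) * (b + x)) = -(n * (b + x)) + (b + x) by push_cast; ring,
        ex_add (-(n * (b + x)))]
      ring
    · exact (hcont.mul (by fun_prop)).intervalIntegrable _ _
    · exact (hcont.mul (by fun_prop)).intervalIntegrable _ _
  have hdm := hdiff _ _ _ hcm kneg fun w hw => ex_ne_one_of_im hw.2.ne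
  have hdp := hdiff _ _ _ hcp kpos fun w hw => ex_ne_one_of_im hw.1.ne'
  have hstep : ∀ n : ℤ, c n - c' n = c (n - 1) - c' (n - 1) := by
    intro n
    have := fourierC_congr_base hd h1 (hneg hcm) (hpos hcp) n
    rw [hdm, hdp] at this
    linear_combination this
  have hconst : ∀ n : ℤ, c n - c' n = c 0 - c' 0 := by
    intro n
    induction n with
    | zero => rfl
    | succ n ih => rw [hstep, add_sub_cancel_right, ih]
    | pred n ih => rw [← hstep, ih]
  have hlim : Tendsto (fun n : ℕ => c n) atTop (𝓝 0) := by
    obtain ⟨M, hM0, hM⟩ := exists_bound_line kneg.continuousOn hcm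
    have h2 : Tendsto (fun n : ℕ => M * Real.exp (2 * π * cm.im) ^ n) atTop (𝓝 (M * 0)) := by
      refine (tendsto_pow_atTop_nhds_zero_of_lt_one (Real.exp_pos _).le ?_).const_mul M
      rw [Real.exp_lt_one_iff]
      have := hcm.2
      have := Real.pi_pos
      nlinarith
    rw [mul_zero] at h2
    refine squeeze_zero_norm (fun n => ?_) h2
    have h3 := norm_fourierC_le hM n
    rw [← Real.exp_nat_mul]
    refine h3.trans (le_of_eq ?_)
    push_cast
    ring_nf
  have hlim' : Tendsto (fun n : ℕ => c' (-n)) atTop (𝓝 0) := by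
    obtain ⟨M, hM0, hM⟩ := exists_bound_line kpos.continuousOn hcp
    have h2 : Tendsto (fun n : ℕ => M * Real.exp (-(2 * π * cp.im)) ^ n) atTop (𝓝 (M * 0)) := by
      refine (tendsto_pow_atTop_nhds_zero_of_lt_one (Real.exp_pos _).le ?_).const_mul M
      rw [Real.exp_lt_one_iff]
      have := hcp.1
      have := Real.pi_pos
      nlinarith
    rw [mul_zero] at h2
    refine squeeze_zero_norm (fun n => ?_) h2
    have h3 := norm_fourierC_le hM (-n)
    rw [← Real.exp_nat_mul]
    refine h3.trans (le_of_eq ?_)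
    push_cast
    ring_nf
  have h0mem : (0 : ℂ) ∈ strip α β := by simp [strip, hα, hβ]
  have hsum := (fourier_hasSum hd h1 (hneg hcm) h0mem).nat_add_neg_add_one.tendsto_sum_nat
  have hpart : ∀ N : ℕ, ∑ i ∈ Finset.range N, (fourierC h cm i * ex (((i : ℤ) : ℂ) * 0) +
        fourierC h cm (-((i : ℤ) + 1)) *
          ex (((-((i : ℤ) + 1) : ℤ) : ℂ) * 0)) = c (N - 1) - c (-N - 1) := by
    intro N
    induction N with
    | zero => simp
    | succ N ih =>
      rw [Finset.sum_range_succ, ih, hdm, hdm]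
      simp only [mul_zero, ex_zero, mul_one]
      rw [show ((N + 1 : ℕ) : ℤ) - 1 = N by push_cast; ring,
        show -((N + 1 : ℕ) : ℤ) - 1 = -((N : ℤ) + 1) - 1 by push_cast; ring,
        show -(N : ℤ) - 1 = -((N : ℤ) + 1) by ring]
      ring
  rw [tendsto_congr hpart] at hsum
  have e1 : Tendsto (fun N : ℕ => c ((N + 1 : ℕ) - 1) - c (-(N + 1 : ℕ) - 1)) atTop
      (𝓝 (h 0)) := hsum.comp (tendsto_add_atTop_nat 1)
  have e2 : Tendsto (fun N : ℕ => c ((N + 1 : ℕ) - 1) - c (-(N + 1 : ℕ) - 1)) atTop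
      (𝓝 (0 - (0 + (c 0 - c' 0)))) := by
    refine Tendsto.sub ?_ ?_
    · refine hlim.congr fun n => ?_
      congr 1; push_cast; ring
    · have := ((hlim'.comp (tendsto_add_atTop_nat 2)).add_const (c 0 - c' 0))
      refine this.congr fun n => ?_
      simp only [Function.comp_apply]
      rw [← hconst (-((n + 2 : ℕ) : ℤ)), show -((n + 1 : ℕ) : ℤ) - 1 = -((n + 2 : ℕ) : ℤ) by
        push_cast; ring]
      ring
  have e3 := tendsto_nhds_unique e1 e2
  have e4 : ∀ b, fourierC k b 0 = lineInt k b := fun b => by simp [fourierC]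
  rw [← e4, ← e4]
  linear_combination e3

/-- The integral of `g` against the Kronecker function of the difference, along the line
through `c`. -/
def krInt (g : ℂ → ℂ) (ω σ c y : ℂ) : ℂ := lineInt (fun t => g t * kr ω (t - y) σ) c

lemma differentiableOn_mul_kr {g : ℂ → ℂ} {α β : ℝ} (hg : HolOn g (strip α β))
    {ω σ : ℂ} (hσ : 0 < σ.im) (hω : th0 ω σ ≠ 0) (y : ℂ) {α' β' : ℝ} (h1 : α ≤ α') (h2 : β' ≤ β)
    (h3 : y.im - σ.im ≤ α') (h4 : β' ≤ y.im) :
    HolOn (fun t => g t * kr ω (t - y) σ) (strip α' β') := by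
  refine (hg.mono fun z hz => ⟨h1.trans_lt hz.1, hz.2.trans_le h2⟩).fun_mul ?_
  refine DifferentiableOn.comp (g := fun w => kr ω w σ) (f := fun t => t - y) (t := strip (-σ.im) 0)
    (differentiableOn_kr ω hσ hω (fun z hz => ⟨hz.1, hz.2.trans hσ⟩)
      fun w hw => ex_ne_one_of_im hw.2.ne) (by fun_prop) fun z hz => ?_
  constructor <;> simp only [sub_im] <;> linarith [hz.1, hz.2]

lemma krInt_congr_base {g : ℂ → ℂ} {α β : ℝ} (hg : HolOn g (strip α β))
    (hg1 : ∀ z, g (z + 1) = g z) {ω σ : ℂ} (hσ : 0 < σ.im) (hω : th0 ω σ ≠ 0) {y c c' : ℂ}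
    (hc : c ∈ strip α β) (hc' : c' ∈ strip α β) (h1 : c.im ∈ Ioo (y.im - σ.im) y.im)
    (h2 : c'.im ∈ Ioo (y.im - σ.im) y.im) : krInt g ω σ c y = krInt g ω σ c' y := by
  refine lineInt_congr_base (differentiableOn_mul_kr hg hσ hω y (le_max_left α (y.im - σ.im))
    (min_le_left β y.im) (le_max_right _ _) (min_le_right _ _)) (fun z _ => ?_)
    ⟨max_lt hc.1 h1.1, lt_min hc.2 h1.2⟩ ⟨max_lt hc'.1 h2.1, lt_min hc'.2 h2.2⟩
  rw [hg1, show z + 1 - y = z - y + 1 by ring, kr_add_one]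

/-- The jump of `krInt` when the line passes the pole at `t = y`, expressed through the
quasi-periodicity of the Kronecker function. -/
lemma krInt_add_sigma {g : ℂ → ℂ} {α β : ℝ} (hg : HolOn g (strip α β))
    (hg1 : ∀ z, g (z + 1) = g z) {ω σ : ℂ} (hσ : 0 < σ.im) (hω : th0 ω σ ≠ 0) {y c c' : ℂ}
    (hc : c ∈ strip α β) (hc' : c' ∈ strip α β) (h1 : c.im ∈ Ioo (y.im - σ.im) y.im)
    (h2 : c'.im ∈ Ioo y.im (y.im + σ.im)) :
    ex (-ω) * krInt g ω σ c' (y + σ) = krInt g ω σ c y - 2 * π * I * g y := by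
  have e1 : ex (-ω) * krInt g ω σ c' (y + σ) = lineInt (fun t => g t * kr ω (t - y) σ) c' := by
    rw [krInt, lineInt, lineInt, ← intervalIntegral.integral_const_mul]
    refine intervalIntegral.integral_congr fun x _ => ?_
    rw [show c' + x - y = c' + x - (y + σ) + σ by ring, kr_add_sigma]
    ring
  have hshift : ∀ c : ℂ, lineInt (fun t => g t * kr ω (t - y) σ) c =
      lineInt (fun w => g (w + y) * krH ω w σ / (1 - ex w)) (c - y) := by
    intro c
    rw [lineInt, lineInt]
    refine intervalIntegral.integral_congr fun x _ => ?_
    rw [kr_eq ω _ hσ, show c - y + x + y = c + x by ring, show c - y + x = c + x - y by ring]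
    ring
  have hd : HolOn (fun w => g (w + y) * krH ω w σ)
      (strip (max (α - y.im) (-σ.im)) (min (β - y.im) σ.im)) := by
    refine DifferentiableOn.fun_mul ?_ ((differentiableOn_krH ω hσ hω).mono fun z hz => ?_)
    · refine DifferentiableOn.comp (g := g) (f := fun w => w + y) hg (by fun_prop) fun z hz => ?_
      have := le_max_left (α - y.im) (-σ.im)
      have := min_le_left (β - y.im) σ.im
      constructor <;> simp only [add_im] <;> linarith [hz.1, hz.2]
    · exact ⟨(le_max_right _ _).trans_lt hz.1, hz.2.trans_le (min_le_right _ _)⟩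
  have hj := lineInt_div_one_sub_ex_jump hd (fun w _ => by
      rw [show w + 1 + y = w + y + 1 by ring, hg1, krH_add_one]) (cm := c - y) (cp := c' - y)
    ⟨max_lt (by simp; exact hc.1) (by simp; linarith [h1.1]), by simp; exact h1.2⟩
    ⟨by simp; exact h2.1, lt_min (by simp; exact hc'.2) (by simp; linarith [h2.2])⟩
  have hP := P1_ne_zero_of_pos hσ hσ
  have h0 : krH ω 0 σ = -(2 * π * I) := by
    rw [krH, th1, add_zero, zero_add, sub_zero]
    field_simp
  rw [h0, zero_add] at hj
  rw [e1, krInt, hshift c, hshift c']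
  linear_combination -hj

/-- The kernel `Q` intertwines two products of theta functions with the Kronecker function. -/
lemma theta_mul_Q (ν t y a : ℂ) {σ : ℂ} (hσ : 0 < σ.im) (h1 : theta (ν - a) σ ≠ 0)
    (h2 : theta (ν + a) σ ≠ 0) (h3 : theta (t - y) σ ≠ 0) :
    theta (ν + t) σ * theta (ν - y) σ * Q ν σ (a / 2) =
      theta (t + a) σ * theta (a - y) σ * kr (ν - a) (t - y) σ +
        theta (t - a) σ * theta (a + y) σ * kr (ν + a) (t - y) σ := by
  have h := theta_three_term ν t y a hσ
  rw [Q, kr, kr, show 4 * (a / 2) = 2 * a by ring, show 2 * (a / 2) = a by ring]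
  field_simp
  linear_combination (deriv (fun z => theta z σ) 0) * h

/-! ### Doubly periodic functions near a parallelogram -/

lemma eq_zero_of_mul_eq_zero_entire {f g : ℂ → ℂ} (hf : Differentiable ℂ f)
    (hg : Differentiable ℂ g) {z₀ : ℂ} (h0 : f z₀ ≠ 0) (h : ∀ z, f z * g z = 0) (z : ℂ) :
    g z = 0 := by
  have hga : AnalyticOnNhd ℂ g univ := hg.differentiableOn.analyticOnNhd isOpen_univ
  have := hga.eqOn_of_preconnected_of_eventuallyEq (g := fun _ => 0)
    (fun _ _ => analyticAt_const) isPreconnected_univ (mem_univ z₀)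
    ((hf.continuous.continuousAt.eventually_ne h0).mono fun w hw =>
      (mul_eq_zero.1 (h w)).resolve_left hw)
  exact this (mem_univ z)

/-- The coordinate along `σ` of `z - z₁` in the basis `(-1, σ)`. -/
def parR (σ z₁ z : ℂ) : ℝ := (z - z₁).im / σ.im

/-- The coordinate along `-1` of `z - z₁` in the basis `(-1, σ)`. -/
def parS (σ z₁ z : ℂ) : ℝ := parR σ z₁ z * σ.re - (z - z₁).re

/-- The neighbourhood with margin `ε` of the parallelogram `z₁ + [0, -1] + [0, σ]`. -/
def par (σ z₁ : ℂ) (ε : ℝ) : Set ℂ :=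
  {z | parR σ z₁ z ∈ Ioo (-ε) (1 + ε) ∧ parS σ z₁ z ∈ Ioo (-ε) (1 + ε)}

lemma continuous_parR (σ z₁ : ℂ) : Continuous (parR σ z₁) := by unfold parR; fun_prop

lemma continuous_parS (σ z₁ : ℂ) : Continuous (parS σ z₁) := by
  unfold parS; exact ((continuous_parR σ z₁).mul_const _).sub (by fun_prop)

lemma isOpen_par (σ z₁ : ℂ) (ε : ℝ) : IsOpen (par σ z₁ ε) :=
  (isOpen_Ioo.preimage (continuous_parR σ z₁)).inter (isOpen_Ioo.preimage (continuous_parS σ z₁))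

/-- The parametrisation of the plane by the coordinates in the basis `(-1, σ)`. -/
def parMap (σ z₁ : ℂ) (p : ℝ × ℝ) : ℂ := z₁ - p.2 + p.1 * σ

lemma continuous_parMap (σ z₁ : ℂ) : Continuous (parMap σ z₁) := by unfold parMap; fun_prop

lemma parR_parMap {σ : ℂ} (hσ : 0 < σ.im) (z₁ : ℂ) (p : ℝ × ℝ) :
    parR σ z₁ (parMap σ z₁ p) = p.1 := by
  simp [parR, parMap, hσ.ne']

lemma parS_parMap {σ : ℂ} (hσ : 0 < σ.im) (z₁ : ℂ) (p : ℝ × ℝ) :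
    parS σ z₁ (parMap σ z₁ p) = p.2 := by
  rw [parS, parR_parMap hσ]; simp [parMap]; ring

lemma parMap_par {σ : ℂ} (hσ : 0 < σ.im) (z₁ z : ℂ) :
    parMap σ z₁ (parR σ z₁ z, parS σ z₁ z) = z := by
  apply Complex.ext
  · simp [parMap, parS]; ring
  · simp [parMap, parR, hσ.ne']

lemma par_eq_image {σ : ℂ} (hσ : 0 < σ.im) (z₁ : ℂ) (ε : ℝ) :
    par σ z₁ ε = parMap σ z₁ '' (Ioo (-ε) (1 + ε) ×ˢ Ioo (-ε) (1 + ε)) := by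
  ext z
  constructor
  · intro hz
    exact ⟨_, ⟨hz.1, hz.2⟩, parMap_par hσ z₁ z⟩
  · rintro ⟨p, hp, rfl⟩
    exact ⟨by rw [parR_parMap hσ]; exact hp.1, by rw [parS_parMap hσ]; exact hp.2⟩

lemma isPreconnected_par {σ : ℂ} (hσ : 0 < σ.im) (z₁ : ℂ) (ε : ℝ) :
    IsPreconnected (par σ z₁ ε) := by
  rw [par_eq_image hσ]
  exact (((convex_Ioo _ _).prod (convex_Ioo _ _)).isPreconnected).image _
    (continuous_parMap σ z₁).continuousOn

lemma parR_add_one (σ z₁ z : ℂ) : parR σ z₁ (z + 1) = parR σ z₁ z := by simp [parR]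

lemma parS_add_one (σ z₁ z : ℂ) : parS σ z₁ (z + 1) = parS σ z₁ z - 1 := by
  simp [parS, parR_add_one]; ring

lemma parR_add_sigma {σ : ℂ} (hσ : 0 < σ.im) (z₁ z : ℂ) : parR σ z₁ (z + σ) = parR σ z₁ z + 1 := by
  simp only [parR, sub_im, add_im]; field_simp; ring

lemma parS_add_sigma {σ : ℂ} (hσ : 0 < σ.im) (z₁ z : ℂ) : parS σ z₁ (z + σ) = parS σ z₁ z := by
  rw [parS, parS, parR_add_sigma hσ]; simp; ring

/-- The modulus has a maximum on the closed parallelogram, hence a local one. -/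
lemma const_of_periodic_par {σ : ℂ} (hσ : 0 < σ.im) (z₁ : ℂ) {ε : ℝ} (hε : 0 < ε) (hε1 : ε < 1)
    {h : ℂ → ℂ} (hd : HolOn h (par σ z₁ ε))
    (h1 : ∀ z ∈ par σ z₁ ε, z + 1 ∈ par σ z₁ ε → h (z + 1) = h z)
    (hs : ∀ z ∈ par σ z₁ ε, z + σ ∈ par σ z₁ ε → h (z + σ) = h z) {z w : ℂ}
    (hz : z ∈ par σ z₁ ε) (hw : w ∈ par σ z₁ ε) : h z = h w := by
  -- the closed parallelogram
  set K : Set ℂ := parMap σ z₁ '' (Icc 0 1 ×ˢ Icc 0 1) with hK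
  have hKc : IsCompact K := (isCompact_Icc.prod isCompact_Icc).image (continuous_parMap σ z₁)
  have hKsub : K ⊆ par σ z₁ ε := by
    rw [par_eq_image hσ]
    refine image_mono (prod_mono ?_ ?_) <;>
      exact fun x hx => ⟨by linarith [hx.1], by linarith [hx.2]⟩
  have hmemK : ∀ z, parR σ z₁ z ∈ Icc (0 : ℝ) 1 → parS σ z₁ z ∈ Icc (0 : ℝ) 1 → z ∈ K :=
    fun z h1 h2 => ⟨_, ⟨h1, h2⟩, parMap_par hσ z₁ z⟩
  have step1 : ∀ z ∈ par σ z₁ ε, ∃ z' ∈ par σ z₁ ε, parS σ z₁ z' ∈ Icc (0 : ℝ) 1 ∧ h z' = h z := by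
    rintro z ⟨hr, hs'⟩
    rcases lt_or_ge (parS σ z₁ z) 0 with h0 | h0
    · have e1 := parR_add_one σ z₁ (z - 1)
      have e2 := parS_add_one σ z₁ (z - 1)
      rw [sub_add_cancel] at e1 e2
      have hm : z - 1 ∈ par σ z₁ ε := ⟨by rw [← e1]; exact hr, by constructor <;> linarith [hs'.1]⟩
      refine ⟨z - 1, hm, ⟨by linarith [hs'.1], by linarith⟩, ?_⟩
      rw [← h1 _ hm (by rw [sub_add_cancel]; exact ⟨hr, hs'⟩), sub_add_cancel]
    · rcases le_or_gt (parS σ z₁ z) 1 with h2 | h2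
      · exact ⟨z, ⟨hr, hs'⟩, ⟨h0, h2⟩, rfl⟩
      · have hm : z + 1 ∈ par σ z₁ ε := ⟨by rw [parR_add_one]; exact hr, by
          rw [parS_add_one]; constructor <;> linarith [hs'.2]⟩
        refine ⟨z + 1, hm, ?_, h1 z ⟨hr, hs'⟩ hm⟩
        rw [parS_add_one]
        constructor <;> linarith [hs'.2]
  have step2 : ∀ z ∈ par σ z₁ ε, ∃ z' ∈ K, h z' = h z := by
    intro z hz
    obtain ⟨z, ⟨hr, hs'⟩, hs1, he⟩ := step1 z hz
    rw [← he]
    rcases lt_or_ge (parR σ z₁ z) 0 with h0 | h0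
    · have hm : z + σ ∈ par σ z₁ ε := ⟨by rw [parR_add_sigma hσ]; constructor <;> linarith [hr.1],
          by rw [parS_add_sigma hσ]; exact hs'⟩
      refine ⟨z + σ, hmemK _ ?_ (by rw [parS_add_sigma hσ]; exact hs1), hs z ⟨hr, hs'⟩ hm⟩
      rw [parR_add_sigma hσ]; constructor <;> linarith [hr.1]
    · rcases le_or_gt (parR σ z₁ z) 1 with h2 | h2
      · exact ⟨z, hmemK z ⟨h0, h2⟩ hs1, rfl⟩
      · have e1 := parR_add_sigma hσ z₁ (z - σ)
        have e2 := parS_add_sigma hσ z₁ (z - σ)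
        rw [sub_add_cancel] at e1 e2
        have hm : z - σ ∈ par σ z₁ ε :=
          ⟨by constructor <;> linarith [hr.2], by rw [← e2]; exact hs'⟩
        refine ⟨z - σ, hmemK _ ⟨by linarith, by linarith [hr.2]⟩ (by rw [← e2]; exact hs1), ?_⟩
        rw [← hs _ hm (by rw [sub_add_cancel]; exact ⟨hr, hs'⟩), sub_add_cancel]
  obtain ⟨m, hm, hmax⟩ := hKc.exists_isMaxOn (f := norm ∘ h)
    (((nonempty_Icc.2 zero_le_one).prod (nonempty_Icc.2 zero_le_one)).image _)
    ((continuous_norm.comp_continuousOn hd.continuousOn).mono hKsub)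
  have hmax' : IsMaxOn (norm ∘ h) (par σ z₁ ε) m := by
    intro z hz
    obtain ⟨z', hz', he⟩ := step2 z hz
    have := hmax hz'
    simpa [← he] using this
  have := eqOn_of_isPreconnected_of_isMaxOn_norm (isPreconnected_par hσ z₁ ε)
    (isOpen_par σ z₁ ε) hd (hKsub hm) hmax'
  rw [this hz, this hw]; rfl

lemma exists_par_subset {σ : ℂ} (hσ : 0 < σ.im) (z₁ : ℂ) {O : Set ℂ} (hO : IsOpen O)
    (h : ∀ r ∈ Icc (0 : ℝ) 1, ∀ s ∈ Icc (0 : ℝ) 1, z₁ - s + r * σ ∈ O) :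
    ∃ ε, 0 < ε ∧ ε < 1 ∧ par σ z₁ ε ⊆ O := by
  obtain ⟨δ, hδ, hsub⟩ := ((isCompact_Icc (a := (0 : ℝ)) (b := 1)).prod
    (isCompact_Icc (a := (0 : ℝ)) (b := 1))).exists_thickening_subset_open
    (hO.preimage (continuous_parMap σ z₁)) (fun p hp => h p.1 hp.1 p.2 hp.2)
  refine ⟨min δ 1 / 2, by positivity, ?_, ?_⟩
  · have := min_le_right δ 1
    linarith
  · have hle := min_le_left δ 1
    rw [par_eq_image hσ, image_subset_iff]
    refine Subset.trans ?_ hsub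
    rintro ⟨r, s⟩ ⟨hr, hs⟩
    rw [Metric.mem_thickening_iff]
    have hc : ∀ x ∈ Ioo (-(min δ 1 / 2)) (1 + min δ 1 / 2), ∃ y ∈ Icc (0 : ℝ) 1, dist x y < δ := by
      intro x hx
      refine ⟨max 0 (min 1 x), ⟨le_max_left _ _, max_le zero_le_one (min_le_left _ _)⟩, ?_⟩
      rw [Real.dist_eq, abs_lt]
      rcases le_total 1 x with h1 | h1
      · rw [min_eq_left h1, max_eq_right zero_le_one]
        constructor <;> linarith [hx.2]
      · rw [min_eq_right h1]
        rcases le_total 0 x with h2 | h2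
        · rw [max_eq_right h2]; constructor <;> linarith
        · rw [max_eq_left h2]; constructor <;> linarith [hx.1]
    obtain ⟨y, hy, hyd⟩ := hc r hr
    obtain ⟨y', hy', hyd'⟩ := hc s hs
    exact ⟨(y, y'), ⟨hy, hy'⟩, by rw [Prod.dist_eq]; exact max_lt hyd hyd'⟩

/-! ### The modular identity for the double products -/

/-- The numerator of the modular combination of elliptic gamma functions. -/
def modN (z τ σ : ℂ) : ℂ :=
  P (σ - z) τ σ * P ((-1 - τ - z) / σ) (-1 / σ) (-τ / σ) * P (z / τ) (-1 / τ) (σ / τ)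

/-- The denominator of the modular combination of elliptic gamma functions. -/
def modD (z τ σ : ℂ) : ℂ :=
  P (z + τ) τ σ * P (z / σ) (-1 / σ) (-τ / σ) * P ((σ - 1 - z) / τ) (-1 / τ) (σ / τ)

/-- The cubic polynomial in the exponent of the modular identity. -/
def modC (z τ σ : ℂ) : ℂ := -(z - (σ - τ - 1) / 2) ^ 3 / (3 * τ * σ) +
    (σ ^ 2 + τ ^ 2 + 1) / (12 * τ * σ) * (z - (σ - τ - 1) / 2)

lemma im_neg_div_pos {τ σ : ℂ} (h : 0 < (σ / τ).im) : 0 < (-τ / σ).im := by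
  have := im_neg_one_div_pos h
  rwa [neg_div, one_div_div, ← neg_div] at this

lemma differentiable_modN {τ σ : ℂ} (hτ : 0 < τ.im) (hσ : 0 < σ.im) (hστ : 0 < (σ / τ).im) :
    Differentiable ℂ fun z => modN z τ σ := by
  unfold modN
  refine ((Differentiable.fun_mul ?_ ?_).fun_mul ?_)
  · exact (differentiable_P hτ hσ).comp (differentiable_id.const_sub σ)
  · exact (differentiable_P (im_neg_one_div_pos hσ) (im_neg_div_pos hστ)).comp
      ((differentiable_id.const_sub (-1 - τ)).div_const σ)
  · exact (differentiable_P (im_neg_one_div_pos hτ) hστ).comp (differentiable_id.div_const τ)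

lemma differentiable_modD {τ σ : ℂ} (hτ : 0 < τ.im) (hσ : 0 < σ.im) (hστ : 0 < (σ / τ).im) :
    Differentiable ℂ fun z => modD z τ σ := by
  unfold modD
  refine ((Differentiable.fun_mul ?_ ?_).fun_mul ?_)
  · exact (differentiable_P hτ hσ).comp (differentiable_id.add_const τ)
  · exact (differentiable_P (im_neg_one_div_pos hσ) (im_neg_div_pos hστ)).comp
      (differentiable_id.div_const σ)
  · exact (differentiable_P (im_neg_one_div_pos hτ) hστ).comp
      ((differentiable_id.const_sub (σ - 1)).div_const τ)

lemma modN_add_one {τ σ : ℂ} (hτ : 0 < τ.im) (hσ : 0 < σ.im) (hστ : 0 < (σ / τ).im)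
    (z : ℂ) : modN (z + 1) τ σ * modD z τ σ *
    exp (π * I * modB ((z + 1) / τ) (σ / τ)) = modN z τ σ * modD (z + 1) τ σ := by
  have hτ0 : τ ≠ 0 := by rintro rfl; simp at hτ
  have hσ0 : σ ≠ 0 := by rintro rfl; simp at hσ
  have hτ1 := im_neg_one_div_pos hτ
  have hσ1 := im_neg_one_div_pos hσ
  have hτσ := im_neg_div_pos hστ
  refine sub_eq_zero.1 (eq_zero_of_mul_eq_zero_entire
    (f := fun z => th0 ((z + 1) / τ) (σ / τ)) (z₀ := τ / 2 - 1)
    (g := fun z => modN (z + 1) τ σ * modD z τ σ *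
      exp (π * I * modB ((z + 1) / τ) (σ / τ)) - modN z τ σ * modD (z + 1) τ σ)
    ((differentiable_th0 hστ).comp ((differentiable_id.add_const 1).div_const τ)) ?_ ?_ ?_ z)
  · have hN := differentiable_modN hτ hσ hστ
    have hD := differentiable_modD hτ hσ hστ
    have hN1 : Differentiable ℂ fun z => modN (z + 1) τ σ := hN.comp (differentiable_id.add_const 1)
    have hD1 : Differentiable ℂ fun z => modD (z + 1) τ σ := hD.comp (differentiable_id.add_const 1)
    have hB : Differentiable ℂ fun z => exp (π * I * modB ((z + 1) / τ) (σ / τ)) := by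
      unfold modB; fun_prop
    exact ((hN1.fun_mul hD).fun_mul hB).sub (hN.fun_mul hD1)
  · rw [sub_add_cancel, show τ / 2 / τ = 1 / 2 by field_simp]
    exact th0_half_ne_zero hστ
  · intro z
    have hmod := th0_modular ((z + 1) / τ) hστ
    rw [show (z + 1) / τ / (σ / τ) = (z + 1) / σ by field_simp,
      show -1 / (σ / τ) = -τ / σ by field_simp] at hmod
    have a1 : P (σ - (z + 1)) τ σ = P (σ - z) τ σ := by
      rw [show σ - (z + 1) = σ - z + ((-1 : ℤ) : ℂ) by push_cast; ring, P_add_int]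
    have a2 := P_succ ((-1 - τ - z) / σ) hσ1 hτσ
    rw [show (-1 - τ - z) / σ + -1 / σ = (-1 - τ - (z + 1)) / σ by ring] at a2
    have a3 := P_succ ((z + 1) / τ) hτ1 hστ
    rw [show (z + 1) / τ + -1 / τ = z / τ by ring] at a3
    have b1 : P (z + 1 + τ) τ σ = P (z + τ) τ σ := by
      rw [show z + 1 + τ = z + τ + ((1 : ℤ) : ℂ) by push_cast; ring, P_add_int]
    have b2 := P_succ ((z + 1) / σ) hσ1 hτσ
    rw [show (z + 1) / σ + -1 / σ = z / σ by ring] at b2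
    have b3 := P_succ ((σ - 1 - z) / τ) hτ1 hστ
    rw [show (σ - 1 - z) / τ + -1 / τ = (σ - 1 - (z + 1)) / τ by ring] at b3
    rw [th0, th0, show -τ / σ - (z + 1) / σ = (-1 - τ - z) / σ by ring,
      show σ / τ - (z + 1) / τ = (σ - 1 - z) / τ by ring] at hmod
    simp only [modN, modD]
    rw [a1, a2, a3, b1, b2, b3, th0, show σ / τ - (z + 1) / τ = (σ - 1 - z) / τ by ring]
    linear_combination (-(P (σ - z) τ σ * P ((-1 - τ - (z + 1)) / σ) (-1 / σ) (-τ / σ) *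
      P (z / τ) (-1 / τ) (σ / τ) * P (z + τ) τ σ * P (z / σ) (-1 / σ) (-τ / σ) *
      P ((σ - 1 - (z + 1)) / τ) (-1 / τ) (σ / τ)) * P1 ((z + 1) / τ) (σ / τ) *
      P1 ((σ - 1 - z) / τ) (σ / τ)) * hmod

lemma modN_add_sigma {τ σ : ℂ} (hτ : 0 < τ.im) (hσ : 0 < σ.im) (hστ : 0 < (σ / τ).im)
    (z : ℂ) : modN (z + σ) τ σ * modD z τ σ *
    exp (π * I * modB z τ) = -ex (-z) * (modN z τ σ * modD (z + σ) τ σ) := by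
  have hτ0 : τ ≠ 0 := by rintro rfl; simp at hτ
  have hσ0 : σ ≠ 0 := by rintro rfl; simp at hσ
  have hτ1 := im_neg_one_div_pos hτ
  have hσ1 := im_neg_one_div_pos hσ
  have hτσ := im_neg_div_pos hστ
  refine sub_eq_zero.1 (eq_zero_of_mul_eq_zero_entire (f := fun z => th0 z τ) (z₀ := 1 / 2)
    (g := fun z => modN (z + σ) τ σ * modD z τ σ *
      exp (π * I * modB z τ) - -ex (-z) * (modN z τ σ * modD (z + σ) τ σ))
    (differentiable_th0 hτ) ?_ (th0_half_ne_zero hτ) ?_ z)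
  · have hN := differentiable_modN hτ hσ hστ
    have hD := differentiable_modD hτ hσ hστ
    have hN1 : Differentiable ℂ fun z => modN (z + σ) τ σ := hN.comp (differentiable_id.add_const σ)
    have hD1 : Differentiable ℂ fun z => modD (z + σ) τ σ := hD.comp (differentiable_id.add_const σ)
    have hB : Differentiable ℂ fun z => exp (π * I * modB z τ) := by unfold modB; fun_prop
    have hE : Differentiable ℂ fun z => -ex (-z) := by fun_prop
    exact ((hN1.fun_mul hD).fun_mul hB).sub (hE.fun_mul (hN.fun_mul hD1))
  · intro z
    have hmod := th0_modular z hτ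
    have hneg := th0_neg z hτ
    have a1 := P_succ (-z) hσ hτ
    rw [P_swap (-z) σ τ, P_swap (-z + σ), show -z + σ = σ - z by ring] at a1
    have a2 : P ((-1 - τ - (z + σ)) / σ) (-1 / σ) (-τ / σ) =
        P ((-1 - τ - z) / σ) (-1 / σ) (-τ / σ) := by
      rw [show (-1 - τ - (z + σ)) / σ = (-1 - τ - z) / σ + ((-1 : ℤ) : ℂ) by
        push_cast; field_simp; ring, P_add_int]
    have a3 := P_succ (z / τ) hστ hτ1
    rw [P_swap (z / τ) (σ / τ), P_swap (z / τ + σ / τ), ← add_div] at a3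
    have b1 := P_succ (z + τ) hσ hτ
    rw [P_swap (z + τ) σ τ, P_swap (z + τ + σ), show z + τ + σ = z + σ + τ by ring] at b1
    have b2 : P ((z + σ) / σ) (-1 / σ) (-τ / σ) = P (z / σ) (-1 / σ) (-τ / σ) := by
      rw [show (z + σ) / σ = z / σ + ((1 : ℤ) : ℂ) by push_cast; field_simp, P_add_int]
    have b3 := P_succ ((σ - 1 - (z + σ)) / τ) hστ hτ1
    rw [P_swap _ (σ / τ), P_swap _ (σ / τ), show (σ - 1 - (z + σ)) / τ + σ / τ = (σ - 1 - z) / τ by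
      ring] at b3
    rw [th0, show -1 / τ - z / τ = (σ - 1 - (z + σ)) / τ by ring] at hmod
    rw [th0, show τ - -z = z + τ by ring] at hneg
    simp only [modN, modD]
    rw [show σ - (z + σ) = -z by ring, a1, a2, a3, b1, b2, b3]
    linear_combination (P (σ - z) τ σ * P ((-1 - τ - z) / σ) (-1 / σ) (-τ / σ) *
      P ((z + σ) / τ) (-1 / τ) (σ / τ) * P (z + σ + τ) τ σ * P (z / σ) (-1 / σ) (-τ / σ) *
      P ((σ - 1 - z) / τ) (-1 / τ) (σ / τ) * th0 z τ) *
      (exp (π * I * modB z τ) * hneg + ex (-z) * hmod)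

lemma modC_center (τ σ : ℂ) : modC ((σ - τ - 1) / 2) τ σ = 0 := by simp [modC]

/-- The modular identity for the double products, the three-term relation of the elliptic gamma
function. The quotient of the two sides is doubly periodic and has neither zeros nor poles on a
period parallelogram, hence it is constant; at the centre of the parallelogram it is `1` by
symmetry. -/
lemma modN_eq {τ σ : ℂ} (hτ : 0 < τ.im) (hσ : 0 < σ.im) (hστ : 0 < (σ / τ).im) (z : ℂ) :
    modN z τ σ = exp (π * I * modC z τ σ) * modD z τ σ := by
  have hτ0 : τ ≠ 0 := by rintro rfl; simp at hτ
  have hσ0 : σ ≠ 0 := by rintro rfl; simp at hσ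
  have hτ1 := im_neg_one_div_pos hτ
  have hσ1 := im_neg_one_div_pos hσ
  have hτσ := im_neg_div_pos hστ
  have hN := differentiable_modN hτ hσ hστ
  have hD := differentiable_modD hτ hσ hστ
  have hC : Differentiable ℂ fun z => exp (-(π * I * modC z τ σ)) := by unfold modC; fun_prop
  obtain ⟨ε, hε, hε1, hsub⟩ := exists_par_subset hσ (-τ / 2) (O := {z | modD z τ σ ≠ 0})
    (isOpen_ne_fun hD.continuous continuous_const) (by
      intro r hr s hs
      refine mul_ne_zero (mul_ne_zero ?_ ?_) ?_
      · refine P_ne_zero_of_pos hτ hσ ?_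
        have : (-τ / 2 - s + r * σ + τ).im = τ.im / 2 + r * σ.im := by
          rw [show -τ / 2 - s + r * σ + τ = ((1 / 2 : ℝ) : ℂ) * τ - (s : ℂ) + r * σ by
            push_cast; ring]
          simp only [add_im, sub_im, im_ofReal_mul, ofReal_im]; ring
        rw [this]
        have := mul_nonneg hr.1 hσ.le
        linarith
      · refine P_ne_zero_of_pos hσ1 hτσ ?_
        have : ((-τ / 2 - s + r * σ) / σ).im = (-τ / σ).im / 2 + s * (-1 / σ).im := by
          rw [show (-τ / 2 - s + r * σ) / σ =
            ((1 / 2 : ℝ) : ℂ) * (-τ / σ) + s * (-1 / σ) + (r : ℂ) by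
            push_cast; field_simp; ring]
          simp only [add_im, im_ofReal_mul, ofReal_im]; ring
        rw [this]
        have := mul_nonneg hs.1 hσ1.le
        linarith
      · have e : (σ - 1 - (-τ / 2 - s + r * σ)) / τ =
            ((1 - s : ℝ) : ℂ) * (-1 / τ) + ((1 - r : ℝ) : ℂ) * (σ / τ) + 1 / 2 := by
          push_cast; field_simp; ring
        have him : ((σ - 1 - (-τ / 2 - s + r * σ)) / τ).im =
            (1 - s) * (-1 / τ).im + (1 - r) * (σ / τ).im := by
          rw [e]
          simp only [add_im, im_ofReal_mul]
          norm_num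
        have h1 := mul_nonneg (sub_nonneg.2 hs.2) hτ1.le
        have h2 := mul_nonneg (sub_nonneg.2 hr.2) hστ.le
        refine P_ne_zero_of_im hτ1 hστ (by rw [him]; linarith) fun n hn => ?_
        rw [hn, intCast_im] at him
        have h3 : 1 - s = 0 := by
          by_contra h
          have := mul_pos (lt_of_le_of_ne (sub_nonneg.2 hs.2) (Ne.symm h)) hτ1
          linarith
        have h4 : 1 - r = 0 := by
          by_contra h
          have := mul_pos (lt_of_le_of_ne (sub_nonneg.2 hr.2) (Ne.symm h)) hστ
          linarith
        rw [e, h3, h4] at hn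
        have h5 : ((2 * n : ℤ) : ℂ) = ((1 : ℤ) : ℂ) := by push_cast; rw [← hn]; push_cast; ring
        have h6 : 2 * n = 1 := by exact_mod_cast h5
        omega)
  set h : ℂ → ℂ := fun z => modN z τ σ * exp (-(π * I * modC z τ σ)) / modD z τ σ with hh
  have hd : HolOn h (par σ (-τ / 2) ε) :=
    (hN.fun_mul hC).differentiableOn.fun_div hD.differentiableOn fun z hz => hsub hz
  have hconst := @const_of_periodic_par σ hσ (-τ / 2) ε hε hε1 h hd (fun z hz hz1 => by
      have h1 := hsub hz
      have h2 := hsub hz1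
      rw [hh]
      simp only
      rw [div_eq_div_iff h2 h1]
      have e : exp (-(π * I * modC (z + 1) τ σ)) =
          exp (-(π * I * modC z τ σ)) * exp (π * I * modB ((z + 1) / τ) (σ / τ)) := by
        rw [← exp_add]; congr 1; unfold modC modB; field_simp; ring
      rw [e]
      linear_combination exp (-(π * I * modC z τ σ)) * modN_add_one hτ hσ hστ z)
    (fun z hz hz1 => by
      have h1 := hsub hz
      have h2 := hsub hz1
      rw [hh]
      simp only
      rw [div_eq_div_iff h2 h1]
      have e : exp (-(π * I * modC (z + σ) τ σ)) * -ex (-z) =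
          exp (-(π * I * modC z τ σ)) * exp (π * I * modB z τ) := by
        have e' : -ex (-z) = exp (-(π * I)) * ex (-z) := by rw [exp_neg, exp_pi_mul_I]; norm_num
        rw [e', ex, ← exp_add, ← exp_add, ← exp_add]; congr 1; unfold modC modB; field_simp; ring
      have hx : -ex (-z) ≠ 0 := neg_ne_zero.2 (ex_ne_zero _)
      refine mul_right_cancel₀ hx ?_
      linear_combination exp (-(π * I * modC z τ σ)) * modN_add_sigma hτ hσ hστ z +
        modN (z + σ) τ σ * modD z τ σ * e)
  have hc : (σ - τ - 1) / 2 ∈ par σ (-τ / 2) ε := by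
    rw [par_eq_image hσ]
    refine ⟨(1 / 2, 1 / 2), ⟨⟨by norm_num; linarith, by norm_num; linarith⟩,
      ⟨by norm_num; linarith, by norm_num; linarith⟩⟩, ?_⟩
    simp only [parMap]; push_cast; ring
  have hval : h ((σ - τ - 1) / 2) = 1 := by
    have e : modN ((σ - τ - 1) / 2) τ σ = modD ((σ - τ - 1) / 2) τ σ := by
      simp only [modN, modD]
      congr 1
      · congr 1
        · rw [show σ - (σ - τ - 1) / 2 = (σ - τ - 1) / 2 + τ + ((1 : ℤ) : ℂ) by push_cast; ring,
            P_add_int]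
        · rw [show (σ - τ - 1) / 2 / σ = (-1 - τ - (σ - τ - 1) / 2) / σ + ((1 : ℤ) : ℂ) by
            push_cast; field_simp; ring, P_add_int]
      · rw [show (σ - 1 - (σ - τ - 1) / 2) / τ = (σ - τ - 1) / 2 / τ + ((1 : ℤ) : ℂ) by
          push_cast; field_simp; ring, P_add_int]
    rw [hh]
    simp only
    rw [modC_center, e, mul_zero, neg_zero, exp_zero, mul_one, div_self (hsub hc)]
  have hloc : ∀ z ∈ par σ (-τ / 2) ε, modN z τ σ = exp (π * I * modC z τ σ) * modD z τ σ := by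
    intro z hz
    have h1 := hconst hz hc
    rw [hval, hh] at h1
    simp only at h1
    rw [div_eq_one_iff_eq (hsub hz), exp_neg] at h1
    rw [← h1]
    field_simp
  have hC' : Differentiable ℂ fun z => exp (π * I * modC z τ σ) := by unfold modC; fun_prop
  have := (hN.differentiableOn.analyticOnNhd isOpen_univ).eqOn_of_preconnected_of_eventuallyEq
    ((hC'.fun_mul hD).differentiableOn.analyticOnNhd isOpen_univ) isPreconnected_univ
    (mem_univ ((σ - τ - 1) / 2)) (by
      filter_upwards [(isOpen_par σ (-τ / 2) ε).mem_nhds hc] with z hz using hloc z hz)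
  exact this (mem_univ z)

/-! ### Functions of a parameter and a variable -/

/-- Joint continuity together with separate holomorphy on a subset of `ℂ × ℂ`: the first variable
is a parameter, the second one will be integrated over. -/
structure NiceOn (S : Set (ℂ × ℂ)) (g : ℂ × ℂ → ℂ) : Prop where
  cont : ContinuousOn g S
  fst : ∀ t, HolOn (fun w => g (w, t)) {w | (w, t) ∈ S}
  snd : ∀ w, HolOn (fun t => g (w, t)) {t | (w, t) ∈ S}

namespace NiceOn

variable {S T : Set (ℂ × ℂ)} {f g h : ℂ × ℂ → ℂ}

lemma mono (hf : NiceOn S f) (h : T ⊆ S) : NiceOn T f :=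
  ⟨hf.cont.mono h, fun t => (hf.fst t).mono fun _ hw => h hw, fun w => (hf.snd w).mono fun _ ht => h ht⟩

lemma congr (hf : NiceOn S f) (h : ∀ q ∈ S, g q = f q) : NiceOn S g :=
  ⟨hf.cont.congr h, fun t => (hf.fst t).congr fun w hw => h (w, t) hw,
    fun w => (hf.snd w).congr fun t ht => h (w, t) ht⟩

lemma const (c : ℂ) : NiceOn S fun _ => c :=
  ⟨continuousOn_const, fun _ => differentiableOn_const _, fun _ => differentiableOn_const _⟩

lemma ofParam {a : ℂ → ℂ} {V : Set ℂ} (ha : HolOn a V) (hS : ∀ q ∈ S, q.1 ∈ V) :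
    NiceOn S fun q => a q.1 :=
  ⟨ha.continuousOn.comp continuousOn_fst hS, fun _ => ha.mono fun _ hw => hS _ hw,
    fun w => differentiableOn_const (a w)⟩

lemma ofVar {a : ℂ → ℂ} {V : Set ℂ} (ha : HolOn a V) (hS : ∀ q ∈ S, q.2 ∈ V) :
    NiceOn S fun q => a q.2 :=
  ⟨ha.continuousOn.comp continuousOn_snd hS, fun t => differentiableOn_const (a t),
    fun _ => ha.mono fun _ hw => hS _ hw⟩

lemma var : NiceOn S fun q => q.2 :=
  ofVar (a := fun t => t) differentiableOn_id fun q _ => mem_univ q.2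

lemma param : NiceOn S fun q => q.1 :=
  ofParam (a := fun t => t) differentiableOn_id fun q _ => mem_univ q.1

lemma add (hf : NiceOn S f) (hg : NiceOn S g) : NiceOn S fun q => f q + g q :=
  ⟨hf.cont.add hg.cont, fun t => (hf.fst t).add (hg.fst t), fun w => (hf.snd w).add (hg.snd w)⟩

lemma neg (hf : NiceOn S f) : NiceOn S fun q => -f q :=
  ⟨hf.cont.neg, fun t => (hf.fst t).neg, fun w => (hf.snd w).neg⟩

lemma sub (hf : NiceOn S f) (hg : NiceOn S g) : NiceOn S fun q => f q - g q :=
  ⟨hf.cont.sub hg.cont, fun t => (hf.fst t).sub (hg.fst t), fun w => (hf.snd w).sub (hg.snd w)⟩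

lemma mul (hf : NiceOn S f) (hg : NiceOn S g) : NiceOn S fun q => f q * g q :=
  ⟨hf.cont.mul hg.cont, fun t => (hf.fst t).fun_mul (hg.fst t),
    fun w => (hf.snd w).fun_mul (hg.snd w)⟩

lemma div (hf : NiceOn S f) (hg : NiceOn S g) (h0 : ∀ q ∈ S, g q ≠ 0) :
    NiceOn S fun q => f q / g q :=
  ⟨hf.cont.div hg.cont h0, fun t => (hf.fst t).fun_div (hg.fst t) fun w hw => h0 (w, t) hw,
    fun w => (hf.snd w).fun_div (hg.snd w) fun t ht => h0 (w, t) ht⟩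

lemma comp_entire {F : ℂ → ℂ} (hF : Differentiable ℂ F) (hf : NiceOn S f) :
    NiceOn S fun q => F (f q) :=
  ⟨hF.continuous.comp_continuousOn hf.cont, fun t => hF.comp_differentiableOn (hf.fst t),
    fun w => hF.comp_differentiableOn (hf.snd w)⟩

lemma ex (hf : NiceOn S f) : NiceOn S fun q => ex (f q) := comp_entire differentiable_ex hf

lemma expo (hf : NiceOn S f) : NiceOn S fun q => exp (f q) := comp_entire differentiable_exp hf

lemma isOpen_fst (hS : IsOpen S) (t : ℂ) : IsOpen {w | (w, t) ∈ S} :=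
  hS.preimage (by fun_prop : Continuous fun w : ℂ => (w, t))

lemma isOpen_snd (hS : IsOpen S) (w : ℂ) : IsOpen {t | (w, t) ∈ S} :=
  hS.preimage (by fun_prop : Continuous fun t : ℂ => (w, t))

lemma dprod {χ : ℕ × ℕ → ℂ} (hχ : ∀ p, ‖χ p‖ ≤ 1) (hS : IsOpen S) (hf : NiceOn S f)
    (hg : NiceOn S g) (hh : NiceOn S h) (h1 : ∀ q ∈ S, 0 < (g q).im) (h2 : ∀ q ∈ S, 0 < (h q).im) :
    NiceOn S fun q => dprod χ (f q) (g q) (h q) :=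
  ⟨contOn_dprod hχ hf.cont hg.cont hh.cont h1 h2,
    fun t => diffOn_dprod hχ (isOpen_fst hS t) (hf.fst t) (hg.fst t) (hh.fst t) (fun w hw => h1 (w, t) hw)
      fun w hw => h2 (w, t) hw,
    fun w => diffOn_dprod hχ (isOpen_snd hS w) (hf.snd w) (hg.snd w) (hh.snd w)
      (fun t ht => h1 (w, t) ht) fun t ht => h2 (w, t) ht⟩

lemma P (hS : IsOpen S) (hf : NiceOn S f)
    (hg : NiceOn S g) (hh : NiceOn S h) (h1 : ∀ q ∈ S, 0 < (g q).im) (h2 : ∀ q ∈ S, 0 < (h q).im) :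
    NiceOn S fun q => P (f q) (g q) (h q) := dprod (by simp) hS hf hg hh h1 h2

lemma PCut (N : ℕ) (hS : IsOpen S) (hf : NiceOn S f)
    (hg : NiceOn S g) (hh : NiceOn S h) (h1 : ∀ q ∈ S, 0 < (g q).im) (h2 : ∀ q ∈ S, 0 < (h q).im) :
    NiceOn S fun q => PCut N (f q) (g q) (h q) := dprod (norm_cutWeight_le N) hS hf hg hh h1 h2

lemma theta (hS : IsOpen S) (hf : NiceOn S f) (hg : NiceOn S g) (h1 : ∀ q ∈ S, 0 < (g q).im) :
    NiceOn S fun q => theta (f q) (g q) :=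
  ⟨contOn_theta hf.cont hg.cont h1,
    fun t => diffOn_theta (isOpen_fst hS t) (hf.fst t) (hg.fst t) fun w hw => h1 (w, t) hw,
    fun w => diffOn_theta (isOpen_snd hS w) (hf.snd w) (hg.snd w) fun t ht => h1 (w, t) ht⟩

lemma jacobi (hS : IsOpen S) (hf : NiceOn S f) (hg : NiceOn S g) (h1 : ∀ q ∈ S, 0 < (g q).im) :
    NiceOn S fun q => jacobiTheta₂ (f q) (g q) :=
  ⟨fun q hq => by
    have := ContinuousWithinAt.prodMk (hf.cont q hq) (hg.cont q hq)
    exact ContinuousAt.comp_continuousWithinAt (f := fun q => (f q, g q))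
      (continuousAt_jacobiTheta₂ (f q) (h1 q hq)) this,
    fun t => diffOn_jacobi (isOpen_fst hS t) (hf.fst t) (hg.fst t) fun w hw => h1 (w, t) hw,
    fun w => diffOn_jacobi (isOpen_snd hS w) (hf.snd w) (hg.snd w) fun t ht => h1 (w, t) ht⟩

lemma lineInt {V : Set ℂ} (hV : IsOpen V) {c : ℂ} (hf : NiceOn S f)
    (hS : ∀ w ∈ V, ∀ x : ℝ, (w, c + x) ∈ S) :
    HolOn (fun w => lineInt (fun t => f (w, t)) c) V := by
  unfold HypTheta.lineInt
  refine differentiableOn_intervalIntegral hV ?_ fun x _ => (hf.fst _).mono fun w hw => hS w hw x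
  exact hf.cont.comp (f := fun p : ℂ × ℝ => (p.1, c + (p.2 : ℂ))) (by fun_prop)
    fun p hp => hS _ hp.1 _

/-- Holomorphic dependence of the integral over a segment with fixed end points. -/
lemma segInt {V : Set ℂ} (hV : IsOpen V) {z z' : ℂ} (hf : NiceOn S f)
    (hS : ∀ w ∈ V, ∀ x ∈ Icc (0 : ℝ) 1, (w, z + x * (z' - z)) ∈ S) :
    HolOn (fun w => segInt (fun t => f (w, t)) z z') V := by
  unfold HypTheta.segInt
  refine (differentiableOn_intervalIntegral hV (f := fun w x => f (w, z + x * (z' - z))) ?_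
    fun x hx => (hf.fst _).mono fun w hw => hS w hw x hx).const_mul _
  exact hf.cont.comp (f := fun p : ℂ × ℝ => (p.1, z + (p.2 : ℂ) * (z' - z))) (by fun_prop)
    fun p hp => hS _ hp.1 _ hp.2

end NiceOn

/-! ### Separation of two families of linear factors -/

/-- The product `∏ (1 - c x)` over a list. -/
def linProd (x : ℂ) (cs : List ℂ) : ℂ := (cs.map fun c => 1 - c * x).prod

@[simp] lemma linProd_nil (x : ℂ) : linProd x [] = 1 := by simp [linProd]

@[simp] lemma linProd_cons (x c : ℂ) (cs : List ℂ) :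
    linProd x (c :: cs) = (1 - c * x) * linProd x cs := by simp [linProd]

/-- Coefficients `(u, v)` with `u ∏ (1 - c x) + v (1 - d y) = ∏ (1 - c d)` if `x y = 1`. -/
def bezIn (x y d : ℂ) : List ℂ → ℂ × ℂ
  | [] => (1, 0)
  | c :: cs => ((bezIn x y d cs).1 * (d * y),
      (bezIn x y d cs).1 * linProd x cs + (bezIn x y d cs).2 * (1 - c * d))

lemma bezIn_spec {x y : ℂ} (h : x * y = 1) (d : ℂ) (cs : List ℂ) :
    (bezIn x y d cs).1 * linProd x cs + (bezIn x y d cs).2 * (1 - d * y) = linProd d cs := by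
  induction cs with
  | nil => simp [bezIn]
  | cons c cs ih =>
    rw [linProd_cons, linProd_cons, ← ih, bezIn]
    linear_combination (-(bezIn x y d cs).1 * linProd x cs * c * d) * h

/-- Coefficients `(u, v)` with `u ∏ (1 - c x) + v ∏ (1 - d y) = ∏∏ (1 - c d)` if `x y = 1`. -/
def bez (x y : ℂ) (cs : List ℂ) : List ℂ → ℂ × ℂ
  | [] => (0, 1)
  | d :: ds => ((bez x y cs ds).1 * linProd d cs +
      (bez x y cs ds).2 * linProd y ds * (bezIn x y d cs).1, (bez x y cs ds).2 * (bezIn x y d cs).2)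

/-- The resultant `∏∏ (1 - c d)` of the two families. -/
def bezW (cs ds : List ℂ) : ℂ := (ds.map fun d => linProd d cs).prod

lemma bez_spec {x y : ℂ} (h : x * y = 1) (cs ds : List ℂ) :
    (bez x y cs ds).1 * linProd x cs + (bez x y cs ds).2 * linProd y ds = bezW cs ds := by
  induction ds with
  | nil => simp [bez, bezW]
  | cons d ds ih =>
    have h1 := bezIn_spec h d cs
    have h2 : bezW cs (d :: ds) = linProd d cs * bezW cs ds := by simp [bezW]
    rw [h2, ← ih, bez, linProd_cons]
    linear_combination ((bez x y cs ds).2 * linProd y ds) * h1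

lemma linProd_ne_zero {x : ℂ} {cs : List ℂ} (h : ∀ c ∈ cs, c * x ≠ 1) : linProd x cs ≠ 0 := by
  rw [linProd]
  refine List.prod_ne_zero fun h0 => ?_
  obtain ⟨c, hc, h1⟩ := List.mem_map.1 h0
  exact h c hc (sub_eq_zero.1 h1).symm

lemma bezW_ne_zero {cs ds : List ℂ} (h : ∀ c ∈ cs, ∀ d ∈ ds, c * d ≠ 1) : bezW cs ds ≠ 0 := by
  rw [bezW]
  refine List.prod_ne_zero fun h0 => ?_
  obtain ⟨d, hd, h1⟩ := List.mem_map.1 h0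
  exact linProd_ne_zero (fun c hc => h c hc d hd) h1

section

variable {S : Set (ℂ × ℂ)} {x y d : ℂ × ℂ → ℂ} {ι : Type*} {c : ι → ℂ × ℂ → ℂ}

lemma NiceOn.linProd (hx : NiceOn S x) (hc : ∀ i, NiceOn S (c i)) (L : List ι) :
    NiceOn S fun q => linProd (x q) (L.map fun i => c i q) := by
  induction L with
  | nil => simpa using NiceOn.const 1
  | cons i L ih =>
    simp only [List.map_cons, linProd_cons]
    exact ((NiceOn.const 1).sub ((hc i).mul hx)).mul ih

lemma NiceOn.bezIn (hx : NiceOn S x) (hy : NiceOn S y) (hd : NiceOn S d)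
    (hc : ∀ i, NiceOn S (c i)) (L : List ι) :
    NiceOn S (fun q => (bezIn (x q) (y q) (d q) (L.map fun i => c i q)).1) ∧
      NiceOn S (fun q => (bezIn (x q) (y q) (d q) (L.map fun i => c i q)).2) := by
  induction L with
  | nil => exact ⟨by simpa [HypTheta.bezIn] using NiceOn.const 1,
      by simpa [HypTheta.bezIn] using NiceOn.const 0⟩
  | cons i L ih =>
    simp only [List.map_cons, HypTheta.bezIn]
    exact ⟨ih.1.mul (hd.mul hy), (ih.1.mul (NiceOn.linProd hx hc L)).add
      (ih.2.mul ((NiceOn.const 1).sub ((hc i).mul hd)))⟩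

lemma NiceOn.bez (hx : NiceOn S x) (hy : NiceOn S y) (hc : ∀ i, NiceOn S (c i)) (L L' : List ι) :
    NiceOn S (fun q => (bez (x q) (y q) (L.map fun i => c i q) (L'.map fun i => c i q)).1) ∧
      NiceOn S (fun q => (bez (x q) (y q) (L.map fun i => c i q) (L'.map fun i => c i q)).2) := by
  induction L' with
  | nil => exact ⟨by simpa [HypTheta.bez] using NiceOn.const 0,
      by simpa [HypTheta.bez] using NiceOn.const 1⟩
  | cons i L' ih =>
    have h := NiceOn.bezIn hx hy (hc i) hc L
    simp only [List.map_cons, HypTheta.bez]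
    exact ⟨(ih.1.mul (NiceOn.linProd (hc i) hc L)).add
      ((ih.2.mul (NiceOn.linProd hy hc L')).mul h.1), ih.2.mul h.2⟩

lemma NiceOn.bezW (hc : ∀ i, NiceOn S (c i)) (L L' : List ι) :
    NiceOn S fun q => bezW (L.map fun i => c i q) (L'.map fun i => c i q) := by
  induction L' with
  | nil => simpa [HypTheta.bezW] using NiceOn.const 1
  | cons i L' ih =>
    have : ∀ q, HypTheta.bezW (L.map fun i => c i q) ((i :: L').map fun i => c i q) =
        HypTheta.linProd (c i q) (L.map fun i => c i q) *
          HypTheta.bezW (L.map fun i => c i q) (L'.map fun i => c i q) := by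
      intro q; simp [HypTheta.bezW]
    simp only [this]
    exact (NiceOn.linProd (hc i) hc L).mul ih

end

/-! ### The kernel and the regularised integral -/

/-- The numerator of the kernel. -/
def kerNum (τ σ a t : ℂ) : ℂ := P (τ + σ - a - t) τ σ * P (τ + σ - a + t) τ σ

/-- The kernel `Γ(a + t) Γ(a - t)` with the elliptic gamma function
`Γ(z) = P(τ + σ - z) / P(z)`. -/
def kerK (τ σ a t : ℂ) : ℂ := kerNum τ σ a t / (P (a + t) τ σ * P (a - t) τ σ)

/-- The values of `a` for which the poles of the kernel may pinch the path of integration. -/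
def polA (τ σ : ℂ) : Set ℂ := {a | ∃ (l : ℤ) (m n : ℕ), 2 * a + l + m * τ + n * σ = 0}

lemma mem_polA_iff (τ σ a : ℂ) : a ∈ polA τ σ ↔ a / 2 ∈ polarSet τ σ := by
  have : ∀ x : ℂ, 4 * (x / 2) = 2 * x := fun x => by ring
  simp only [polA, polarSet, mem_ofPred_eq, this]

lemma polA_countable (τ σ : ℂ) : (polA τ σ).Countable := by
  have : polA τ σ = (fun a => a / 2) ⁻¹' polarSet τ σ := by ext a; exact mem_polA_iff τ σ a
  rw [this]
  exact (polarSet_countable τ σ).preimage (fun a b h => by simpa using h)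

lemma notMem_polA_of_pos {τ σ a : ℂ} (hτ : 0 < τ.im) (hσ : 0 < σ.im) (ha : 0 < a.im) :
    a ∉ polA τ σ := by
  rintro ⟨l, m, n, h⟩
  have h' := congrArg Complex.im h
  simp at h'
  have h1 : 0 ≤ (m : ℝ) * τ.im := by positivity
  have h2 : 0 ≤ (n : ℝ) * σ.im := by positivity
  linarith

/-- The polar set is the zero set of an entire function. -/
lemma notMem_polA_iff {τ σ : ℂ} (hτ : 0 < τ.im) (hσ : 0 < σ.im) (a : ℂ) :
    a ∉ polA τ σ ↔ P (2 * a) τ σ ≠ 0 := by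
  constructor
  · intro h
    refine P_ne_zero hτ hσ fun j k n hn => h ⟨-n, j, k, ?_⟩
    push_cast
    linear_combination hn
  · rintro h ⟨l, m, n, h0⟩
    refine h (tprod_of_exists_eq_zero ⟨(m, n), ?_⟩)
    rw [one_mul, lat, show 2 * a + ((m, n) : ℕ × ℕ).1 * τ + ((m, n) : ℕ × ℕ).2 * σ =
      ((-l : ℤ) : ℂ) by push_cast; linear_combination h0, ex_int, sub_self]

lemma isOpen_compl_polA {τ σ : ℂ} (hτ : 0 < τ.im) (hσ : 0 < σ.im) : IsOpen (polA τ σ)ᶜ := by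
  have : (polA τ σ)ᶜ = {a | P (2 * a) τ σ ≠ 0} := by ext a; exact notMem_polA_iff hτ hσ a
  rw [this]
  exact isOpen_ne_fun ((differentiable_P hτ hσ).continuous.comp (by fun_prop)) continuous_const

lemma isOpen_compl_polarSet {τ σ : ℂ} (hτ : 0 < τ.im) (hσ : 0 < σ.im) :
    IsOpen (polarSet τ σ)ᶜ := by
  convert (isOpen_compl_polA hτ hσ).preimage (continuous_const_mul (2 : ℂ)) using 1
  ext η
  rw [mem_preimage, mem_compl_iff, mem_compl_iff, mem_polA_iff,
    mul_div_cancel_left₀ _ (two_ne_zero)]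

/-- The exponentials of the poles with indices below `N`. -/
def poleList (N : ℕ) (τ σ a : ℂ) : List ℂ := (sq N).toList.map fun p => lat a τ σ p

lemma linProd_poleList (N : ℕ) (τ σ a t : ℂ) :
    linProd (ex t) (poleList N τ σ a) = ∏ p ∈ sq N, (1 - lat (a + t) τ σ p) := by
  rw [linProd, poleList, List.map_map, ← Finset.prod_map_toList]
  congr 1
  refine List.map_congr_left fun p _ => ?_
  simp only [Function.comp_apply, lat]
  rw [← ex_add]
  ring_nf

lemma P_eq_poleList (N : ℕ) (a t : ℂ) {τ σ : ℂ} (hτ : 0 < τ.im) (hσ : 0 < σ.im) :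
    P (a + t) τ σ = linProd (ex t) (poleList N τ σ a) * PCut N (a + t) τ σ := by
  rw [linProd_poleList, P_eq_cut N _ hτ hσ]

lemma bezW_poleList_ne_zero (N : ℕ) {τ σ a : ℂ} (ha : a ∉ polA τ σ) :
    bezW (poleList N τ σ a) (poleList N τ σ a) ≠ 0 := by
  refine bezW_ne_zero ?_
  simp only [poleList, List.mem_map]
  rintro _ ⟨p, -, rfl⟩ _ ⟨q, -, rfl⟩ h
  rw [lat, lat, ← ex_add, ex_eq_one_iff] at h
  obtain ⟨n, hn⟩ := h
  refine ha ⟨-n, p.1 + q.1, p.2 + q.2, ?_⟩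
  push_cast
  linear_combination hn

lemma linProd_poleList_ne_zero (N : ℕ) {τ σ a t : ℂ} (hτ : 0 < τ.im) (hσ : 0 < σ.im)
    (h : 0 < (a + t).im) : linProd (ex t) (poleList N τ σ a) ≠ 0 := by
  refine linProd_ne_zero ?_
  simp only [poleList, List.mem_map]
  rintro _ ⟨p, -, rfl⟩ h1
  rw [lat, ← ex_add] at h1
  refine ex_ne_one_of_im_pos ?_ h1
  have h3 : (a + p.1 * τ + p.2 * σ + t).im = (a + t).im + p.1 * τ.im + p.2 * σ.im := by simp; ring
  rw [h3]
  positivity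

/-- The part of the kernel which is regular below its upper poles. -/
def partD (N : ℕ) (τ σ a t : ℂ) : ℂ :=
  (bez (ex t) (ex (-t)) (poleList N τ σ a) (poleList N τ σ a)).1 * kerNum τ σ a t /
    (bezW (poleList N τ σ a) (poleList N τ σ a) * linProd (ex (-t)) (poleList N τ σ a) *
      (PCut N (a + t) τ σ * PCut N (a - t) τ σ))

/-- The part of the kernel which is regular above its lower poles. -/
def partU (N : ℕ) (τ σ a t : ℂ) : ℂ :=
  (bez (ex t) (ex (-t)) (poleList N τ σ a) (poleList N τ σ a)).2 * kerNum τ σ a t /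
    (bezW (poleList N τ σ a) (poleList N τ σ a) * linProd (ex t) (poleList N τ σ a) *
      (PCut N (a + t) τ σ * PCut N (a - t) τ σ))

lemma partD_add_partU (N : ℕ) {τ σ a t : ℂ} (hτ : 0 < τ.im) (hσ : 0 < σ.im) (ha : a ∉ polA τ σ)
    (h1 : 0 < (a + t).im) (h2 : 0 < (a - t).im) :
    partD N τ σ a t + partU N τ σ a t = kerK τ σ a t := by
  have hW := bezW_poleList_ne_zero N ha
  have hA := linProd_poleList_ne_zero N hτ hσ h1
  have hB := linProd_poleList_ne_zero N (t := -t) hτ hσ (by rwa [← sub_eq_add_neg])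
  have hP1 := P_ne_zero_of_pos hτ hσ h1
  have hP2 := P_ne_zero_of_pos hτ hσ h2
  have e1 := P_eq_poleList N a t hτ hσ
  have e2 := P_eq_poleList N a (-t) hτ hσ
  rw [← sub_eq_add_neg] at e2
  rw [e1] at hP1
  rw [e2] at hP2
  have hC1 := right_ne_zero_of_mul hP1
  have hC2 := right_ne_zero_of_mul hP2
  have hb := bez_spec (x := ex t) (y := ex (-t)) (by rw [← ex_add]; simp) (poleList N τ σ a)
    (poleList N τ σ a)
  rw [partD, partU, kerK, e1, e2]
  rw [div_add_div _ _ (by simp [hW, hB, hC1, hC2]) (by simp [hW, hA, hC1, hC2]),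
    div_eq_div_iff (by simp [hW, hA, hB, hC1, hC2]) (by simp [hA, hB, hC1, hC2])]
  linear_combination (kerNum τ σ a t * linProd (ex t) (poleList N τ σ a) *
    linProd (ex (-t)) (poleList N τ σ a) * bezW (poleList N τ σ a) (poleList N τ σ a) *
      (PCut N (a + t) τ σ * PCut N (a - t) τ σ) ^ 2) * hb

/-- The height `R` separates, from both sides, the poles with indices below `N` from the others. -/
def Good (N : ℕ) (R : ℝ) (τ σ a : ℂ) : Prop :=
  |a.im| < R ∧ R < a.im + N * τ.im ∧ R < a.im + N * σ.im

/-- The regularised integral of the kernel against `F`: the two parts of the kernel are integrated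
over two lines which avoid their respective poles. -/
def sepInt (N : ℕ) (R : ℝ) (τ σ a : ℂ) (F : ℂ → ℂ) : ℂ :=
  lineInt (fun t => partD N τ σ a t * F t) (-(R * I)) + lineInt (fun t => partU N τ σ a t * F t) (R * I)

section Param

variable {V : Set ℂ} {τ σ a : ℂ → ℂ}

lemma isOpen_param_set (hV : IsOpen V) (hτ : HolOn τ V) (hσ : HolOn σ V)
    (ha : HolOn a V) {f : ℂ × ℂ × ℂ × ℂ → ℝ} (hf : Continuous f) :
    IsOpen {q : ℂ × ℂ | q.1 ∈ V ∧ 0 < f (τ q.1, σ q.1, a q.1, q.2)} := by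
  have h : ContinuousOn (fun q : ℂ × ℂ => f (τ q.1, σ q.1, a q.1, q.2)) (V ×ˢ univ) := by
    refine hf.comp_continuousOn (ContinuousOn.prodMk ?_ (ContinuousOn.prodMk ?_
      (ContinuousOn.prodMk ?_ continuousOn_snd)))
    · exact hτ.continuousOn.comp continuousOn_fst fun q hq => hq.1
    · exact hσ.continuousOn.comp continuousOn_fst fun q hq => hq.1
    · exact ha.continuousOn.comp continuousOn_fst fun q hq => hq.1
  have := h.isOpen_inter_preimage (hV.prod isOpen_univ) isOpen_Ioi (t := Ioi (0 : ℝ))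
  convert this using 1
  ext q
  simp

/-- The set where the lower part of the kernel is regular. -/
def regD (N : ℕ) (V : Set ℂ) (τ σ a : ℂ → ℂ) : Set (ℂ × ℂ) :=
  {q | q.1 ∈ V ∧ 0 < min ((a q.1).im - q.2.im)
    (min ((a q.1).im + q.2.im + N * (τ q.1).im) ((a q.1).im + q.2.im + N * (σ q.1).im))}

/-- The set where the upper part of the kernel is regular. -/
def regU (N : ℕ) (V : Set ℂ) (τ σ a : ℂ → ℂ) : Set (ℂ × ℂ) :=
  {q | q.1 ∈ V ∧ 0 < min ((a q.1).im + q.2.im)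
    (min ((a q.1).im - q.2.im + N * (τ q.1).im) ((a q.1).im - q.2.im + N * (σ q.1).im))}

variable (hV : IsOpen V) (hτ : HolOn τ V) (hσ : HolOn σ V)
    (ha : HolOn a V) (hτ0 : ∀ w ∈ V, 0 < (τ w).im) (hσ0 : ∀ w ∈ V, 0 < (σ w).im)
    (hpol : ∀ w ∈ V, a w ∉ polA (τ w) (σ w))

include hV hτ hσ ha in
lemma isOpen_regD (N : ℕ) : IsOpen (regD N V τ σ a) :=
  isOpen_param_set hV hτ hσ ha (f := fun x => min (x.2.2.1.im - x.2.2.2.im)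
    (min (x.2.2.1.im + x.2.2.2.im + N * x.1.im) (x.2.2.1.im + x.2.2.2.im + N * x.2.1.im)))
    (by fun_prop)

include hV hτ hσ ha in
lemma isOpen_regU (N : ℕ) : IsOpen (regU N V τ σ a) :=
  isOpen_param_set hV hτ hσ ha (f := fun x => min (x.2.2.1.im + x.2.2.2.im)
    (min (x.2.2.1.im - x.2.2.2.im + N * x.1.im) (x.2.2.1.im - x.2.2.2.im + N * x.2.1.im)))
    (by fun_prop)

include hτ hσ ha in
lemma NiceOn.lat {S : Set (ℂ × ℂ)} (hS : ∀ q ∈ S, q.1 ∈ V) (p : ℕ × ℕ) :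
    NiceOn S fun q => lat (a q.1) (τ q.1) (σ q.1) p := by
  unfold HypTheta.lat
  exact (((NiceOn.ofParam ha hS).add ((NiceOn.const _).mul (NiceOn.ofParam hτ hS))).add
    ((NiceOn.const _).mul (NiceOn.ofParam hσ hS))).ex

include hτ hσ ha hτ0 hσ0 in
lemma NiceOn.kerNum {S : Set (ℂ × ℂ)} (hSo : IsOpen S) (hS : ∀ q ∈ S, q.1 ∈ V) :
    NiceOn S fun q => kerNum (τ q.1) (σ q.1) (a q.1) q.2 := by
  have h1 := NiceOn.ofParam hτ hS
  have h2 := NiceOn.ofParam hσ hS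
  have h3 := NiceOn.ofParam ha hS
  unfold HypTheta.kerNum
  exact (NiceOn.P hSo (((h1.add h2).sub h3).sub NiceOn.var) h1 h2 (fun q hq => hτ0 _ (hS q hq))
    fun q hq => hσ0 _ (hS q hq)).mul (NiceOn.P hSo (((h1.add h2).sub h3).add NiceOn.var) h1 h2
      (fun q hq => hτ0 _ (hS q hq)) fun q hq => hσ0 _ (hS q hq))

include hV hτ hσ ha hτ0 hσ0 hpol in
lemma NiceOn.partD (N : ℕ) :
    NiceOn (regD N V τ σ a) fun q => partD N (τ q.1) (σ q.1) (a q.1) q.2 := by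
  have hSo := isOpen_regD hV hτ hσ ha N
  have hS : ∀ q ∈ regD N V τ σ a, q.1 ∈ V := fun q hq => hq.1
  have h1 := NiceOn.ofParam hτ hS
  have h2 := NiceOn.ofParam hσ hS
  have h3 := NiceOn.ofParam ha hS
  have hc := fun p => NiceOn.lat (a := a) hτ hσ ha hS p
  unfold HypTheta.partD poleList
  have hx : NiceOn (regD N V τ σ a) fun q => HypTheta.ex q.2 := NiceOn.var.ex
  have hy : NiceOn (regD N V τ σ a) fun q => HypTheta.ex (-q.2) := NiceOn.var.neg.ex
  have p1 := fun q (hq : q ∈ regD N V τ σ a) => hτ0 _ (hS q hq)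
  have p2 := fun q (hq : q ∈ regD N V τ σ a) => hσ0 _ (hS q hq)
  refine ((NiceOn.bez hx hy hc _ _).1.mul (NiceOn.kerNum hτ hσ ha hτ0 hσ0 hSo hS)).div
    (((NiceOn.bezW hc _ _).mul (NiceOn.linProd hy hc _)).mul
      ((NiceOn.PCut N hSo (h3.add NiceOn.var) h1 h2 p1 p2).mul
        (NiceOn.PCut N hSo (h3.sub NiceOn.var) h1 h2 p1 p2))) ?_
  rintro q ⟨hq, h0⟩
  rw [lt_min_iff, lt_min_iff] at h0
  have t0 := hτ0 _ hq
  have s0 := hσ0 _ hq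
  have e1 : 0 ≤ (N : ℝ) * (τ q.1).im := by positivity
  have e2 : 0 ≤ (N : ℝ) * (σ q.1).im := by positivity
  refine mul_ne_zero (mul_ne_zero (bezW_poleList_ne_zero N (hpol _ hq))
    (linProd_poleList_ne_zero N t0 s0 ?_))
    (mul_ne_zero (PCut_ne_zero t0 s0 ?_ ?_) (PCut_ne_zero t0 s0 ?_ ?_)) <;>
    simp only [add_im, neg_im, sub_im] <;> linarith [h0.1, h0.2.1, h0.2.2]

include hV hτ hσ ha hτ0 hσ0 hpol in
lemma NiceOn.partU (N : ℕ) :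
    NiceOn (regU N V τ σ a) fun q => partU N (τ q.1) (σ q.1) (a q.1) q.2 := by
  have hSo := isOpen_regU hV hτ hσ ha N
  have hS : ∀ q ∈ regU N V τ σ a, q.1 ∈ V := fun q hq => hq.1
  have h1 := NiceOn.ofParam hτ hS
  have h2 := NiceOn.ofParam hσ hS
  have h3 := NiceOn.ofParam ha hS
  have hc := fun p => NiceOn.lat (a := a) hτ hσ ha hS p
  unfold HypTheta.partU poleList
  have hx : NiceOn (regU N V τ σ a) fun q => HypTheta.ex q.2 := NiceOn.var.ex
  have hy : NiceOn (regU N V τ σ a) fun q => HypTheta.ex (-q.2) := NiceOn.var.neg.ex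
  have p1 := fun q (hq : q ∈ regU N V τ σ a) => hτ0 _ (hS q hq)
  have p2 := fun q (hq : q ∈ regU N V τ σ a) => hσ0 _ (hS q hq)
  refine ((NiceOn.bez hx hy hc _ _).2.mul (NiceOn.kerNum hτ hσ ha hτ0 hσ0 hSo hS)).div
    (((NiceOn.bezW hc _ _).mul (NiceOn.linProd hx hc _)).mul
      ((NiceOn.PCut N hSo (h3.add NiceOn.var) h1 h2 p1 p2).mul
        (NiceOn.PCut N hSo (h3.sub NiceOn.var) h1 h2 p1 p2))) ?_
  rintro q ⟨hq, h0⟩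
  rw [lt_min_iff, lt_min_iff] at h0
  have t0 := hτ0 _ hq
  have s0 := hσ0 _ hq
  have e1 : 0 ≤ (N : ℝ) * (τ q.1).im := by positivity
  have e2 : 0 ≤ (N : ℝ) * (σ q.1).im := by positivity
  refine mul_ne_zero (mul_ne_zero (bezW_poleList_ne_zero N (hpol _ hq))
    (linProd_poleList_ne_zero N t0 s0 ?_))
    (mul_ne_zero (PCut_ne_zero t0 s0 ?_ ?_) (PCut_ne_zero t0 s0 ?_ ?_)) <;>
    simp only [add_im, sub_im] <;> linarith [h0.1, h0.2.1, h0.2.2]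

include hV hτ hσ ha hτ0 hσ0 hpol in
lemma differentiableOn_sepInt {N : ℕ} {R : ℝ} (hgood : ∀ w ∈ V, Good N R (τ w) (σ w) (a w))
    {F : ℂ × ℂ → ℂ} (hF : NiceOn (V ×ˢ univ) F) :
    HolOn (fun w => sepInt N R (τ w) (σ w) (a w) fun t => F (w, t)) V := by
  unfold sepInt
  refine DifferentiableOn.add ?_ ?_
  · refine NiceOn.lineInt hV ((NiceOn.partD hV hτ hσ ha hτ0 hσ0 hpol N).mul
      (hF.mono fun q hq => ⟨hq.1, trivial⟩)) fun w hw x => ⟨hw, ?_⟩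
    obtain ⟨h1, h2, h3⟩ := hgood w hw
    rw [abs_lt] at h1
    simp only [lt_min_iff]
    simp
    exact ⟨by linarith, by linarith, by linarith⟩
  · refine NiceOn.lineInt hV ((NiceOn.partU hV hτ hσ ha hτ0 hσ0 hpol N).mul
      (hF.mono fun q hq => ⟨hq.1, trivial⟩)) fun w hw x => ⟨hw, ?_⟩
    obtain ⟨h1, h2, h3⟩ := hgood w hw
    rw [abs_lt] at h1
    simp only [lt_min_iff]
    simp
    exact ⟨by linarith, by linarith, by linarith⟩

end Param

lemma partD_add_one (N : ℕ) (τ σ a t : ℂ) : partD N τ σ a (t + 1) = partD N τ σ a t := by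
  have h1 : ∀ z : ℂ, P (z + 1) τ σ = P z τ σ := fun z => by simpa using P_add_int z τ σ 1
  have h2 : ∀ z : ℂ, PCut N (z + 1) τ σ = PCut N z τ σ := fun z => by
    simpa [PCut] using dprod_add_int (cutWeight N) z τ σ 1
  have e1 : ex (-(t + 1)) = ex (-t) := by rw [← ex_add_one (-(t + 1))]; ring_nf
  rw [partD, partD, kerNum, kerNum, ex_add_one, e1, ← add_assoc, h1, ← h1 (τ + σ - a - (t + 1)),
    ← add_assoc, h2, ← h2 (a - (t + 1)), show τ + σ - a - (t + 1) + 1 = τ + σ - a - t by ring,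
    show a - (t + 1) + 1 = a - t by ring]

lemma partU_add_one (N : ℕ) (τ σ a t : ℂ) : partU N τ σ a (t + 1) = partU N τ σ a t := by
  have h1 : ∀ z : ℂ, P (z + 1) τ σ = P z τ σ := fun z => by simpa using P_add_int z τ σ 1
  have h2 : ∀ z : ℂ, PCut N (z + 1) τ σ = PCut N z τ σ := fun z => by
    simpa [PCut] using dprod_add_int (cutWeight N) z τ σ 1
  have e1 : ex (-(t + 1)) = ex (-t) := by rw [← ex_add_one (-(t + 1))]; ring_nf
  rw [partU, partU, kerNum, kerNum, ex_add_one, e1, ← add_assoc, h1, ← h1 (τ + σ - a - (t + 1)),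
    ← add_assoc, h2, ← h2 (a - (t + 1)), show τ + σ - a - (t + 1) + 1 = τ + σ - a - t by ring,
    show a - (t + 1) + 1 = a - t by ring]

/-- An entire function of period one. -/
def PerEntire (F : ℂ → ℂ) : Prop := Differentiable ℂ F ∧ ∀ t, F (t + 1) = F t

section Fixed

variable {τ σ a : ℂ} (hτ : 0 < τ.im) (hσ : 0 < σ.im)

include hτ hσ in
lemma differentiableOn_partD (ha : a ∉ polA τ σ) (N : ℕ) :
    HolOn (partD N τ σ a) {t | (a, t) ∈ regD N univ (fun _ => τ) (fun _ => σ) fun _ => a} :=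
  (NiceOn.partD isOpen_univ (τ := fun _ => τ) (σ := fun _ => σ) (a := fun _ => a)
    (differentiableOn_const _) (differentiableOn_const _) (differentiableOn_const _)
    (fun _ _ => hτ) (fun _ _ => hσ) (fun _ _ => ha) N).snd a

include hτ hσ in
lemma differentiableOn_partU (ha : a ∉ polA τ σ) (N : ℕ) :
    HolOn (partU N τ σ a) {t | (a, t) ∈ regU N univ (fun _ => τ) (fun _ => σ) fun _ => a} :=
  (NiceOn.partU isOpen_univ (τ := fun _ => τ) (σ := fun _ => σ) (a := fun _ => a)
    (differentiableOn_const _) (differentiableOn_const _) (differentiableOn_const _)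
    (fun _ _ => hτ) (fun _ _ => hσ) (fun _ _ => ha) N).snd a

include hτ hσ in
/-- For `Im a > 0` both lines can be moved to the real axis. -/
lemma sepInt_of_pos (ha : 0 < a.im) {N : ℕ} {R : ℝ} (hg : Good N R τ σ a) {F : ℂ → ℂ}
    (hF : PerEntire F) : sepInt N R τ σ a F = lineInt (fun t => kerK τ σ a t * F t) 0 := by
  obtain ⟨h1, h2, h3⟩ := hg
  have hpol := notMem_polA_of_pos hτ hσ ha
  rw [abs_lt] at h1
  set β := min (a.im + N * τ.im) (a.im + N * σ.im) with hβ
  have hb : R < β := lt_min h2 h3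
  have hb1 := min_le_left (a.im + N * τ.im) (a.im + N * σ.im)
  have hb2 := min_le_right (a.im + N * τ.im) (a.im + N * σ.im)
  have d1 : HolOn (fun t => partD N τ σ a t * F t) (strip (-β) a.im) := by
    refine ((differentiableOn_partD hτ hσ hpol N).mono fun t ht => ⟨trivial, ?_⟩).fun_mul
      hF.1.differentiableOn
    simp only [lt_min_iff]
    exact ⟨by linarith [ht.2], by linarith [ht.1], by linarith [ht.1]⟩
  have d2 : HolOn (fun t => partU N τ σ a t * F t) (strip (-a.im) β) := by
    refine ((differentiableOn_partU hτ hσ hpol N).mono fun t ht => ⟨trivial, ?_⟩).fun_mul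
      hF.1.differentiableOn
    simp only [lt_min_iff]
    exact ⟨by linarith [ht.1], by linarith [ht.2], by linarith [ht.2]⟩
  have m1 : (0 : ℂ) ∈ strip (-β) a.im := ⟨by simp; linarith, by simpa using ha⟩
  have m2 : (0 : ℂ) ∈ strip (-a.im) β := ⟨by simpa using ha, by simp; linarith⟩
  have c1 := lineInt_congr_base d1 (fun t _ => by rw [partD_add_one, hF.2])
    (c := -(R * I)) (c' := 0) ⟨by simp; linarith, by simp; linarith⟩ m1
  have c2 := lineInt_congr_base d2 (fun t _ => by rw [partU_add_one, hF.2])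
    (c := R * I) (c' := 0) ⟨by simp; linarith, by simp; linarith⟩ m2
  rw [sepInt, c1, c2, lineInt, lineInt, lineInt, ← intervalIntegral.integral_add]
  · refine intervalIntegral.integral_congr fun x _ => ?_
    rw [← add_mul, partD_add_partU N hτ hσ hpol] <;> simpa using ha
  · exact (continuousOn_line d1.continuousOn m1).intervalIntegrable _ _
  · exact (continuousOn_line d2.continuousOn m2).intervalIntegrable _ _

include hτ hσ in
/-- The regularised integral depends neither on the lines nor on the number of separated poles. -/
lemma sepInt_congr (ha : a ∉ polA τ σ) {N N' : ℕ} {R R' : ℝ} (hg : Good N R τ σ a)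
    (hg' : Good N' R' τ σ a) {F : ℂ → ℂ} (hF : PerEntire F) :
    sepInt N R τ σ a F = sepInt N' R' τ σ a F := by
  -- both sides are holomorphic in `a` in a horizontal strip and agree in its upper half
  set U : Set ℂ := strip (max (-(min R R')) (max (max (R - N * τ.im) (R - N * σ.im))
    (max (R' - N' * τ.im) (R' - N' * σ.im)))) (min R R') with hU
  have hUg : ∀ b ∈ U, Good N R τ σ b ∧ Good N' R' τ σ b := by
    rintro b ⟨h1, h2⟩
    simp only [max_lt_iff, lt_min_iff] at h1 h2
    obtain ⟨h3, ⟨h4, h5⟩, h6, h7⟩ := h1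
    have e1 := min_le_left R R'
    have e2 := min_le_right R R'
    exact ⟨⟨abs_lt.2 ⟨by linarith, h2.1⟩, by linarith, by linarith⟩,
      ⟨abs_lt.2 ⟨by linarith, h2.2⟩, by linarith, by linarith⟩⟩
  have hmem : ∀ b : ℂ, |b.im| < min R R' → a.im ≤ b.im → b ∈ U := by
    intro b hb hab
    rw [abs_lt] at hb
    refine ⟨?_, hb.2⟩
    simp only [max_lt_iff]
    exact ⟨hb.1, ⟨by linarith [hg.2.1], by linarith [hg.2.2]⟩, by linarith [hg'.2.1],
      by linarith [hg'.2.2]⟩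
  have haU : a ∈ U := hmem a (lt_min hg.1 hg'.1) le_rfl
  have hclosed : IsOpen (U \ polA τ σ) := by
    exact (isOpen_strip _ _).inter (isOpen_compl_polA hτ hσ)
  have hd : ∀ {N : ℕ} {R : ℝ}, (∀ b ∈ U, Good N R τ σ b) →
      HolOn (fun b => sepInt N R τ σ b F) (U \ polA τ σ) := fun hgd =>
    differentiableOn_sepInt hclosed (τ := fun _ => τ) (σ := fun _ => σ) (a := fun b => b)
      (F := fun q => F q.2) (differentiableOn_const _) (differentiableOn_const _) differentiableOn_id
      (fun _ _ => hτ) (fun _ _ => hσ) (fun b hb => hb.2) (fun b hb => hgd b hb.1)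
      (NiceOn.ofVar hF.1.differentiableOn (V := univ) fun _ _ => trivial)
  refine eqOn_diff_countable (isOpen_strip _ _) (convex_strip _ _) (polA_countable τ σ) hclosed
    (hd fun b hb => (hUg b hb).1) (hd fun b hb => (hUg b hb).2) (V := {b | 0 < b.im})
    (isOpen_lt continuous_const continuous_im) ?_ ?_ ⟨haU, ha⟩
  · have hR : 0 < min R R' := lt_min ((abs_nonneg _).trans_lt hg.1) ((abs_nonneg _).trans_lt hg'.1)
    rcases lt_or_ge 0 a.im with h0 | h0
    · exact ⟨a, h0, haU⟩
    · refine ⟨((min R R' / 2 : ℝ) : ℂ) * I, ?_, hmem _ ?_ ?_⟩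
      · simp only [mem_ofPred_eq, im_ofReal_mul, I_im, mul_one]; positivity
      · simp only [im_ofReal_mul, I_im, mul_one]
        rw [abs_of_pos (by positivity)]; linarith
      · simp only [im_ofReal_mul, I_im, mul_one]; linarith
  · rintro b ⟨hb0, hb⟩
    rw [sepInt_of_pos hτ hσ hb0 (hUg b hb.1).1 hF, sepInt_of_pos hτ hσ hb0 (hUg b hb.1).2 hF]

end Fixed

/-- A height admissible for the regularised integral. -/
def stdR (a : ℂ) : ℝ := |a.im| + 1

/-- A number of separated poles admissible for the regularised integral at height `stdR`. -/
def stdN (τ σ a : ℂ) : ℕ := ⌈(2 * |a.im| + 2) / min τ.im σ.im⌉₊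

lemma good_std {τ σ : ℂ} (hτ : 0 < τ.im) (hσ : 0 < σ.im) (a : ℂ) :
    Good (stdN τ σ a) (stdR a) τ σ a := by
  have hm : 0 < min τ.im σ.im := lt_min hτ hσ
  have h1 : 2 * |a.im| + 2 ≤ stdN τ σ a * min τ.im σ.im := by
    rw [← div_le_iff₀ hm]; exact Nat.le_ceil _
  have h2 := neg_abs_le a.im
  have h3 : (stdN τ σ a : ℝ) * min τ.im σ.im ≤ stdN τ σ a * τ.im := by gcongr; exact min_le_left _ _
  have h4 : (stdN τ σ a : ℝ) * min τ.im σ.im ≤ stdN τ σ a * σ.im := by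
    gcongr; exact min_le_right _ _
  unfold stdR
  exact ⟨by linarith, by linarith, by linarith⟩

/-- The analytic continuation in `a` of `F ↦ ∫₀¹ K F` from the upper half plane. -/
def regInt (τ σ a : ℂ) (F : ℂ → ℂ) : ℂ := sepInt (stdN τ σ a) (stdR a) τ σ a F

lemma regInt_eq_sepInt {τ σ a : ℂ} (hτ : 0 < τ.im) (hσ : 0 < σ.im) (ha : a ∉ polA τ σ) {N : ℕ}
    {R : ℝ} (hg : Good N R τ σ a) {F : ℂ → ℂ} (hF : PerEntire F) :
    regInt τ σ a F = sepInt N R τ σ a F := sepInt_congr hτ hσ ha (good_std hτ hσ a) hg hF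

lemma regInt_of_pos {τ σ a : ℂ} (hτ : 0 < τ.im) (hσ : 0 < σ.im) (ha : 0 < a.im) {F : ℂ → ℂ}
    (hF : PerEntire F) : regInt τ σ a F = lineInt (fun t => kerK τ σ a t * F t) 0 :=
  sepInt_of_pos hτ hσ ha (good_std hτ hσ a) hF

lemma differentiableOn_regInt {V : Set ℂ} {τ σ a : ℂ → ℂ} (hV : IsOpen V)
    (hτ : HolOn τ V) (hσ : HolOn σ V) (ha : HolOn a V)
    (hτ0 : ∀ w ∈ V, 0 < (τ w).im) (hσ0 : ∀ w ∈ V, 0 < (σ w).im)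
    (hpol : ∀ w ∈ V, a w ∉ polA (τ w) (σ w)) {F : ℂ × ℂ → ℂ} (hF : NiceOn (V ×ˢ univ) F)
    (hF1 : ∀ w ∈ V, ∀ t, F (w, t + 1) = F (w, t)) :
    HolOn (fun w => regInt (τ w) (σ w) (a w) fun t => F (w, t)) V := by
  intro w₀ hw₀
  set N := stdN (τ w₀) (σ w₀) (a w₀)
  set R := stdR (a w₀)
  have hg : Good N R (τ w₀) (σ w₀) (a w₀) := good_std (hτ0 _ hw₀) (hσ0 _ hw₀) _
  have cτ := continuous_im.continuousAt.comp (hτ.continuousOn.continuousAt (hV.mem_nhds hw₀))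
  have cσ := continuous_im.continuousAt.comp (hσ.continuousOn.continuousAt (hV.mem_nhds hw₀))
  have ca := continuous_im.continuousAt.comp (ha.continuousOn.continuousAt (hV.mem_nhds hw₀))
  have hev : ∀ᶠ w in 𝓝 w₀, Good N R (τ w) (σ w) (a w) := by
    have e1 := ca.abs.eventually_lt (continuousAt_const (y := R)) hg.1
    have e2 := (continuousAt_const (y := R)).eventually_lt
      (ca.add (continuousAt_const.mul cτ)) hg.2.1
    have e3 := (continuousAt_const (y := R)).eventually_lt
      (ca.add (continuousAt_const.mul cσ)) hg.2.2
    filter_upwards [e1, e2, e3] with w h1 h2 h3 using ⟨h1, h2, h3⟩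
  obtain ⟨V', hV', hV'o, hw'⟩ := eventually_nhds_iff.1 (hev.and (hV.eventually_mem hw₀))
  have hd := differentiableOn_sepInt (τ := τ) (σ := σ) (a := a) hV'o
    (hτ.mono fun w hw => (hV' w hw).2) (hσ.mono fun w hw => (hV' w hw).2)
    (ha.mono fun w hw => (hV' w hw).2) (fun w hw => hτ0 w (hV' w hw).2)
    (fun w hw => hσ0 w (hV' w hw).2) (fun w hw => hpol w (hV' w hw).2) (N := N) (R := R)
    (fun w hw => (hV' w hw).1) (hF.mono fun q hq => ⟨(hV' _ hq.1).2, trivial⟩)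
  refine DifferentiableAt.differentiableWithinAt ?_
  refine (hd.differentiableAt (hV'o.mem_nhds hw')).congr_of_eventuallyEq ?_
  filter_upwards [hV'o.mem_nhds hw'] with w hw
  have hwV := (hV' w hw).2
  refine regInt_eq_sepInt (hτ0 w hwV) (hσ0 w hwV) (hpol w hwV) (hV' w hw).1 ⟨?_, hF1 w hwV⟩
  have := hF.snd w
  have hu : {t : ℂ | (w, t) ∈ V ×ˢ (univ : Set ℂ)} = univ := by ext t; simp [hwV]
  rwa [hu, differentiableOn_univ] at this

/-! ### The hypergeometric function as a regularised integral -/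

/-- The product of theta functions in the integrand. -/
def thF (lam mu τ σ t : ℂ) : ℂ := theta (lam + t) τ * theta (mu + t) σ

lemma perEntire_thF (lam mu : ℂ) {τ σ : ℂ} (hτ : 0 < τ.im) (hσ : 0 < σ.im) :
    PerEntire (thF lam mu τ σ) := by
  refine ⟨?_, fun t => ?_⟩
  · exact ((differentiable_theta hτ).comp (differentiable_id.const_add lam)).fun_mul
      ((differentiable_theta hσ).comp (differentiable_id.const_add mu))
  · rw [thF, thF, ← add_assoc, ← add_assoc, theta_add_one, theta_add_one, neg_mul_neg]

lemma Omega_eq {τ σ a t : ℂ} (hτ : 0 < τ.im) (hσ : 0 < σ.im) (h1 : 0 < (t + a).im)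
    (h2 : 0 < (τ + σ + a - t).im) : Omega a t τ σ =
      P (t - a) τ σ * P (τ + σ - a - t) τ σ / (P (t + a) τ σ * P (τ + σ + a - t) τ σ) := by
  have hp := fun z : ℂ => (multipliable_dprod z hτ hσ (χ := fun _ => 1) (by simp)).hasProd
  have hnum := (hp (t - a)).mul (hp (τ + σ - a - t))
  have hden := (hp (t + a)).mul (hp (τ + σ + a - t))
  have hne : P (t + a) τ σ * P (τ + σ + a - t) τ σ ≠ 0 :=
    mul_ne_zero (P_ne_zero_of_pos hτ hσ h1) (P_ne_zero_of_pos hτ hσ h2)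
  have hdiv := Tendsto.div hnum hden hne
  have : HasProd (fun p : ℕ × ℕ => ((1 - 1 * lat (t - a) τ σ p) * (1 - 1 * lat (τ + σ - a - t) τ σ p)) /
      ((1 - 1 * lat (t + a) τ σ p) * (1 - 1 * lat (τ + σ + a - t) τ σ p)))
      (P (t - a) τ σ * P (τ + σ - a - t) τ σ / (P (t + a) τ σ * P (τ + σ + a - t) τ σ)) := by
    refine hdiv.congr fun s => ?_
    exact (Finset.prod_div_distrib ..).symm
  rw [← this.tprod_eq, Omega]
  refine tprod_congr fun p => ?_
  simp only [lat, ex, one_mul]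
  rw [show τ + σ - a - t + p.1 * τ + p.2 * σ = -t - a + (p.1 + 1) * τ + (p.2 + 1) * σ by ring,
    show τ + σ + a - t + p.1 * τ + p.2 * σ = -t + a + (p.1 + 1) * τ + (p.2 + 1) * σ by ring]

lemma Omega_eq_kerK {τ σ a t : ℂ} (hτ : 0 < τ.im) (hσ : 0 < σ.im) (ha : 0 < a.im)
    (ht : t.im = 0) : Omega a t τ σ =
      -ex (a - t) * th0 (t - a) σ * th0 (t - a) τ * kerK τ σ a t := by
  have h1 : 0 < (a + t).im := by simpa [ht] using ha
  have h2 : 0 < (a - t).im := by simpa [ht] using ha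
  have h3 : 0 < (τ + σ + a - t).im := by simp [ht]; positivity
  have hP1 := P_ne_zero_of_pos hτ hσ h1
  have hP2 := P_ne_zero_of_pos hτ hσ h2
  have hP3 := P_ne_zero_of_pos hτ hσ h3
  rw [Omega_eq hτ hσ (by rwa [add_comm]) h3, kerK, kerNum, add_comm t a]
  have a1 := P_succ (t - a) hτ hσ
  have a2 := P_succ (t - a + τ) hσ hτ
  rw [P_swap (t - a + τ) σ τ, P_swap (t - a + τ + σ),
    show t - a + τ + σ = τ + σ - a + t by ring] at a2
  have b1 := P_succ (a - t) hτ hσ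
  have b2 := P_succ (a - t + τ) hσ hτ
  rw [P_swap (a - t + τ) σ τ, P_swap (a - t + τ + σ),
    show a - t + τ + σ = τ + σ + a - t by ring] at b2
  have c1 := P1_succ (a - t) hσ
  have c2 := P1_succ (t - a) hτ
  rw [th0, th0, show σ - (t - a) = a - t + σ by ring, show τ - (t - a) = a - t + τ by ring]
  have hx : ex (t - a) = (ex (a - t))⁻¹ := by rw [← ex_neg, neg_sub]
  have hx0 := ex_ne_zero (a - t)
  have hc : 1 - ex (a - t) ≠ 0 := sub_ne_zero.2 (ex_ne_one_of_im_pos h2).symm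
  have key : P1 (t - a) σ * P1 (t - a + τ) τ * (P1 (a - t) σ * P1 (a - t + τ) τ) =
      -ex (a - t) * (P1 (t - a) σ * P1 (a - t + σ) σ) * (P1 (t - a) τ * P1 (a - t + τ) τ) := by
    rw [c1, c2, hx]
    field_simp
    ring
  rw [a1, a2, mul_div_assoc', div_eq_div_iff (mul_ne_zero hP1 hP3) (mul_ne_zero hP1 hP2), b1, b2]
  linear_combination (P (τ + σ - a + t) τ σ * P (τ + σ - a - t) τ σ * P (a + t) τ σ *
    P (τ + σ + a - t) τ σ) * key

lemma integrand_eq {lam mu τ σ η t : ℂ} (hτ : 0 < τ.im) (hσ : 0 < σ.im) (hη : 0 < η.im)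
    (ht : t.im = 0) (h1 : theta (t - 2 * η) τ ≠ 0) (h2 : theta (t - 2 * η) σ ≠ 0) :
    integrand lam mu τ σ η t = -1 / (thC τ * thC σ) * (kerK τ σ (2 * η) t * thF lam mu τ σ t) := by
  have ha : 0 < (2 * η).im := by simpa using hη
  have hC := thC_ne_zero hτ
  have hC' := thC_ne_zero hσ
  rw [integrand, Omega_eq_kerK hτ hσ ha ht, thF, div_mul_eq_mul_div,
    div_eq_div_iff (mul_ne_zero h1 h2) (mul_ne_zero hC hC'), theta_eq_th0 (t - 2 * η) hτ,
    theta_eq_th0 (t - 2 * η) hσ]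
  have e : ex (2 * η - t) = exp (-(π * I * (t - 2 * η))) * exp (-(π * I * (t - 2 * η))) := by
    rw [ex, ← exp_add]; ring_nf
  rw [e]
  ring

lemma uUpper_eq {lam mu τ σ η : ℂ} (hτ : 0 < τ.im) (hσ : 0 < σ.im) (hη : 0 < η.im) :
    uUpper lam mu τ σ η = exp (-(π * I * lam * mu) / (2 * η)) *
      (-1 / (thC τ * thC σ) * lineInt (fun t => kerK τ σ (2 * η) t * thF lam mu τ σ t) 0) := by
  rw [uUpper, lineInt]
  congr 1
  rw [← intervalIntegral.integral_const_mul]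
  -- the zeros of the denominator form a countable set
  have hcount : ∀ ρ : ℂ, 0 < ρ.im → {t : ℝ | theta ((t : ℂ) - 2 * η) ρ = 0}.Countable := by
    intro ρ hρ
    have h := (countable_range fun p : ℤ × ℤ => (p.1 : ℂ) + p.2 * ρ + 2 * η).preimage
      Complex.ofReal_injective
    refine h.mono fun t ht => ?_
    by_contra hne
    refine theta_ne_zero hρ (fun m n hmn => hne ⟨(m, n), ?_⟩) ht
    linear_combination -hmn
  apply intervalIntegral.integral_congr_ae
  have h1 : ∀ᵐ t : ℝ, t ∉ {t : ℝ | theta ((t : ℂ) - 2 * η) τ = 0} ∪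
      {t : ℝ | theta ((t : ℂ) - 2 * η) σ = 0} :=
    ((hcount τ hτ).union (hcount σ hσ)).ae_notMem _
  filter_upwards [h1] with t ht _
  simp only [mem_union, mem_ofPred_eq, not_or] at ht
  rw [zero_add]
  exact integrand_eq hτ hσ hη (ofReal_im t) ht.1 ht.2

/-- The analytic continuation exists, and is given by the regularised integral. -/
lemma isContinuation_regInt (lam mu : ℂ) {τ σ : ℂ} (hτ : 0 < τ.im) (hσ : 0 < σ.im) :
    IsContinuation lam mu τ σ fun η => exp (-(π * I * lam * mu) / (2 * η)) *
      (-1 / (thC τ * thC σ) * regInt τ σ (2 * η) (thF lam mu τ σ)) := by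
  have hiff : ∀ η, 2 * η ∈ polA τ σ ↔ η ∈ polarSet τ σ := fun η => by
    rw [mem_polA_iff, show 2 * η / 2 = η by ring]
  refine ⟨?_, fun η hη => ?_⟩
  · have hopen := isOpen_compl_polarSet hτ hσ
    refine DifferentiableOn.analyticOnNhd ?_ hopen
    refine DifferentiableOn.fun_mul (DifferentiableOn.cexp ?_) (DifferentiableOn.const_mul ?_ _)
    · refine (differentiableOn_const (c := -(π * I * lam * mu))).fun_div
        (d := fun η => 2 * η) (by fun_prop) fun η hη h0 => hη ⟨0, 0, 0, ?_⟩
      push_cast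
      linear_combination 2 * h0
    · exact differentiableOn_regInt hopen (τ := fun _ => τ) (σ := fun _ => σ) (a := fun η => 2 * η)
        (F := fun q => thF lam mu τ σ q.2) (differentiableOn_const _) (differentiableOn_const _)
        (by fun_prop) (fun _ _ => hτ) (fun _ _ => hσ) (fun η hη => by rw [hiff]; exact hη)
        (NiceOn.ofVar (perEntire_thF lam mu hτ hσ).1.differentiableOn (V := univ) fun _ _ => trivial)
        fun _ _ t => (perEntire_thF lam mu hτ hσ).2 t
  · simp only
    rw [uUpper_eq hτ hσ hη, regInt_of_pos hτ hσ (by simpa using hη) (perEntire_thF lam mu hτ hσ)]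

lemma isContinuation_u (lam mu : ℂ) {τ σ : ℂ} (hτ : 0 < τ.im) (hσ : 0 < σ.im) :
    IsContinuation lam mu τ σ (u lam mu τ σ) :=
  Classical.epsilon_spec ⟨_, isContinuation_regInt lam mu hτ hσ⟩

lemma u_eq_regInt (lam mu : ℂ) {τ σ a : ℂ} (hτ : 0 < τ.im) (hσ : 0 < σ.im) (ha : a ∉ polA τ σ) :
    u lam mu τ σ (a / 2) = exp (-(π * I * lam * mu) / a) *
      (-1 / (thC τ * thC σ) * regInt τ σ a (thF lam mu τ σ)) := by
  have h := IsContinuation.eqOn hτ hσ (isContinuation_u lam mu hτ hσ)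
    (isContinuation_regInt lam mu hτ hσ) (x := a / 2) (fun hm => ha ((mem_polA_iff τ σ a).2 hm))
  rw [h, show 2 * (a / 2) = a by ring]

/-! ### Integration against the Kronecker function along moving lines -/

lemma theta_sub_ne_zero {σ t y : ℂ} (hσ : 0 < σ.im) (h1 : y.im - σ.im < t.im) (h2 : t.im < y.im) :
    theta (t - y) σ ≠ 0 := by
  refine theta_ne_zero hσ fun m n h => ?_
  have him := congrArg Complex.im h
  simp only [sub_im, add_im, intCast_im, zero_add, mul_im, intCast_re, zero_mul, add_zero] at him
  have h3 : (n : ℝ) < 0 := by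
    by_contra! hn
    nlinarith
  have h4 : (-1 : ℝ) < n := by
    by_contra! hn
    nlinarith
  have h5 : n < 0 := by exact_mod_cast h3
  have h6 : -1 < n := by exact_mod_cast h4
  omega

/-- The integral against the Kronecker function depends holomorphically on the parameters and on
the position of its pole. -/
lemma niceOn_krInt {V : Set ℂ} (hV : IsOpen V) {σ : ℂ} (hσ : 0 < σ.im) {G : ℂ × ℂ → ℂ} {α β : ℝ}
    (hG : NiceOn (V ×ˢ strip α β) G) {ω : ℂ → ℂ} (hω : HolOn ω V)
    (hω0 : ∀ w ∈ V, th0 (ω w) σ ≠ 0) {c : ℂ} (hc : c ∈ strip α β) :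
    NiceOn (V ×ˢ strip c.im (c.im + σ.im))
      fun q => krInt (fun t => G (q.1, t)) (ω q.1) σ c q.2 := by
  have hθ := (differentiable_theta hσ)
  have h1 : ∀ q ∈ V ×ˢ strip c.im (c.im + σ.im), ∀ x : ℝ, theta (c + x - q.2) σ ≠ 0 := by
    intro q hq x
    apply theta_sub_ne_zero hσ <;> simp <;> linarith [hq.2.1, hq.2.2]
  have h2 : ∀ w ∈ V, theta (ω w) σ ≠ 0 := fun w hw h => hω0 w hw ((theta_eq_zero_iff _ hσ).1 h)
  have hmem : ∀ x : ℝ, c + x ∈ strip α β := strip_add_real hc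
  have hcont : ContinuousOn (fun p : (ℂ × ℂ) × ℝ => G (p.1.1, c + p.2) * kr (ω p.1.1)
      (c + p.2 - p.1.2) σ) ((V ×ˢ strip c.im (c.im + σ.im)) ×ˢ univ) := by
    have e1 : ContinuousOn (fun p : (ℂ × ℂ) × ℝ => G (p.1.1, c + p.2))
        ((V ×ˢ strip c.im (c.im + σ.im)) ×ˢ univ) :=
      hG.cont.comp (f := fun p : (ℂ × ℂ) × ℝ => (p.1.1, c + (p.2 : ℂ))) (by fun_prop)
        fun p hp => ⟨hp.1.1, hmem _⟩
    have e2 : ContinuousOn (fun p : (ℂ × ℂ) × ℝ => ω p.1.1)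
        ((V ×ˢ strip c.im (c.im + σ.im)) ×ˢ univ) :=
      hω.continuousOn.comp (f := fun p : (ℂ × ℂ) × ℝ => p.1.1) (by fun_prop) fun p hp => hp.1.1
    refine e1.mul ?_
    unfold kr
    refine ContinuousOn.div (continuousOn_const.mul (hθ.continuous.comp_continuousOn
      (e2.add (by fun_prop)))) ((hθ.continuous.comp_continuousOn e2).mul
      (hθ.continuous.comp_continuousOn (by fun_prop))) fun p hp => mul_ne_zero (h2 _ hp.1.1)
      (h1 _ hp.1 _)
  have hO : IsOpen (strip c.im (c.im + σ.im)) := isOpen_strip _ _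
  refine ⟨?_, fun y => ?_, fun w => ?_⟩
  · rw [continuousOn_iff_continuous_domRestrict]
    refine intervalIntegral.continuous_parametric_intervalIntegral_of_continuous'
      (f := fun (q : ↥(V ×ˢ strip c.im (c.im + σ.im))) (x : ℝ) => G (q.1.1, c + x) * kr (ω q.1.1)
        (c + x - q.1.2) σ) ?_ 0 1
    exact hcont.comp_continuous (f := fun r : ↥(V ×ˢ strip c.im (c.im + σ.im)) × ℝ => (r.1.1, r.2))
      (by fun_prop) fun r => ⟨r.1.2, mem_univ _⟩
  · by_cases hy : y ∈ strip c.im (c.im + σ.im)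
    swap
    · exact (differentiableOn_empty (𝕜 := ℂ)).mono fun w hw => hy hw.2
    have hs : {w | (w, y) ∈ V ×ˢ strip c.im (c.im + σ.im)} = V := by ext w; simp [hy]
    rw [hs]
    refine differentiableOn_intervalIntegral hV ?_ fun x _ => ?_
    · exact hcont.comp (f := fun p : ℂ × ℝ => ((p.1, y), p.2)) (by fun_prop)
        fun p hp => ⟨⟨hp.1, hy⟩, mem_univ _⟩
    · refine ((hG.fst (c + x)).mono fun w hw => ⟨hw, hmem x⟩).fun_mul ?_
      unfold kr
      have e1 : HolOn (fun w => theta (ω w + (c + x - y)) σ) V :=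
        hθ.comp_differentiableOn (hω.add_const (c + x - y))
      have e2 : HolOn (fun w => theta (ω w) σ) V := hθ.comp_differentiableOn hω
      exact (e1.const_mul _).fun_div (e2.mul_const (theta (c + x - y) σ)) fun w hw =>
        mul_ne_zero (h2 w hw) (h1 (w, y) ⟨hw, hy⟩ x)
  · by_cases hw : w ∈ V
    swap
    · exact (differentiableOn_empty (𝕜 := ℂ)).mono fun y hy => hw hy.1
    have hs : {y | (w, y) ∈ V ×ˢ strip c.im (c.im + σ.im)} = strip c.im (c.im + σ.im) := by
      ext y; simp [hw]
    rw [hs]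
    refine differentiableOn_intervalIntegral hO ?_ fun x _ => ?_
    · exact hcont.comp (f := fun p : ℂ × ℝ => ((w, p.1), p.2)) (by fun_prop)
        fun p hp => ⟨⟨hw, hp.1⟩, mem_univ _⟩
    · unfold kr
      have e1 : HolOn (fun y : ℂ => theta (ω w + (c + x - y)) σ)
          (strip c.im (c.im + σ.im)) := hθ.comp_differentiableOn (by fun_prop)
      have e2 : HolOn (fun y : ℂ => theta (c + x - y) σ)
          (strip c.im (c.im + σ.im)) := hθ.comp_differentiableOn (by fun_prop)
      exact ((e1.const_mul (deriv (fun z => theta z σ) 0)).fun_div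
        (e2.const_mul (theta (ω w) σ)) fun y hy =>
        mul_ne_zero (h2 w hw) (h1 (w, y) ⟨hw, hy⟩ x)).const_mul (G (w, c + x))

/-- A height at which the strips `α < Im t < β` and `Im y - Im σ < Im t < Im y` meet. -/
def krLev (σ : ℂ) (α β : ℝ) (y : ℂ) : ℝ := (max α (y.im - σ.im) + min β y.im) / 2

/-- The integral of `g` against the Kronecker function of `t - y` over a line on which `g` is
regular and `Im y - Im σ < Im t < Im y`. -/
def krLine (g : ℂ → ℂ) (ω σ : ℂ) (α β : ℝ) (y : ℂ) : ℂ := krInt g ω σ (I * krLev σ α β y) y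

lemma krLev_spec {σ y : ℂ} {α β : ℝ} (hσ : 0 < σ.im) (hαβ : α < β)
    (hy : y ∈ strip α (β + σ.im)) : I * krLev σ α β y ∈ strip α β ∧
      (I * (krLev σ α β y : ℂ)).im ∈ Ioo (y.im - σ.im) y.im := by
  have h0 : max α (y.im - σ.im) < min β y.im := by
    rw [max_lt_iff, lt_min_iff, lt_min_iff]
    exact ⟨⟨hαβ, hy.1⟩, by linarith [hy.2], by linarith⟩
  have h1 := le_max_left α (y.im - σ.im)
  have h2 := le_max_right α (y.im - σ.im)
  have h3 := min_le_left β y.im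
  have h4 := min_le_right β y.im
  have h5 : (I * (krLev σ α β y : ℂ)).im = krLev σ α β y := by simp
  refine ⟨⟨?_, ?_⟩, ?_, ?_⟩ <;> rw [h5, krLev] <;> linarith

lemma krLine_eq {g : ℂ → ℂ} {α β : ℝ} (hg : HolOn g (strip α β))
    (hg1 : ∀ z, g (z + 1) = g z) {ω σ : ℂ} (hσ : 0 < σ.im) (hω : th0 ω σ ≠ 0) {y c : ℂ}
    (hc : c ∈ strip α β) (h1 : c.im ∈ Ioo (y.im - σ.im) y.im) :
    krLine g ω σ α β y = krInt g ω σ c y := by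
  have hy : y ∈ strip α (β + σ.im) := ⟨hc.1.trans h1.2, by linarith [hc.2, h1.1]⟩
  obtain ⟨h2, h3⟩ := krLev_spec hσ (hc.1.trans hc.2) hy
  exact krInt_congr_base hg hg1 hσ hω h2 hc h3 h1

lemma niceOn_krLine {V : Set ℂ} (hV : IsOpen V) {σ : ℂ} (hσ : 0 < σ.im) {G : ℂ × ℂ → ℂ}
    {α β : ℝ} (hαβ : α < β) (hG : NiceOn (V ×ˢ strip α β) G)
    (hG1 : ∀ w ∈ V, ∀ t, G (w, t + 1) = G (w, t)) {ω : ℂ → ℂ} (hω : HolOn ω V)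
    (hω0 : ∀ w ∈ V, th0 (ω w) σ ≠ 0) :
    NiceOn (V ×ˢ strip α (β + σ.im)) fun q => krLine (fun t => G (q.1, t)) (ω q.1) σ α β q.2 := by
  have hloc : ∀ y ∈ strip α (β + σ.im), ∃ c ∈ strip α β, y ∈ strip c.im (c.im + σ.im) := by
    intro y hy
    obtain ⟨h2, h3⟩ := krLev_spec hσ hαβ hy
    exact ⟨_, h2, h3.2, by linarith [h3.1]⟩
  have heq : ∀ c ∈ strip α β, ∀ q ∈ V ×ˢ strip c.im (c.im + σ.im),
      krLine (fun t => G (q.1, t)) (ω q.1) σ α β q.2 =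
        krInt (fun t => G (q.1, t)) (ω q.1) σ c q.2 := by
    intro c hc q hq
    exact krLine_eq ((hG.snd q.1).mono fun t ht => ⟨hq.1, ht⟩) (hG1 _ hq.1) hσ (hω0 _ hq.1) hc
      ⟨by linarith [hq.2.2], hq.2.1⟩
  have hO : ∀ c : ℂ, IsOpen (strip c.im (c.im + σ.im)) := fun c => isOpen_strip _ _
  refine ⟨fun q hq => ?_, fun y w hw => ?_, fun w y hy => ?_⟩
  · obtain ⟨c, hc, hy⟩ := hloc q.2 hq.2
    have h := (niceOn_krInt hV hσ hG hω hω0 hc).congr (heq c hc)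
    exact (h.cont.continuousAt ((hV.prod (hO c)).mem_nhds ⟨hq.1, hy⟩)).continuousWithinAt
  · obtain ⟨c, hc, hy⟩ := hloc y hw.2
    have h := (niceOn_krInt hV hσ hG hω hω0 hc).congr (heq c hc)
    exact ((h.fst y).differentiableAt ((NiceOn.isOpen_fst (hV.prod (hO c)) y).mem_nhds
      ⟨hw.1, hy⟩)).differentiableWithinAt
  · obtain ⟨c, hc, hy'⟩ := hloc y hy.2
    have h := (niceOn_krInt hV hσ hG hω hω0 hc).congr (heq c hc)
    exact ((h.snd w).differentiableAt ((NiceOn.isOpen_snd (hV.prod (hO c)) w).mem_nhds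
      ⟨hy.1, hy'⟩)).differentiableWithinAt

lemma differentiableOn_krLine {g : ℂ → ℂ} {α β : ℝ} (hαβ : α < β)
    (hg : HolOn g (strip α β)) (hg1 : ∀ z, g (z + 1) = g z) {ω σ : ℂ} (hσ : 0 < σ.im)
    (hω : th0 ω σ ≠ 0) : HolOn (krLine g ω σ α β) (strip α (β + σ.im)) := by
  have h := niceOn_krLine (V := univ) isOpen_univ hσ hαβ (G := fun q => g q.2)
    (NiceOn.ofVar hg fun q hq => hq.2) (fun _ _ t => hg1 t) (ω := fun _ => ω)
    (differentiableOn_const _) fun _ _ => hω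
  exact (h.snd 0).mono fun y hy => ⟨mem_univ _, hy⟩

lemma krLine_add_sigma {g : ℂ → ℂ} {α β : ℝ} (hg : HolOn g (strip α β))
    (hg1 : ∀ z, g (z + 1) = g z) {ω σ : ℂ} (hσ : 0 < σ.im) (hω : th0 ω σ ≠ 0) {y : ℂ}
    (hy : y ∈ strip α β) :
    ex (-ω) * krLine g ω σ α β (y + σ) = krLine g ω σ α β y - 2 * π * I * g y := by
  have hαβ := hy.1.trans hy.2
  obtain ⟨h1, h2⟩ := krLev_spec hσ hαβ (y := y) ⟨hy.1, by linarith [hy.2]⟩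
  obtain ⟨h3, h4⟩ := krLev_spec hσ hαβ (y := y + σ) ⟨by simp; linarith [hy.1], by simp; exact hy.2⟩
  refine krInt_add_sigma hg hg1 hσ hω h1 h3 h2 ?_
  simpa using h4

/-- The double integral of `k(y) g(t)` against the Kronecker function of `t - y`, where `y` runs
over the period segment from `b` to `b + σ`. -/
def krDouble (k g : ℂ → ℂ) (ω σ : ℂ) (α β : ℝ) (b : ℂ) : ℂ :=
  segInt (fun y => k y * krLine g ω σ α β y) b (b + σ)

/-- Moving the period segment of the outer integral crosses the pole at `t = y` and produces a
single integral. -/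
lemma krDouble_sub {k g : ℂ → ℂ} {α β : ℝ} {T : Set ℂ} (hT : IsOpen T) (hTc : Convex ℝ T)
    {ω σ : ℂ} (hTσ : ∀ y ∈ T, y + σ ∈ T) (hk : HolOn k T)
    (hkσ : ∀ y ∈ T, k (y + σ) = ex (-ω) * k y)
    (hg : HolOn g (strip α β)) (hg1 : ∀ z, g (z + 1) = g z) (hσ : 0 < σ.im)
    (hω : th0 ω σ ≠ 0) {b b' : ℂ} (hb : b ∈ T ∩ strip α β) (hb' : b' ∈ T ∩ strip α β) :
    krDouble k g ω σ α β b - krDouble k g ω σ α β b' =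
      -(2 * π * I) * segInt (fun y => k y * g y) b' b := by
  have hαβ := hb.2.1.trans hb.2.2
  set U := T ∩ strip α (β + σ.im)
  have hU : IsOpen U := hT.inter (isOpen_strip _ _)
  have hUc : Convex ℝ U := hTc.inter (convex_strip _ _)
  set U' := T ∩ strip α β
  have hU' : IsOpen U' := hT.inter (isOpen_strip _ _)
  have hUc' : Convex ℝ U' := hTc.inter (convex_strip _ _)
  have hsub : ∀ y ∈ U', y ∈ U := fun y hy => ⟨hy.1, hy.2.1, by linarith [hy.2.2]⟩
  have hsub' : ∀ y ∈ U', y + σ ∈ U := fun y hy => ⟨hTσ y hy.1, by simp; linarith [hy.2.1],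
    by simp; linarith [hy.2.2]⟩
  have hf : HolOn (fun y => k y * krLine g ω σ α β y) U := (hk.mono fun y hy => hy.1).fun_mul
      ((differentiableOn_krLine hαβ hg hg1 hσ hω).mono fun y hy => hy.2)
  obtain ⟨G, hG⟩ := exists_primitive hU hUc hf
  have hD : ∀ y ∈ U', HasDerivAt (fun b => G (b + σ) - G b) (-(2 * π * I) * (k y * g y)) y := by
    intro y hy
    have h1 := ((hG _ (hsub' y hy)).comp_add_const y σ).sub (hG _ (hsub y hy))
    refine h1.congr_deriv ?_
    rw [hkσ y hy.1]
    linear_combination (k y) * krLine_add_sigma hg hg1 hσ hω hy.2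
  have hc : ContinuousOn (fun y => -(2 * π * I) * (k y * g y)) U' :=
    (((hk.mono fun y hy => hy.1).fun_mul (hg.mono fun y hy => hy.2)).const_mul _).continuousOn
  have h := segInt_eq_sub hUc' hc hD hb' hb
  rw [krDouble, krDouble, segInt_eq_sub hUc hf.continuousOn hG (hsub b hb) (hsub' b hb),
    segInt_eq_sub hUc hf.continuousOn hG (hsub b' hb') (hsub' b' hb')]
  rw [← h, segInt, segInt, intervalIntegral.integral_const_mul]
  ring

/-! ### Kernels times theta functions -/

/-- The kernel multiplied by `θ₀(a + t; σ)`, which cancels the zeros of a row of factors, so that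
it is regular in the strip `-Im a - Im τ < Im t < Im a`. -/
def gam (τ σ a t : ℂ) : ℂ :=
  P (σ - a - t) τ σ * P (τ + σ - a + t) τ σ / (P (a + τ + t) τ σ * P (a - t) τ σ)

lemma kerK_neg (τ σ a t : ℂ) : kerK τ σ a (-t) = kerK τ σ a t := by
  rw [kerK, kerK, kerNum, kerNum]
  simp only [sub_neg_eq_add, ← sub_eq_add_neg]
  rw [mul_comm (P (a - t) τ σ), mul_comm (P (τ + σ - a + t) τ σ)]

lemma kerK_swap (τ σ a t : ℂ) : kerK τ σ a t = kerK σ τ a t := by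
  rw [kerK, kerK, kerNum, kerNum, add_comm τ σ, P_swap _ τ σ, P_swap _ τ σ, P_swap _ τ σ,
    P_swap _ τ σ]

lemma kerK_add_int (τ σ a t : ℂ) (n : ℤ) : kerK τ σ a (t + n) = kerK τ σ a t := by
  rw [kerK, kerK, kerNum, kerNum, show τ + σ - a - (t + n) = τ + σ - a - t + ((-n : ℤ) : ℂ) by
    push_cast; ring, show a - (t + n) = a - t + ((-n : ℤ) : ℂ) by push_cast; ring, ← add_assoc,
    ← add_assoc, P_add_int, P_add_int, P_add_int, P_add_int]

lemma kerK_mul_th0 {τ σ a t : ℂ} (hτ : 0 < τ.im) (hσ : 0 < σ.im) (h : 0 < (a + t).im) :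
    kerK τ σ a t * th0 (a + t) σ = gam τ σ a t := by
  have h1 := P1_ne_zero_of_pos hσ h
  rw [kerK, kerNum, gam, th0, P_succ (a + t) hτ hσ, P_succ (σ - a - t) hτ hσ,
    show σ - a - t + τ = τ + σ - a - t by ring, show a + t + τ = a + τ + t by ring,
    show σ - (a + t) = σ - a - t by ring]
  field_simp

lemma gam_reflect (τ σ a t : ℂ) : gam τ σ a (-t - τ) = gam τ σ a t := by
  rw [gam, gam, show σ - a - (-t - τ) = τ + σ - a + t by ring,
    show τ + σ - a + (-t - τ) = σ - a - t by ring, show a + τ + (-t - τ) = a - t by ring,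
    show a - (-t - τ) = a + τ + t by ring, mul_comm (P (a - t) τ σ),
    mul_comm (P (τ + σ - a + t) τ σ)]

lemma gam_add_int (τ σ a t : ℂ) (n : ℤ) : gam τ σ a (t + n) = gam τ σ a t := by
  rw [gam, gam, show σ - a - (t + n) = σ - a - t + ((-n : ℤ) : ℂ) by
    push_cast; ring, show a - (t + n) = a - t + ((-n : ℤ) : ℂ) by push_cast; ring, ← add_assoc,
    ← add_assoc, P_add_int, P_add_int, P_add_int, P_add_int]

lemma NiceOn.gam {S : Set (ℂ × ℂ)} (hS : IsOpen S) {τ σ : ℂ} (hτ : 0 < τ.im) (hσ : 0 < σ.im)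
    {a t : ℂ × ℂ → ℂ} (ha : NiceOn S a) (ht : NiceOn S t)
    (h : ∀ q ∈ S, t q ∈ strip (-(a q).im - τ.im) (a q).im) :
    NiceOn S fun q => gam τ σ (a q) (t q) := by
  have hP : ∀ {z : ℂ × ℂ → ℂ}, NiceOn S z → NiceOn S fun q => HypTheta.P (z q) τ σ := fun hz =>
    NiceOn.P hS hz (NiceOn.const τ) (NiceOn.const σ) (fun _ _ => hτ) fun _ _ => hσ
  refine NiceOn.div ((hP (((NiceOn.const σ).sub ha).sub ht)).mul
    (hP (((NiceOn.const (τ + σ)).sub ha).add ht)))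
    ((hP ((ha.add (NiceOn.const τ)).add ht)).mul (hP (ha.sub ht))) fun q hq => mul_ne_zero
    (P_ne_zero_of_pos hτ hσ ?_) (P_ne_zero_of_pos hτ hσ ?_) <;> simp <;> linarith [(h q hq).1,
      (h q hq).2]

lemma differentiableOn_kerK {τ σ a : ℂ} (hτ : 0 < τ.im) (hσ : 0 < σ.im) :
    HolOn (kerK τ σ a) (strip (-a.im) a.im) := by
  have hP : ∀ {z : ℂ → ℂ} (_ : Differentiable ℂ z), Differentiable ℂ fun t => P (z t) τ σ :=
    fun hz => (differentiable_P hτ hσ).comp hz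
  refine DifferentiableOn.fun_div ((hP (by fun_prop)).fun_mul (hP (by fun_prop))).differentiableOn
    ((hP (by fun_prop)).fun_mul (hP (by fun_prop))).differentiableOn fun t ht => mul_ne_zero
    (P_ne_zero_of_pos hτ hσ ?_) (P_ne_zero_of_pos hτ hσ ?_) <;> simp <;> linarith [ht.1, ht.2]

/-- The set of `y` with `y / σ` in a horizontal strip. -/
def skew (σ : ℂ) (α β : ℝ) : Set ℂ := {y | y / σ ∈ strip α β}

lemma isOpen_skew (σ : ℂ) (α β : ℝ) : IsOpen (skew σ α β) :=
  (isOpen_strip α β).preimage (by fun_prop)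

lemma convex_skew (σ : ℂ) (α β : ℝ) : Convex ℝ (skew σ α β) := by
  refine (convex_strip α β).is_linear_preimage (f := fun y : ℂ => y / σ) ⟨fun x y => ?_,
    fun c x => ?_⟩
  · exact add_div x y σ
  · simp [mul_div_assoc]

lemma skew_add {σ : ℂ} (hσ : 0 < σ.im) {α β : ℝ} {y : ℂ} (hy : y ∈ skew σ α β) :
    y + σ ∈ skew σ α β := by
  have hσ0 : σ ≠ 0 := by rintro rfl; simp at hσ
  simp only [skew, mem_ofPred_eq, add_div, div_self hσ0] at hy ⊢
  exact strip_add_one hy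

section Factors

variable (τ σ lam ell a : ℂ)

/-- The integrand in `t` belonging to `θ(t + a, σ)`. -/
def gA (t : ℂ) : ℂ := thC σ * exp (-(π * I * (a + t))) * gam τ σ a t * theta (lam + t) τ

/-- The integrand in `t` belonging to `θ(t - a, σ)`. -/
def gB (t : ℂ) : ℂ := -(thC σ * exp (-(π * I * (a - t))) * gam τ σ a (-t) * theta (lam + t) τ)

/-- The theta factor of the integrand in `y`. -/
def facY (ν y : ℂ) : ℂ := expπ ((y ^ 2 - 2 * ν * y) / σ) * theta (ell + y / σ) (-τ / σ)

/-- The integrand in `y` belonging to `θ(a - y, σ)`, where `ν = ω + a`. -/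
def kA (ω y : ℂ) : ℂ := thC σ * exp (-(π * I * (a - y + modB (a - y) σ))) *
    gam (-τ / σ) (-1 / σ) (a / σ) (-y / σ) * facY τ σ ell (ω + a) y

/-- The integrand in `y` belonging to `θ(a + y, σ)`, where `ν = ω - a`. -/
def kB (ω y : ℂ) : ℂ := thC σ * exp (-(π * I * (a + y + modB (a + y) σ))) *
    gam (-τ / σ) (-1 / σ) (a / σ) (y / σ) * facY τ σ ell (ω - a) y

lemma gA_add_one (t : ℂ) : gA τ σ lam a (t + 1) = gA τ σ lam a t := by
  have := gam_add_int τ σ a t 1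
  rw [Int.cast_one] at this
  rw [gA, gA, this, ← add_assoc lam, theta_add_one, show -(π * I * (a + (t + 1))) =
    -(π * I * (a + t)) - π * I by ring, exp_sub, exp_pi_mul_I]
  ring

lemma gB_add_one (t : ℂ) : gB τ σ lam a (t + 1) = gB τ σ lam a t := by
  have := gam_add_int τ σ a (-t) (-1)
  rw [show -t + ((-1 : ℤ) : ℂ) = -(t + 1) by push_cast; ring] at this
  rw [gB, gB, this, ← add_assoc lam, theta_add_one, show -(π * I * (a - (t + 1))) =
    -(π * I * (a - t)) + π * I by ring, exp_add, exp_pi_mul_I]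
  ring

lemma gB_add_tau (t : ℂ) : gB τ σ lam a (t + τ) = ex (-lam) * gA τ σ lam a t := by
  rw [gB, gA, show -(t + τ) = -t - τ by ring, gam_reflect, ← add_assoc, theta_add_tau]
  have : exp (-(π * I * (a - (t + τ)))) * exp (-(π * I * (τ + 2 * (lam + t)))) =
      ex (-lam) * exp (-(π * I * (a + t))) := by
    rw [ex, ← exp_add, ← exp_add]; ring_nf
  linear_combination (thC σ * gam τ σ a t * theta (lam + t) τ) * this

variable {σ}

lemma kA_add_sigma (hσ : 0 < σ.im) (ω y : ℂ) :
    kA τ σ ell a ω (y + σ) = ex (-ω) * kA τ σ ell a ω y := by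
  have hσ0 : σ ≠ 0 := by rintro rfl; simp at hσ
  have h1 := gam_add_int (-τ / σ) (-1 / σ) (a / σ) (-y / σ) (-1)
  rw [show -y / σ + ((-1 : ℤ) : ℂ) = -(y + σ) / σ by push_cast; field_simp; ring] at h1
  rw [kA, kA, h1, facY, facY, show ell + (y + σ) / σ = ell + y / σ + 1 by field_simp; ring,
    theta_add_one]
  have : exp (-(π * I * (a - (y + σ) + modB (a - (y + σ)) σ))) *
      expπ (((y + σ) ^ 2 - 2 * (ω + a) * (y + σ)) / σ) =
      exp (π * I) * ex (-ω) * (exp (-(π * I * (a - y + modB (a - y) σ))) *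
        expπ ((y ^ 2 - 2 * (ω + a) * y) / σ)) := by
    rw [ex, ← exp_add, ← exp_add, ← exp_add, ← exp_add]
    congr 1
    rw [modB, modB]
    field_simp
    ring
  rw [exp_pi_mul_I] at this
  linear_combination (-thC σ * gam (-τ / σ) (-1 / σ) (a / σ) (-y / σ) *
    theta (ell + y / σ) (-τ / σ)) * this

lemma kB_add_sigma (hσ : 0 < σ.im) (ω y : ℂ) :
    kB τ σ ell a ω (y + σ) = ex (-ω) * kB τ σ ell a ω y := by
  have hσ0 : σ ≠ 0 := by rintro rfl; simp at hσ
  have h1 := gam_add_int (-τ / σ) (-1 / σ) (a / σ) (y / σ) 1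
  rw [show y / σ + ((1 : ℤ) : ℂ) = (y + σ) / σ by push_cast; field_simp] at h1
  rw [kB, kB, h1, facY, facY, show ell + (y + σ) / σ = ell + y / σ + 1 by field_simp; ring,
    theta_add_one]
  have : exp (-(π * I * (a + (y + σ) + modB (a + (y + σ)) σ))) *
      expπ (((y + σ) ^ 2 - 2 * (ω - a) * (y + σ)) / σ) * exp (π * I) =
      ex (-ω) * (exp (-(π * I * (a + y + modB (a + y) σ))) *
        expπ ((y ^ 2 - 2 * (ω - a) * y) / σ)) := by
    rw [ex, ← exp_add, ← exp_add, ← exp_add, ← exp_add]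
    congr 1
    rw [modB, modB]
    field_simp
    ring
  rw [exp_pi_mul_I] at this
  linear_combination (thC σ * gam (-τ / σ) (-1 / σ) (a / σ) (y / σ) *
    theta (ell + y / σ) (-τ / σ)) * this

lemma kB_add_tau (hσ : 0 < σ.im) (ω y : ℂ) :
    kB τ σ ell a ω (y + τ) = -ex (ell - ω * τ / σ) * kA τ σ ell a ω y := by
  have hσ0 : σ ≠ 0 := by rintro rfl; simp at hσ
  have h1 := gam_reflect (-τ / σ) (-1 / σ) (a / σ) (-y / σ)
  rw [show -(-y / σ) - -τ / σ = (y + τ) / σ by field_simp; ring] at h1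
  have h2 := theta_add_tau (ell + (y + τ) / σ) (-τ / σ)
  rw [show ell + (y + τ) / σ + -τ / σ = ell + y / σ by field_simp; ring] at h2
  rw [kB, kA, h1, facY, facY, h2]
  have : exp (-(π * I * (a + (y + τ) + modB (a + (y + τ)) σ))) *
      expπ (((y + τ) ^ 2 - 2 * (ω - a) * (y + τ)) / σ) =
      ex (ell - ω * τ / σ) * (exp (-(π * I * (a - y + modB (a - y) σ))) *
        expπ ((y ^ 2 - 2 * (ω + a) * y) / σ)) *
        exp (-(π * I * (-τ / σ + 2 * (ell + (y + τ) / σ)))) := by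
    rw [ex, ← exp_add, ← exp_add, ← exp_add, ← exp_add]
    congr 1
    rw [modB, modB]
    field_simp
    ring
  linear_combination (thC σ * gam (-τ / σ) (-1 / σ) (a / σ) (-y / σ) *
    theta (ell + (y + τ) / σ) (-τ / σ)) * this

variable {τ a}

lemma gA_eq (hτ : 0 < τ.im) (hσ : 0 < σ.im) {t : ℂ} (h : 0 < (a + t).im) :
    gA τ σ lam a t = kerK τ σ a t * theta (t + a) σ * theta (lam + t) τ := by
  rw [gA, ← kerK_mul_th0 hτ hσ h, add_comm t a, theta_eq_th0 (a + t) hσ]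
  ring

lemma gB_eq (hτ : 0 < τ.im) (hσ : 0 < σ.im) {t : ℂ} (h : 0 < (a - t).im) :
    gB τ σ lam a t = kerK τ σ a t * theta (t - a) σ * theta (lam + t) τ := by
  rw [gB, ← kerK_mul_th0 hτ hσ (t := -t) (by rwa [← sub_eq_add_neg]), kerK_neg, ← neg_sub a t,
    theta_neg, theta_eq_th0 (a - t) hσ, ← sub_eq_add_neg]
  ring

lemma theta_eq_th0_modular (z : ℂ) (hσ : 0 < σ.im) : theta z σ =
    thC σ * exp (-(π * I * (z + modB z σ))) * th0 (z / σ) (-1 / σ) := by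
  rw [theta_eq_th0 z hσ, th0_modular z hσ, mul_add, neg_add, exp_add, exp_neg (π * I * modB z σ)]
  have := exp_ne_zero (π * I * modB z σ)
  field_simp

lemma kA_eq (hσ : 0 < σ.im) (hτσ : 0 < (-τ / σ).im) {y : ℂ} (ω : ℂ) (h : 0 < (a / σ - y / σ).im) :
    kA τ σ ell a ω y = kerK (-1 / σ) (-τ / σ) (a / σ) (y / σ) * theta (a - y) σ *
      facY τ σ ell (ω + a) y := by
  rw [kA, theta_eq_th0_modular (a - y) hσ, ← kerK_mul_th0 hτσ (im_neg_one_div_pos hσ) (t := -y / σ)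
    (by rwa [neg_div, ← sub_eq_add_neg]), kerK_swap, neg_div σ y, kerK_neg, ← sub_eq_add_neg, sub_div]
  ring

lemma kB_eq (hσ : 0 < σ.im) (hτσ : 0 < (-τ / σ).im) {y : ℂ} (ω : ℂ) (h : 0 < (a / σ + y / σ).im) :
    kB τ σ ell a ω y = kerK (-1 / σ) (-τ / σ) (a / σ) (y / σ) * theta (a + y) σ *
      facY τ σ ell (ω - a) y := by
  rw [kB, theta_eq_th0_modular (a + y) hσ, ← kerK_mul_th0 hτσ (im_neg_one_div_pos hσ) h, kerK_swap,
    add_div]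
  ring

end Factors

lemma differentiable_facY {τ σ : ℂ} (hτσ : 0 < (-τ / σ).im) (ell ν : ℂ) :
    Differentiable ℂ (facY τ σ ell ν) := by
  unfold facY
  exact Differentiable.fun_mul (by fun_prop)
    ((differentiable_theta hτσ).comp (f := fun y : ℂ => ell + y / σ) (by fun_prop))

lemma differentiableOn_gam {τ σ : ℂ} (hτ : 0 < τ.im) (hσ : 0 < σ.im) (a : ℂ) :
    HolOn (gam τ σ a) (strip (-a.im - τ.im) a.im) :=
  ((NiceOn.gam (S := univ ×ˢ strip (-a.im - τ.im) a.im) (isOpen_univ.prod (isOpen_strip _ _)) hτ hσ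
    (NiceOn.const a) NiceOn.var fun _ hq => hq.2).snd 0).mono fun _ ht => ⟨mem_univ _, ht⟩

lemma differentiableOn_gA {τ σ : ℂ} (hτ : 0 < τ.im) (hσ : 0 < σ.im) (lam a : ℂ) :
    HolOn (gA τ σ lam a) (strip (-a.im - τ.im) a.im) := by
  have h1 : Differentiable ℂ fun t : ℂ => thC σ * exp (-(π * I * (a + t))) := by fun_prop
  exact (h1.differentiableOn.fun_mul (differentiableOn_gam hτ hσ a)).fun_mul
    ((differentiable_theta hτ).comp (f := fun t : ℂ => lam + t) (by fun_prop)).differentiableOn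

lemma differentiableOn_gB {τ σ : ℂ} (hτ : 0 < τ.im) (hσ : 0 < σ.im) (lam a : ℂ) :
    HolOn (gB τ σ lam a) (strip (-a.im) (a.im + τ.im)) := by
  have h1 : Differentiable ℂ fun t : ℂ => thC σ * exp (-(π * I * (a - t))) := by fun_prop
  refine ((h1.differentiableOn.fun_mul ((differentiableOn_gam hτ hσ a).comp (f := fun t => -t)
    (by fun_prop) fun t ht => ?_)).fun_mul
    ((differentiable_theta hτ).comp (f := fun t : ℂ => lam + t) (by fun_prop)).differentiableOn).neg
  constructor <;> simp <;> linarith [ht.1, ht.2]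

lemma differentiable_modB (σ : ℂ) : Differentiable ℂ fun z => modB z σ := by unfold modB; fun_prop

lemma differentiableOn_kA {τ σ : ℂ} (hσ : 0 < σ.im) (hτσ : 0 < (-τ / σ).im) (ell a ω : ℂ) :
    HolOn (kA τ σ ell a ω) (skew σ (-(a / σ).im) ((a / σ).im + (-τ / σ).im)) := by
  have hB := differentiable_modB σ
  have h1 : Differentiable ℂ fun y : ℂ => thC σ *
      exp (-(π * I * (a - y + modB (a - y) σ))) := by fun_prop
  refine (h1.differentiableOn.fun_mul ((differentiableOn_gam hτσ (im_neg_one_div_pos hσ)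
    (a / σ)).comp (f := fun y => -y / σ) (by fun_prop) fun y hy => ?_)).fun_mul
    (differentiable_facY hτσ ell (ω + a)).differentiableOn
  have hn : (-y / σ).im = -(y / σ).im := by rw [neg_div, neg_im]
  constructor <;> rw [hn] <;> linarith [hy.1, hy.2]

lemma differentiableOn_kB {τ σ : ℂ} (hσ : 0 < σ.im) (hτσ : 0 < (-τ / σ).im) (ell a ω : ℂ) :
    HolOn (kB τ σ ell a ω) (skew σ (-(a / σ).im - (-τ / σ).im) (a / σ).im) := by
  have hB := differentiable_modB σ
  have h1 : Differentiable ℂ fun y : ℂ => thC σ *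
      exp (-(π * I * (a + y + modB (a + y) σ))) := by fun_prop
  exact (h1.differentiableOn.fun_mul ((differentiableOn_gam hτσ (im_neg_one_div_pos hσ)
    (a / σ)).comp (f := fun y => y / σ) (by fun_prop) fun y hy => hy)).fun_mul
    (differentiable_facY hτσ ell (ω - a)).differentiableOn

/-! ### The product of two hypergeometric integrals -/

lemma segInt_comp_add (f : ℂ → ℂ) (z w d : ℂ) :
    segInt f (z + d) (w + d) = segInt (fun y => f (y + d)) z w := by
  rw [segInt, segInt, add_sub_add_right_eq_sub]
  congr 1
  refine intervalIntegral.integral_congr fun s _ => ?_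
  congr 1
  ring

lemma segInt_const_mul (f : ℂ → ℂ) (z w d : ℂ) :
    segInt (fun y => d * f y) z w = d * segInt f z w := by
  rw [segInt, segInt, intervalIntegral.integral_const_mul]
  ring

lemma segInt_congr {f g : ℂ → ℂ} {z w : ℂ}
    (h : ∀ s ∈ Icc (0 : ℝ) 1, f (z + s * (w - z)) = g (z + s * (w - z))) :
    segInt f z w = segInt g z w := by
  rw [segInt, segInt]
  congr 1
  refine intervalIntegral.integral_congr fun s hs => ?_
  rw [uIcc_of_le zero_le_one] at hs
  exact h s hs

lemma period_segment_mem {α β : ℝ} {σ b : ℂ} (hσ : 0 < σ.im) (hb : b ∈ strip α β) {s : ℝ}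
    (hs : s ∈ Icc (0 : ℝ) 1) : b + s * (b + σ - b) ∈ strip α (β + σ.im) := by
  have h1 : (b + s * (b + σ - b)).im = b.im + s * σ.im := by simp
  constructor <;> rw [h1] <;> nlinarith [hb.1, hb.2, hs.1, hs.2]

lemma krDouble_congr_strip (k : ℂ → ℂ) {g : ℂ → ℂ} {α β α' β' : ℝ}
    (hg : HolOn g (strip α' β')) (hg1 : ∀ z, g (z + 1) = g z) {ω σ : ℂ}
    (hσ : 0 < σ.im) (hω : th0 ω σ ≠ 0) (h1 : α' ≤ α) (h2 : β ≤ β') {b : ℂ} (hb : b ∈ strip α β) :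
    krDouble k g ω σ α' β' b = krDouble k g ω σ α β b := by
  refine segInt_congr fun s hs => ?_
  obtain ⟨h3, h4⟩ := krLev_spec hσ (hb.1.trans hb.2) (period_segment_mem hσ hb hs)
  rw [krLine_eq hg hg1 hσ hω (c := I * krLev σ α β (b + s * (b + σ - b)))
    ⟨h1.trans_lt h3.1, h3.2.trans_le h2⟩ h4]
  rfl

/-- The double integral attached to `θ(t + a, σ) θ(a - y, σ)`, over the period segment starting at
`-τ / 2`. -/
def dbl (τ σ lam ell a ω : ℂ) : ℂ :=
  krDouble (kA τ σ ell a ω) (gA τ σ lam a) ω σ (-(3 / 4 * τ.im)) (-(1 / 4 * τ.im)) (-τ / 2)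

/-- The translation by `τ` carries the second double integral into the first one. -/
lemma krDouble_kB_gB {τ σ a : ℂ} (hτ : 0 < τ.im) (hσ : 0 < σ.im) (lam ell ω : ℂ)
    (h1 : |a.im| < 1 / 4 * τ.im) (hω : th0 ω σ ≠ 0) :
    krDouble (kB τ σ ell a ω) (gB τ σ lam a) ω σ (1 / 4 * τ.im) (3 / 4 * τ.im) (τ / 2) =
      -ex (ell - ω * τ / σ - lam) * dbl τ σ lam ell a ω := by
  obtain ⟨h1, h2⟩ := abs_lt.1 h1
  have key : ∀ y ∈ strip (-(3 / 4 * τ.im)) (-(1 / 4 * τ.im) + σ.im),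
      krLine (gB τ σ lam a) ω σ (1 / 4 * τ.im) (3 / 4 * τ.im) (y + τ) =
        ex (-lam) * krLine (gA τ σ lam a) ω σ (-(3 / 4 * τ.im)) (-(1 / 4 * τ.im)) y := by
    intro y hy
    obtain ⟨h3, h4⟩ := krLev_spec hσ (by linarith) hy
    rw [krLine_eq ((differentiableOn_gB hτ hσ lam a).mono fun t ht => ⟨by linarith [ht.1],
      by linarith [ht.2]⟩) (gB_add_one τ σ lam a) hσ hω
      (c := I * krLev σ (-(3 / 4 * τ.im)) (-(1 / 4 * τ.im)) y + τ)
      (by constructor <;> simp only [add_im] <;> linarith [h3.1, h3.2])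
      (by constructor <;> simp only [add_im] <;> linarith [h4.1, h4.2]), krLine, krInt, krInt,
      lineInt, lineInt, ← intervalIntegral.integral_const_mul]
    refine intervalIntegral.integral_congr fun x _ => ?_
    rw [show ∀ c : ℂ, c + τ + x = c + x + τ from fun c => by ring, gB_add_tau,
      add_sub_add_right_eq_sub]
    ring
  have hb : -τ / 2 ∈ strip (-(3 / 4 * τ.im)) (-(1 / 4 * τ.im)) := by
    have : (-τ / 2).im = -τ.im / 2 := by simp
    constructor <;> rw [this] <;> linarith
  rw [krDouble, dbl, krDouble, ← segInt_const_mul, show τ / 2 + σ = -τ / 2 + σ + τ by ring,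
    show τ / 2 = -τ / 2 + τ by ring, segInt_comp_add]
  refine segInt_congr fun s hs => ?_
  rw [key _ (period_segment_mem hσ hb hs), kB_add_tau τ ell a hσ,
    show ell - ω * τ / σ - lam = ell - ω * τ / σ + -lam by ring, ex_add]
  ring

section Nice

variable {τ σ a : ℂ} (hτ : 0 < τ.im) (hσ : 0 < σ.im) (hτσ : 0 < (-τ / σ).im)

include hτ hσ in
lemma krLine_gA_gB (lam : ℂ) {ν y : ℂ} (ha : 0 < a.im) (h1 : th0 (ν - a) σ ≠ 0)
    (h2 : th0 (ν + a) σ ≠ 0) (hy : y ∈ strip (-a.im) (a.im + σ.im)) :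
    theta (a - y) σ * krLine (gA τ σ lam a) (ν - a) σ (-a.im) a.im y +
      theta (a + y) σ * krLine (gB τ σ lam a) (ν + a) σ (-a.im) a.im y =
      theta (ν - y) σ * Q ν σ (a / 2) * regInt τ σ a (thF lam ν τ σ) := by
  obtain ⟨h3, h4⟩ := krLev_spec hσ (by linarith) hy
  set c : ℂ := I * krLev σ (-a.im) a.im y with hc
  have hgA := (differentiableOn_gA hτ hσ lam a).mono (s := strip (-a.im) a.im)
    fun t ht => ⟨by linarith [ht.1], ht.2⟩
  have hgB := (differentiableOn_gB hτ hσ lam a).mono (s := strip (-a.im) a.im)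
    fun t ht => ⟨ht.1, by linarith [ht.2]⟩
  have hI : ∀ {g : ℂ → ℂ} {ω : ℂ}, HolOn g (strip (-a.im) a.im) → th0 ω σ ≠ 0 →
      IntervalIntegrable (fun x : ℝ => g (c + x) * kr ω (c + x - y) σ) MeasureTheory.volume 0 1 := by
    intro g ω hg hω
    have hd := differentiableOn_mul_kr hg hσ hω y (le_max_left (-a.im) (y.im - σ.im))
      (min_le_left a.im y.im) (le_max_right _ _) (min_le_right _ _)
    have hcl : c ∈ strip (max (-a.im) (y.im - σ.im)) (min a.im y.im) :=
      ⟨max_lt h3.1 h4.1, lt_min h3.2 h4.2⟩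
    refine ContinuousOn.intervalIntegrable ?_
    exact hd.continuousOn.comp (f := fun x : ℝ => c + (x : ℂ)) (by fun_prop)
      fun x _ => strip_add_real hcl x
  have hF := perEntire_thF lam ν hτ hσ
  have hreg : regInt τ σ a (thF lam ν τ σ) = lineInt (fun t => kerK τ σ a t * thF lam ν τ σ t) c := by
    rw [regInt_of_pos hτ hσ ha hF]
    refine lineInt_congr_base (α := -a.im) (β := a.im) ((differentiableOn_kerK hτ hσ).fun_mul
      hF.1.differentiableOn) (fun t _ => ?_) ⟨by simpa using ha, by simpa using ha⟩ h3
    have := kerK_add_int τ σ a t 1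
    rw [Int.cast_one] at this
    rw [this, hF.2]
  rw [hreg, krLine, krLine, ← hc, krInt, krInt, lineInt, lineInt, lineInt,
    ← intervalIntegral.integral_const_mul, ← intervalIntegral.integral_const_mul,
    ← intervalIntegral.integral_const_mul, ← intervalIntegral.integral_add
      ((hI hgA h1).const_mul _) ((hI hgB h2).const_mul _)]
  refine intervalIntegral.integral_congr fun x _ => ?_
  have him : (c + x).im = c.im := by simp
  have h5 := theta_mul_Q ν (c + x) y a hσ (fun h => h1 ((theta_eq_zero_iff _ hσ).1 h))
    (fun h => h2 ((theta_eq_zero_iff _ hσ).1 h)) (theta_sub_ne_zero hσ (by rw [him]; exact h4.1)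
      (by rw [him]; exact h4.2))
  rw [gA_eq lam hτ hσ (by rw [add_im, him]; linarith [h3.1]),
    gB_eq lam hτ hσ (by rw [sub_im, him]; linarith [h3.2]), thF]
  linear_combination (-(kerK τ σ a (c + x) * theta (lam + (c + x)) τ)) * h5

include hσ in
lemma lineInt_kerK_mul_facY {ell ν : ℂ} (hτσ : 0 < (-τ / σ).im) (ha2 : 0 < (a / σ).im) :
    lineInt (fun s => kerK (-1 / σ) (-τ / σ) (a / σ) s * theta (ν - s * σ) σ *
        facY τ σ ell ν (s * σ)) 0 =
      -(exp (-(π * I * ν ^ 2 / σ)) / (-I * (-I * σ) ^ (1 / 2 : ℂ))) *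
        regInt (-1 / σ) (-τ / σ) (a / σ) (thF (-ν / σ) ell (-1 / σ) (-τ / σ)) := by
  have hσ0 : σ ≠ 0 := by rintro rfl; simp at hσ
  have hs : -I * (-I * σ) ^ (1 / 2 : ℂ) ≠ 0 := by simp [hσ0]
  rw [regInt_of_pos (im_neg_one_div_pos hσ) hτσ ha2 (perEntire_thF _ _ (im_neg_one_div_pos hσ) hτσ),
    lineInt, lineInt, ← intervalIntegral.integral_const_mul]
  refine intervalIntegral.integral_congr fun x _ => ?_
  simp only [zero_add]
  have h1 := theta_modular (ν - x * σ) hσ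
  rw [show (ν - x * σ) / σ = -(-ν / σ + x) by field_simp; ring, theta_neg] at h1
  rw [thF, facY, mul_div_assoc, div_self hσ0, mul_one]
  have h2 : exp (π * I * (ν - x * σ) ^ 2 / σ) * exp (-(π * I * ν ^ 2 / σ)) =
      expπ (((x * σ) ^ 2 - 2 * ν * (x * σ)) / σ) := by
    rw [← exp_add]; congr 1; ring
  rw [← h2, ← mul_right_inj' hs]
  have h3 : -I * (-I * σ) ^ (1 / 2 : ℂ) * (-(exp (-(π * I * ν ^ 2 / σ)) /
      (-I * (-I * σ) ^ (1 / 2 : ℂ)))) = -exp (-(π * I * ν ^ 2 / σ)) := by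
    field_simp
  rw [← mul_assoc, ← mul_assoc, ← mul_assoc (-I * (-I * σ) ^ (1 / 2 : ℂ)) (-_ ), h3]
  linear_combination (-(kerK (-1 / σ) (-τ / σ) (a / σ) x * theta (ell + x) (-τ / σ) *
    exp (-(π * I * ν ^ 2 / σ)))) * h1

include hτ hσ hτσ in
/-- The Weierstrass identity under the double integral; the variables then separate. -/
lemma krDouble_add_krDouble (lam ell : ℂ) {ν : ℂ} (ha : 0 < a.im) (ha2 : 0 < (a / σ).im)
    (h1 : th0 (ν - a) σ ≠ 0) (h2 : th0 (ν + a) σ ≠ 0) :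
    krDouble (kA τ σ ell a (ν - a)) (gA τ σ lam a) (ν - a) σ (-a.im) a.im 0 +
      krDouble (kB τ σ ell a (ν + a)) (gB τ σ lam a) (ν + a) σ (-a.im) a.im 0 =
      σ * Q ν σ (a / 2) * regInt τ σ a (thF lam ν τ σ) *
        lineInt (fun s => kerK (-1 / σ) (-τ / σ) (a / σ) s * theta (ν - s * σ) σ *
          facY τ σ ell ν (s * σ)) 0 := by
  have hσ0 : σ ≠ 0 := by rintro rfl; simp at hσ
  have hσ2 := im_neg_one_div_pos hσ
  have hgA := (differentiableOn_gA hτ hσ lam a).mono (s := strip (-a.im) a.im)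
    fun t ht => ⟨by linarith [ht.1], ht.2⟩
  have hgB := (differentiableOn_gB hτ hσ lam a).mono (s := strip (-a.im) a.im)
    fun t ht => ⟨ht.1, by linarith [ht.2]⟩
  have h0 : (0 : ℂ) ∈ strip (-a.im) a.im := ⟨by simpa using ha, by simpa using ha⟩
  have hmem : ∀ s ∈ Icc (0 : ℝ) 1, (s : ℂ) * σ ∈ strip (-a.im) (a.im + σ.im) := fun s hs => by
    simpa using period_segment_mem hσ h0 hs
  have him : ∀ s : ℝ, (s * σ / σ : ℂ).im = 0 := fun s => by rw [mul_div_assoc, div_self hσ0]; simp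
  have hI : ∀ {k g : ℂ → ℂ} {ω : ℂ}, ContinuousOn k (skew σ (-(a / σ).im) (a / σ).im) →
      HolOn g (strip (-a.im) a.im) → (∀ z, g (z + 1) = g z) → th0 ω σ ≠ 0 →
      IntervalIntegrable (fun s : ℝ => k (s * σ) * krLine g ω σ (-a.im) a.im (s * σ))
        MeasureTheory.volume 0 1 := by
    intro k g ω hk hg hg1 hω
    refine ContinuousOn.intervalIntegrable (ContinuousOn.mul (hk.comp (by fun_prop) fun s hs => ?_)
      ((differentiableOn_krLine (by linarith) hg hg1 hσ hω).continuousOn.comp (by fun_prop)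
        fun s hs => ?_))
    · refine ⟨?_, ?_⟩ <;> rw [him] <;> linarith
    · rw [uIcc_of_le zero_le_one] at hs
      exact hmem s hs
  have hkA := (differentiableOn_kA hσ hτσ ell a (ν - a)).continuousOn.mono
    (t := skew σ (-(a / σ).im) (a / σ).im) fun y hy => ⟨hy.1, by linarith [hy.2]⟩
  have hkB := (differentiableOn_kB hσ hτσ ell a (ν + a)).continuousOn.mono
    (t := skew σ (-(a / σ).im) (a / σ).im) fun y hy => ⟨by linarith [hy.1], hy.2⟩
  simp only [krDouble, segInt, lineInt, zero_add, sub_zero]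
  rw [← mul_add, ← intervalIntegral.integral_add (hI hkA hgA (gA_add_one τ σ lam a) h1)
    (hI hkB hgB (gB_add_one τ σ lam a) h2), mul_assoc σ, mul_assoc σ,
    ← intervalIntegral.integral_const_mul (Q ν σ (a / 2) * regInt τ σ a (thF lam ν τ σ))]
  congr 1
  refine intervalIntegral.integral_congr fun s hs => ?_
  rw [uIcc_of_le zero_le_one] at hs
  have h3 := krLine_gA_gB hτ hσ lam ha h1 h2 (hmem s hs)
  rw [kA_eq ell hσ hτσ _ (by rw [sub_im, him]; linarith),
    kB_eq ell hσ hτσ _ (by rw [add_im, him]; linarith), sub_add_cancel, add_sub_cancel_right,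
    show (s : ℂ) * σ / σ = s by field_simp]
  linear_combination (kerK (-1 / σ) (-τ / σ) (a / σ) s * facY τ σ ell ν (s * σ)) * h3

include hτ hσ hτσ in
/-- The product of two hypergeometric integrals, for `a` in the common part of three half planes. -/
lemma regInt_mul_regInt_of_pos (lam ell : ℂ) {ν : ℂ} (ha : 0 < a.im) (ha2 : 0 < (a / σ).im)
    (ha' : a.im < 1 / 4 * τ.im)
    (h1 : th0 (ν - a) σ ≠ 0) (h2 : th0 (ν + a) σ ≠ 0) :
    σ * Q ν σ (a / 2) * regInt τ σ a (thF lam ν τ σ) *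
        (-(exp (-(π * I * ν ^ 2 / σ)) / (-I * (-I * σ) ^ (1 / 2 : ℂ))) *
        regInt (-1 / σ) (-τ / σ) (a / σ) (thF (-ν / σ) ell (-1 / σ) (-τ / σ))) =
      dbl τ σ lam ell a (ν - a) - ex (ell - (ν + a) * τ / σ - lam) * dbl τ σ lam ell a (ν + a) -
        2 * π * I * (segInt (fun y => kA τ σ ell a (ν - a) y * gA τ σ lam a y) (-τ / 2) 0 +
          segInt (fun y => kB τ σ ell a (ν + a) y * gB τ σ lam a y) (τ / 2) 0) := by
  have hσ0 : σ ≠ 0 := by rintro rfl; simp at hσ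
  have him : (-τ / 2).im = -τ.im / 2 := by simp
  have him' : (τ / 2).im = τ.im / 2 := by simp
  have him2 : (-τ / 2 / σ).im = (-τ / σ).im / 2 := by
    rw [show -τ / 2 / σ = -τ / σ / 2 by ring]; simp
  have him2' : (τ / 2 / σ).im = -(-τ / σ).im / 2 := by
    rw [show τ / 2 / σ = -(-τ / σ / 2) by ring]; simp; ring
  have e0 : (0 : ℂ) ∈ strip (-a.im) a.im := ⟨by simpa using ha, by simpa using ha⟩
  have eA : -τ / 2 ∈ strip (-(3 / 4 * τ.im)) (-(1 / 4 * τ.im)) := by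
    constructor <;> rw [him] <;> linarith
  have eB : τ / 2 ∈ strip (1 / 4 * τ.im) (3 / 4 * τ.im) := by constructor <;> rw [him'] <;> linarith
  have hA := krDouble_sub (isOpen_skew σ _ _) (convex_skew σ _ _) (fun y hy => skew_add hσ hy)
    (differentiableOn_kA hσ hτσ ell a (ν - a)) (fun y _ => kA_add_sigma τ ell a hσ _ y)
    (differentiableOn_gA hτ hσ lam a) (gA_add_one τ σ lam a) hσ h1 (b := 0) (b' := -τ / 2)
    ⟨⟨by simp; linarith, by simp; linarith⟩, by simp; linarith, by simp; linarith⟩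
    ⟨⟨by rw [him2]; linarith, by rw [him2]; linarith⟩, by rw [him]; linarith, by rw [him]; linarith⟩
  have hB := krDouble_sub (isOpen_skew σ _ _) (convex_skew σ _ _) (fun y hy => skew_add hσ hy)
    (differentiableOn_kB hσ hτσ ell a (ν + a)) (fun y _ => kB_add_sigma τ ell a hσ _ y)
    (differentiableOn_gB hτ hσ lam a) (gB_add_one τ σ lam a) hσ h2 (b := 0) (b' := τ / 2)
    ⟨⟨by simp; linarith, by simp; linarith⟩, by simp; linarith, by simp; linarith⟩
    ⟨⟨by rw [him2']; linarith, by rw [him2']; linarith⟩, by rw [him']; linarith,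
      by rw [him']; linarith⟩
  rw [krDouble_congr_strip _ (differentiableOn_gA hτ hσ lam a) (gA_add_one τ σ lam a) hσ h1
      (by linarith) le_rfl e0,
    krDouble_congr_strip _ (differentiableOn_gA hτ hσ lam a) (gA_add_one τ σ lam a) hσ h1
      (by linarith) (by linarith) eA] at hA
  rw [krDouble_congr_strip _ (differentiableOn_gB hτ hσ lam a) (gB_add_one τ σ lam a) hσ h2
      le_rfl (by linarith) e0,
    krDouble_congr_strip _ (differentiableOn_gB hτ hσ lam a) (gB_add_one τ σ lam a) hσ h2
      (by linarith) (by linarith) eB,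
    krDouble_kB_gB hτ hσ lam ell _ (by rw [abs_lt]; constructor <;> linarith) h2] at hB
  have hsum := krDouble_add_krDouble hτ hσ hτσ lam ell ha ha2 h1 h2
  rw [lineInt_kerK_mul_facY hσ hτσ ha2] at hsum
  rw [← hsum, dbl]
  linear_combination hA + hB

end Nice

/-! ### The single integral and its path -/

section Modular

variable {τ σ : ℂ} (hτ : 0 < τ.im) (hσ : 0 < σ.im) (hστ : 0 < (σ / τ).im)

include hτ hσ hστ in
/-- The variant of the modular identity `modN_eq` in which a row of factors is moved from one side
to the other by the modular transformation of `θ₀`. -/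
lemma modular_reflect (z : ℂ) :
    P (τ + σ - z) τ σ * P (-1 / σ - z / σ) (-1 / σ) (-τ / σ) * P (z / τ) (-1 / τ) (σ / τ) =
      expπ (modB z σ + modC z τ σ) * (P (-1 / τ + σ / τ - z / τ) (-1 / τ) (σ / τ) * P z τ σ *
          P (-τ / σ + z / σ) (-1 / σ) (-τ / σ)) := by
  have hτσ := im_neg_div_pos hστ
  have hτ3 := im_neg_one_div_pos hτ
  have hσ2 := im_neg_one_div_pos hσ
  have hP : ∀ {u v : ℂ} {z : ℂ → ℂ}, 0 < u.im → 0 < v.im → Differentiable ℂ z →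
      Differentiable ℂ fun t => P (z t) u v := fun hu hv hz => (differentiable_P hu hv).comp hz
  have hB := differentiable_modB σ
  have hC : Differentiable ℂ fun z => modC z τ σ := by unfold modC; fun_prop
  have hg : Differentiable ℂ fun z => P (τ + σ - z) τ σ * P (-1 / σ - z / σ) (-1 / σ) (-τ / σ) *
      P (z / τ) (-1 / τ) (σ / τ) - expπ (modB z σ + modC z τ σ) *
        (P (-1 / τ + σ / τ - z / τ) (-1 / τ) (σ / τ) * P z τ σ *
          P (-τ / σ + z / σ) (-1 / σ) (-τ / σ)) := by
    refine Differentiable.sub (((hP hτ hσ (by fun_prop)).fun_mul (hP hσ2 hτσ (by fun_prop))).fun_mul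
      (hP hτ3 hστ (by fun_prop))) (Differentiable.fun_mul (by fun_prop)
      (((hP hτ3 hστ (by fun_prop)).fun_mul (hP hτ hσ (by fun_prop))).fun_mul
      (hP hσ2 hτσ (by fun_prop))))
  refine sub_eq_zero.1 (eq_zero_of_mul_eq_zero_entire (differentiable_th0 hσ) hg
    (th0_half_ne_zero hσ) (fun z => ?_) z)
  have h1 := modN_eq hτ hσ hστ z
  have h2 := th0_modular z hσ
  rw [modN, modD, P_succ (σ - z) hτ hσ, P_swap (z / σ), P_succ (z / σ) hτσ hσ2,
    P_swap _ (-τ / σ)] at h1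
  rw [th0, th0] at h2
  rw [th0, P_succ z hτ hσ, P_swap (-1 / σ - z / σ), P_succ (-1 / σ - z / σ) hτσ hσ2,
    P_swap _ (-τ / σ), show -1 / σ - z / σ + -τ / σ = (-1 - τ - z) / σ by ring,
    show -1 / τ + σ / τ - z / τ = (σ - 1 - z) / τ by ring,
    show -τ / σ + z / σ = z / σ + -τ / σ by ring, show τ + σ - z = σ - z + τ by ring, mul_add,
    exp_add]
  linear_combination (P1 z σ * P1 (-1 / σ - z / σ) (-1 / σ)) * h1 +
    exp (π * I * modC z τ σ) * P (z + τ) τ σ * P1 z σ *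
      P (z / σ + -τ / σ) (-1 / σ) (-τ / σ) * P ((σ - 1 - z) / τ) (-1 / τ) (σ / τ) * h2

include hτ hσ hστ in
lemma gam_mul_gam {a y : ℂ} (h1 : 0 < (a + y).im + τ.im) (h2 : 0 < (a - y).im)
    (h3 : 0 < ((a + y) / σ).im) (h4 : 0 < ((a - y) / σ).im + (-τ / σ).im)
    (h5 : 0 < ((a + y) / τ).im) (h6 : 0 < ((a - y) / τ).im) :
    gam τ σ a y * gam (-τ / σ) (-1 / σ) (a / σ) (-y / σ) =
      expπ (modB (a - y) σ + modC (a - y) τ σ + modC (a + y) τ σ) *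
        kerK (-1 / τ) (σ / τ) (a / τ) (y / τ) := by
  have hτσ := im_neg_div_pos hστ
  have hτ3 := im_neg_one_div_pos hτ
  have hσ2 := im_neg_one_div_pos hσ
  have e1 := modN_eq hτ hσ hστ (a + y)
  have e2 := modular_reflect hτ hσ hστ (a - y)
  rw [modN, modD] at e1
  have n1 : P (a + y + τ) τ σ ≠ 0 := P_ne_zero_of_pos hτ hσ (by simpa using h1)
  have n2 : P (a - y) τ σ ≠ 0 := P_ne_zero_of_pos hτ hσ h2
  have n3 : P ((a + y) / σ) (-1 / σ) (-τ / σ) ≠ 0 := P_ne_zero_of_pos hσ2 hτσ h3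
  have n4 : P (-τ / σ + (a - y) / σ) (-1 / σ) (-τ / σ) ≠ 0 :=
    P_ne_zero_of_pos hσ2 hτσ (by rw [add_im]; linarith)
  have n5 : P ((a + y) / τ) (-1 / τ) (σ / τ) ≠ 0 := P_ne_zero_of_pos hτ3 hστ h5
  have n6 : P ((a - y) / τ) (-1 / τ) (σ / τ) ≠ 0 := P_ne_zero_of_pos hτ3 hστ h6
  rw [gam, gam, kerK, kerNum, P_swap _ (-τ / σ), P_swap _ (-τ / σ), P_swap _ (-τ / σ),
    P_swap _ (-τ / σ), show a + τ + y = a + y + τ by ring, show σ - a - y = σ - (a + y) by ring,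
    show τ + σ - a + y = τ + σ - (a - y) by ring,
    show -1 / σ - a / σ - -y / σ = -1 / σ - (a - y) / σ by ring,
    show -τ / σ + -1 / σ - a / σ + -y / σ = (-1 - τ - (a + y)) / σ by ring,
    show a / σ + -τ / σ + -y / σ = -τ / σ + (a - y) / σ by ring,
    show a / σ - -y / σ = (a + y) / σ by ring,
    show -1 / τ + σ / τ - a / τ - y / τ = (σ - 1 - (a + y)) / τ by ring,
    show -1 / τ + σ / τ - a / τ + y / τ = -1 / τ + σ / τ - (a - y) / τ by ring,
    show a / τ + y / τ = (a + y) / τ by ring, show a / τ - y / τ = (a - y) / τ by ring,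
    mul_add _ (modB (a - y) σ + modC (a - y) τ σ), exp_add]
  rw [div_mul_div_comm, mul_div_assoc', div_eq_div_iff (by simp [n1, n2, n3, n4])
    (by simp [n5, n6])]
  linear_combination (P (τ + σ - (a - y)) τ σ * P (-1 / σ - (a - y) / σ) (-1 / σ) (-τ / σ) *
    P ((a - y) / τ) (-1 / τ) (σ / τ)) * e1 + (exp (π * I * modC (a + y) τ σ) *
    (P (a + y + τ) τ σ * P ((a + y) / σ) (-1 / σ) (-τ / σ) *
    P ((σ - 1 - (a + y)) / τ) (-1 / τ) (σ / τ))) * e2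

end Modular

/-- The integrand of the single integral, in the variable `T = y / τ`. -/
def openF (τ σ lam ell a ν T : ℂ) : ℂ := thC σ ^ 2 * exp (-(2 * π * I * a)) *
    expπ (modC (a + τ * T) τ σ + modC (a - τ * T) τ σ) *
    theta (lam + τ * T) τ * facY τ σ ell ν (τ * T)

/-- The integral over the broken line from `-1/2` to `1/2` with vertices `-p` and `p`. -/
def polyInt (f : ℂ → ℂ) (p : ℂ) : ℂ := segInt f (-1 / 2) (-p) + segInt f (-p) p + segInt f p (1 / 2)

lemma polyInt_eq_segInt {f : ℂ → ℂ} {h : ℝ} (hf : HolOn f (strip (-h) h)) {p : ℂ}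
    (hp : |p.im| < h) : polyInt f p = segInt f (-1 / 2) 0 + segInt f 0 (1 / 2) := by
  obtain ⟨h1, h2⟩ := abs_lt.1 hp
  have hU := isOpen_strip (-h) h
  have hc := convex_strip (-h) h
  have m1 : (-1 / 2 : ℂ) ∈ strip (-h) h := by constructor <;> simp <;> linarith
  have m2 : (1 / 2 : ℂ) ∈ strip (-h) h := by constructor <;> simp <;> linarith
  have m3 : (0 : ℂ) ∈ strip (-h) h := by constructor <;> simp <;> linarith
  have m4 : p ∈ strip (-h) h := ⟨h1, h2⟩
  have m5 : -p ∈ strip (-h) h := by constructor <;> simp <;> linarith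
  rw [polyInt, segInt_add_segInt hU hc hf m1 m5 m4, segInt_add_segInt hU hc hf m1 m4 m2,
    segInt_add_segInt hU hc hf m1 m3 m2]

lemma segInt_comp_mul (f : ℂ → ℂ) (z w d : ℂ) :
    segInt f (d * z) (d * w) = d * segInt (fun y => f (d * y)) z w := by
  rw [segInt, segInt, ← mul_assoc, ← mul_sub]
  congr 1
  refine intervalIntegral.integral_congr fun s _ => ?_
  congr 1
  ring

lemma segInt_symm (f : ℂ → ℂ) (z w : ℂ) : segInt f w z = -segInt f z w := by
  have h := intervalIntegral.integral_comp_sub_left (fun s : ℝ => f (z + s * (w - z))) 1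
    (a := 0) (b := 1)
  rw [sub_self, sub_zero] at h
  rw [segInt, segInt, ← h, ← neg_mul, neg_sub]
  congr 1
  refine intervalIntegral.integral_congr fun s _ => ?_
  congr 1
  push_cast
  ring

lemma differentiable_openF {τ σ : ℂ} (hτ : 0 < τ.im) (hτσ : 0 < (-τ / σ).im) (lam ell a ν : ℂ) :
    Differentiable ℂ (openF τ σ lam ell a ν) := by
  have hC : Differentiable ℂ fun z => modC z τ σ := by unfold modC; fun_prop
  have h1 : Differentiable ℂ fun T : ℂ => theta (lam + τ * T) τ :=
    (differentiable_theta hτ).comp (f := fun T => lam + τ * T) (by fun_prop)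
  have h2 : Differentiable ℂ fun T : ℂ => facY τ σ ell ν (τ * T) :=
    (differentiable_facY hτσ ell ν).comp (f := fun T => τ * T) (by fun_prop)
  unfold openF
  fun_prop

section Nice

variable {τ σ a : ℂ} (hτ : 0 < τ.im) (hσ : 0 < σ.im) (hστ : 0 < (σ / τ).im)

include hτ hσ hστ in
/-- The two single integrals combine, by the modular identity, into one integral with the kernel
of the third pair of periods. -/
lemma segInt_add_segInt_eq_polyInt (lam ell ν : ℂ) (ha : 0 < a.im) (ha2 : 0 < (a / σ).im)
    (ha3 : 0 < (a / τ).im) {p : ℂ} (hp : |p.im| < (a / τ).im) :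
    segInt (fun y => kA τ σ ell a (ν - a) y * gA τ σ lam a y) (-τ / 2) 0 +
        segInt (fun y => kB τ σ ell a (ν + a) y * gB τ σ lam a y) (τ / 2) 0 =
      τ * polyInt (fun T => kerK (-1 / τ) (σ / τ) (a / τ) T * openF τ σ lam ell a ν T) p := by
  have hτ0 : τ ≠ 0 := by rintro rfl; simp at hτ
  have hτσ := im_neg_div_pos hστ
  have hdiff : HolOn (fun T => kerK (-1 / τ) (σ / τ) (a / τ) T *
      openF τ σ lam ell a ν T) (strip (-(a / τ).im) (a / τ).im) :=
    (differentiableOn_kerK (im_neg_one_div_pos hτ) hστ).fun_mul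
      (differentiable_openF hτ hτσ lam ell a ν).differentiableOn
  have him : ∀ r : ℝ, (τ * r / σ).im = -(r * (-τ / σ).im) := fun r => by
    rw [show τ * r / σ = -((r : ℂ) * (-τ / σ)) by ring, neg_im, im_ofReal_mul]
  have him' : ∀ r : ℝ, (τ * r).im = r * τ.im := fun r => by rw [mul_comm, im_ofReal_mul]
  have him'' : ∀ r : ℝ, (τ * r / τ).im = 0 := fun r => by
    rw [mul_div_assoc, mul_div_cancel₀ _ hτ0]; simp
  have eA : ∀ r ∈ Icc (-(1 / 2) : ℝ) 0, kA τ σ ell a (ν - a) (τ * r) * gA τ σ lam a (τ * r) =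
      kerK (-1 / τ) (σ / τ) (a / τ) r * openF τ σ lam ell a ν r := by
    intro r hr
    have h := gam_mul_gam hτ hσ hστ (a := a) (y := τ * r)
      (by rw [add_im, him']; nlinarith [hr.1]) (by rw [sub_im, him']; nlinarith [hr.2])
      (by rw [add_div, add_im, him]; nlinarith [hr.2])
      (by rw [sub_div, sub_im, him]; nlinarith [hr.1])
      (by rw [add_div, add_im, him'']; linarith) (by rw [sub_div, sub_im, him'']; linarith)
    rw [show τ * (r : ℂ) / τ = r by field_simp, add_assoc, mul_add, exp_add] at h
    rw [kA, gA, openF, sub_add_cancel, mul_add _ (a - τ * r), neg_add, exp_add,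
      exp_neg (π * I * modB (a - τ * r) σ)]
    have hx : exp (-(π * I * (a - τ * r))) * exp (-(π * I * (a + τ * r))) =
        exp (-(2 * π * I * a)) := by
      rw [← exp_add]; ring_nf
    rw [← hx, add_comm (modC (a + τ * r) τ σ)]
    have hE := exp_ne_zero (π * I * modB (a - τ * r) σ)
    have h' : (exp (π * I * modB (a - τ * r) σ))⁻¹ *
        (gam τ σ a (τ * r) * gam (-τ / σ) (-1 / σ) (a / σ) (-(τ * r) / σ)) =
        expπ (modC (a - τ * r) τ σ + modC (a + τ * r) τ σ) * kerK (-1 / τ) (σ / τ) (a / τ) r := by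
      rw [h, ← mul_assoc, ← mul_assoc, inv_mul_cancel₀ hE, one_mul]
    linear_combination (thC σ ^ 2 * exp (-(π * I * (a - τ * r))) *
      exp (-(π * I * (a + τ * r))) * theta (lam + τ * r) τ * facY τ σ ell ν (τ * r)) * h'
  have eB : ∀ r ∈ Icc (0 : ℝ) (1 / 2), kB τ σ ell a (ν + a) (τ * r) * gB τ σ lam a (τ * r) =
      -(kerK (-1 / τ) (σ / τ) (a / τ) r * openF τ σ lam ell a ν r) := by
    intro r hr
    have h := gam_mul_gam hτ hσ hστ (a := a) (y := -(τ * r))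
      (by rw [← sub_eq_add_neg, sub_im, him']; nlinarith [hr.2])
      (by rw [sub_neg_eq_add, add_im, him']; nlinarith [hr.1])
      (by rw [← sub_eq_add_neg, sub_div, sub_im, him]; nlinarith [hr.1])
      (by rw [sub_neg_eq_add, add_div, add_im, him]; nlinarith [hr.2])
      (by rw [← sub_eq_add_neg, sub_div, sub_im, him'']; linarith)
      (by rw [sub_neg_eq_add, add_div, add_im, him'']; linarith)
    rw [show -(τ * (r : ℂ)) / τ = -r by field_simp, kerK_neg, sub_neg_eq_add, ← sub_eq_add_neg,
      neg_neg, add_assoc, mul_add, exp_add] at h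
    rw [kB, gB, openF, add_sub_cancel_right, mul_add _ (a + τ * r), neg_add, exp_add,
      exp_neg (π * I * modB (a + τ * r) σ)]
    have hx : exp (-(π * I * (a - τ * r))) * exp (-(π * I * (a + τ * r))) =
        exp (-(2 * π * I * a)) := by
      rw [← exp_add]; ring_nf
    rw [← hx]
    have hE := exp_ne_zero (π * I * modB (a + τ * r) σ)
    have h' : (exp (π * I * modB (a + τ * r) σ))⁻¹ *
        (gam τ σ a (-(τ * r)) * gam (-τ / σ) (-1 / σ) (a / σ) (τ * r / σ)) =
        expπ (modC (a + τ * r) τ σ + modC (a - τ * r) τ σ) * kerK (-1 / τ) (σ / τ) (a / τ) r := by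
      rw [h, ← mul_assoc, ← mul_assoc, inv_mul_cancel₀ hE, one_mul]
    linear_combination (-(thC σ ^ 2 * exp (-(π * I * (a - τ * r))) *
      exp (-(π * I * (a + τ * r))) * theta (lam + τ * r) τ * facY τ σ ell ν (τ * r))) * h'
  rw [polyInt_eq_segInt hdiff hp, segInt_symm _ 0 (τ / 2),
    show -τ / 2 = τ * (-1 / 2) by ring, show τ / 2 = τ * (1 / 2) by ring]
  nth_rw 1 [← mul_zero τ]
  nth_rw 2 [← mul_zero τ]
  rw [segInt_comp_mul, segInt_comp_mul, mul_add, ← mul_neg]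
  congr 2
  · refine segInt_congr fun s hs => ?_
    have h := eA (-(1 / 2) + s * (1 / 2)) ⟨by linarith [hs.1], by linarith [hs.2]⟩
    push_cast at h
    rw [show (-1 / 2 : ℂ) + s * (0 - -1 / 2) = -(1 / 2) + s * (1 / 2) by ring]
    exact h
  · rw [neg_eq_iff_eq_neg, ← neg_one_mul, ← segInt_const_mul]
    refine segInt_congr fun s hs => ?_
    have h := eB (s * (1 / 2)) ⟨by linarith [hs.1], by linarith [hs.2]⟩
    push_cast at h
    rw [show (0 : ℂ) + s * (1 / 2 - 0) = s * (1 / 2) by ring, neg_one_mul]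
    exact h

end Nice

/-! ### Continuation of the product formula -/

/-- An open half plane. -/
def half (α β γ : ℝ) : Set ℂ := {z | 0 < α * z.re + β * z.im + γ}

lemma isOpen_half (α β γ : ℝ) : IsOpen (half α β γ) := isOpen_lt continuous_const (by fun_prop)

lemma convex_half (α β γ : ℝ) : Convex ℝ (half α β γ) := by
  have h : IsLinearMap ℝ fun z : ℂ => α * z.re + β * z.im :=
    ⟨fun x y => by simp only [add_re, add_im]; ring, fun c x => by simp; ring⟩
  have := convex_halfSpace_gt h (-γ)
  have e : half α β γ = {z : ℂ | -γ < α * z.re + β * z.im} := by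
    ext z
    simp only [half, mem_ofPred_eq]
    constructor <;> intro h <;> linarith
  rwa [e]

/-- A convex region lying above the broken line with vertices `-1/2, -p, p, 1/2`, where
`p = s + 2 c s i`. -/
def reg3 (c s : ℝ) : Set ℂ := half 1 0 (1 / 2) ∩ (half (-1) 0 (1 / 2) ∩ (half (-(2 * c)) 1 0 ∩
    (half 0 1 (2 * c * s) ∩ half (4 * c * s) (1 - 2 * s) (2 * c * s))))

lemma isOpen_reg3 (c s : ℝ) : IsOpen (reg3 c s) :=
  IsOpen.inter (isOpen_half _ _ _) (IsOpen.inter (isOpen_half _ _ _) (IsOpen.inter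
    (isOpen_half _ _ _) (IsOpen.inter (isOpen_half _ _ _) (isOpen_half _ _ _))))

lemma convex_reg3 (c s : ℝ) : Convex ℝ (reg3 c s) :=
  Convex.inter (convex_half _ _ _) (Convex.inter (convex_half _ _ _) (Convex.inter
    (convex_half _ _ _) (Convex.inter (convex_half _ _ _) (convex_half _ _ _))))

lemma mem_reg3 {c s : ℝ} {z : ℂ} : z ∈ reg3 c s ↔ -(1 / 2) < z.re ∧ z.re < 1 / 2 ∧
    2 * c * z.re < z.im ∧ -(2 * c * s) < z.im ∧
      0 < 4 * c * s * z.re + (1 - 2 * s) * z.im + 2 * c * s := by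
  simp only [reg3, half, mem_inter_iff, mem_ofPred_eq]
  constructor
  · rintro ⟨h1, h2, h3, h4, h5⟩
    exact ⟨by linarith, by linarith, by linarith, by linarith, by linarith⟩
  · rintro ⟨h1, h2, h3, h4, h5⟩
    exact ⟨by linarith, by linarith, by linarith, by linarith, by linarith⟩

/-- The vertex of the broken line. -/
def polyV (c s : ℝ) : ℂ := s + 2 * c * s * I

lemma polyV_re (c s : ℝ) : (polyV c s).re = s := by simp [polyV]

lemma polyV_im (c s : ℝ) : (polyV c s).im = 2 * c * s := by simp [polyV]

/-- A closed set containing the broken line and avoiding `±reg3`. -/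
def polyS (c s : ℝ) : Set ℂ :=
  {T | |T.re| ≤ 1 / 2 ∧ |T.im| ≤ 2 * c * s ∧ T ∉ reg3 c s ∧ -T ∉ reg3 c s}

lemma neg_mem_polyS {c s : ℝ} {T : ℂ} (h : T ∈ polyS c s) : -T ∈ polyS c s := by
  obtain ⟨h1, h2, h3, h4⟩ := h
  exact ⟨by simpa using h1, by simpa using h2, h4, by simpa using h3⟩

lemma middle_mem_polyS {c s : ℝ} (hc : 0 < c) (hs : 0 < s) (hs2 : s < 1 / 2) {r : ℝ}
    (hr : r ∈ Icc (0 : ℝ) 1) : -polyV c s + r * (polyV c s - -polyV c s) ∈ polyS c s := by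
  have hre : (-polyV c s + r * (polyV c s - -polyV c s)).re = (2 * r - 1) * s := by
    rw [add_re, re_ofReal_mul, sub_re, neg_re, polyV_re]; ring
  have him : (-polyV c s + r * (polyV c s - -polyV c s)).im = (2 * r - 1) * (2 * c * s) := by
    rw [add_im, im_ofReal_mul, sub_im, neg_im, polyV_im]; ring
  have hcs : 0 < 2 * c * s := by positivity
  refine ⟨?_, ?_, fun h => ?_, fun h => ?_⟩
  · rw [hre, abs_le]; constructor <;> nlinarith [hr.1, hr.2]
  · rw [him, abs_le]; constructor <;> nlinarith [hr.1, hr.2]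
  · have := (mem_reg3.1 h).2.2.1
    rw [hre, him] at this
    linarith
  · have := (mem_reg3.1 h).2.2.1
    rw [neg_re, neg_im, hre, him] at this
    linarith

lemma right_mem_polyS {c s : ℝ} (hc : 0 < c) (hs : 0 < s) (hs2 : s < 1 / 2) {r : ℝ}
    (hr : r ∈ Icc (0 : ℝ) 1) : polyV c s + r * (1 / 2 - polyV c s) ∈ polyS c s := by
  have hre : (polyV c s + r * (1 / 2 - polyV c s)).re = (1 - r) * s + r / 2 := by
    rw [add_re, re_ofReal_mul, sub_re, polyV_re]; norm_num; ring
  have him : (polyV c s + r * (1 / 2 - polyV c s)).im = (1 - r) * (2 * c * s) := by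
    rw [add_im, im_ofReal_mul, sub_im, polyV_im]; norm_num; ring
  have hcs : 0 < 2 * c * s := by positivity
  have hrc : 0 ≤ r * c := mul_nonneg hr.1 hc.le
  refine ⟨?_, ?_, fun h => ?_, fun h => ?_⟩
  · rw [hre, abs_le]; constructor <;> nlinarith [hr.1, hr.2]
  · rw [him, abs_le]; constructor <;> nlinarith [hr.1, hr.2]
  · have := (mem_reg3.1 h).2.2.1
    rw [hre, him] at this
    nlinarith
  · have := (mem_reg3.1 h).2.2.2.2
    rw [neg_re, neg_im, hre, him] at this
    nlinarith

lemma left_mem_polyS {c s : ℝ} (hc : 0 < c) (hs : 0 < s) (hs2 : s < 1 / 2) {r : ℝ}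
    (hr : r ∈ Icc (0 : ℝ) 1) : -1 / 2 + r * (-polyV c s - -1 / 2) ∈ polyS c s := by
  have h := neg_mem_polyS (right_mem_polyS hc hs hs2 (r := 1 - r) ⟨by linarith [hr.2],
    by linarith [hr.1]⟩)
  convert h using 1
  push_cast
  ring

lemma P_sub_ne_zero {c s : ℝ} {τ σ a T : ℂ} (hτ : 0 < τ.im) (hσ : 0 < σ.im)
    (ha : a ∈ reg3 c s) (hT : T ∈ polyS c s) (h1 : 4 * c * s ≤ τ.im) (h2 : 4 * c * s ≤ σ.im) :
    P (a - T) τ σ ≠ 0 := by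
  obtain ⟨b1, b2, b3, b4, b5⟩ := mem_reg3.1 ha
  obtain ⟨t1, t2, t3, t4⟩ := hT
  obtain ⟨t1, t1'⟩ := abs_le.1 t1
  obtain ⟨t2, t2'⟩ := abs_le.1 t2
  refine P_ne_zero hτ hσ fun j k n hn => ?_
  have him := congrArg Complex.im hn
  have hre := congrArg Complex.re hn
  simp only [add_im, sub_im, mul_im, natCast_re, natCast_im, zero_mul, add_zero, intCast_im] at him
  have hj : (0 : ℝ) ≤ j * τ.im := by positivity
  have hk : (0 : ℝ) ≤ k * σ.im := by positivity
  have hj0 : j = 0 := by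
    by_contra h0
    have : (1 : ℝ) ≤ j := by exact_mod_cast Nat.one_le_iff_ne_zero.2 h0
    nlinarith
  have hk0 : k = 0 := by
    by_contra h0
    have : (1 : ℝ) ≤ k := by exact_mod_cast Nat.one_le_iff_ne_zero.2 h0
    nlinarith
  subst hj0 hk0
  simp only [Nat.cast_zero, zero_mul, add_zero, sub_re, intCast_re] at hre
  have hn1 : (n : ℝ) < 1 := by linarith
  have hn2 : (-1 : ℝ) < n := by linarith
  have hn0 : n = 0 := by
    have : n < 1 := by exact_mod_cast hn1
    have : -1 < n := by exact_mod_cast hn2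
    omega
  subst hn0
  refine t3 ?_
  have : T = a := by linear_combination -hn + (by push_cast; ring : ((0 : ℕ) : ℂ) * τ +
    ((0 : ℕ) : ℂ) * σ - ((0 : ℤ) : ℂ) = 0)
  rwa [this]

lemma P_add_ne_zero {c s : ℝ} {τ σ a T : ℂ} (hτ : 0 < τ.im) (hσ : 0 < σ.im)
    (ha : a ∈ reg3 c s) (hT : T ∈ polyS c s) (h1 : 4 * c * s ≤ τ.im) (h2 : 4 * c * s ≤ σ.im) :
    P (a + T) τ σ ≠ 0 := by
  have := P_sub_ne_zero hτ hσ ha (neg_mem_polyS hT) h1 h2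
  rwa [sub_neg_eq_add] at this

/-- The set where the kernel is regular. -/
def kerReg (V : Set ℂ) (τ σ : ℂ) (a : ℂ → ℂ) : Set (ℂ × ℂ) :=
  {q | q.1 ∈ V ∧ P (a q.1 + q.2) τ σ * P (a q.1 - q.2) τ σ ≠ 0}

section Kernel

variable {V : Set ℂ} (hV : IsOpen V) {τ σ : ℂ} (hτ : 0 < τ.im) (hσ : 0 < σ.im) {a : ℂ → ℂ}
  (ha : HolOn a V)

include hV hτ hσ ha in
lemma isOpen_kerReg : IsOpen (kerReg V τ σ a) := by
  have hac : ContinuousOn (fun q : ℂ × ℂ => a q.1) (V ×ˢ univ) :=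
    ha.continuousOn.comp continuousOn_fst fun q hq => hq.1
  have hP := (differentiable_P hτ hσ).continuous
  have h : ContinuousOn (fun q : ℂ × ℂ => P (a q.1 + q.2) τ σ * P (a q.1 - q.2) τ σ) (V ×ˢ univ) :=
    (hP.comp_continuousOn (hac.add continuousOn_snd)).mul
      (hP.comp_continuousOn (hac.sub continuousOn_snd))
  have := h.isOpen_inter_preimage (hV.prod isOpen_univ) isOpen_compl_singleton (t := {0}ᶜ)
  convert this using 1
  ext q
  simp [kerReg]

include hV hτ hσ ha in
lemma niceOn_kerK : NiceOn (kerReg V τ σ a) fun q => kerK τ σ (a q.1) q.2 := by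
  have hSo := isOpen_kerReg hV hτ hσ ha
  have hS : ∀ q ∈ kerReg V τ σ a, q.1 ∈ V := fun q hq => hq.1
  have h3 := NiceOn.ofParam ha hS
  have h1 := NiceOn.const (S := kerReg V τ σ a) τ
  have h2 := NiceOn.const (S := kerReg V τ σ a) σ
  unfold kerK
  exact (NiceOn.kerNum (differentiableOn_const τ) (differentiableOn_const σ) ha (fun _ _ => hτ)
    (fun _ _ => hσ) hSo hS).div ((NiceOn.P hSo (h3.add NiceOn.var) h1 h2 (fun _ _ => hτ)
      fun _ _ => hσ).mul (NiceOn.P hSo (h3.sub NiceOn.var) h1 h2 (fun _ _ => hτ)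
      fun _ _ => hσ)) fun q hq => hq.2

include hV hτ hσ ha in
lemma differentiableOn_polyInt {c s : ℝ} (hc : 0 < c) (hs : 0 < s) (hs2 : s < 1 / 2)
    (h1 : 4 * c * s ≤ τ.im) (h2 : 4 * c * s ≤ σ.im) (ha3 : ∀ w ∈ V, a w ∈ reg3 c s)
    {F : ℂ × ℂ → ℂ} (hF : NiceOn (V ×ˢ univ) F) :
    HolOn (fun w => polyInt (fun T => kerK τ σ (a w) T * F (w, T)) (polyV c s)) V := by
  have hN := (niceOn_kerK hV hτ hσ ha).mul (hF.mono fun q hq => ⟨hq.1, mem_univ _⟩)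
  have hm : ∀ w ∈ V, ∀ T ∈ polyS c s, (w, T) ∈ kerReg V τ σ a := fun w hw T hT =>
    ⟨hw, mul_ne_zero (P_add_ne_zero hτ hσ (ha3 w hw) hT h1 h2)
      (P_sub_ne_zero hτ hσ (ha3 w hw) hT h1 h2)⟩
  exact ((hN.segInt hV fun w hw x hx => hm w hw _ (left_mem_polyS hc hs hs2 hx)).add
    (hN.segInt hV fun w hw x hx => hm w hw _ (middle_mem_polyS hc hs hs2 hx))).add
    (hN.segInt hV fun w hw x hx => hm w hw _ (right_mem_polyS hc hs hs2 hx))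

end Kernel

lemma start_mem_reg3 {c s : ℝ} (hc : 0 < c) (hs : 0 < s) (hs4 : s < 1 / 4) :
    2 * (s : ℂ) * (1 + 3 * c * I) ∈ reg3 c s := by
  have hre : (2 * (s : ℂ) * (1 + 3 * c * I)).re = 2 * s := by simp
  have him : (2 * (s : ℂ) * (1 + 3 * c * I)).im = 6 * c * s := by simp; ring
  have hcs : 0 < c * s := by positivity
  rw [mem_reg3, hre, him]
  refine ⟨by linarith, by linarith, by linarith, by linarith, by nlinarith⟩

/-- For a periodic integrand the broken line computes the regularised integral. -/
lemma polyInt_eq_regInt {c s : ℝ} (hc : 0 < c) (hs : 0 < s) (hs4 : s < 1 / 4) {τ σ a : ℂ}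
    (hτ : 0 < τ.im) (hσ : 0 < σ.im) (h1 : 4 * c * s ≤ τ.im) (h2 : 4 * c * s ≤ σ.im)
    (ha : a ∈ reg3 c s) (hpol : a ∉ polA τ σ) {F : ℂ → ℂ} (hF : PerEntire F) :
    polyInt (fun T => kerK τ σ a T * F T) (polyV c s) = regInt τ σ a F := by
  have hO : IsOpen (reg3 c s \ polA τ σ) := (isOpen_reg3 c s).inter (isOpen_compl_polA hτ hσ)
  have hF2 : NiceOn ((reg3 c s \ polA τ σ) ×ˢ univ) fun q => F q.2 :=
    NiceOn.ofVar (V := univ) hF.1.differentiableOn fun q _ => mem_univ _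
  refine eqOn_diff_countable (isOpen_reg3 c s) (convex_reg3 c s) (polA_countable τ σ) hO
    (differentiableOn_polyInt hO hτ hσ differentiableOn_id hc hs (by linarith) h1 h2
      (fun w hw => hw.1) hF2)
    (differentiableOn_regInt hO (differentiableOn_const τ) (differentiableOn_const σ)
      differentiableOn_id (fun _ _ => hτ) (fun _ _ => hσ) (fun w hw => hw.2) hF2
      fun _ _ t => hF.2 t)
    (V := {z | 2 * c * s < z.im}) (isOpen_lt continuous_const continuous_im)
    ⟨2 * (s : ℂ) * (1 + 3 * c * I), ?_, start_mem_reg3 hc hs hs4⟩ (fun z hz => ?_) ⟨ha, hpol⟩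
  · have him : (2 * (s : ℂ) * (1 + 3 * c * I)).im = 6 * c * s := by simp; ring
    have hcs : 0 < c * s := by positivity
    change 2 * c * s < _
    rw [him]
    linarith
  · have hcs : 0 < 2 * c * s := by positivity
    have hz1 : 2 * c * s < z.im := hz.1
    have hz0 : 0 < z.im := hcs.trans hz1
    have hd : HolOn (fun T => kerK τ σ z T * F T) (strip (-z.im) z.im) :=
      (differentiableOn_kerK hτ hσ).fun_mul hF.1.differentiableOn
    have m1 : (-1 / 2 : ℂ) ∈ strip (-z.im) z.im := by constructor <;> simp <;> linarith
    have m2 : (1 / 2 : ℂ) ∈ strip (-z.im) z.im := by constructor <;> simp <;> linarith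
    have m3 : (0 : ℂ) ∈ strip (-z.im) z.im := by constructor <;> simp <;> linarith
    simp only [id]
    rw [polyInt_eq_segInt hd (by rw [polyV_im, abs_of_pos hcs]; exact hz1),
      segInt_add_segInt (isOpen_strip _ _) (convex_strip _ _) hd m1 m3 m2,
      regInt_of_pos hτ hσ hz0 hF, lineInt_congr_base hd (fun t _ => ?_) m3 m1, lineInt_eq_segInt]
    · norm_num
    · have := kerK_add_int τ σ z t 1
      rw [Int.cast_one] at this
      rw [this, hF.2]

section Double

variable {V : Set ℂ} (hV : IsOpen V) {τ σ : ℂ} (hτ : 0 < τ.im) (hσ : 0 < σ.im)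
  (hτσ : 0 < (-τ / σ).im) {a ω : ℂ → ℂ} (ha : HolOn a V) (hω : HolOn ω V)

lemma niceOn_facY {S : Set (ℂ × ℂ)} (hS : IsOpen S) (hτσ : 0 < (-τ / σ).im) (ell : ℂ)
    {ν y : ℂ × ℂ → ℂ} (hν : NiceOn S ν) (hy : NiceOn S y) :
    NiceOn S fun q => facY τ σ ell (ν q) (y q) := by
  unfold facY
  refine ((NiceOn.const (π * I)).mul (NiceOn.congr (((hy.mul hy).sub
    (((NiceOn.const 2).mul hν).mul hy)).mul (NiceOn.const σ⁻¹)) fun q _ => ?_)).expo.mul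
    (NiceOn.theta hS ((NiceOn.const ell).add (NiceOn.congr (hy.mul (NiceOn.const σ⁻¹))
      fun q _ => ?_)) (NiceOn.const _) fun _ _ => hτσ)
  · rw [div_eq_mul_inv, pow_two]
  · rw [div_eq_mul_inv]

include hV hτ hσ hτσ ha hω in
lemma differentiableOn_dbl (lam ell : ℂ) (h1 : ∀ w ∈ V, |(a w).im| < 1 / 4 * τ.im)
    (h2 : ∀ w ∈ V, |(a w / σ).im| < 1 / 4 * (-τ / σ).im) (h3 : ∀ w ∈ V, th0 (ω w) σ ≠ 0) :
    HolOn (fun w => dbl τ σ lam ell (a w) (ω w)) V := by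
  have hS1o : IsOpen (V ×ˢ strip (-(3 / 4 * τ.im)) (-(1 / 4 * τ.im))) := hV.prod (isOpen_strip _ _)
  have ha1 := NiceOn.ofParam (S := V ×ˢ strip (-(3 / 4 * τ.im)) (-(1 / 4 * τ.im))) ha
    fun q hq => hq.1
  have hgA : NiceOn (V ×ˢ strip (-(3 / 4 * τ.im)) (-(1 / 4 * τ.im)))
      fun q => gA τ σ lam (a q.1) q.2 := by
    unfold gA
    refine (((NiceOn.const _).mul ((NiceOn.const _).mul (ha1.add NiceOn.var)).neg.expo).mul
      (NiceOn.gam hS1o hτ hσ ha1 NiceOn.var fun q hq => ?_)).mul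
      (NiceOn.theta hS1o ((NiceOn.const lam).add NiceOn.var) (NiceOn.const τ) fun _ _ => hτ)
    have := abs_lt.1 (h1 q.1 hq.1)
    exact ⟨by linarith [hq.2.1], by linarith [hq.2.2]⟩
  have hkr := niceOn_krLine hV hσ (by linarith) hgA (fun w _ t => gA_add_one τ σ lam (a w) t) hω h3
  set T := strip (-(3 / 4 * τ.im)) (-(1 / 4 * τ.im) + σ.im) ∩
    skew σ (1 / 4 * (-τ / σ).im) (3 / 4 * (-τ / σ).im) with hT
  have hS2o : IsOpen (V ×ˢ T) := hV.prod ((isOpen_strip _ _).inter (isOpen_skew _ _ _))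
  have ha2 := NiceOn.ofParam (S := V ×ˢ T) ha fun q hq => hq.1
  have hω2 := NiceOn.ofParam (S := V ×ˢ T) hω fun q hq => hq.1
  have haσ := NiceOn.ofParam (S := V ×ˢ T) (ha.div_const σ) fun q hq => hq.1
  have hy : NiceOn (V ×ˢ T) fun q => -q.2 / σ :=
    NiceOn.ofVar (a := fun y => -y / σ) (V := univ) (by fun_prop) fun _ _ => mem_univ _
  have hkA : NiceOn (V ×ˢ T) fun q => kA τ σ ell (a q.1) (ω q.1) q.2 := by
    unfold kA
    refine (((NiceOn.const _).mul ((NiceOn.const _).mul ((ha2.sub NiceOn.var).add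
      (NiceOn.comp_entire (differentiable_modB σ) (ha2.sub NiceOn.var)))).neg.expo).mul
      (NiceOn.gam hS2o hτσ (im_neg_one_div_pos hσ) haσ hy fun q hq => ?_)).mul
      (niceOn_facY hS2o hτσ ell (hω2.add ha2) NiceOn.var)
    have := abs_lt.1 (h2 q.1 hq.1)
    have e : (-q.2 / σ).im = -(q.2 / σ).im := by rw [neg_div, neg_im]
    have h5 := hq.2.2
    exact ⟨by rw [e]; linarith [h5.2], by rw [e]; linarith [h5.1]⟩
  have hN := hkA.mul (hkr.mono fun q hq => ⟨hq.1, hq.2.1⟩)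
  refine hN.segInt hV fun w hw x hx => ⟨hw, period_segment_mem hσ ?_ hx, ?_⟩
  · have : (-τ / 2).im = -τ.im / 2 := by simp
    constructor <;> rw [this] <;> linarith
  · have hσ0 : σ ≠ 0 := by rintro rfl; simp at hσ
    have : ((-τ / 2 + x * (-τ / 2 + σ - -τ / 2)) / σ).im = (-τ / σ).im / 2 := by
      rw [show (-τ / 2 + x * (-τ / 2 + σ - -τ / 2)) / σ = ((1 / 2 : ℝ) : ℂ) * (-τ / σ) + (x : ℝ) by
        push_cast; field_simp; ring, add_im, im_ofReal_mul, ofReal_im]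
      ring
    constructor <;> rw [this] <;> linarith

lemma niceOn_openF {S : Set (ℂ × ℂ)} (hS : IsOpen S) (hτ : 0 < τ.im) (hτσ : 0 < (-τ / σ).im)
    (lam ell : ℂ) {b ν : ℂ × ℂ → ℂ} (hb : NiceOn S b) (hν : NiceOn S ν) :
    NiceOn S fun q => openF τ σ lam ell (b q) (ν q) q.2 := by
  have hC : Differentiable ℂ fun z => modC z τ σ := by unfold modC; fun_prop
  have hT := (NiceOn.const (S := S) τ).mul NiceOn.var
  unfold openF
  exact ((((NiceOn.const _).mul ((NiceOn.const _).mul hb).neg.expo).mul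
    ((NiceOn.const _).mul ((NiceOn.comp_entire hC (hb.add hT)).add
      (NiceOn.comp_entire hC (hb.sub hT)))).expo).mul
    (NiceOn.theta hS ((NiceOn.const lam).add hT) (NiceOn.const τ) fun _ _ => hτ)).mul
    (niceOn_facY hS hτσ ell hν hT)

end Double

lemma th0_zeros_countable {σ : ℂ} (hσ : 0 < σ.im) : {z | th0 z σ = 0}.Countable := by
  refine (Set.countable_range fun p : ℤ × ℤ => (p.1 : ℂ) + p.2 * σ).mono fun z hz => ?_
  by_contra h
  exact th0_ne_zero hσ (fun m n hmn => h ⟨(m, n), hmn.symm⟩) hz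

/-- The region of `a` in which the product formula is continued. -/
def contReg (c s : ℝ) (τ σ : ℂ) : Set ℂ :=
  {a | a / τ ∈ reg3 c s} ∩ (strip (-(1 / 4 * τ.im)) (1 / 4 * τ.im) ∩
    skew σ (-(1 / 4 * (-τ / σ).im)) (1 / 4 * (-τ / σ).im))

lemma isOpen_contReg (c s : ℝ) (τ σ : ℂ) : IsOpen (contReg c s τ σ) :=
  ((isOpen_reg3 c s).preimage (by fun_prop : Continuous fun a : ℂ => a / τ)).inter
    ((isOpen_strip _ _).inter (isOpen_skew _ _ _))

lemma convex_contReg (c s : ℝ) (τ σ : ℂ) : Convex ℝ (contReg c s τ σ) :=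
  ((convex_reg3 c s).is_linear_preimage (f := fun y : ℂ => y / τ) ⟨fun x y => add_div x y τ,
    fun c x => by simp [mul_div_assoc]⟩).inter ((convex_strip _ _).inter (convex_skew _ _ _))

/-- The product formula, continued beyond the common part of the half planes. -/
lemma regInt_mul_regInt {c s : ℝ} (hc : 0 < c) (hs : 0 < s) (hs4 : s < 1 / 4) {τ σ : ℂ}
    (hτ : 0 < τ.im) (hσ : 0 < σ.im) (hστ : 0 < (σ / τ).im) (hτ3 : 4 * c * s ≤ (-1 / τ).im)
    (hσ3 : 4 * c * s ≤ (σ / τ).im)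
    (hstart : ∃ a ∈ contReg c s τ σ, 0 < a.im ∧ 0 < (a / σ).im ∧ 2 * c * s < (a / τ).im)
    (lam ell ν : ℂ) {a : ℂ} (ha : a ∈ contReg c s τ σ) (hp1 : a ∉ polA τ σ)
    (hp2 : a / σ ∉ polA (-1 / σ) (-τ / σ)) (h1 : th0 (ν - a) σ ≠ 0) (h2 : th0 (ν + a) σ ≠ 0) :
    σ * Q ν σ (a / 2) * regInt τ σ a (thF lam ν τ σ) *
        (-(exp (-(π * I * ν ^ 2 / σ)) / (-I * (-I * σ) ^ (1 / 2 : ℂ))) *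
        regInt (-1 / σ) (-τ / σ) (a / σ) (thF (-ν / σ) ell (-1 / σ) (-τ / σ))) =
      dbl τ σ lam ell a (ν - a) - ex (ell - (ν + a) * τ / σ - lam) * dbl τ σ lam ell a (ν + a) -
        2 * π * I * (τ * polyInt (fun T => kerK (-1 / τ) (σ / τ) (a / τ) T *
          openF τ σ lam ell a ν T) (polyV c s)) := by
  have hσ0 : σ ≠ 0 := by rintro rfl; simp at hσ
  have hτσ := im_neg_div_pos hστ
  have hτ3' := im_neg_one_div_pos hτ
  have hσ2 := im_neg_one_div_pos hσ
  set Z : Set ℂ := polA τ σ ∪ ((fun a => a / σ) ⁻¹' polA (-1 / σ) (-τ / σ) ∪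
    ((fun a => ν - a) ⁻¹' {z | th0 z σ = 0} ∪ (fun a => ν + a) ⁻¹' {z | th0 z σ = 0})) with hZ
  have hmem : ∀ a, a ∉ Z ↔ a ∉ polA τ σ ∧ a / σ ∉ polA (-1 / σ) (-τ / σ) ∧ th0 (ν - a) σ ≠ 0 ∧
      th0 (ν + a) σ ≠ 0 := fun a => by simp [hZ, not_or]
  have hZc : Z.Countable := (polA_countable τ σ).union (((polA_countable _ _).preimage
    fun x y h => by simpa [hσ0] using h).union (((th0_zeros_countable hσ).preimage
    fun x y h => by simpa using h).union ((th0_zeros_countable hσ).preimage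
    fun x y h => by simpa using h)))
  have hO : IsOpen (contReg c s τ σ \ Z) := by
    have e : contReg c s τ σ \ Z = contReg c s τ σ ∩ ((polA τ σ)ᶜ ∩ ((fun a => a / σ) ⁻¹'
        (polA (-1 / σ) (-τ / σ))ᶜ ∩ ((fun a => th0 (ν - a) σ) ⁻¹' {0}ᶜ ∩
          (fun a => th0 (ν + a) σ) ⁻¹' {0}ᶜ))) := by
      ext a
      simp only [Set.mem_sdiff, hmem, mem_inter_iff, mem_compl_iff, mem_preimage, mem_singleton_iff, ne_eq]
    have hth := (differentiable_th0 hσ).continuous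
    rw [e]
    exact (isOpen_contReg c s τ σ).inter ((isOpen_compl_polA hτ hσ).inter
      (((isOpen_compl_polA hσ2 hτσ).preimage (by fun_prop)).inter
      ((isOpen_compl_singleton.preimage (hth.comp (by fun_prop))).inter
      (isOpen_compl_singleton.preimage (hth.comp (by fun_prop))))))
  have hU : ∀ a ∈ contReg c s τ σ \ Z, |a.im| < 1 / 4 * τ.im ∧
      |(a / σ).im| < 1 / 4 * (-τ / σ).im := fun a ha => ⟨abs_lt.2 ha.1.2.1, abs_lt.2 ha.1.2.2⟩
  have hθ := differentiable_theta hσ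
  have hθ0 : ∀ z, th0 z σ ≠ 0 → theta z σ ≠ 0 := fun z hz h => hz ((theta_eq_zero_iff z hσ).1 h)
  have hQ : HolOn (fun a => Q ν σ (a / 2)) (contReg c s τ σ \ Z) := by
    have e1 : Differentiable ℂ fun a : ℂ => theta (4 * (a / 2)) σ :=
      hθ.comp (f := fun a : ℂ => 4 * (a / 2)) (by fun_prop)
    have e2 : Differentiable ℂ fun a : ℂ => theta (ν - 2 * (a / 2)) σ :=
      hθ.comp (f := fun a : ℂ => ν - 2 * (a / 2)) (by fun_prop)
    have e3 : Differentiable ℂ fun a : ℂ => theta (ν + 2 * (a / 2)) σ :=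
      hθ.comp (f := fun a : ℂ => ν + 2 * (a / 2)) (by fun_prop)
    refine (e1.mul_const _).differentiableOn.fun_div (e2.fun_mul e3).differentiableOn fun a ha => ?_
    obtain ⟨-, -, h1, h2⟩ := (hmem a).1 ha.2
    rw [mul_div_cancel₀ _ two_ne_zero]
    exact mul_ne_zero (hθ0 _ h1) (hθ0 _ h2)
  have hE1 : HolOn (fun a => regInt τ σ a (thF lam ν τ σ)) (contReg c s τ σ \ Z) :=
    differentiableOn_regInt hO (differentiableOn_const τ) (differentiableOn_const σ)
      differentiableOn_id (fun _ _ => hτ) (fun _ _ => hσ) (fun a ha => ((hmem a).1 ha.2).1)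
      (F := fun q => thF lam ν τ σ q.2)
      (NiceOn.ofVar (V := univ) (perEntire_thF lam ν hτ hσ).1.differentiableOn fun q _ => mem_univ _)
      fun _ _ t => (perEntire_thF lam ν hτ hσ).2 t
  have hE2 : HolOn (fun a => regInt (-1 / σ) (-τ / σ) (a / σ)
      (thF (-ν / σ) ell (-1 / σ) (-τ / σ))) (contReg c s τ σ \ Z) :=
    differentiableOn_regInt hO (differentiableOn_const _) (differentiableOn_const _)
      (a := fun a => a / σ) (by fun_prop) (fun _ _ => hσ2) (fun _ _ => hτσ)
      (fun a ha => ((hmem a).1 ha.2).2.1) (F := fun q => thF (-ν / σ) ell (-1 / σ) (-τ / σ) q.2)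
      (NiceOn.ofVar (V := univ) (perEntire_thF _ _ hσ2 hτσ).1.differentiableOn fun q _ => mem_univ _)
      fun _ _ t => (perEntire_thF _ _ hσ2 hτσ).2 t
  have hD1 := differentiableOn_dbl hO hτ hσ hτσ (a := fun a => a) (ω := fun a => ν - a)
    differentiableOn_id (by fun_prop) lam ell (fun a ha => (hU a ha).1) (fun a ha => (hU a ha).2)
    fun a ha => ((hmem a).1 ha.2).2.2.1
  have hD2 := differentiableOn_dbl hO hτ hσ hτσ (a := fun a => a) (ω := fun a => ν + a)
    differentiableOn_id (by fun_prop) lam ell (fun a ha => (hU a ha).1) (fun a ha => (hU a ha).2)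
    fun a ha => ((hmem a).1 ha.2).2.2.2
  have hex : HolOn (fun a => ex (ell - (ν + a) * τ / σ - lam)) (contReg c s τ σ \ Z) :=
    DifferentiableOn.ex (by fun_prop)
  have hP := differentiableOn_polyInt hO hτ3' hστ (a := fun a => a / τ) (by fun_prop) hc hs
    (by linarith) hτ3 hσ3 (fun a ha => ha.1.1)
    (niceOn_openF (S := (contReg c s τ σ \ Z) ×ˢ univ) (hO.prod isOpen_univ) hτ hτσ lam ell
      NiceOn.param (NiceOn.const ν))
  have hL := (((hQ.const_mul σ).fun_mul hE1).fun_mul (hE2.const_mul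
    (-(exp (-(π * I * ν ^ 2 / σ)) / (-I * (-I * σ) ^ (1 / 2 : ℂ))))))
  have hR := (hD1.fun_sub (hex.fun_mul hD2)).fun_sub ((hP.const_mul τ).const_mul (2 * π * I))
  obtain ⟨a₀, ha₀, b1, b2, b3⟩ := hstart
  refine eqOn_diff_countable (isOpen_contReg c s τ σ) (convex_contReg c s τ σ) hZc hO hL hR
    (V := {a | 0 < a.im} ∩ ({a | 0 < (a / σ).im} ∩ {a | 2 * c * s < (a / τ).im}))
    ((isOpen_lt continuous_const continuous_im).inter ((isOpen_lt continuous_const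
      (by fun_prop)).inter (isOpen_lt continuous_const (by fun_prop)))) ⟨a₀, ⟨b1, b2, b3⟩, ha₀⟩
    (fun z hz => ?_) ⟨ha, (hmem a).2 ⟨hp1, hp2, h1, h2⟩⟩
  obtain ⟨⟨c1, c2, c3⟩, hz2⟩ := hz
  have c3' : 2 * c * s < (z / τ).im := c3
  have hcs : 0 < 2 * c * s := by positivity
  obtain ⟨-, -, n1, n2⟩ := (hmem z).1 hz2.2
  have h := regInt_mul_regInt_of_pos hτ hσ hτσ lam ell c1 c2 (abs_lt.1 (hU z hz2).1).2 n1 n2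
  rw [segInt_add_segInt_eq_polyInt hτ hσ hστ lam ell ν c1 c2 (hcs.trans c3')
    (p := polyV c s) (by rw [polyV_im, abs_of_pos hcs]; exact c3')] at h
  exact h

/-! ### Quasi-periodicity and symmetries of the hypergeometric integrals -/

lemma theta_sub_int_mul (z : ℂ) (m : ℤ) (σ : ℂ) : theta (z - m * σ) σ =
    expπ (m + 2 * m * z - m ^ 2 * σ) * theta z σ := by
  have key : ∀ (k : ℂ), expπ (k + 1 + 2 * (k + 1) * z - (k + 1) ^ 2 * σ) *
      exp (-(π * I * (σ + 2 * (z - (k + 1) * σ)))) =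
      -expπ (k + 2 * k * z - k ^ 2 * σ) := by
    intro k
    have h : expπ (k + 1 + 2 * (k + 1) * z - (k + 1) ^ 2 * σ) *
        exp (-(π * I * (σ + 2 * (z - (k + 1) * σ)))) =
        exp (π * I) * expπ (k + 2 * k * z - k ^ 2 * σ) := by
      rw [← exp_add, ← exp_add]
      ring_nf
    rw [h, exp_pi_mul_I, neg_one_mul]
  have hne : ∀ k : ℂ, exp (-(π * I * (σ + 2 * (z - (k + 1) * σ)))) ≠ 0 := fun k => exp_ne_zero _
  induction m with
  | zero => simp
  | succ n ih =>
    have h := theta_add_tau (z - ((n : ℂ) + 1) * σ) σ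
    rw [show z - ((n : ℂ) + 1) * σ + σ = z - ((n : ℤ) : ℂ) * σ by push_cast; ring, ih] at h
    push_cast at h ⊢
    rw [← mul_right_inj' (hne n)]
    linear_combination h - (theta z σ) * key n
  | pred n ih =>
    have h := theta_add_tau (z - ((-n : ℤ) : ℂ) * σ) σ
    rw [ih] at h
    push_cast at h ⊢
    have hk := key (-(n : ℂ) - 1)
    rw [sub_add_cancel] at hk
    rw [show z - (-(n : ℂ) - 1) * σ = z - -(n : ℂ) * σ + σ by ring, h]
    linear_combination (-theta z σ) * hk

lemma theta_add_int_mul_sub (z w : ℂ) (m : ℤ) (σ : ℂ) : theta (z - m * σ + w) σ * theta z σ =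
      ex (m * w) * (theta (z + w) σ * theta (z - m * σ) σ) := by
  rw [show z - m * σ + w = z + w - m * σ by ring, theta_sub_int_mul, theta_sub_int_mul, ex]
  have : expπ (m + 2 * m * (z + w) - m ^ 2 * σ) =
      exp (2 * π * I * (m * w)) * expπ (m + 2 * m * z - m ^ 2 * σ) := by
    rw [← exp_add]; ring_nf
  rw [this]
  ring

lemma kr_sub_int_mul (ω w : ℂ) (m : ℤ) {σ : ℂ} (hω : theta ω σ ≠ 0) :
    kr (ω - m * σ) w σ = ex (m * w) * kr ω w σ := by
  have h := theta_add_int_mul_sub ω w m σ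
  have h1 : theta (ω - m * σ) σ ≠ 0 := by
    rw [theta_sub_int_mul]; exact mul_ne_zero (exp_ne_zero _) hω
  rw [kr, kr]
  by_cases hw : theta w σ = 0
  · simp [hw]
  · field_simp
    linear_combination (deriv (fun z => theta z σ) 0) * h

/-- An identity between regularised integrals follows from its validity in the upper half plane. -/
lemma regInt_ext {τ σ : ℂ} (hτ : 0 < τ.im) (hσ : 0 < σ.im) {F G : ℂ × ℂ → ℂ}
    (hF : NiceOn univ F) (hG : NiceOn univ G) (hF1 : ∀ a t, F (a, t + 1) = F (a, t))
    (hG1 : ∀ a t, G (a, t + 1) = G (a, t)) (h : ∀ a : ℂ, 0 < a.im →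
      regInt τ σ a (fun t => F (a, t)) = regInt τ σ a fun t => G (a, t)) {a : ℂ}
    (ha : a ∉ polA τ σ) : regInt τ σ a (fun t => F (a, t)) = regInt τ σ a fun t => G (a, t) := by
  have hO : IsOpen (univ \ polA τ σ) := isOpen_univ.inter (isOpen_compl_polA hτ hσ)
  have hD : ∀ {F : ℂ × ℂ → ℂ}, NiceOn univ F → (∀ a t, F (a, t + 1) = F (a, t)) →
      HolOn (fun a => regInt τ σ a fun t => F (a, t)) (univ \ polA τ σ) :=
    fun hF hF1 => differentiableOn_regInt hO (a := fun a => a) (differentiableOn_const τ)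
      (differentiableOn_const σ) differentiableOn_id (fun _ _ => hτ) (fun _ _ => hσ)
      (fun w hw => hw.2) (hF.mono fun _ _ => mem_univ _) fun w _ t => hF1 w t
  exact eqOn_diff_countable isOpen_univ convex_univ (polA_countable τ σ) hO (hD hF hF1) (hD hG hG1)
    (V := {a | 0 < a.im}) (isOpen_lt continuous_const continuous_im) ⟨I, by simp, mem_univ _⟩
    (fun z hz => h z hz.1) ⟨mem_univ _, ha⟩

lemma regInt_comp_neg {τ σ a : ℂ} (hτ : 0 < τ.im) (hσ : 0 < σ.im) (ha : a ∉ polA τ σ)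
    {F : ℂ → ℂ} (hF : PerEntire F) : regInt τ σ a (fun t => F (-t)) = regInt τ σ a F := by
  have hF' : PerEntire fun t => F (-t) := ⟨hF.1.comp differentiable_neg, fun t => by
    show F (-(t + 1)) = F (-t)
    rw [← hF.2 (-(t + 1))]; ring_nf⟩
  refine regInt_ext hτ hσ (F := fun q => F (-q.2)) (G := fun q => F q.2)
    (NiceOn.comp_entire hF.1 NiceOn.var.neg) (NiceOn.comp_entire hF.1 NiceOn.var)
    (fun _ t => hF'.2 t) (fun _ t => hF.2 t) (fun a ha => ?_) ha
  have hd : HolOn (fun t => kerK τ σ a t * F t) (strip (-a.im) a.im) :=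
    (differentiableOn_kerK hτ hσ).fun_mul hF.1.differentiableOn
  have hp : ∀ t ∈ strip (-a.im) a.im, kerK τ σ a (t + 1) * F (t + 1) = kerK τ σ a t * F t :=
    fun t _ => by
      have := kerK_add_int τ σ a t 1
      rw [Int.cast_one] at this
      rw [this, hF.2]
  simp only
  rw [regInt_of_pos hτ hσ ha hF', regInt_of_pos hτ hσ ha hF,
    lineInt_congr_base hd hp (c := 0) (c' := -1) ?_ ?_]
  · have h := intervalIntegral.integral_comp_sub_left
      (fun x : ℝ => kerK τ σ a (-1 + x) * F (-1 + x)) 1 (a := 0) (b := 1)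
    rw [sub_self, sub_zero] at h
    rw [lineInt, lineInt, ← h]
    refine intervalIntegral.integral_congr fun x _ => ?_
    have e : (-1 : ℂ) + ((1 - x : ℝ) : ℂ) = -(0 + (x : ℂ)) := by push_cast; ring
    rw [← kerK_neg]
    simp only [e]
  · constructor <;> simp <;> linarith
  · constructor <;> simp <;> linarith

lemma u_neg_neg (lam mu : ℂ) {τ σ a : ℂ} (hτ : 0 < τ.im) (hσ : 0 < σ.im) (ha : a ∉ polA τ σ) :
    u (-lam) (-mu) τ σ (a / 2) = u lam mu τ σ (a / 2) := by
  rw [u_eq_regInt _ _ hτ hσ ha, u_eq_regInt _ _ hτ hσ ha,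
    ← regInt_comp_neg hτ hσ ha (perEntire_thF lam mu hτ hσ)]
  have : (fun t => thF lam mu τ σ (-t)) = thF (-lam) (-mu) τ σ := by
    funext t
    rw [thF, thF, show lam + -t = -(-lam + t) by ring, show mu + -t = -(-mu + t) by ring,
      theta_neg, theta_neg, neg_mul_neg]
  rw [this]
  ring_nf

lemma regInt_const_mul (τ σ a c : ℂ) (F : ℂ → ℂ) :
    (regInt τ σ a fun t => c * F t) = c * regInt τ σ a F := by
  rw [regInt, regInt, sepInt, sepInt, lineInt, lineInt, lineInt, lineInt, mul_add,
    ← intervalIntegral.integral_const_mul, ← intervalIntegral.integral_const_mul]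
  congr 1 <;> refine intervalIntegral.integral_congr fun x _ => ?_ <;> ring

/-- Shifting the path by `τ` exchanges `θ(t - a, σ)` and `θ(t + a, σ)`. -/
lemma regInt_shift {τ σ a : ℂ} (hτ : 0 < τ.im) (hσ : 0 < σ.im) (ha : a ∉ polA τ σ) (lam : ℂ)
    (m : ℤ) : regInt τ σ a (fun t => theta (lam + t) τ * theta (-a + t) σ * ex (m * t)) =
      ex (m * τ - lam) *
        regInt τ σ a (fun t => theta (lam + t) τ * theta (a + t) σ * ex (m * t)) := by
  have hN : ∀ b : ℂ, NiceOn univ fun q : ℂ × ℂ =>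
      theta (lam + q.2) τ * theta (b * q.1 + q.2) σ * ex (m * q.2) := fun b =>
    ((NiceOn.theta isOpen_univ ((NiceOn.const lam).add NiceOn.var) (NiceOn.const τ)
      fun _ _ => hτ).mul (NiceOn.theta isOpen_univ (((NiceOn.const b).mul NiceOn.param).add
      NiceOn.var) (NiceOn.const σ) fun _ _ => hσ)).mul ((NiceOn.const (m : ℂ)).mul NiceOn.var).ex
  have hexm : ∀ t : ℂ, ex (m * (t + 1)) = ex (m * t) := fun t => by
    rw [mul_add, mul_one, ex_add_int]
  have hper : ∀ b t : ℂ, theta (lam + (t + 1)) τ * theta (b + (t + 1)) σ * ex (m * (t + 1)) =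
      theta (lam + t) τ * theta (b + t) σ * ex (m * t) := fun b t => by
    rw [← add_assoc, ← add_assoc, theta_add_one, theta_add_one, neg_mul_neg, hexm]
  have hE : ∀ b a : ℂ, PerEntire fun t => theta (lam + t) τ * theta (b * a + t) σ * ex (m * t) :=
    fun b a => ⟨differentiableOn_univ.1 ((hN b).snd a), hper _⟩
  rw [← regInt_const_mul]
  have main := regInt_ext hτ hσ (F := fun q => theta (lam + q.2) τ * theta (-1 * q.1 + q.2) σ *
    ex (m * q.2)) (G := fun q => ex (m * τ - lam) * (theta (lam + q.2) τ *
    theta (1 * q.1 + q.2) σ * ex (m * q.2))) (hN (-1)) ((NiceOn.const _).mul (hN 1))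
    (fun a t => hper _ t) (fun a t => by simp only [hper]) (fun a ha => ?_) ha
  · simpa only [neg_one_mul, one_mul] using main
  simp only
  rw [regInt_const_mul, regInt_of_pos hτ hσ ha (hE _ _), regInt_of_pos hτ hσ ha (hE _ _)]
  have e1 : lineInt (fun t => kerK τ σ a t *
      (theta (lam + t) τ * theta (-1 * a + t) σ * ex (m * t))) 0 =
      lineInt (fun t => gB τ σ lam a t * ex (m * t)) 0 := by
    refine intervalIntegral.integral_congr fun x _ => ?_
    simp only
    rw [gB_eq lam hτ hσ (by simpa using ha), show -1 * a + (0 + (x : ℂ)) = 0 + x - a by ring]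
    ring
  have e2 : lineInt (fun t => kerK τ σ a t *
      (theta (lam + t) τ * theta (1 * a + t) σ * ex (m * t))) 0 =
      lineInt (fun t => gA τ σ lam a t * ex (m * t)) 0 := by
    refine intervalIntegral.integral_congr fun x _ => ?_
    simp only
    rw [gA_eq lam hτ hσ (by simpa using ha), one_mul, add_comm a]
    ring
  have hd : HolOn (fun t => gB τ σ lam a t * ex (m * t)) (strip (-a.im) (a.im + τ.im)) :=
    (differentiableOn_gB hτ hσ lam a).fun_mul (DifferentiableOn.ex (by fun_prop))
  rw [e1, e2, lineInt_congr_base hd (fun t _ => by rw [gB_add_one, hexm]) (c' := τ)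
    ⟨by simpa using ha, by simp; linarith⟩ ⟨by linarith, by linarith⟩, lineInt, lineInt,
    ← intervalIntegral.integral_const_mul]
  refine intervalIntegral.integral_congr fun x _ => ?_
  rw [add_comm τ, gB_add_tau, zero_add, show (m : ℂ) * (x + τ) = m * x + m * τ by ring, ex_add,
    sub_eq_add_neg, ex_add]
  ring

/-! ### Summation of theta series under the integral -/

lemma hasSum_integral_jacobi {h z : ℝ → ℂ} (hh : ContinuousOn h (Icc 0 1))
    (hz : ContinuousOn z (Icc 0 1)) {τ : ℂ} (hτ : 0 < τ.im) :
    HasSum (fun m : ℤ => ∫ x in (0 : ℝ)..1, h x * jacobiTheta₂_term m (z x) τ)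
      (∫ x in (0 : ℝ)..1, h x * jacobiTheta₂ (z x) τ) := by
  obtain ⟨M, hM⟩ := isCompact_Icc.exists_bound_of_continuousOn hh
  obtain ⟨S, hS⟩ := isCompact_Icc.exists_bound_of_continuousOn hz
  have hsub : uIoc (0 : ℝ) 1 ⊆ Icc 0 1 := by rw [uIoc_of_le zero_le_one]; exact Ioc_subset_Icc_self
  have hsum : Summable fun m : ℤ => M * Real.exp (-π * (τ.im * (m : ℝ) ^ 2 - 2 * S * |m|)) := by
    have := summable_pow_mul_jacobiTheta₂_term_bound S hτ 0
    simp only [pow_zero, one_mul] at this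
    exact this.mul_left M
  refine intervalIntegral.hasSum_integral_of_dominated_convergence
    (fun m _ => M * Real.exp (-π * (τ.im * (m : ℝ) ^ 2 - 2 * S * |m|))) (fun m => ?_)
    (fun m => ?_) ?_ ?_ ?_
  · refine (ContinuousOn.mono (ContinuousOn.mul hh ?_) hsub).aestronglyMeasurable measurableSet_uIoc
    unfold jacobiTheta₂_term
    fun_prop
  · refine Eventually.of_forall fun x hx => ?_
    rw [norm_mul]
    exact mul_le_mul (hM x (hsub hx)) (norm_jacobiTheta₂_term_le hτ
      ((abs_im_le_norm _).trans (hS x (hsub hx))) le_rfl m) (norm_nonneg _)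
      ((norm_nonneg _).trans (hM x (hsub hx)))
  · exact Eventually.of_forall fun x _ => hsum
  · exact intervalIntegrable_const
  · exact Eventually.of_forall fun x _ => (hasSum_jacobiTheta₂_term (z x) hτ).mul_left _

lemma hasSum_segInt_jacobi {h z : ℂ → ℂ} {p q : ℂ}
    (hh : ContinuousOn (fun s : ℝ => h (p + s * (q - p))) (Icc 0 1)) (hz : Continuous z) {τ : ℂ}
    (hτ : 0 < τ.im) :
    HasSum (fun m : ℤ => segInt (fun t => h t * jacobiTheta₂_term m (z t) τ) p q)
      (segInt (fun t => h t * jacobiTheta₂ (z t) τ) p q) :=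
  (hasSum_integral_jacobi hh (z := fun s => z (p + s * (q - p))) (by fun_prop) hτ).mul_left _

lemma hasSum_regInt_jacobi {τ σ a : ℂ} (hτ : 0 < τ.im) (hσ : 0 < σ.im) (ha : a ∉ polA τ σ)
    {H z : ℂ → ℂ} (hH : Continuous H) (hz : Continuous z) {τ' : ℂ} (hτ' : 0 < τ'.im) :
    HasSum (fun m : ℤ => regInt τ σ a fun t => H t * jacobiTheta₂_term m (z t) τ')
      (regInt τ σ a fun t => H t * jacobiTheta₂ (z t) τ') := by
  obtain ⟨h1, h2, h3⟩ := good_std hτ hσ a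
  rw [abs_lt] at h1
  have d1 : ContinuousOn (fun x : ℝ => partD (stdN τ σ a) τ σ a (-(stdR a * I) + x) *
      H (-(stdR a * I) + x)) (Icc 0 1) := by
    refine ContinuousOn.mul ((differentiableOn_partD hτ hσ ha _).continuousOn.comp (by fun_prop)
      fun x _ => ⟨trivial, ?_⟩) (by fun_prop)
    simp only [lt_min_iff]
    refine ⟨?_, ?_, ?_⟩ <;> simp <;> linarith
  have d2 : ContinuousOn (fun x : ℝ => partU (stdN τ σ a) τ σ a (stdR a * I + x) *
      H (stdR a * I + x)) (Icc 0 1) := by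
    refine ContinuousOn.mul ((differentiableOn_partU hτ hσ ha _).continuousOn.comp (by fun_prop)
      fun x _ => ⟨trivial, ?_⟩) (by fun_prop)
    simp only [lt_min_iff]
    refine ⟨?_, ?_, ?_⟩ <;> simp <;> linarith
  have := (hasSum_integral_jacobi d1 (z := fun x => z (-(stdR a * I) + x)) (by fun_prop) hτ').add
    (hasSum_integral_jacobi d2 (z := fun x => z (stdR a * I + x)) (by fun_prop) hτ')
  simpa only [regInt, sepInt, lineInt, mul_assoc] using this

/-! ### Growth of the double integrals -/

lemma kr_eq_ex_mul (m : ℤ) {ω t y σ : ℂ} (hω : theta ω σ ≠ 0) :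
    ex (m * y) * kr (ω - m * σ) (t - y) σ = ex (m * t) * kr ω (t - y) σ := by
  rw [kr_sub_int_mul ω _ m hω, ← mul_assoc, ← ex_add]
  ring_nf

lemma norm_ex_int_mul_le (m : ℤ) {t : ℂ} {B : ℝ} (h : |t.im| ≤ B) :
    ‖ex (m * t)‖ ≤ Real.exp (2 * π * B * |(m : ℝ)|) := by
  rw [norm_ex, Real.exp_le_exp, mul_im, intCast_re, intCast_im, zero_mul, add_zero]
  have h1 : -(m * t.im) ≤ |(m : ℝ)| * B := by
    refine (neg_le_abs _).trans ?_
    rw [abs_mul]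
    exact mul_le_mul_of_nonneg_left h (abs_nonneg _)
  nlinarith [Real.pi_pos]

/-- The double integrals grow at most exponentially under shifts of `ω` by multiples of `σ`. -/
lemma exists_norm_krDouble_le {k g : ℂ → ℂ} {α β B : ℝ} (hαβ : α < β)
    (hB : ∀ t ∈ strip α β, |t.im| ≤ B) (hg : ContinuousOn g (strip α β)) {ω σ b : ℂ}
    (hσ : 0 < σ.im) (hω : theta ω σ ≠ 0)
    (hb : ∀ s ∈ Icc (0 : ℝ) 1, b + s * (b + σ - b) ∈ strip α (β + σ.im))
    (hk : ContinuousOn (fun s : ℝ => k (b + s * (b + σ - b))) (Icc 0 1)) :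
    ∃ C, ∀ m : ℤ, ‖krDouble (fun y => ex (m * y) * k y) g (ω - m * σ) σ α β b‖ ≤
      C * Real.exp (2 * π * B * |(m : ℝ)|) := by
  set y : ℝ → ℂ := fun s => b + s * (b + σ - b) with hy
  have hyc : Continuous y := by fun_prop
  set c : ℝ → ℂ := fun s => I * krLev σ α β (y s) with hc
  have hcc : Continuous c := by
    have : Continuous fun s => krLev σ α β (y s) := by unfold krLev; fun_prop
    fun_prop
  have hθ := (differentiable_theta hσ).continuous
  have hmem : ∀ s ∈ Icc (0 : ℝ) 1, ∀ x : ℝ, c s + x ∈ strip α β := fun s hs x =>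
    strip_add_real (krLev_spec hσ hαβ (hb s hs)).1 x
  have hΦ : ContinuousOn (fun q : ℝ × ℝ => k (y q.1) * (g (c q.1 + q.2) *
      kr ω (c q.1 + q.2 - y q.1) σ)) (Icc 0 1 ×ˢ Icc 0 1) := by
    refine ContinuousOn.mul (hk.comp continuousOn_fst fun q hq => hq.1) (ContinuousOn.mul
      (hg.comp (by fun_prop) fun q hq => hmem q.1 hq.1 q.2) ?_)
    unfold kr
    refine ContinuousOn.div (by fun_prop) (by fun_prop) fun q hq => mul_ne_zero hω ?_
    have := (krLev_spec hσ hαβ (hb q.1 hq.1)).2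
    apply theta_sub_ne_zero hσ
    · rw [add_im (c q.1), ofReal_im, add_zero]; exact this.1
    · rw [add_im (c q.1), ofReal_im, add_zero]; exact this.2
  obtain ⟨M, hM⟩ := (isCompact_Icc.prod isCompact_Icc).exists_bound_of_continuousOn hΦ
  refine ⟨‖b + σ - b‖ * M, fun m => ?_⟩
  have hI : ∀ s ∈ Icc (0 : ℝ) 1, ‖ex (m * y s) * k (y s) * krLine g (ω - m * σ) σ α β (y s)‖ ≤
      M * Real.exp (2 * π * B * |(m : ℝ)|) := by
    intro s hs
    have e : ex (m * y s) * k (y s) * krLine g (ω - m * σ) σ α β (y s) =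
        ∫ x in (0 : ℝ)..1, ex (m * (c s + x)) * (k (y s) * (g (c s + x) *
          kr ω (c s + x - y s) σ)) := by
      rw [krLine, krInt, lineInt, ← intervalIntegral.integral_const_mul]
      refine intervalIntegral.integral_congr fun x _ => ?_
      have := kr_eq_ex_mul m (t := c s + x) (y := y s) hω
      simp only [hc] at this ⊢
      linear_combination k (y s) * g (I * krLev σ α β (y s) + x) * this
    rw [e]
    refine (intervalIntegral.norm_integral_le_of_norm_le_const
      (C := M * Real.exp (2 * π * B * |(m : ℝ)|)) fun x hx => ?_).trans (by simp)
    rw [uIoc_of_le zero_le_one] at hx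
    rw [norm_mul, mul_comm]
    have h1 := hM (s, x) ⟨hs, Ioc_subset_Icc_self hx⟩
    exact mul_le_mul h1 (norm_ex_int_mul_le m (hB _ (hmem s hs x))) (norm_nonneg _)
      ((norm_nonneg _).trans h1)
  rw [krDouble, segInt, norm_mul, mul_assoc]
  refine mul_le_mul_of_nonneg_left ?_ (norm_nonneg _)
  refine (intervalIntegral.norm_integral_le_of_norm_le_const
    (C := M * Real.exp (2 * π * B * |(m : ℝ)|)) fun s hs => ?_).trans (by simp)
  rw [uIoc_of_le zero_le_one] at hs
  exact hI s (Ioc_subset_Icc_self hs)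

lemma exists_norm_dbl_le {τ σ a ω : ℂ} (hτ : 0 < τ.im) (hσ : 0 < σ.im) (hτσ : 0 < (-τ / σ).im)
    (lam ell : ℂ) (h1 : |a.im| < 1 / 4 * τ.im) (h2 : |(a / σ).im| < 1 / 4 * (-τ / σ).im)
    (hω : theta ω σ ≠ 0) : ∃ C, ∀ m : ℤ, ‖dbl τ σ lam ell a (ω - m * σ)‖ ≤
      C * Real.exp (2 * π * (3 / 4 * τ.im) * |(m : ℝ)|) := by
  have hσ0 : σ ≠ 0 := by rintro rfl; simp at hσ
  obtain ⟨h1l, h1r⟩ := abs_lt.1 h1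
  obtain ⟨h2l, h2r⟩ := abs_lt.1 h2
  have hk : ∀ m : ℤ, kA τ σ ell a (ω - m * σ) = fun y => ex (m * y) * kA τ σ ell a ω y := by
    intro m
    funext y
    rw [kA, kA, facY, facY]
    have : expπ ((y ^ 2 - 2 * (ω - m * σ + a) * y) / σ) = ex (m * y) *
        expπ ((y ^ 2 - 2 * (ω + a) * y) / σ) := by
      rw [ex, ← exp_add]
      congr 1
      field_simp
      ring
    rw [this]
    ring
  simp only [dbl, hk]
  refine exists_norm_krDouble_le (by linarith) (fun t ht => ?_)
    (((differentiableOn_gA hτ hσ lam a).continuousOn).mono fun t ht => ?_) hσ hω (fun s hs => ?_) ?_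
  · rw [abs_le]; constructor <;> linarith [ht.1, ht.2]
  · exact ⟨by linarith [ht.1], by linarith [ht.2]⟩
  · have e : (-τ / 2 + s * (-τ / 2 + σ - -τ / 2)).im = -τ.im / 2 + s * σ.im := by
      rw [add_sub_cancel_left]; simp
    constructor <;> rw [e] <;> nlinarith [hs.1, hs.2]
  · refine (differentiableOn_kA hσ hτσ ell a ω).continuousOn.comp (by fun_prop) fun s hs => ?_
    have e : ((-τ / 2 + s * (-τ / 2 + σ - -τ / 2)) / σ).im = 1 / 2 * (-τ / σ).im := by
      rw [add_sub_cancel_left, add_div, mul_div_assoc, div_self hσ0, mul_one, add_im, ofReal_im,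
        add_zero, show -τ / 2 / σ = ((1 / 2 : ℝ) : ℂ) * (-τ / σ) by push_cast; ring, im_ofReal_mul]
    constructor <;> rw [e] <;> linarith

lemma summable_exp_quad_abs {T : ℝ} (hT : 0 < T) (S : ℝ) :
    Summable fun m : ℤ => Real.exp (-π * (T * (m : ℝ) ^ 2 - 2 * S * |(m : ℝ)|)) := by
  have := summable_pow_mul_jacobiTheta₂_term_bound S hT 0
  simpa using this

/-! ### Symmetries of the hypergeometric function at special points -/

lemma polA_comm (τ σ : ℂ) : polA τ σ = polA σ τ := by
  ext a
  constructor <;> rintro ⟨l, m, n, h⟩ <;> exact ⟨l, n, m, by linear_combination h⟩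

lemma regInt_swap {τ σ a : ℂ} (hτ : 0 < τ.im) (hσ : 0 < σ.im) (ha : a ∉ polA τ σ)
    {F : ℂ → ℂ} (hF : PerEntire F) : regInt τ σ a F = regInt σ τ a F := by
  have hO : IsOpen (univ \ polA τ σ) := isOpen_univ.inter (isOpen_compl_polA hτ hσ)
  have hN : NiceOn ((univ \ polA τ σ) ×ˢ univ) fun q => F q.2 :=
    NiceOn.ofVar (V := univ) hF.1.differentiableOn fun _ _ => mem_univ _
  have hD : ∀ τ' σ' : ℂ, 0 < τ'.im → 0 < σ'.im → polA τ' σ' = polA τ σ →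
      HolOn (fun a => regInt τ' σ' a F) (univ \ polA τ σ) := fun τ' σ' h1 h2 h =>
    differentiableOn_regInt hO (a := fun a => a) (differentiableOn_const τ')
      (differentiableOn_const σ') differentiableOn_id (fun _ _ => h1) (fun _ _ => h2)
      (fun w hw => h ▸ hw.2) hN fun w _ t => hF.2 t
  refine eqOn_diff_countable isOpen_univ convex_univ (polA_countable τ σ) hO (hD τ σ hτ hσ rfl)
    (hD σ τ hσ hτ (polA_comm σ τ)) (V := {a | 0 < a.im}) (isOpen_lt continuous_const continuous_im)
    ⟨I, by simp, mem_univ _⟩ (fun z hz => ?_) ⟨mem_univ _, ha⟩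
  simp only [regInt_of_pos hτ hσ hz.1 hF, regInt_of_pos hσ hτ hz.1 hF, kerK_swap τ σ]

/-- The value of `u` does not change when `λ = -a` is replaced by `λ = a`. -/
lemma u_neg_a (mu : ℂ) {τ σ a : ℂ} (hτ : 0 < τ.im) (hσ : 0 < σ.im) (ha : a ∉ polA τ σ)
    (ha0 : a ≠ 0) : u (-a) mu τ σ (a / 2) = u a mu τ σ (a / 2) := by
  have h := regInt_shift hσ hτ (polA_comm τ σ ▸ ha) mu 0
  simp only [Int.cast_zero, zero_mul, ex_zero, mul_one, zero_sub] at h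
  have e : ∀ b, (fun t => theta (mu + t) σ * theta (b + t) τ) = thF b mu τ σ := fun b => by
    funext t; rw [thF, mul_comm]
  rw [e, e, ← regInt_swap hτ hσ ha (perEntire_thF _ _ hτ hσ),
    ← regInt_swap hτ hσ ha (perEntire_thF _ _ hτ hσ)] at h
  rw [u_eq_regInt _ _ hτ hσ ha, u_eq_regInt _ _ hτ hσ ha, h]
  have : exp (-(π * I * -a * mu) / a) * ex (-mu) = exp (-(π * I * a * mu) / a) := by
    rw [ex, ← exp_add]
    congr 1
    field_simp
    ring
  linear_combination (-1 / (thC τ * thC σ) * regInt τ σ a (thF a mu τ σ)) * this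

/-! ### The defining series -/

lemma Q_sub_int_mul (z η σ : ℂ) (n : ℤ) :
    Q (z - n * σ) σ η = ex (n ^ 2 * σ - 2 * n * z) * Q z σ η := by
  rw [Q, Q, show z - n * σ - 2 * η = z - 2 * η - n * σ by ring,
    show z - n * σ + 2 * η = z + 2 * η - n * σ by ring, theta_sub_int_mul, theta_sub_int_mul]
  have h : expπ (n + 2 * n * (z - 2 * η) - n ^ 2 * σ) *
      expπ (n + 2 * n * (z + 2 * η) - n ^ 2 * σ) * ex (n ^ 2 * σ - 2 * n * z) =
      1 := by
    rw [ex, ← exp_add, ← exp_add, exp_eq_one_iff]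
    exact ⟨n, by ring⟩
  have e := left_ne_zero_of_mul_eq_one h
  rw [mul_mul_mul_comm, ← div_div, mul_div_assoc, ← mul_div_assoc, eq_div_of_mul_eq e
    ((mul_comm _ _).trans h), div_div, div_eq_mul_inv, mul_inv]
  ring

/-- The dependence of the terms of the series on the summation index, apart from the factor `Q`
and constants, extended to complex values of the index. -/
def termV (κ : ℤ) (lam τ a x : ℂ) : ℂ := expπ ((τ + 2 * a) / (2 * κ) * x ^ 2 - lam * x) *
    regInt τ (-(κ * a)) a (thF lam (x * a) τ (-(κ * a)))

lemma term_eq {κ : ℤ} (j : ℤ) (lam : ℂ) {τ a : ℂ} (hτ : 0 < τ.im)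
    (hσ : 0 < (-(κ * a)).im) (hp : a ∉ polA τ (-(κ * a))) :
    term κ j lam τ (a / 2) = -1 / (thC τ * thC (-(κ * a))) *
      (Q (j * a) (-(κ * a)) (a / 2) * termV κ lam τ a j) := by
  have ha : a ≠ 0 := by rintro rfl; simp at hσ
  rw [term, show 2 * (a / 2) * (j : ℂ) = j * a by ring, show -2 * (a / 2) * (κ : ℂ) = -(κ * a) by
    ring, show 4 * (a / 2) = 2 * a by ring, u_eq_regInt _ _ hτ hσ hp, termV, mul_sub, exp_sub]
  have h1 : exp (-(π * I * lam * (j * a)) / a) * expπ (lam * j) = 1 := by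
    rw [← exp_add, ← exp_zero]
    congr 1
    field_simp
    ring
  have h2 := exp_ne_zero (π * I * (lam * j))
  rw [eq_div_of_mul_eq h2 h1, ← mul_assoc (π * I : ℂ) ((τ + 2 * a) / (2 * κ))]
  field_simp

/-- The series sums to one regularised integral, with a Jacobi theta function in the integrand. -/
lemma hasSum_term {κ : ℤ} (hκ : 0 < κ) (l : ℤ) (lam : ℂ) {τ a : ℂ} (hτ : 0 < τ.im)
    (hσ : 0 < (-(κ * a)).im) (hp : a ∉ polA τ (-(κ * a))) :
    HasSum (fun m : ℤ => term κ (2 * κ * m + l) lam τ (a / 2))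
      (-1 / (thC τ * thC (-(κ * a))) * (Q (l * a) (-(κ * a)) (a / 2) *
        (expπ ((τ + 2 * a) / (2 * κ) * l ^ 2 - lam * l) *
          regInt τ (-(κ * a)) a fun t => thF lam (l * a) τ (-(κ * a)) t *
            jacobiTheta₂ (2 * t + l * τ - κ * lam) (2 * κ * τ)))) := by
  have hκ0 : (κ : ℂ) ≠ 0 := by exact_mod_cast hκ.ne'
  have hT : 0 < (2 * κ * τ).im := by
    rw [show (2 * κ * τ : ℂ) = ((2 * κ : ℝ) : ℂ) * τ by push_cast; ring, im_ofReal_mul]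
    have : (0 : ℝ) < κ := by exact_mod_cast hκ
    positivity
  have hs := hasSum_regInt_jacobi hτ hσ hp (H := thF lam (l * a) τ (-(κ * a)))
    (z := fun t => 2 * t + l * τ - κ * lam) (perEntire_thF _ _ hτ hσ).1.continuous (by fun_prop) hT
  refine (((hs.mul_left _).mul_left _).mul_left _).congr_fun fun m => ?_
  rw [term_eq _ _ hτ hσ hp, termV]
  congr 1
  have e : ((2 * κ * m + l : ℤ) : ℂ) * a = l * a - (2 * m : ℤ) * (-(κ * a)) := by push_cast; ring
  rw [e, Q_sub_int_mul, mul_assoc, mul_left_comm]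
  congr 1
  rw [← regInt_const_mul, ← regInt_const_mul, ← regInt_const_mul]
  congr 1
  funext t
  rw [thF, thF, sub_add_eq_add_sub, theta_sub_int_mul, jacobiTheta₂_term]
  have h : ex ((2 * m : ℤ) ^ 2 * (-(κ * a)) - 2 * (2 * m : ℤ) * (l * a)) *
      (expπ ((τ + 2 * a) / (2 * κ) * ((2 * κ * m + l : ℤ) : ℂ) ^ 2 - lam * (2 * κ * m + l : ℤ)) *
      expπ ((2 * m : ℤ) + 2 * (2 * m : ℤ) * (l * a + t) - (2 * m : ℤ) ^ 2 * (-(κ * a)))) =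
      expπ ((τ + 2 * a) / (2 * κ) * l ^ 2 - lam * l) *
        exp (2 * π * I * m * (2 * t + l * τ - κ * lam) + π * I * m ^ 2 * (2 * κ * τ)) := by
    rw [ex, ← exp_add, ← exp_add, ← exp_add, exp_eq_exp_iff_exists_int]
    refine ⟨m, ?_⟩
    push_cast
    field_simp
    ring
  linear_combination (theta (lam + t) τ * theta (l * a + t) (-(κ * a))) * h

lemma differentiable_termV (κ : ℤ) (lam : ℂ) {τ a : ℂ} (hτ : 0 < τ.im)
    (hσ : 0 < (-(κ * a)).im) (hp : a ∉ polA τ (-(κ * a))) :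
    Differentiable ℂ (termV κ lam τ a) := by
  have hN : NiceOn (univ ×ˢ univ) fun q : ℂ × ℂ => thF lam (q.1 * a) τ (-(κ * a)) q.2 :=
    (NiceOn.theta (isOpen_univ.prod isOpen_univ) ((NiceOn.const lam).add NiceOn.var)
      (NiceOn.const τ) fun _ _ => hτ).mul (NiceOn.theta (isOpen_univ.prod isOpen_univ)
      ((NiceOn.param.mul (NiceOn.const a)).add NiceOn.var) (NiceOn.const _) fun _ _ => hσ)
  have h := differentiableOn_regInt isOpen_univ (differentiableOn_const τ)
    (differentiableOn_const (-(κ * a))) (differentiableOn_const a) (fun _ _ => hτ) (fun _ _ => hσ)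
    (fun _ _ => hp) hN fun _ _ t => (perEntire_thF _ _ hτ hσ).2 t
  unfold termV
  exact Differentiable.fun_mul (by fun_prop) (differentiableOn_univ.1 h)

/-- The residues of two neighbouring terms at a common pole cancel. -/
lemma termV_mul_theta_add {κ : ℤ} (lam : ℂ) {τ a : ℂ} (hτ : 0 < τ.im)
    (hσ : 0 < (-(κ * a)).im) (hp : a ∉ polA τ (-(κ * a))) (m : ℤ) :
    termV κ lam τ a (κ * m + 1) * theta ((κ * m - 2) * a) (-(κ * a)) +
      termV κ lam τ a (κ * m - 1) * theta ((κ * m + 2) * a) (-(κ * a)) = 0 := by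
  have hκ : (κ : ℂ) ≠ 0 := by rintro h; simp [h] at hσ
  have hV : ∀ b t : ℂ, thF lam ((κ * m + b) * a) τ (-(κ * a)) t =
      expπ (m + 2 * m * (b * a) - m ^ 2 * (-(κ * a))) *
        (theta (lam + t) τ * theta (b * a + t) (-(κ * a)) * ex (m * t)) := by
    intro b t
    rw [thF, show (κ * m + b) * a + t = b * a + t - m * (-(κ * a)) by ring, theta_sub_int_mul]
    have : expπ (m + 2 * m * (b * a + t) - m ^ 2 * (-(κ * a))) =
        expπ (m + 2 * m * (b * a) - m ^ 2 * (-(κ * a))) * ex (m * t) := by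
      rw [ex, ← exp_add]; ring_nf
    rw [this]
    ring
  have e1 := funext (hV 1)
  have e2 := funext (hV (-1))
  rw [← sub_eq_add_neg] at e2
  simp only [neg_one_mul, one_mul] at e1 e2
  have e3 := theta_sub_int_mul (2 * a) m (-(κ * a))
  have e4 := theta_sub_int_mul (-(2 * a)) m (-(κ * a))
  rw [theta_neg] at e4
  rw [termV, termV, show thF lam ((κ * m + 1) * a) τ (-(κ * a)) = _ from e1,
    show thF lam ((κ * m - 1) * a) τ (-(κ * a)) = _ from e2, regInt_const_mul, regInt_const_mul,
    regInt_shift hτ hσ hp, show (κ * m - 2) * a = -(2 * a) - m * (-(κ * a)) by ring,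
    show (κ * m + 2) * a = 2 * a - m * (-(κ * a)) by ring, e3, e4]
  have key : expπ ((τ + 2 * a) / (2 * κ) * (κ * m + 1) ^ 2 - lam * (κ * m + 1)) *
      expπ (m + 2 * m * a - m ^ 2 * (-(κ * a))) *
      expπ (m + 2 * m * (-(2 * a)) - m ^ 2 * (-(κ * a))) =
      expπ ((τ + 2 * a) / (2 * κ) * (κ * m - 1) ^ 2 - lam * (κ * m - 1)) *
      expπ (m + 2 * m * (-a) - m ^ 2 * (-(κ * a))) * ex (m * τ - lam) *
      expπ (m + 2 * m * (2 * a) - m ^ 2 * (-(κ * a))) := by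
    rw [ex, ← exp_add, ← exp_add, ← exp_add, ← exp_add, ← exp_add]
    congr 1
    field_simp
    ring
  linear_combination (-theta (2 * a) (-(κ * a)) * regInt τ (-(κ * a)) a (fun t =>
    theta (lam + t) τ * theta (a + t) (-(κ * a)) * ex (m * t))) * key

/-! ### The difference of two hypergeometric functions -/

/-- The function of the index by which the transformation matrix is expressed. -/
def uDiff (κ l : ℤ) (τ σ x : ℂ) : ℂ :=
  u (x / κ) (-(l / κ)) τ σ (-1 / (2 * κ)) - u (x / κ) (l / κ) τ σ (-1 / (2 * κ))

lemma notMem_polA_neg_inv {κ : ℤ} (hκ : 4 ≤ κ) {τ σ : ℂ} (hτ : 0 < τ.im) (hσ : 0 < σ.im) :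
    (-1 / κ : ℂ) ∉ polA τ σ := by
  rintro ⟨l, m, n, h⟩
  have hκ0 : (κ : ℂ) ≠ 0 := by exact_mod_cast (by omega : κ ≠ 0)
  have h1 := congrArg Complex.im h
  rw [show (-1 / κ : ℂ) = ((-1 / κ : ℝ) : ℂ) by push_cast; ring] at h1
  simp only [add_im, mul_im, intCast_im, natCast_im, natCast_re, zero_mul, add_zero, ofReal_im,
    mul_zero, ofReal_re, zero_im, re_ofNat, im_ofNat] at h1
  have h2 : 0 ≤ (m : ℝ) * τ.im := by positivity
  have h3 : 0 ≤ (n : ℝ) * σ.im := by positivity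
  have hm : m = 0 := by
    have : (m : ℝ) * τ.im = 0 := by linarith
    simpa [hτ.ne'] using this
  have hn : n = 0 := by
    have : (n : ℝ) * σ.im = 0 := by linarith
    simpa [hσ.ne'] using this
  subst hm hn
  have h4 : (l : ℂ) * κ = 2 := by
    field_simp at h
    push_cast at h
    linear_combination h
  have h5 : l * κ = 2 := by exact_mod_cast h4
  have hl : 0 < l := by
    by_contra! hl
    nlinarith
  nlinarith

section Difference

variable {κ : ℤ} (hκ : 4 ≤ κ) (l : ℤ) {τ σ : ℂ} (hτ : 0 < τ.im) (hσ : 0 < σ.im)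

include hκ hτ hσ

lemma u_neg_inv (lam mu : ℂ) : u lam mu τ σ (-1 / (2 * κ)) = expπ (κ * lam * mu) *
    (-1 / (thC τ * thC σ) * regInt τ σ (-1 / κ) (thF lam mu τ σ)) := by
  have hκ0 : (κ : ℂ) ≠ 0 := by exact_mod_cast (by omega : κ ≠ 0)
  rw [show (-1 / (2 * κ) : ℂ) = -1 / κ / 2 by field_simp,
    u_eq_regInt _ _ hτ hσ (notMem_polA_neg_inv hκ hτ hσ)]
  congr 2
  field_simp

lemma uDiff_neg (x : ℂ) : uDiff κ l τ σ (-x) = -uDiff κ l τ σ x := by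
  have h := fun mu => u_neg_neg (x / κ) mu hτ hσ (notMem_polA_neg_inv hκ hτ hσ)
  have e : (-1 / (2 * κ) : ℂ) = -1 / κ / 2 := by
    have hκ0 : (κ : ℂ) ≠ 0 := by exact_mod_cast (by omega : κ ≠ 0)
    field_simp
  have h2 := h (-(l / κ))
  rw [neg_neg] at h2
  rw [uDiff, uDiff, e, neg_div (κ : ℂ), h, h2]
  ring

lemma uDiff_zero : uDiff κ l τ σ 0 = 0 := by
  have := uDiff_neg hκ l hτ hσ 0
  rw [neg_zero] at this
  linear_combination (1 / 2) * this

lemma uDiff_one : uDiff κ l τ σ 1 = 0 := by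
  have hκ0 : (κ : ℂ) ≠ 0 := by exact_mod_cast (by omega : κ ≠ 0)
  have hp := notMem_polA_neg_inv hκ hτ hσ
  have e : (-1 / (2 * κ) : ℂ) = -1 / κ / 2 := by field_simp
  have e2 : (1 / κ : ℂ) = -(-1 / κ) := by ring
  have h := u_neg_neg (-(-1 / κ)) (l / κ) hτ hσ hp
  rw [neg_neg] at h
  rw [uDiff, e, e2, ← h, u_neg_a _ hτ hσ hp (by simp [hκ0]), sub_self]

lemma uDiff_add (x : ℂ) : uDiff κ l τ σ (x + κ) = -expπ l * uDiff κ l τ σ x := by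
  have hκ0 : (κ : ℂ) ≠ 0 := by exact_mod_cast (by omega : κ ≠ 0)
  have h : ∀ mu, thF (x / κ + 1) mu τ σ = fun t => -1 * thF (x / κ) mu τ σ t := fun mu => by
    funext t
    rw [thF, thF, add_right_comm, theta_add_one]
    ring
  have e1 : expπ (κ * (x / κ + 1) * (l / κ)) = expπ l * expπ (κ * (x / κ) * (l / κ)) := by
    rw [← exp_add]
    congr 1
    field_simp
    ring
  have e2 : expπ (κ * (x / κ + 1) * -(l / κ)) = expπ l * expπ (κ * (x / κ) * -(l / κ)) := by
    rw [← exp_add, exp_eq_exp_iff_exists_int]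
    refine ⟨-l, ?_⟩
    push_cast
    field_simp
    ring
  rw [uDiff, uDiff, add_div, div_self hκ0]
  simp only [u_neg_inv hκ hτ hσ, h, regInt_const_mul, e1, e2]
  ring

lemma exists_uDiff_add_mul (m : ℤ) : ∃ s, ∀ x, uDiff κ l τ σ (κ * m + x) = s * uDiff κ l τ σ x := by
  have h0 := neg_ne_zero.2 (exp_ne_zero (π * I * l))
  refine ⟨(-expπ l) ^ m, fun x => ?_⟩
  induction m with
  | zero => simp
  | succ n ih =>
    rw [show κ * ((n + 1 : ℤ) : ℂ) + x = κ * (n : ℤ) + x + κ by push_cast; ring,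
      uDiff_add hκ l hτ hσ, ih, zpow_add_one₀ h0]
    ring
  | pred n ih =>
    have h := uDiff_add hκ l hτ hσ (κ * ((-n - 1 : ℤ) : ℂ) + x)
    rw [show κ * ((-n - 1 : ℤ) : ℂ) + x + κ = κ * ((-n : ℤ) : ℂ) + x by push_cast; ring, ih] at h
    rw [← mul_right_inj' h0, ← h, ← mul_assoc, ← zpow_one_add₀ h0]
    ring_nf

lemma uDiff_add_two_mul (m : ℤ) (x : ℂ) : uDiff κ l τ σ (2 * κ * m + x) = uDiff κ l τ σ x := by
  have h1 : ∀ x, uDiff κ l τ σ (x + 2 * κ) = uDiff κ l τ σ x := fun x => by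
    have : expπ l * expπ l = 1 := by
      rw [← exp_add, exp_eq_one_iff]
      exact ⟨l, by ring⟩
    rw [show x + 2 * κ = x + κ + κ by ring, uDiff_add hκ l hτ hσ, uDiff_add hκ l hτ hσ]
    linear_combination (uDiff κ l τ σ x) * this
  induction m with
  | zero => simp
  | succ n ih =>
    rw [← ih, ← h1 (2 * κ * ((n : ℤ) : ℂ) + x)]
    congr 1
    push_cast
    ring
  | pred n ih =>
    rw [← ih, ← h1 (2 * κ * ((-n - 1 : ℤ) : ℂ) + x)]
    congr 1
    push_cast
    ring

lemma differentiable_uDiff : Differentiable ℂ (uDiff κ l τ σ) := by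
  have h : ∀ mu, Differentiable ℂ fun x => u (x / κ) mu τ σ (-1 / (2 * κ)) := by
    intro mu
    have hN : NiceOn (univ ×ˢ univ) fun q : ℂ × ℂ => thF (q.1 / κ) mu τ σ q.2 := by
      have h1 : NiceOn (univ ×ˢ univ) fun q : ℂ × ℂ => q.1 / κ := by
        simp only [div_eq_mul_inv]
        exact NiceOn.param.mul (NiceOn.const _)
      exact (NiceOn.theta (isOpen_univ.prod isOpen_univ) (h1.add NiceOn.var) (NiceOn.const τ)
        fun _ _ => hτ).mul (NiceOn.theta (isOpen_univ.prod isOpen_univ)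
        ((NiceOn.const mu).add NiceOn.var) (NiceOn.const _) fun _ _ => hσ)
    have h := differentiableOn_regInt isOpen_univ (differentiableOn_const τ)
      (differentiableOn_const σ) (differentiableOn_const (-1 / κ : ℂ)) (fun _ _ => hτ)
      (fun _ _ => hσ) (fun _ _ => notMem_polA_neg_inv hκ hτ hσ) hN
      fun _ _ t => (perEntire_thF _ _ hτ hσ).2 t
    simp only [u_neg_inv hκ hτ hσ]
    exact Differentiable.fun_mul (by fun_prop) ((differentiableOn_univ.1 h).const_mul _)
  exact (h _).sub (h _)

end Difference

/-! ### Telescoping -/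

lemma sum_range_sub_add_two (A : ℕ → ℂ) (n : ℕ) :
    ∑ i ∈ Finset.range n, (A i - A (i + 2)) = A 0 + A 1 - A n - A (n + 1) := by
  induction n with
  | zero => simp
  | succ n ih => rw [Finset.sum_range_succ, ih]; ring

lemma tsum_sub_succ {B : ℤ → ℂ} (hB : Summable B) : ∑' k, (B k - B (k + 1)) = 0 := by
  have h1 : Summable fun k : ℤ => B (k + 1) := (Equiv.addRight (1 : ℤ)).summable_iff.2 hB
  have h2 : ∑' k, B (k + 1) = ∑' k, B k := (Equiv.addRight (1 : ℤ)).tsum_eq B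
  rw [hB.tsum_sub h1, h2, sub_self]

/-- A telescoping sum in steps of two which is interrupted at the multiples of `κ`: the two terms
next to such a multiple telescope only together. -/
lemma tsum_eq_zero_of_telescope {κ : ℤ} (hκ : 4 ≤ κ) {f A : ℤ → ℂ} (hf : Summable f)
    (h1 : Summable fun m => A (κ * m + 1)) (h2 : Summable fun m => A (κ * m + 2))
    (h : ∀ x : ℤ, ¬ κ ∣ x - 1 → ¬ κ ∣ x + 1 → f x = A (x - 1) - A (x + 1))
    (hpm : ∀ m : ℤ, f (κ * m - 1) + f (κ * m + 1) = A (κ * m - 2) - A (κ * m + 2)) :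
    ∑' n, f n = 0 := by
  obtain ⟨N, rfl⟩ : ∃ N : ℕ, κ = N + 3 := ⟨(κ - 3).toNat, by omega⟩
  have hN : 1 ≤ N := by omega
  have hdvd : ∀ k : ℤ, ∀ i : ℤ, 1 ≤ i → i < N + 3 → ¬ ((N : ℤ) + 3) ∣ (N + 3) * k + i := by
    rintro k i hi hi2 hd
    have := Int.le_of_dvd (by omega) ((Int.dvd_add_right (dvd_mul_right _ k)).1 hd)
    omega
  set B : ℤ → ℂ := fun k => A ((N + 3) * k + 1) + A ((N + 3) * k + 2) with hB
  have hf2 : Summable fun n => f (n + 2) := (Equiv.addRight (2 : ℤ)).summable_iff.2 hf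
  have hblock : ∀ k : ℤ, ∑ i : Fin (N + 3), f (((N + 3 : ℕ) : ℤ) * k + (i : ℕ) + 2) =
      B k - B (k + 1) := by
    intro k
    rw [Fin.sum_univ_eq_sum_range (fun i => f (((N + 3 : ℕ) : ℤ) * k + (i : ℕ) + 2)),
      Finset.sum_range_succ, Finset.sum_range_succ, Finset.sum_range_succ]
    have e1 : ∑ i ∈ Finset.range N, f (((N + 3 : ℕ) : ℤ) * k + (i : ℕ) + 2) =
        ∑ i ∈ Finset.range N, ((fun i : ℕ => A ((N + 3) * k + i + 1)) i -
          (fun i : ℕ => A ((N + 3) * k + i + 1)) (i + 2)) := by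
      refine Finset.sum_congr rfl fun i hi => ?_
      have hi' := Finset.mem_range.1 hi
      push_cast
      rw [h, show ((N : ℤ) + 3) * k + i + 2 - 1 = (N + 3) * k + i + 1 by ring,
        show ((N : ℤ) + 3) * k + i + 2 + 1 = (N + 3) * k + (i + 2) + 1 by ring]
      · rw [show ((N : ℤ) + 3) * k + i + 2 - 1 = (N + 3) * k + (i + 1) by ring]
        exact hdvd k _ (by omega) (by omega)
      · rw [show ((N : ℤ) + 3) * k + i + 2 + 1 = (N + 3) * k + (i + 3) by ring]
        rcases Nat.lt_or_ge (i + 3) (N + 3) with h3 | h3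
        · exact hdvd k _ (by omega) (by omega)
        · omega
    rw [e1, sum_range_sub_add_two]
    have e2 := hpm (k + 1)
    have e3 : f (((N : ℤ) + 3) * (k + 1)) = A ((N + 3) * (k + 1) - 1) - A ((N + 3) * (k + 1) + 1) := by
      refine h _ ?_ ?_
      · rw [show ((N : ℤ) + 3) * (k + 1) - 1 = (N + 3) * k + (N + 2) by ring]
        exact hdvd k _ (by omega) (by omega)
      · exact hdvd (k + 1) _ (by omega) (by omega)
    simp only [hB]
    push_cast
    rw [show ((N : ℤ) + 3) * k + N + 2 = (N + 3) * (k + 1) - 1 by ring,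
      show ((N : ℤ) + 3) * k + (N + 1) + 2 = (N + 3) * (k + 1) by ring,
      show ((N : ℤ) + 3) * k + (N + 2) + 2 = (N + 3) * (k + 1) + 1 by ring,
      show ((N : ℤ) + 3) * k + N + 1 = (N + 3) * (k + 1) - 2 by ring,
      show ((N : ℤ) + 3) * k + (N + 1) + 1 = (N + 3) * (k + 1) - 1 by ring,
      show ((N : ℤ) + 3) * k + 0 + 1 = (N + 3) * k + 1 by ring,
      show ((N : ℤ) + 3) * k + 1 + 1 = (N + 3) * k + 2 by ring]
    linear_combination e2 + e3
  have hinj : ∀ i : Fin (N + 3), Summable fun k : ℤ => f (((N + 3 : ℕ) : ℤ) * k + (i : ℕ) + 2) :=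
    fun i => hf2.comp_injective (i := fun k : ℤ => ((N + 3 : ℕ) : ℤ) * k + (i : ℕ)) fun x y hxy => by
      have : ((N + 3 : ℕ) : ℤ) * x = ((N + 3 : ℕ) : ℤ) * y := by simpa using hxy
      exact mul_left_cancel₀ (by positivity) this
  rw [← (Equiv.addRight (2 : ℤ)).tsum_eq f]
  simp only [Equiv.coe_addRight]
  rw [tsum_int_mod (m := N + 3) hf2, ← Summable.tsum_finsetSum fun i _ => hinj i]
  simp only [hblock]
  exact tsum_sub_succ (h1.add h2)

/-! ### The neighbourhood of a pole -/

lemma tendsto_div_of_hasDerivAt {f g : ℂ → ℂ} {f' g' : ℂ} (hf : HasDerivAt f f' 0)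
    (hg : HasDerivAt g g' 0) (hf0 : f 0 = 0) (hg0 : g 0 = 0) (hg' : g' ≠ 0) :
    Tendsto (fun x => f x / g x) (𝓝[≠] 0) (𝓝 (f' / g')) := by
  have h1 := hasDerivAt_iff_tendsto_slope.1 hf
  have h2 := hasDerivAt_iff_tendsto_slope.1 hg
  refine (h1.div h2 hg').congr' ?_
  filter_upwards [self_mem_nhdsWithin] with x hx
  have hx : x ≠ 0 := hx
  rw [Pi.div_apply, slope_def_field, slope_def_field, hf0, hg0, sub_zero, sub_zero, sub_zero]
  field_simp

lemma deriv_theta_zero_ne_zero {σ : ℂ} (hσ : 0 < σ.im) : deriv (fun z => theta z σ) 0 ≠ 0 := by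
  rw [deriv_theta_zero hσ]
  have := thC_ne_zero hσ
  have h2 := P1_ne_zero_of_pos hσ hσ
  have h3 : (π : ℂ) ≠ 0 := by exact_mod_cast Real.pi_ne_zero
  simp [this, h2, h3]

lemma theta_mul_ne_zero {κ : ℤ} {a : ℂ} (hκ : 0 < κ) (ha : a.im < 0) {j : ℤ} (hj : ¬ κ ∣ j) :
    theta (j * a) (-(κ * a)) ≠ 0 := by
  have hσ : 0 < (-(κ * a)).im := by
    have : (0 : ℝ) < κ := by exact_mod_cast hκ
    rw [neg_im, ← ofReal_intCast, im_ofReal_mul]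
    nlinarith
  refine theta_ne_zero hσ fun m n h => hj ⟨-n, ?_⟩
  have h1 := congrArg Complex.im h
  simp only [mul_im, intCast_re, intCast_im, add_im, neg_im, neg_re, zero_mul, add_zero, zero_add] at h1
  have h2 : (j + n * κ : ℝ) * a.im = 0 := by linear_combination h1
  have h3 : (j + n * κ : ℝ) = 0 := by simpa [ha.ne] using h2
  have h4 : j + n * κ = 0 := by exact_mod_cast h3
  linear_combination h4

/-- The terms which have a pole next to a multiple of `κ` cancel in the limit. -/
lemma tendsto_terms_add {κ : ℤ} (hκ : 4 ≤ κ) (lam : ℂ) {τ a : ℂ} (hτ : 0 < τ.im) (ha : a.im < 0)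
    (hσ : 0 < (-(κ * a)).im) (hp : a ∉ polA τ (-(κ * a))) (l : ℤ) {τ' σ' : ℂ} (hτ' : 0 < τ'.im)
    (hσ' : 0 < σ'.im) (m : ℤ) :
    Tendsto (fun ε : ℂ =>
      Q ((κ * m + 1 + ε) * a) (-(κ * a)) (a / 2) * termV κ lam τ a (κ * m + 1 + ε) *
        uDiff κ l τ' σ' (κ * m + 1 + ε) +
      Q ((κ * m - 1 + ε) * a) (-(κ * a)) (a / 2) * termV κ lam τ a (κ * m - 1 + ε) *
        uDiff κ l τ' σ' (κ * m - 1 + ε)) (𝓝[≠] 0) (𝓝 0) := by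
  have ha0 : a ≠ 0 := by rintro rfl; simp at ha
  set σ := -(κ * a) with hσdef
  set V := termV κ lam τ a with hV
  set w := uDiff κ l τ' σ' with hw
  have hVc : Continuous V := (differentiable_termV κ lam hτ hσ hp).continuous
  have hwd : Differentiable ℂ w := differentiable_uDiff hκ l hτ' hσ'
  have hθd := differentiable_theta hσ
  have hθc := hθd.continuous
  have hg : HasDerivAt (fun ε : ℂ => theta (ε * a) σ) (deriv (fun z => theta z σ) 0 * a) 0 := by
    have h1 : HasDerivAt (fun z => theta z σ) (deriv (fun z => theta z σ) 0) (0 * a) := by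
      rw [zero_mul]; exact (hθd 0).hasDerivAt
    exact HasDerivAt.comp (h₂ := fun z => theta z σ) (h := fun ε : ℂ => ε * a) (0 : ℂ) h1
      (hasDerivAt_mul_const a)
  have hg0 : theta (0 * a) σ = 0 := by rw [zero_mul, theta_zero]
  have hw1 : HasDerivAt (fun ε => w (1 + ε)) (deriv w 1) 0 := by
    have h1 : HasDerivAt w (deriv w 1) (1 + 0) := by rw [add_zero]; exact (hwd 1).hasDerivAt
    exact h1.comp_const_add 1 0
  have hodd : ∀ x, w (-x) = -w x := uDiff_neg hκ l hτ' hσ'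
  have hw2 : HasDerivAt (fun ε => w (-1 + ε)) (deriv w 1) 0 := by
    have h1 : HasDerivAt w (deriv w 1) (1 - 0) := by rw [sub_zero]; exact (hwd 1).hasDerivAt
    have h2 := (h1.comp_const_sub 1 0).fun_neg
    rw [neg_neg] at h2
    refine h2.congr_of_eventuallyEq (Eventually.of_forall fun ε => ?_)
    simp only
    rw [← hodd]
    ring_nf
  have hone : w 1 = 0 := uDiff_one hκ l hτ' hσ'
  have hne : deriv (fun z => theta z σ) 0 * a ≠ 0 := mul_ne_zero (deriv_theta_zero_ne_zero hσ) ha0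
  have t1 := tendsto_div_of_hasDerivAt hw1 hg (by rw [add_zero, hone]) hg0 hne
  have t2 := tendsto_div_of_hasDerivAt hw2 hg (by rw [add_zero, hodd, hone, neg_zero]) hg0 hne
  have hnd : ∀ b : ℤ, b = 2 ∨ b = -2 → theta ((κ * m + b) * a) σ ≠ 0 := by
    intro b hb
    have := theta_mul_ne_zero (κ := κ) (j := κ * m + b) (by omega) ha fun hd => by
      have h1 := (Int.dvd_add_right (dvd_mul_right κ m)).1 hd
      have h2 : κ ∣ 2 := by rcases hb with rfl | rfl <;> simpa using h1
      have := Int.le_of_dvd (by norm_num) h2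
      omega
    push_cast at this
    exact this
  have n1 := hnd 2 (Or.inl rfl)
  have n2 := hnd (-2) (Or.inr rfl)
  push_cast at n1 n2
  rw [← sub_eq_add_neg] at n2
  obtain ⟨s, hs⟩ := exists_uDiff_add_mul hκ l hτ' hσ' m
  set E : ℂ → ℂ := fun ε => expπ (m + 2 * m * (ε * a) - m ^ 2 * σ) with hE
  have hE0 : ∀ ε, E ε ≠ 0 := fun ε => exp_ne_zero _
  have hc1 : Tendsto (fun ε => theta (2 * a) σ * deriv (fun z => theta z σ) 0 * s / E ε *
      (V (κ * m + 1 + ε) / theta ((κ * m + 2 + ε) * a) σ)) (𝓝[≠] 0)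
      (𝓝 (theta (2 * a) σ * deriv (fun z => theta z σ) 0 * s / E 0 *
        (V (κ * m + 1 + 0) / theta ((κ * m + 2 + 0) * a) σ))) := by
    refine (ContinuousAt.tendsto ?_).mono_left nhdsWithin_le_nhds
    refine ContinuousAt.mul (ContinuousAt.div (by fun_prop) (by fun_prop) (hE0 0))
      (ContinuousAt.div (by fun_prop) (by fun_prop) (by rwa [add_zero]))
  have hc2 : Tendsto (fun ε => theta (2 * a) σ * deriv (fun z => theta z σ) 0 * s / E ε *
      (V (κ * m - 1 + ε) / theta ((κ * m - 2 + ε) * a) σ)) (𝓝[≠] 0)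
      (𝓝 (theta (2 * a) σ * deriv (fun z => theta z σ) 0 * s / E 0 *
        (V (κ * m - 1 + 0) / theta ((κ * m - 2 + 0) * a) σ))) := by
    refine (ContinuousAt.tendsto ?_).mono_left nhdsWithin_le_nhds
    refine ContinuousAt.mul (ContinuousAt.div (by fun_prop) (by fun_prop) (hE0 0))
      (ContinuousAt.div (by fun_prop) (by fun_prop) (by rwa [add_zero]))
  have hlim := (hc1.mul t1).add (hc2.mul t2)
  have hz := termV_mul_theta_add lam hτ hσ hp m
  rw [← hV] at hz
  have hlim0 : theta (2 * a) σ * deriv (fun z => theta z σ) 0 * s / E 0 *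
      (V (κ * m + 1 + 0) / theta ((κ * m + 2 + 0) * a) σ) *
        (deriv w 1 / (deriv (fun z => theta z σ) 0 * a)) +
      theta (2 * a) σ * deriv (fun z => theta z σ) 0 * s / E 0 *
      (V (κ * m - 1 + 0) / theta ((κ * m - 2 + 0) * a) σ) *
        (deriv w 1 / (deriv (fun z => theta z σ) 0 * a)) = 0 := by
    rw [← add_mul, ← mul_add, add_zero, add_zero, add_zero, add_zero, div_add_div _ _ n1 n2,
      mul_comm (theta _ σ) (V (κ * m - 1)), hz]
    simp
  rw [hlim0] at hlim
  refine hlim.congr fun ε => ?_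
  have hthE : theta ((κ * m + ε) * a) σ = E ε * theta (ε * a) σ := by
    rw [hE, ← theta_sub_int_mul]
    congr 1
    rw [hσdef]
    ring
  rw [Q, Q, show 4 * (a / 2) = 2 * a by ring,
    show (κ * m + 1 + ε) * a - 2 * (a / 2) = (κ * m + ε) * a by ring,
    show (κ * m + 1 + ε) * a + 2 * (a / 2) = (κ * m + 2 + ε) * a by ring,
    show (κ * m - 1 + ε) * a - 2 * (a / 2) = (κ * m - 2 + ε) * a by ring,
    show (κ * m - 1 + ε) * a + 2 * (a / 2) = (κ * m + ε) * a by ring, hthE,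
    show (κ * m + 1 + ε : ℂ) = κ * m + (1 + ε) by ring,
    show (κ * m - 1 + ε : ℂ) = κ * m + (-1 + ε) by ring, hw, hs, hs]
  simp only [div_eq_mul_inv, mul_inv]
  ring

/-! ### The product formula along arithmetic progressions -/

/-- The conditions on `a` under which the product formula is summed, with `σ = -κ a`. -/
structure SumRegion (κ : ℤ) (c s : ℝ) (τ a : ℂ) : Prop where
  four_le : 4 ≤ κ
  c_pos : 0 < c
  s_pos : 0 < s
  s_lt : s < 1 / 4
  im_τ : 0 < τ.im
  im_a : a.im < 0
  im_div : 0 < (-(κ * a) / τ).im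
  le_τ : 4 * c * s ≤ (-1 / τ).im
  le_σ : 4 * c * s ≤ (-(κ * a) / τ).im
  start : ∃ b ∈ contReg c s τ (-(κ * a)), 0 < b.im ∧ 0 < (b / -(κ * a)).im ∧ 2 * c * s < (b / τ).im
  mem : a ∈ contReg c s τ (-(κ * a))
  notMem : a ∉ polA τ (-(κ * a))

lemma im_neg_mul_pos {κ : ℤ} (hκ : 4 ≤ κ) {a : ℂ} (ha : a.im < 0) : 0 < (-(κ * a)).im := by
  have : (4 : ℝ) ≤ κ := by exact_mod_cast hκ
  rw [neg_im, ← ofReal_intCast, im_ofReal_mul]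
  nlinarith

section Progression

variable (κ : ℤ) (c s : ℝ) (lam ell τ a x : ℂ)

/-- The exponential factor which turns the product formula into a telescoping relation. -/
def expX : ℂ := expπ (τ / (2 * κ) * x ^ 2 - lam * x + ell * x)

/-- The telescoping part of the product formula at `ν = x a`. -/
def dblX : ℂ := expX κ lam ell τ (x + 1) * dbl τ (-(κ * a)) lam ell a (x * a)

/-- The remaining integral in the product formula at `ν = x a`. -/
def polyX : ℂ := expX κ lam ell τ x * polyInt (fun T => kerK (-1 / τ) (-(κ * a) / τ) (a / τ) T *
  openF τ (-(κ * a)) lam ell a (x * a) T) (polyV c s)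

/-- The constant relating the product formula to the functions `u`. -/
def constK : ℂ := -(κ * a) * (thC (-1 / -(κ * a)) * thC (-τ / -(κ * a))) /
  (-I * (-I * -(κ * a)) ^ (1 / 2 : ℂ))

end Progression

lemma summable_int_of_mod {m : ℕ} [NeZero m] {f : ℤ → ℂ}
    (hf : ∀ i : Fin m, Summable fun k : ℤ => f (m * k + i)) : Summable f := by
  rw [← (Int.divModEquiv m).symm.summable_iff, ← (Equiv.prodComm (Fin m) ℤ).summable_iff,
    ← summable_norm_iff, summable_prod_of_nonneg fun _ => norm_nonneg _]
  refine ⟨fun i => ?_, (hasSum_fintype _).summable⟩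
  refine (hf i).norm.congr fun k => ?_
  simp [Int.divModEquiv, mul_comm]

section Region

variable {κ : ℤ} {c s : ℝ} {τ a : ℂ} (h : SumRegion κ c s τ a)

include h

lemma SumRegion.im_σ : 0 < (-(κ * a)).im := im_neg_mul_pos h.four_le h.im_a

lemma SumRegion.κ_ne : (κ : ℂ) ≠ 0 := by
  have := h.four_le
  exact_mod_cast (by omega : κ ≠ 0)

lemma SumRegion.a_ne : a ≠ 0 := by
  rintro rfl
  simpa using h.im_a

lemma SumRegion.im_τ2 : 0 < (-1 / -(κ * a)).im := im_neg_one_div_pos h.im_σ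

lemma SumRegion.im_σ2 : 0 < (-τ / -(κ * a)).im := im_neg_div_pos h.im_div

lemma constK_ne_zero : constK κ τ a ≠ 0 := by
  have h1 := thC_ne_zero h.im_τ2
  have h2 := thC_ne_zero h.im_σ2
  have h3 := h.κ_ne
  have h4 := h.a_ne
  exact div_ne_zero (mul_ne_zero (by simp [h3, h4]) (mul_ne_zero h1 h2)) (by simp [h3, h4])

/-- The product formula at `ν = x a`, as a telescoping relation in `x`. -/
lemma product_progression (lam ell x : ℂ) (h1 : theta ((x - 1) * a) (-(κ * a)) ≠ 0)
    (h2 : theta ((x + 1) * a) (-(κ * a)) ≠ 0) :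
    constK κ τ a * (Q (x * a) (-(κ * a)) (a / 2) * termV κ lam τ a x *
      u (x / κ) ell (-1 / -(κ * a)) (-τ / -(κ * a)) (-1 / (2 * κ))) =
    dblX κ lam ell τ a (x - 1) - dblX κ lam ell τ a (x + 1) -
      2 * π * I * τ * polyX κ c s lam ell τ a x := by
  have hσ := h.im_σ
  have hκ := h.κ_ne
  have ha := h.a_ne
  have hC1 := thC_ne_zero h.im_τ2
  have hC2 := thC_ne_zero h.im_σ2
  have e1 : a / -(κ * a) = -1 / κ := by field_simp
  have hp2 : a / -(κ * a) ∉ polA (-1 / -(κ * a)) (-τ / -(κ * a)) := by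
    rw [e1]; exact notMem_polA_neg_inv h.four_le h.im_τ2 h.im_σ2
  have main := regInt_mul_regInt h.c_pos h.s_pos h.s_lt h.im_τ hσ h.im_div h.le_τ h.le_σ h.start
    lam ell (x * a) h.mem h.notMem hp2
    (by rw [Ne, ← theta_eq_zero_iff _ hσ, ← sub_one_mul]; exact h1)
    (by rw [Ne, ← theta_eq_zero_iff _ hσ, ← add_one_mul]; exact h2)
  rw [u_neg_inv h.four_le h.im_τ2 h.im_σ2, termV, constK, dblX, dblX, polyX, sub_add_cancel]
  rw [e1, show -(x * a) / -(κ * a) = x / κ by field_simp] at main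
  have f1 : expX κ lam ell τ x * exp (-(π * I * (x * a) ^ 2 / -(κ * a))) =
      expπ ((τ + 2 * a) / (2 * κ) * x ^ 2 - lam * x) * expπ (κ * (x / κ) * ell) := by
    rw [expX, ← exp_add, ← exp_add]
    congr 1
    field_simp
    ring
  have f2 : expX κ lam ell τ (x + 1 + 1) =
      expX κ lam ell τ x * ex (ell - (x * a + a) * τ / -(κ * a) - lam) := by
    rw [expX, expX, ex, ← exp_add]
    congr 1
    field_simp
    ring
  rw [f2, sub_one_mul, add_one_mul]
  generalize (-I * -(κ * a)) ^ (1 / 2 : ℂ) = r at main ⊢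
  generalize regInt (-1 / -(κ * a)) (-τ / -(κ * a)) (-1 / κ)
    (thF (x / κ) ell (-1 / -(κ * a)) (-τ / -(κ * a))) = R2 at main ⊢
  generalize regInt τ (-(κ * a)) a (thF lam (x * a) τ (-(κ * a))) = R1 at main ⊢
  generalize dbl τ (-(κ * a)) lam ell a (x * a - a) = D1 at main ⊢
  generalize dbl τ (-(κ * a)) lam ell a (x * a + a) = D2 at main ⊢
  generalize polyInt (fun T => kerK (-1 / τ) (-(κ * a) / τ) (a / τ) T *
    openF τ (-(κ * a)) lam ell a (x * a) T) (polyV c s) = R3 at main ⊢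
  generalize thC (-1 / -(κ * a)) = C1 at hC1 ⊢
  generalize thC (-τ / -(κ * a)) = C2 at hC2 ⊢
  have e3 : ∀ A B C D E F : ℂ, A * (C1 * C2) / (-I * r) * (B * (C * R1) *
      (D * (-1 / (C1 * C2) * R2))) = A * B * R1 * (-(C * D / (-I * r)) * R2) := by
    intro A B C D E F
    field_simp
  rw [e3 _ _ _ _ 0 0, ← f1]
  linear_combination expX κ lam ell τ x * main

lemma summable_dblX (lam ell : ℂ) (r : ℤ) (hr : ¬ κ ∣ r) :
    Summable fun m : ℤ => dblX κ lam ell τ a ((κ * m + r : ℤ) : ℂ) := by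
  have hκ := h.κ_ne
  have hκ0 : (0 : ℝ) < κ := by
    have := h.four_le
    exact_mod_cast (by omega : 0 < κ)
  have hk0 : 0 < κ := by have := h.four_le; omega
  have hτ := h.im_τ
  obtain ⟨C, hC⟩ := exists_norm_dbl_le hτ h.im_σ h.im_σ2 lam ell (abs_lt.2 h.mem.2.1)
    (abs_lt.2 h.mem.2.2) (theta_mul_ne_zero hk0 h.im_a hr)
  have hC0 : 0 ≤ C := by
    have := (norm_nonneg (dbl τ (-(κ * a)) lam ell a (r * a - (0 : ℤ) * (-(κ * a))))).trans (hC 0)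
    simpa using this
  have he : ∀ m : ℤ, expX κ lam ell τ (((κ * m + r : ℤ) : ℂ) + 1) =
      expX κ lam ell τ (r + 1) * expπ (κ * τ / 2 * m ^ 2 +
        (τ * (r + 1) + κ * (ell - lam)) * m) := by
    intro m
    rw [expX, expX, ← exp_add]
    congr 1
    push_cast
    field_simp
    ring
  set d : ℂ := τ * (r + 1) + κ * (ell - lam) with hd
  have hT : 0 < κ * τ.im / 2 := by positivity
  refine Summable.of_norm_bounded (g := fun m : ℤ => ‖expX κ lam ell τ (r + 1)‖ * C *
    Real.exp (-π * (κ * τ.im / 2 * (m : ℝ) ^ 2 - 2 * (|d.im| / 2 + 3 / 4 * τ.im) *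
      |(m : ℝ)|))) ((summable_exp_quad_abs hT _).mul_left _) fun m => ?_
  have hm : ((κ * m + r : ℤ) : ℂ) * a = r * a - m * (-(κ * a)) := by push_cast; ring
  rw [dblX, he, hm, norm_mul, norm_mul, mul_assoc ‖expX κ lam ell τ (r + 1)‖,
    mul_assoc ‖expX κ lam ell τ (r + 1)‖]
  refine mul_le_mul_of_nonneg_left ?_ (norm_nonneg _)
  have h1 : ‖expπ (κ * τ / 2 * m ^ 2 + d * m)‖ ≤
      Real.exp (-π * (κ * τ.im / 2 * (m : ℝ) ^ 2 - |d.im| * |(m : ℝ)|)) := by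
    rw [norm_exp, Real.exp_le_exp]
    have e : (π * I * (κ * τ / 2 * m ^ 2 + d * m)).re =
        -π * (κ * τ.im / 2 * (m : ℝ) ^ 2 + d.im * m) := by
      rw [show (π * I * (κ * τ / 2 * m ^ 2 + d * m) : ℂ) =
        ((π : ℝ) : ℂ) * (I * (((κ / 2 * m ^ 2 : ℝ) : ℂ) * τ + ((m : ℝ) : ℂ) * d)) by
        push_cast; ring, re_ofReal_mul, I_mul_re, add_im, im_ofReal_mul, im_ofReal_mul]
      ring
    have h2 : -(d.im * m) ≤ |d.im| * |(m : ℝ)| := by rw [← abs_mul]; exact neg_le_abs _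
    rw [e]
    nlinarith [Real.pi_pos]
  refine (mul_le_mul h1 (hC m) (norm_nonneg _) (Real.exp_pos _).le).trans (le_of_eq ?_)
  rw [mul_left_comm, ← Real.exp_add]
  ring_nf

lemma differentiable_polyX (lam ell : ℂ) : Differentiable ℂ (polyX κ c s lam ell τ a) := by
  have hN : NiceOn (univ ×ˢ univ) fun q : ℂ × ℂ => openF τ (-(κ * a)) lam ell a (q.1 * a) q.2 :=
    niceOn_openF (isOpen_univ.prod isOpen_univ) h.im_τ h.im_σ2 lam ell (NiceOn.const a)
      (NiceOn.param.mul (NiceOn.const a))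
  have h1 := differentiableOn_polyInt isOpen_univ (im_neg_one_div_pos h.im_τ) h.im_div
    (differentiableOn_const (a / τ)) h.c_pos h.s_pos (by linarith [h.s_lt]) h.le_τ h.le_σ
    (fun _ _ => h.mem.1) hN
  unfold polyX expX
  exact Differentiable.fun_mul (by fun_prop) (differentiableOn_univ.1 h1)

lemma continuousAt_dblX (lam ell : ℂ) {x : ℂ} (hx : theta (x * a) (-(κ * a)) ≠ 0) :
    ContinuousAt (dblX κ lam ell τ a) x := by
  have hσ := h.im_σ
  have hθ := (differentiable_theta hσ).continuous
  have hV : IsOpen {x : ℂ | theta (x * a) (-(κ * a)) ≠ 0} :=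
    isOpen_ne_fun (by fun_prop) continuous_const
  have h1 := differentiableOn_dbl hV h.im_τ hσ h.im_σ2 (a := fun _ => a) (ω := fun x => x * a)
    (differentiableOn_const a) (by fun_prop) lam ell (fun _ _ => abs_lt.2 h.mem.2.1)
    (fun _ _ => abs_lt.2 h.mem.2.2) fun w hw h0 => hw ((theta_eq_zero_iff _ hσ).2 h0)
  have h2 := h1.continuousOn.continuousAt (hV.mem_nhds hx)
  unfold dblX expX
  exact ContinuousAt.mul (by fun_prop) h2

end Region

/-! ### Summation of the product formula -/

section Region

variable {κ : ℤ} {c s : ℝ} {τ a : ℂ} (h : SumRegion κ c s τ a)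

include h

lemma uDiff_progression (l : ℤ) (lam x : ℂ) (h1 : theta ((x - 1) * a) (-(κ * a)) ≠ 0)
    (h2 : theta ((x + 1) * a) (-(κ * a)) ≠ 0) :
    constK κ τ a * (Q (x * a) (-(κ * a)) (a / 2) * termV κ lam τ a x *
      uDiff κ l (-1 / -(κ * a)) (-τ / -(κ * a)) x) + 2 * π * I * τ *
      (polyX κ c s lam (-(l / κ)) τ a x - polyX κ c s lam (l / κ) τ a x) =
    (dblX κ lam (-(l / κ)) τ a (x - 1) - dblX κ lam (l / κ) τ a (x - 1)) -
      (dblX κ lam (-(l / κ)) τ a (x + 1) - dblX κ lam (l / κ) τ a (x + 1)) := by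
  rw [uDiff]
  linear_combination product_progression h lam (-(l / κ)) x h1 h2 -
    product_progression h lam (l / κ) x h1 h2

/-- The relation across a multiple of `κ`, where the terms of the series have poles. -/
lemma dblX_sub_dblX (l : ℤ) (lam : ℂ) (m : ℤ) :
    (dblX κ lam (-(l / κ)) τ a (κ * m - 2) - dblX κ lam (l / κ) τ a (κ * m - 2)) -
      (dblX κ lam (-(l / κ)) τ a (κ * m + 2) - dblX κ lam (l / κ) τ a (κ * m + 2)) =
    2 * π * I * τ *
      (polyX κ c s lam (-(l / κ)) τ a (κ * m - 1) - polyX κ c s lam (l / κ) τ a (κ * m - 1)) +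
    2 * π * I * τ *
      (polyX κ c s lam (-(l / κ)) τ a (κ * m + 1) - polyX κ c s lam (l / κ) τ a (κ * m + 1)) := by
  have hσ := h.im_σ
  have hθ := (differentiable_theta hσ).continuous
  have hnd : ∀ b : ℤ, b = 2 ∨ b = -2 → theta ((κ * m + b) * a) (-(κ * a)) ≠ 0 := by
    intro b hb
    have h4 := h.four_le
    have := theta_mul_ne_zero (κ := κ) (j := κ * m + b) (by omega) h.im_a fun hd => by
      have h1 := (Int.dvd_add_right (dvd_mul_right κ m)).1 hd
      have h2 : κ ∣ 2 := by rcases hb with rfl | rfl <;> simpa using h1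
      have := Int.le_of_dvd (by norm_num) h2
      omega
    push_cast at this
    exact this
  have n1 := hnd 2 (Or.inl rfl)
  have n2 := hnd (-2) (Or.inr rfl)
  push_cast at n1 n2
  rw [← sub_eq_add_neg] at n2
  have hev : ∀ b : ℂ, theta (b * a) (-(κ * a)) ≠ 0 →
      ∀ᶠ ε in 𝓝[≠] (0 : ℂ), theta ((b + ε) * a) (-(κ * a)) ≠ 0 := by
    intro b hb
    have hc : ContinuousAt (fun ε : ℂ => theta ((b + ε) * a) (-(κ * a))) 0 := by fun_prop
    exact (hc.eventually_ne (by rwa [add_zero])).filter_mono nhdsWithin_le_nhds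
  have hev0 : ∀ᶠ ε in 𝓝[≠] (0 : ℂ), theta ((κ * m + ε) * a) (-(κ * a)) ≠ 0 := by
    have hg : HasDerivAt (fun ε : ℂ => theta (ε * a) (-(κ * a)))
        (deriv (fun z => theta z (-(κ * a))) 0 * a) 0 := by
      have h1 : HasDerivAt (fun z => theta z (-(κ * a))) (deriv (fun z => theta z (-(κ * a))) 0)
          (0 * a) := by
        rw [zero_mul]; exact (differentiable_theta hσ 0).hasDerivAt
      exact HasDerivAt.comp (h₂ := fun z => theta z (-(κ * a))) (h := fun ε : ℂ => ε * a) (0 : ℂ) h1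
        (hasDerivAt_mul_const a)
    filter_upwards [hg.eventually_ne (c := 0) (mul_ne_zero (deriv_theta_zero_ne_zero hσ) h.a_ne)]
      with ε hε
    rw [show (κ * m + ε) * a = ε * a - m * (-(κ * a)) by ring, theta_sub_int_mul]
    exact mul_ne_zero (exp_ne_zero _) hε
  have hA : ∀ (ell b : ℂ), theta (b * a) (-(κ * a)) ≠ 0 →
      Tendsto (fun ε => dblX κ lam ell τ a (b + ε)) (𝓝[≠] 0) (𝓝 (dblX κ lam ell τ a b)) := by
    intro ell b hb
    have h1 : Tendsto (fun ε => b + ε) (𝓝[≠] (0 : ℂ)) (𝓝 b) := by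
      have : Tendsto (fun ε : ℂ => b + ε) (𝓝 0) (𝓝 (b + 0)) := (by fun_prop :
        Continuous fun ε : ℂ => b + ε).tendsto 0
      rw [add_zero] at this
      exact this.mono_left nhdsWithin_le_nhds
    exact (continuousAt_dblX h lam ell hb).tendsto.comp h1
  have hR : ∀ (ell b : ℂ), Tendsto (fun ε => polyX κ c s lam ell τ a (b + ε)) (𝓝[≠] 0)
      (𝓝 (polyX κ c s lam ell τ a b)) := by
    intro ell b
    have hc := (differentiable_polyX h lam ell).continuous
    have : Tendsto (fun ε : ℂ => polyX κ c s lam ell τ a (b + ε)) (𝓝 0)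
        (𝓝 (polyX κ c s lam ell τ a (b + 0))) := (hc.comp (by fun_prop :
        Continuous fun ε : ℂ => b + ε)).tendsto 0
    rw [add_zero] at this
    exact this.mono_left nhdsWithin_le_nhds
  have hT := (tendsto_terms_add h.four_le lam h.im_τ h.im_a hσ h.notMem l h.im_τ2 h.im_σ2 m).const_mul
    (constK κ τ a)
  rw [mul_zero] at hT
  have hL := ((hA (-(l / κ)) _ n2).sub (hA (l / κ) _ n2)).sub
    ((hA (-(l / κ)) _ n1).sub (hA (l / κ) _ n1))
  have hR2 := hT.add ((((hR (-(l / κ)) (κ * m - 1)).sub (hR (l / κ) (κ * m - 1))).const_mul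
    (2 * π * I * τ)).add (((hR (-(l / κ)) (κ * m + 1)).sub (hR (l / κ) (κ * m + 1))).const_mul
    (2 * π * I * τ)))
  rw [zero_add] at hR2
  refine tendsto_nhds_unique hL (hR2.congr' ?_)
  filter_upwards [hev0, hev _ n1, hev _ n2] with ε e0 e1 e2
  have g1 := uDiff_progression h l lam (κ * m - 1 + ε)
    (by rwa [show (κ * m - 1 + ε - 1 : ℂ) = κ * m - 2 + ε by ring])
    (by rwa [show (κ * m - 1 + ε + 1 : ℂ) = κ * m + ε by ring])
  have g2 := uDiff_progression h l lam (κ * m + 1 + ε)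
    (by rwa [show (κ * m + 1 + ε - 1 : ℂ) = κ * m + ε by ring])
    (by rwa [show (κ * m + 1 + ε + 1 : ℂ) = κ * m + 2 + ε by ring])
  rw [show (κ * m - 1 + ε - 1 : ℂ) = κ * m - 2 + ε by ring,
    show (κ * m - 1 + ε + 1 : ℂ) = κ * m + ε by ring] at g1
  rw [show (κ * m + 1 + ε - 1 : ℂ) = κ * m + ε by ring,
    show (κ * m + 1 + ε + 1 : ℂ) = κ * m + 2 + ε by ring] at g2
  linear_combination g1 + g2

/-- The sum over the residue classes of the products of the hypergeometric theta functions and the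
entries of the matrix reduces to a sum of single integrals. -/
lemma tsum_term_mul_uDiff (l : ℤ) (lam : ℂ) (hsum : Summable fun j : ℤ =>
      term κ j lam τ (a / 2) * uDiff κ l (-1 / -(κ * a)) (-τ / -(κ * a)) j)
    (hR : ∀ ell : ℂ, Summable fun j : ℤ => polyX κ c s lam ell τ a j) :
    constK κ τ a * (thC τ * thC (-(κ * a))) *
      ∑' j : ℤ, term κ j lam τ (a / 2) * uDiff κ l (-1 / -(κ * a)) (-τ / -(κ * a)) j =
    2 * π * I * τ * (∑' j : ℤ, polyX κ c s lam (-(l / κ)) τ a j -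
      ∑' j : ℤ, polyX κ c s lam (l / κ) τ a j) := by
  have hσ := h.im_σ
  have h4 := h.four_le
  have hC : thC τ * thC (-(κ * a)) ≠ 0 := mul_ne_zero (thC_ne_zero h.im_τ) (thC_ne_zero hσ)
  set w := uDiff κ l (-1 / -(κ * a)) (-τ / -(κ * a)) with hw
  have hodd : ∀ x, w (-x) = -w x := uDiff_neg h4 l h.im_τ2 h.im_σ2
  have hone : w 1 = 0 := uDiff_one h4 l h.im_τ2 h.im_σ2
  have hterm : ∀ j : ℤ, Q (j * a) (-(κ * a)) (a / 2) * termV κ lam τ a j * w j =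
      -(thC τ * thC (-(κ * a))) * (term κ j lam τ (a / 2) * w j) := by
    intro j
    rw [term_eq j lam h.im_τ hσ h.notMem]
    linear_combination (Q (j * a) (-(κ * a)) (a / 2) * termV κ lam τ a j * w j) *
      mul_div_cancel₀ (-1 : ℂ) hC
  set f : ℤ → ℂ := fun j => constK κ τ a *
    (Q (j * a) (-(κ * a)) (a / 2) * termV κ lam τ a j * w j) + 2 * π * I * τ *
    (polyX κ c s lam (-(l / κ)) τ a j - polyX κ c s lam (l / κ) τ a j) with hf
  have hs1 : Summable fun j : ℤ => constK κ τ a *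
      (Q (j * a) (-(κ * a)) (a / 2) * termV κ lam τ a j * w j) := by
    simp only [hterm]
    exact (hsum.mul_left _).mul_left _
  have hs2 : Summable fun j : ℤ => 2 * π * I * τ *
      (polyX κ c s lam (-(l / κ)) τ a j - polyX κ c s lam (l / κ) τ a j) :=
    ((hR _).sub (hR _)).mul_left _
  have key : ∑' j, f j = 0 := by
    refine tsum_eq_zero_of_telescope h4 (A := fun j => dblX κ lam (-(l / κ)) τ a j -
      dblX κ lam (l / κ) τ a j) (hs1.add hs2) ?_ ?_ (fun x hx1 hx2 => ?_) fun m => ?_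
    · exact (summable_dblX h lam _ 1 fun hd => by
        have := Int.le_of_dvd (by norm_num) hd; omega).sub (summable_dblX h lam _ 1 fun hd => by
        have := Int.le_of_dvd (by norm_num) hd; omega)
    · exact (summable_dblX h lam _ 2 fun hd => by
        have := Int.le_of_dvd (by norm_num) hd; omega).sub (summable_dblX h lam _ 2 fun hd => by
        have := Int.le_of_dvd (by norm_num) hd; omega)
    · have n1 := theta_mul_ne_zero (κ := κ) (by omega) h.im_a hx1
      have n2 := theta_mul_ne_zero (κ := κ) (by omega) h.im_a hx2
      push_cast at n1 n2 ⊢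
      exact uDiff_progression h l lam x n1 n2
    · obtain ⟨r, hr⟩ := exists_uDiff_add_mul h4 l h.im_τ2 h.im_σ2 m
      rw [← hw] at hr
      have z1 : w (κ * m + 1) = 0 := by rw [hr, hone, mul_zero]
      have z2 : w (κ * m - 1) = 0 := by rw [sub_eq_add_neg, hr, hodd, hone, neg_zero, mul_zero]
      simp only [hf]
      push_cast
      rw [z1, z2, mul_zero, mul_zero, mul_zero, zero_add, mul_zero, zero_add, dblX_sub_dblX h]
  simp only [hf] at key
  rw [hs1.tsum_add hs2, tsum_mul_left, tsum_mul_left, (hR _).tsum_sub (hR _)] at key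
  simp only [hterm] at key
  rw [tsum_mul_left] at key
  linear_combination -key

end Region

/-! ### The sum over residue classes -/

lemma summable_term_mul_uDiff {κ : ℤ} (hκ : 4 ≤ κ) (l : ℤ) (lam : ℂ) {τ a τ' σ' : ℂ}
    (hτ : 0 < τ.im) (hσ : 0 < (-(κ * a)).im) (hp : a ∉ polA τ (-(κ * a))) (hτ' : 0 < τ'.im)
    (hσ' : 0 < σ'.im) :
    Summable fun j : ℤ => term κ j lam τ (a / 2) * uDiff κ l τ' σ' j := by
  obtain ⟨N, rfl⟩ : ∃ N : ℕ, κ = N := ⟨κ.toNat, by omega⟩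
  have : NeZero (2 * N) := ⟨by omega⟩
  refine summable_int_of_mod (m := 2 * N) fun i => ?_
  have h := (hasSum_term (κ := N) (by omega) i lam hτ hσ hp).summable.mul_right (uDiff N l τ' σ' i)
  refine h.congr fun k => ?_
  have := uDiff_add_two_mul hκ l hτ' hσ' k i
  push_cast at this ⊢
  rw [this]

lemma DeltaTilde_neg {κ : ℤ} (l : ℤ) (lam : ℂ) {τ a : ℂ} (hτ : 0 < τ.im)
    (hσ : 0 < (-(κ * a)).im) (hp : a ∉ polA τ (-(κ * a))) :
    DeltaTilde l κ (-lam) τ (a / 2) = DeltaTilde (-l) κ lam τ (a / 2) := by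
  rw [DeltaTilde, DeltaTilde, ← (Equiv.neg ℤ).tsum_eq]
  refine tsum_congr fun m => ?_
  rw [Equiv.neg_apply, show 2 * κ * m + -l = -(2 * κ * -m + l) by ring, term_eq _ _ hτ hσ hp,
    term_eq _ _ hτ hσ hp]
  generalize 2 * κ * -m + l = j
  have e : (fun t => thF lam (-j * a) τ (-(κ * a)) (-t)) = thF (-lam) (j * a) τ (-(κ * a)) := by
    funext t
    rw [thF, thF, show lam + -t = -(-lam + t) by ring, show -j * a + -t = -(j * a + t) by ring,
      theta_neg, theta_neg, neg_mul_neg]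
  have hQ : Q (-j * a) (-(κ * a)) (a / 2) = Q (j * a) (-(κ * a)) (a / 2) := by
    rw [Q, Q, show -j * a - 2 * (a / 2) = -(j * a + 2 * (a / 2)) by ring,
      show -j * a + 2 * (a / 2) = -(j * a - 2 * (a / 2)) by ring, theta_neg, theta_neg, neg_mul_neg,
      mul_comm (theta (j * a + 2 * (a / 2)) _)]
  rw [termV, termV, ← e, Int.cast_neg, hQ, regInt_comp_neg hτ hσ hp (perEntire_thF _ _ hτ hσ)]
  ring_nf

lemma sum_range_eq_sum_Icc {κ : ℤ} {N : ℕ} (hN : κ = N) (hκ : 4 ≤ κ) {D : ℤ → ℂ}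
    (h : ∀ j, j = 0 ∨ j = 1 ∨ j = -1 ∨ j = κ - 1 ∨ j = -κ ∨ j = -κ + 1 → D j = 0) :
    ∑ i : Fin (2 * N), D (i - κ) = ∑ j ∈ Finset.Icc 2 (κ - 2), (D j + D (-j)) := by
  subst hN
  rw [Fin.sum_univ_eq_sum_range (fun i : ℕ => D (i - (N : ℤ))), Finset.sum_add_distrib]
  have e1 : ∑ j ∈ Finset.Icc (2 : ℤ) (N - 2), D (-j) =
      ∑ j ∈ Finset.Icc (-((N : ℤ) - 2)) (-2), D j :=
    Finset.sum_nbij' (fun j => -j) (fun j => -j) (fun j hj => by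
      simp only [Finset.mem_Icc] at hj ⊢; omega) (fun j hj => by
      simp only [Finset.mem_Icc] at hj ⊢; omega) (fun j _ => neg_neg j) (fun j _ => neg_neg j)
      fun j _ => rfl
  have e2 : ∑ i ∈ Finset.range (2 * N), D (i - (N : ℤ)) = ∑ j ∈ Finset.Ico (-(N : ℤ)) N, D j :=
    Finset.sum_nbij' (fun i => (i : ℤ) - N) (fun j => (j + N).toNat) (fun j hj => by
      simp only [Finset.mem_range, Finset.mem_Ico] at hj ⊢; omega) (fun j hj => by
      simp only [Finset.mem_range, Finset.mem_Ico] at hj ⊢; omega) (fun j _ => by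
      simp) (fun j hj => by simp only [Finset.mem_Ico] at hj; omega) fun j _ => rfl
  rw [e1, e2, ← Finset.sum_union (Finset.disjoint_left.2 fun j hj hj2 => by
    simp only [Finset.mem_Icc] at hj hj2; omega)]
  refine (Finset.sum_subset (fun j hj => ?_) fun j hj hj2 => h j ?_).symm
  · simp only [Finset.mem_union, Finset.mem_Icc, Finset.mem_Ico] at hj ⊢; omega
  · simp only [Finset.mem_union, Finset.mem_Icc, Finset.mem_Ico, not_or, not_and, not_le] at hj hj2
    omega

/-- Sum over residues mod `2κ`: `uDiff` is odd, which pairs `j` with `-j`, and it vanishes at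
`0, 1, κ - 1, κ`. -/
lemma tsum_term_eq_sum {κ : ℤ} (hκ : 4 ≤ κ) (l : ℤ) (lam : ℂ) {τ a τ' σ' : ℂ}
    (hτ : 0 < τ.im) (hσ : 0 < (-(κ * a)).im) (hp : a ∉ polA τ (-(κ * a))) (hτ' : 0 < τ'.im)
    (hσ' : 0 < σ'.im) :
    ∑' j : ℤ, term κ j lam τ (a / 2) * uDiff κ l τ' σ' j =
      ∑ j ∈ Finset.Icc (2 : ℤ) (κ - 2), Delta j κ lam τ (a / 2) * uDiff κ l τ' σ' j := by
  obtain ⟨N, hN⟩ : ∃ N : ℕ, κ = N := ⟨κ.toNat, by omega⟩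
  have : NeZero (2 * N) := ⟨by omega⟩
  set w := uDiff κ l τ' σ' with hw
  have hodd : ∀ x, w (-x) = -w x := uDiff_neg hκ l hτ' hσ'
  have hone : w 1 = 0 := uDiff_one hκ l hτ' hσ'
  have hadd : ∀ x, w (x + κ) = -expπ l * w x := uDiff_add hκ l hτ' hσ'
  have hzero : w 0 = 0 := uDiff_zero hκ l hτ' hσ'
  have hs := summable_term_mul_uDiff hκ l lam hτ hσ hp hτ' hσ'
  rw [← (Equiv.subRight κ).tsum_eq]
  simp only [Equiv.subRight_apply]
  have hs2 : Summable fun j : ℤ => term κ (j - κ) lam τ (a / 2) * w ((j - κ : ℤ) : ℂ) :=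
    (Equiv.subRight κ).summable_iff.2 hs
  rw [tsum_int_mod (m := 2 * N) hs2]
  have e : ∀ i : Fin (2 * N), ∑' k : ℤ, term κ (((2 * N : ℕ) : ℤ) * k + (i : ℕ) - κ) lam τ (a / 2) *
      w ((((2 * N : ℕ) : ℤ) * k + (i : ℕ) - κ : ℤ) : ℂ) =
      (fun j : ℤ => DeltaTilde j κ lam τ (a / 2) * w j) ((i : ℕ) - κ) := by
    intro i
    simp only [DeltaTilde]
    rw [← tsum_mul_right]
    refine tsum_congr fun k => ?_
    have e1 : ((2 * N : ℕ) : ℤ) * k + (i : ℕ) - κ = 2 * κ * k + ((i : ℕ) - κ) := by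
      push_cast; rw [hN]; ring
    have e2 := uDiff_add_two_mul hκ l hτ' hσ' k (((i : ℕ) - κ : ℤ) : ℂ)
    rw [← hw] at e2
    rw [e1]
    congr 1
    rw [← e2]
    push_cast
    rfl
  refine (Finset.sum_congr rfl fun i _ => e i).trans ?_
  rw [sum_range_eq_sum_Icc (D := fun j : ℤ => DeltaTilde j κ lam τ (a / 2) * w j) hN hκ]
  · refine Finset.sum_congr rfl fun j _ => ?_
    rw [Delta, DeltaTilde_neg j lam hτ hσ hp, Int.cast_neg, hodd]
    ring
  · intro j hj
    have : w j = 0 := by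
      rcases hj with rfl | rfl | rfl | rfl | rfl | rfl
      · simpa using hzero
      · simpa using hone
      · push_cast; rw [hodd, hone, neg_zero]
      · push_cast
        rw [sub_eq_neg_add, hadd, hodd, hone]; simp
      · have := hadd 0
        rw [zero_add, hzero, mul_zero] at this
        push_cast
        rw [hodd, this, neg_zero]
      · have := hadd (-1)
        rw [hodd, hone, neg_zero, mul_zero] at this
        push_cast
        rw [show (-κ + 1 : ℂ) = -(-1 + κ) by ring, hodd, this, neg_zero]
    simp only [this, mul_zero]

/-! ### Evaluation of the sum of the remaining integrals -/

lemma polyInt_const_mul (f : ℂ → ℂ) (p d : ℂ) : polyInt (fun T => d * f T) p = d * polyInt f p := by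
  rw [polyInt, polyInt, segInt_const_mul, segInt_const_mul, segInt_const_mul]
  ring

lemma hasSum_polyInt_jacobi {c s : ℝ} (hc : 0 < c) (hs : 0 < s) (hs2 : s < 1 / 2) {h z : ℂ → ℂ}
    (hh : ContinuousOn h (polyS c s)) (hz : Continuous z) {τ : ℂ} (hτ : 0 < τ.im) :
    HasSum (fun m : ℤ => polyInt (fun t => h t * jacobiTheta₂_term m (z t) τ) (polyV c s))
      (polyInt (fun t => h t * jacobiTheta₂ (z t) τ) (polyV c s)) :=
  ((hasSum_segInt_jacobi (hh.comp (by fun_prop) fun _ hr => left_mem_polyS hc hs hs2 hr) hz hτ).add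
    (hasSum_segInt_jacobi (hh.comp (by fun_prop) fun _ hr => middle_mem_polyS hc hs hs2 hr) hz
      hτ)).add
    (hasSum_segInt_jacobi (hh.comp (by fun_prop) fun _ hr => right_mem_polyS hc hs hs2 hr) hz hτ)

lemma continuousOn_kerK_polyS {c s : ℝ} {τ σ a : ℂ} (hτ : 0 < τ.im) (hσ : 0 < σ.im)
    (ha : a ∈ reg3 c s) (h1 : 4 * c * s ≤ τ.im) (h2 : 4 * c * s ≤ σ.im) :
    ContinuousOn (kerK τ σ a) (polyS c s) := by
  have hP := (differentiable_P hτ hσ).continuous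
  unfold kerK kerNum
  exact ContinuousOn.div (by fun_prop) (by fun_prop) fun T hT => mul_ne_zero
    (P_add_ne_zero hτ hσ ha hT h1 h2) (P_sub_ne_zero hτ hσ ha hT h1 h2)

lemma Q_neg (z σ η : ℂ) : Q (-z) σ η = Q z σ η := by
  rw [Q, Q, show -z - 2 * η = -(z + 2 * η) by ring, show -z + 2 * η = -(z - 2 * η) by ring,
    theta_neg, theta_neg, neg_mul_neg, mul_comm (theta (z + 2 * η) σ)]

lemma Q_modular (z η : ℂ) {τ : ℂ} (hτ : 0 < τ.im) : Q (z / τ) (-1 / τ) (η / τ) =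
    τ * exp (π * I * (8 * η ^ 2 - 2 * z ^ 2) / τ) * Q z τ η := by
  have hτ0 : τ ≠ 0 := by rintro rfl; simp at hτ
  have hs : -I * (-I * τ) ^ (1 / 2 : ℂ) ≠ 0 := by simp [hτ0]
  have hd : deriv (fun z => theta z (-1 / τ)) 0 =
      τ * (-I * (-I * τ) ^ (1 / 2 : ℂ)) * deriv (fun z => theta z τ) 0 := by
    have h1 : (fun z => theta z (-1 / τ)) = fun z => -I * (-I * τ) ^ (1 / 2 : ℂ) *
        exp (π * I * (z * τ) ^ 2 / τ) * theta (z * τ) τ := by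
      funext z
      rw [← theta_modular _ hτ, mul_div_cancel_right₀ _ hτ0]
    have h2 : HasDerivAt (fun z => theta z τ) (deriv (fun z => theta z τ) 0) (0 * τ) := by
      rw [zero_mul]; exact (differentiable_theta hτ 0).hasDerivAt
    have h3 : HasDerivAt (fun z => theta (z * τ) τ) (deriv (fun z => theta z τ) 0 * τ) 0 :=
      HasDerivAt.comp (h₂ := fun z => theta z τ) (h := fun z : ℂ => z * τ) (0 : ℂ) h2
        (hasDerivAt_mul_const τ)
    have h4 : DifferentiableAt ℂ (fun z : ℂ => -I * (-I * τ) ^ (1 / 2 : ℂ) *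
        exp (π * I * (z * τ) ^ 2 / τ)) 0 := by fun_prop
    rw [h1, (h4.hasDerivAt.fun_mul h3).deriv]
    simp [theta_zero]
    ring
  rw [Q, Q, hd, show 4 * (η / τ) = 4 * η / τ by ring,
    show z / τ - 2 * (η / τ) = (z - 2 * η) / τ by ring,
    show z / τ + 2 * (η / τ) = (z + 2 * η) / τ by ring, theta_modular _ hτ, theta_modular _ hτ,
    theta_modular _ hτ]
  generalize -I * (-I * τ) ^ (1 / 2 : ℂ) = r at hs ⊢
  have he : exp (π * I * (8 * η ^ 2 - 2 * z ^ 2) / τ) *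
      (exp (π * I * (z - 2 * η) ^ 2 / τ) * exp (π * I * (z + 2 * η) ^ 2 / τ)) =
      exp (π * I * (4 * η) ^ 2 / τ) := by
    rw [← exp_add, ← exp_add]; congr 1; ring
  have e1 := exp_ne_zero (π * I * (z - 2 * η) ^ 2 / τ)
  have e2 := exp_ne_zero (π * I * (z + 2 * η) ^ 2 / τ)
  rw [← he]
  by_cases h0 : theta (z - 2 * η) τ * theta (z + 2 * η) τ = 0
  · rcases mul_eq_zero.1 h0 with h0 | h0 <;> simp [h0]
  · obtain ⟨h1, h2⟩ := mul_ne_zero_iff.1 h0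
    field_simp

section Region

variable {κ : ℤ} {c s : ℝ} {τ a : ℂ} (h : SumRegion κ c s τ a)

include h

lemma hasSum_polyX (lam ell : ℂ) : HasSum (fun j : ℤ => polyX κ c s lam ell τ a j)
    (polyInt (fun T => kerK (-1 / τ) (-(κ * a) / τ) (a / τ) T * (openF τ (-(κ * a)) lam ell a 0 T *
        jacobiTheta₂ (τ * T / κ - lam / 2 + ell / 2) (τ / (2 * κ)))) (polyV c s)) := by
  have hκ := h.κ_ne
  have ha := h.a_ne
  have hT : 0 < (τ / (2 * κ)).im := by
    have h0 : (0 : ℝ) < κ := by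
      have := h.four_le
      exact_mod_cast (by omega : 0 < κ)
    rw [show τ / (2 * κ) = ((1 / (2 * κ) : ℝ) : ℂ) * τ by push_cast; field_simp, im_ofReal_mul]
    have := h.im_τ
    positivity
  have h1 := hasSum_polyInt_jacobi h.c_pos h.s_pos (by linarith [h.s_lt])
    ((continuousOn_kerK_polyS (im_neg_one_div_pos h.im_τ) h.im_div h.mem.1 h.le_τ h.le_σ).fun_mul
      (differentiable_openF h.im_τ h.im_σ2 lam ell a 0).continuous.continuousOn)
    (z := fun T => τ * T / κ - lam / 2 + ell / 2) (by fun_prop) hT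
  simp only [← mul_assoc (kerK _ _ _ _)]
  refine h1.congr_fun fun j => ?_
  rw [polyX, ← polyInt_const_mul]
  congr 1
  funext T
  have e : expX κ lam ell τ j * expπ (((τ * T) ^ 2 - 2 * (j * a) * (τ * T)) /
      -(κ * a)) = expπ (((τ * T) ^ 2 - 2 * 0 * (τ * T)) / -(κ * a)) *
      jacobiTheta₂_term j (τ * T / κ - lam / 2 + ell / 2) (τ / (2 * κ)) := by
    rw [expX, jacobiTheta₂_term, ← exp_add, ← exp_add]
    congr 1
    field_simp
    ring
  simp only [openF, facY]
  linear_combination (kerK (-1 / τ) (-(κ * a) / τ) (a / τ) T * (thC (-(κ * a)) ^ 2 *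
    exp (-(2 * π * I * a)) * expπ (modC (a + τ * T) τ (-(κ * a)) +
    modC (a - τ * T) τ (-(κ * a))) * theta (lam + τ * T) τ *
    theta (ell + τ * T / -(κ * a)) (-τ / -(κ * a)))) * e

/-- The part of the exponent in the transformed integrals which does not depend on `l`. -/
def phaseK (κ : ℤ) (τ a lam : ℂ) : ℂ :=
  2 * modC a τ (-(κ * a)) - 2 * a - (κ + 2) * lam ^ 2 / (2 * τ)

/-- The theta factors of the remaining integrals, transformed to the modulus `-1 / τ`. -/
lemma openF_mul_jacobi (lam : ℂ) (l : ℤ) (T : ℂ) : openF τ (-(κ * a)) lam (-(l / κ)) a 0 T *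
      jacobiTheta₂ (τ * T / κ - lam / 2 + -(l / κ) / 2) (τ / (2 * κ)) =
    thC (-(κ * a)) ^ 2 * (-I * (-(κ * a) / τ)) ^ (1 / 2 : ℂ) /
      ((-I * τ) ^ (1 / 2 : ℂ) * (-I * (τ / (2 * κ))) ^ (1 / 2 : ℂ)) *
      expπ (phaseK κ τ a lam -
        l * lam / τ - l ^ 2 * (2 * a + 1) / (2 * κ * τ)) *
      (thF (lam / τ) (l * (a / τ)) (-1 / τ) (-(κ * a) / τ) T *
        jacobiTheta₂ (2 * T + l * (-1 / τ) - κ * (lam / τ)) (2 * κ * (-1 / τ))) := by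
  have hκ := h.κ_ne
  have ha := h.a_ne
  have hτ := h.im_τ
  have hτ0 : τ ≠ 0 := by rintro rfl; simp at hτ
  have hs : (-I * τ) ^ (1 / 2 : ℂ) ≠ 0 := by simp [hτ0]
  have hs' : (-I * (τ / (2 * κ))) ^ (1 / 2 : ℂ) ≠ 0 := by simp [hτ0, hκ]
  have t1 := theta_modular (lam + τ * T) hτ
  have t2 := theta_modular (l * (a / τ) + T) h.im_div
  have t3 := jacobiTheta₂_functional_equation (τ * T / κ - lam / 2 + -(l / κ) / 2) (τ / (2 * κ))
  rw [show (lam + τ * T) / τ = lam / τ + T by field_simp] at t1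
  rw [show (l * (a / τ) + T) / (-(κ * a) / τ) = -(l / κ) + τ * T / -(κ * a) by field_simp; ring,
    show -1 / (-(κ * a) / τ) = -τ / -(κ * a) by field_simp] at t2
  rw [show (τ * T / κ - lam / 2 + -(l / κ) / 2) / (τ / (2 * κ)) =
    2 * T + l * (-1 / τ) - κ * (lam / τ) by field_simp; ring,
    show -1 / (τ / (2 * κ)) = 2 * κ * (-1 / τ) by field_simp] at t3
  rw [openF, facY, thF, t1, t2, t3]
  have key : exp (-(2 * π * I * a)) * expπ (modC (a + τ * T) τ (-(κ * a)) +
      modC (a - τ * T) τ (-(κ * a))) * expπ (((τ * T) ^ 2 - 2 * 0 * (τ * T)) /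
      -(κ * a)) * exp (π * I * (l * (a / τ) + T) ^ 2 / (-(κ * a) / τ)) *
      exp (-π * I * (τ * T / κ - lam / 2 + -(l / κ) / 2) ^ 2 / (τ / (2 * κ))) =
      expπ (phaseK κ τ a lam -
        l * lam / τ - l ^ 2 * (2 * a + 1) / (2 * κ * τ)) *
        exp (π * I * (lam + τ * T) ^ 2 / τ) := by
    rw [← exp_add, ← exp_add, ← exp_add, ← exp_add, ← exp_add]
    congr 1
    rw [phaseK, modC, modC, modC]
    field_simp
    ring
  generalize (-I * τ) ^ (1 / 2 : ℂ) = r1 at hs ⊢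
  generalize (-I * (τ / (2 * κ))) ^ (1 / 2 : ℂ) = r2 at hs' ⊢
  generalize (-I * (-(κ * a) / τ)) ^ (1 / 2 : ℂ) = r3 at ⊢
  generalize jacobiTheta₂ (2 * T + l * (-1 / τ) - κ * (lam / τ)) (2 * κ * (-1 / τ)) = J
  generalize theta (l * (a / τ) + T) (-(κ * a) / τ) = θ2
  generalize theta (lam + τ * T) τ = θ1
  have e : ∀ C E K : ℂ, C ^ 2 * r3 / (r1 * r2) * E * (-I * r1 * K * θ1 * θ2 * J) =
      C ^ 2 * (-I * r3) * (1 / r2) * θ1 * θ2 * J * (E * K) := by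
    intro C E K
    field_simp
  rw [e, ← key]
  ring

lemma tsum_polyX (hp : a / τ ∉ polA (-1 / τ) (-(κ * a) / τ)) (lam : ℂ) (l : ℤ) :
    ∑' j : ℤ, polyX κ c s lam (-(l / κ)) τ a j =
    thC (-(κ * a)) ^ 2 * (-I * (-(κ * a) / τ)) ^ (1 / 2 : ℂ) /
      ((-I * τ) ^ (1 / 2 : ℂ) * (-I * (τ / (2 * κ))) ^ (1 / 2 : ℂ)) *
      expπ (phaseK κ τ a lam -
        l * lam / τ - l ^ 2 * (2 * a + 1) / (2 * κ * τ)) *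
      regInt (-1 / τ) (-(κ * a) / τ) (a / τ) (fun T =>
        thF (lam / τ) (l * (a / τ)) (-1 / τ) (-(κ * a) / τ) T *
          jacobiTheta₂ (2 * T + l * (-1 / τ) - κ * (lam / τ)) (2 * κ * (-1 / τ))) := by
  have hτ3 := im_neg_one_div_pos h.im_τ
  have h4 := h.four_le
  have hT : 0 < (2 * κ * (-1 / τ)).im := by
    rw [show (2 * κ * (-1 / τ) : ℂ) = ((2 * κ : ℝ) : ℂ) * (-1 / τ) by push_cast; ring,
      im_ofReal_mul]
    have : (0 : ℝ) < κ := by exact_mod_cast (by omega : 0 < κ)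
    positivity
  have hF := perEntire_thF (lam / τ) (l * (a / τ)) hτ3 h.im_div
  have hJ : PerEntire fun T => thF (lam / τ) (l * (a / τ)) (-1 / τ) (-(κ * a) / τ) T *
      jacobiTheta₂ (2 * T + l * (-1 / τ) - κ * (lam / τ)) (2 * κ * (-1 / τ)) := by
    have hj : Differentiable ℂ fun z => jacobiTheta₂ z (2 * κ * (-1 / τ)) := fun z =>
      differentiableAt_jacobiTheta₂_fst z hT
    refine ⟨hF.1.fun_mul (hj.comp (f := fun T => 2 * T + l * (-1 / τ) - κ * (lam / τ))
      (by fun_prop)), fun T => ?_⟩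
    beta_reduce
    rw [hF.2, show 2 * (T + 1) + l * (-1 / τ) - κ * (lam / τ) =
      2 * T + l * (-1 / τ) - κ * (lam / τ) + 1 + 1 by ring, jacobiTheta₂_add_left,
      jacobiTheta₂_add_left]
  rw [(hasSum_polyX h lam (-(l / κ))).tsum_eq]
  simp only [openF_mul_jacobi h]
  have e : ∀ x y z : ℂ, x * (y * z) = y * (x * z) := mul_left_comm
  simp only [e (kerK _ _ _ _) (_ * exp _)]
  rw [polyInt_const_mul, polyInt_eq_regInt h.c_pos h.s_pos h.s_lt hτ3 h.im_div h.le_τ h.le_σ h.mem.1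
    hp hJ]

/-- The sums of the remaining integrals are multiples of the series at `-1 / τ`, with a factor
independent of `l`. -/
lemma Q_mul_tsum_polyX (hp : a / τ ∉ polA (-1 / τ) (-(κ * a) / τ)) (lam : ℂ) (l : ℤ) :
    Q (l / κ) (-τ / -(κ * a)) (-1 / (2 * κ)) * ∑' j : ℤ, polyX κ c s lam (-(l / κ)) τ a j =
    -(thC (-1 / τ) * thC (-(κ * a) / τ)) * (thC (-(κ * a)) ^ 2 *
      (-I * (-(κ * a) / τ)) ^ (1 / 2 : ℂ) /
      ((-I * τ) ^ (1 / 2 : ℂ) * (-I * (τ / (2 * κ))) ^ (1 / 2 : ℂ))) * (-(κ * a) / τ) *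
      expπ (phaseK κ τ a lam -
        2 * a / (κ * τ)) * DeltaTilde l κ (lam / τ) (-1 / τ) (a / τ / 2) := by
  have hκ := h.κ_ne
  have ha := h.a_ne
  have hτ0 : τ ≠ 0 := by
    rintro rfl
    simpa using h.im_τ
  have hτ3 := im_neg_one_div_pos h.im_τ
  have h4 := h.four_le
  have hC : thC (-1 / τ) * thC (-(κ * a) / τ) ≠ 0 :=
    mul_ne_zero (thC_ne_zero hτ3) (thC_ne_zero h.im_div)
  have e3 : -(κ * (a / τ)) = -(κ * a) / τ := by ring
  have hD := hasSum_term (κ := κ) (by omega) l (lam / τ) (a := a / τ) hτ3 (by rw [e3]; exact h.im_div)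
    (by rw [e3]; exact hp)
  rw [e3] at hD
  have hQ := Q_modular (-(l * (a / τ))) (a / τ / 2) h.im_div
  rw [Q_neg, show -(l * (a / τ)) / (-(κ * a) / τ) = l / κ by field_simp,
    show -1 / (-(κ * a) / τ) = -τ / -(κ * a) by field_simp,
    show a / τ / 2 / (-(κ * a) / τ) = -1 / (2 * κ) by field_simp] at hQ
  rw [DeltaTilde, hD.tsum_eq, tsum_polyX h hp, hQ]
  have key : exp (π * I * (8 * (a / τ / 2) ^ 2 - 2 * (-(l * (a / τ))) ^ 2) / (-(κ * a) / τ)) *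
      expπ (phaseK κ τ a lam -
        l * lam / τ - l ^ 2 * (2 * a + 1) / (2 * κ * τ)) =
      expπ (phaseK κ τ a lam - 2 * a / (κ * τ)) *
      expπ ((-1 / τ + 2 * (a / τ)) / (2 * κ) * l ^ 2 - lam / τ * l) := by
    rw [← exp_add, ← exp_add]
    congr 1
    field_simp
    ring
  generalize regInt (-1 / τ) (-(κ * a) / τ) (a / τ) _ = R
  generalize Q (l * (a / τ)) (-(κ * a) / τ) (a / τ / 2) = q
  generalize thC (-(κ * a)) ^ 2 * (-I * (-(κ * a) / τ)) ^ (1 / 2 : ℂ) /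
      ((-I * τ) ^ (1 / 2 : ℂ) * (-I * (τ / (2 * κ))) ^ (1 / 2 : ℂ)) = N
  generalize thC (-1 / τ) * thC (-(κ * a) / τ) = C at hC ⊢
  have e : ∀ E X : ℂ, -C * N * (-(κ * a) / τ) * E * (-1 / C * (q * (X * R))) =
      N * (-(κ * a) / τ) * q * R * (E * X) := by
    intro E X
    field_simp
  rw [e, ← key]
  ring

end Region

/-! ### The transformation formula in the region of summation -/

lemma SMinus_eq {κ : ℤ} (hκ : 4 ≤ κ) (j l : ℤ) {τ a : ℂ} (ha : a ≠ 0) :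
    SMinus κ j l τ (a / 2) = Q (l / κ) (-τ / -(κ * a)) (-1 / (2 * κ)) *
      uDiff κ l (-1 / -(κ * a)) (-τ / -(κ * a)) j := by
  have hκ0 : (κ : ℂ) ≠ 0 := by exact_mod_cast (by omega : κ ≠ 0)
  rw [SMinus, uDiff, show τ / (2 * (a / 2) * κ) = -τ / -(κ * a) by field_simp,
    show 1 / (2 * (a / 2) * κ) = -1 / -(κ * a) by field_simp]

lemma inv_cpow_half {τ : ℂ} (hτ : 0 < τ.im) {κ : ℤ} (hκ : 0 < κ) :
    (2 * κ * I / τ) ^ (1 / 2 : ℂ) = ((-I * (τ / (2 * κ))) ^ (1 / 2 : ℂ))⁻¹ := by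
  have hκ0 : (κ : ℂ) ≠ 0 := by exact_mod_cast hκ.ne'
  have hκ1 : (0 : ℝ) < κ := by exact_mod_cast hκ
  have hτ0 : τ ≠ 0 := by rintro rfl; simp at hτ
  have hre : 0 < (-I * (τ / (2 * κ))).re := by
    rw [show -I * (τ / (2 * κ)) = ((1 / (2 * κ) : ℝ) : ℂ) * (-I * τ) by push_cast; field_simp,
      re_ofReal_mul]
    simp only [neg_mul, neg_re, I_mul_re, neg_neg]
    positivity
  rw [← inv_cpow _ _ fun h => ?_]
  · congr 1
    field_simp
    rw [I_sq]
  · have := abs_arg_lt_pi_div_two_iff.2 (Or.inl hre)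
    rw [h, abs_of_pos Real.pi_pos] at this
    linarith [Real.pi_pos]

/-- The constants on both sides of the transformation formula agree. -/
lemma const_identity {κ : ℤ} (hκ : 4 ≤ κ) {τ a : ℂ} (hτ : 0 < τ.im) (ha : a.im < 0)
    (hστ : 0 < (-(κ * a) / τ).im) (lam : ℂ) :
    constK κ τ a * (thC τ * thC (-(κ * a))) *
      (CMinus κ τ (a / 2) * exp (-(π * I / (2 * τ)) * (κ + 2) * lam ^ 2)) =
    2 * π * I * τ * (-(thC (-1 / τ) * thC (-(κ * a) / τ)) * (thC (-(κ * a)) ^ 2 *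
      (-I * (-(κ * a) / τ)) ^ (1 / 2 : ℂ) /
      ((-I * τ) ^ (1 / 2 : ℂ) * (-I * (τ / (2 * κ))) ^ (1 / 2 : ℂ))) * (-(κ * a) / τ) *
      expπ (phaseK κ τ a lam - 2 * a / (κ * τ))) := by
  have hκ0 : (κ : ℂ) ≠ 0 := by exact_mod_cast (by omega : κ ≠ 0)
  have hτ0 : τ ≠ 0 := by rintro rfl; simp at hτ
  have ha0 : a ≠ 0 := by rintro rfl; simp at ha
  have hσ := im_neg_mul_pos hκ ha
  have m1 := thC_modular hτ
  have m2 := thC_modular hσ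
  have m3 := thC_modular hστ
  rw [show -1 / (-(κ * a) / τ) = -τ / -(κ * a) by field_simp] at m3
  rw [constK, CMinus, inv_cpow_half hτ (by omega), m1, m2, m3]
  have key : exp (-(π * I * ((-(κ * a) + 1 / -(κ * a)) / 6 - 1 / 2))) *
      exp (-(π * I * ((-(κ * a) / τ + 1 / (-(κ * a) / τ)) / 6 - 1 / 2))) *
      exp (π * I * (2 * (a / 2) / κ) + π * I / τ * (4 * (a / 2) ^ 2) * (1 - 1 / (2 * (a / 2) * κ)) +
        π * I / (6 * κ * τ) * psi τ (-2 * (a / 2) * κ) (a / 2)) *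
      exp (-(π * I / (2 * τ)) * (κ + 2) * lam ^ 2) =
      exp (-(π * I * ((τ + 1 / τ) / 6 - 1 / 2))) *
      expπ (phaseK κ τ a lam - 2 * a / (κ * τ)) := by
    rw [← exp_add, ← exp_add, ← exp_add, ← exp_add]
    congr 1
    rw [phaseK, modC, psi]
    field_simp
    ring
  have hr1 : (-I * τ) ^ (1 / 2 : ℂ) ≠ 0 := by simp [hτ0]
  have hr2 : (-I * -(κ * a)) ^ (1 / 2 : ℂ) ≠ 0 := by simp [hκ0, ha0]
  generalize (-I * τ) ^ (1 / 2 : ℂ) = r1 at hr1 ⊢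
  generalize (-I * -(κ * a)) ^ (1 / 2 : ℂ) = r2 at hr2 ⊢
  generalize (-I * (-(κ * a) / τ)) ^ (1 / 2 : ℂ) = r3
  generalize (-I * (τ / (2 * κ))) ^ (1 / 2 : ℂ) = r4
  have e : ∀ x y z w C1 C2 C3 : ℂ, -(κ * a) * (-I * r2 * x * C2 * (-I * r3 * y * C3)) /
      (-I * r2) * (C1 * C2) * (-(2 * π * I) * r4⁻¹ * z * w) =
      -(κ * a) * (-I * r3) * (C1 * C2 ^ 2 * C3) * (-(2 * π * I) * r4⁻¹) * (x * y * z * w) := by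
    intro x y z w C1 C2 C3
    field_simp
  rw [e, key]
  field_simp

lemma transformation_of_sumRegion {κ : ℤ} {c s : ℝ} {τ a : ℂ} (h : SumRegion κ c s τ a)
    (hp : a / τ ∉ polA (-1 / τ) (-(κ * a) / τ)) (l : ℤ) (lam : ℂ) :
    CMinus κ τ (a / 2) * exp (-(π * I / (2 * τ)) * (κ + 2) * lam ^ 2) *
      Delta l κ (lam / τ) (-1 / τ) (a / 2 / τ) =
    ∑ j ∈ Finset.Icc (2 : ℤ) (κ - 2), Delta j κ lam τ (a / 2) * SMinus κ j l τ (a / 2) := by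
  have h4 := h.four_le
  have hτ3 := im_neg_one_div_pos h.im_τ
  have e3 : -(κ * (a / τ)) = -(κ * a) / τ := by ring
  have hC : thC τ * thC (-(κ * a)) ≠ 0 := mul_ne_zero (thC_ne_zero h.im_τ) (thC_ne_zero h.im_σ)
  have hs := summable_term_mul_uDiff h4 l lam h.im_τ h.im_σ h.notMem h.im_τ2 h.im_σ2
  have h1 := tsum_term_mul_uDiff h l lam hs fun ell => (hasSum_polyX h lam ell).summable
  rw [tsum_term_eq_sum h4 l lam h.im_τ h.im_σ h.notMem h.im_τ2 h.im_σ2] at h1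
  have h2 := Q_mul_tsum_polyX h hp lam l
  have h3 := Q_mul_tsum_polyX h hp lam (-l)
  rw [Int.cast_neg, neg_div (κ : ℂ), Q_neg, neg_neg] at h3
  have hsum : ∑ j ∈ Finset.Icc (2 : ℤ) (κ - 2), Delta j κ lam τ (a / 2) * SMinus κ j l τ (a / 2) =
      Q (l / κ) (-τ / -(κ * a)) (-1 / (2 * κ)) * ∑ j ∈ Finset.Icc (2 : ℤ) (κ - 2),
        Delta j κ lam τ (a / 2) * uDiff κ l (-1 / -(κ * a)) (-τ / -(κ * a)) j := by
    rw [Finset.mul_sum]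
    refine Finset.sum_congr rfl fun j _ => ?_
    rw [SMinus_eq h4 j l h.a_ne]
    ring
  rw [hsum, Delta, div_right_comm, DeltaTilde_neg l (lam / τ) (a := a / τ) hτ3
    (by rw [e3]; exact h.im_div) (by rw [e3]; exact hp)]
  have hc := const_identity h4 h.im_τ h.im_a h.im_div lam
  refine mul_left_cancel₀ (mul_ne_zero (constK_ne_zero h) hC) ?_
  linear_combination (DeltaTilde l κ (lam / τ) (-1 / τ) (a / τ / 2) -
    DeltaTilde (-l) κ (lam / τ) (-1 / τ) (a / τ / 2)) * hc - 2 * π * I * τ * (h2 - h3) -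
    Q (l / κ) (-τ / -(κ * a)) (-1 / (2 * κ)) * h1

/-! ### A region of summation near the origin -/

/-- The path `polyV c s` is chosen so that `c s` is of the order of `q`. -/
lemma sumRegion_of_small {κ : ℤ} (hκ : 4 ≤ κ) {τ a : ℂ} (hτ : 0 < τ.im)
    (hp : a ∉ polA τ (-(κ * a))) {p q : ℝ} (hpq : a = τ * (-p - q * I)) (hp0 : 0 < p) (hq0 : 0 < q)
    (hp1 : p < 1 / 16) (h1 : 12 * q * |τ.re| < 5 * p * τ.im) (h2 : 16 * q < 5 * (-1 / τ).im) :
    SumRegion κ (4 * q / (5 * p)) p τ a := by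
  have hκ1 : (4 : ℝ) ≤ κ := by exact_mod_cast hκ
  have hκ0 : (κ : ℂ) ≠ 0 := by exact_mod_cast (by omega : κ ≠ 0)
  have hτ0 : τ ≠ 0 := by rintro rfl; simp at hτ
  have hcp : 4 * (4 * q / (5 * p)) * p = 16 * q / 5 := by field_simp; norm_num
  have hre : -(12 * q * τ.re) < 5 * p * τ.im ∧ 12 * q * τ.re < 5 * p * τ.im := by
    have h3 := mul_le_mul_of_nonneg_left (neg_abs_le τ.re) (by positivity : 0 ≤ 12 * q)
    have h4 := mul_le_mul_of_nonneg_left (le_abs_self τ.re) (by positivity : 0 ≤ 12 * q)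
    constructor <;> linarith
  have him : a.im = -(p * τ.im) - q * τ.re := by
    rw [hpq]
    simp
    ring
  have hpτ : p * τ.im < 1 / 16 * τ.im := mul_lt_mul_of_pos_right hp1 hτ
  have ha : a.im < 0 := by rw [him]; nlinarith
  have hdiv : a / τ = -p - q * I := by rw [hpq]; field_simp
  have hσ3 : (-(κ * a) / τ).im = κ * q := by
    rw [show -(κ * a) / τ = ((κ : ℝ) : ℂ) * -(a / τ) by push_cast; ring, hdiv, im_ofReal_mul]
    simp
  have ha0 : a ≠ 0 := by rintro rfl; simp at ha
  have hστ : 0 < (-(κ * a) / τ).im := by rw [hσ3]; positivity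
  have hτσ := im_neg_div_pos hστ
  have hmem3 : a / τ ∈ reg3 (4 * q / (5 * p)) p := by
    have r1 : (a / τ).re = -p := by rw [hdiv]; simp
    have r2 : (a / τ).im = -q := by rw [hdiv]; simp
    rw [mem_reg3, r1, r2]
    have e1 : 2 * (4 * q / (5 * p)) * -p = -(8 * q / 5) := by field_simp; norm_num
    have e2 : 2 * (4 * q / (5 * p)) * p = 8 * q / 5 := by field_simp; norm_num
    have e3 : 4 * (4 * q / (5 * p)) * p * -p = -(16 * q / 5 * p) := by field_simp; norm_num
    refine ⟨by linarith, by linarith, by linarith, by linarith, ?_⟩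
    rw [e3, e2]
    nlinarith
  -- `-τ / σ = 1 / (κ z)` with `z = a / τ`
  have hζ : ∃ r : ℝ, 0 < r ∧ -τ / -(κ * a) = r * (-p + q * I) := by
    refine ⟨1 / (κ * (p ^ 2 + q ^ 2)), by positivity, ?_⟩
    have h0 : (p ^ 2 + q ^ 2 : ℂ) ≠ 0 := by
      have : (p ^ 2 + q ^ 2 : ℝ) ≠ 0 := by positivity
      exact_mod_cast this
    have h3 : (-p - q * I : ℂ) ≠ 0 := by intro h; rw [h, mul_zero] at hpq; exact ha0 hpq
    rw [hpq]
    push_cast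
    rw [div_mul_eq_mul_div, one_mul, div_eq_div_iff (neg_ne_zero.2 (mul_ne_zero hκ0
      (mul_ne_zero hτ0 h3))) (mul_ne_zero hκ0 h0)]
    linear_combination (-κ * τ * q ^ 2) * I_sq
  obtain ⟨r, hr, hζ⟩ := hζ
  have hζi : (-τ / -(κ * a)).im = r * q := by rw [hζ, im_ofReal_mul]; simp
  refine ⟨hκ, by positivity, hp0, by linarith, hτ, ha, hστ, ?_, ?_, ?_, ⟨hmem3, ⟨?_, ?_⟩, ?_⟩, hp⟩
  · rw [hcp]; linarith
  · rw [hcp, hσ3]; nlinarith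
  · set b : ℂ := τ * (2 * (p : ℂ) * (1 + 3 * (4 * q / (5 * p) : ℝ) * I)) with hb
    have hpc : (p : ℂ) ≠ 0 := by exact_mod_cast hp0.ne'
    have hb' : b = τ * (2 * p + 24 * q / 5 * I) := by rw [hb]; push_cast; field_simp; ring
    have hbi : b.im = 2 * p * τ.im + 24 * q / 5 * τ.re := by
      rw [hb', show (2 * p + 24 * q / 5 * I : ℂ) = ((2 * p : ℝ) : ℂ) + ((24 * q / 5 : ℝ) : ℂ) * I by
        push_cast; ring]
      simp
      ring
    have hbσ : (b / -(κ * a)).im = 14 / 5 * p * (r * q) := by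
      have : b / -(κ * a) = ((-r : ℝ) : ℂ) * ((2 * p + 24 * q / 5 * I) * (-p + q * I)) := by
        rw [hb']; push_cast; linear_combination (-(2 * p + 24 * q / 5 * I)) * hζ
      rw [this, im_ofReal_mul, show ((2 * p + 24 * q / 5 * I) * (-p + q * I) : ℂ) =
        ((-2 * p ^ 2 - 24 * q ^ 2 / 5 : ℝ) : ℂ) + ((-(14 / 5 * p * q) : ℝ) : ℂ) * I by
        push_cast; linear_combination (24 / 5 * q ^ 2 : ℂ) * I_sq]
      rw [add_im, ofReal_im, im_ofReal_mul, I_im]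
      ring
    have hrq : 0 < r * q := by positivity
    refine ⟨b, ⟨?_, ⟨?_, ?_⟩, ?_⟩, ?_, ?_, ?_⟩
    · show b / τ ∈ reg3 _ p
      rw [hb, mul_div_cancel_left₀ _ hτ0]
      exact start_mem_reg3 (by positivity) hp0 (by linarith)
    · rw [hbi]; linarith
    · rw [hbi]; linarith
    · show b / -(κ * a) ∈ strip _ _
      rw [hζi]
      have : p * (r * q) < 1 / 16 * (r * q) := mul_lt_mul_of_pos_right hp1 hrq
      have : 0 < p * (r * q) := by positivity
      exact ⟨by rw [hbσ]; linarith, by rw [hbσ]; linarith⟩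
    · rw [hbi]; linarith
    · rw [hbσ]; positivity
    · rw [hb', mul_div_cancel_left₀ _ hτ0]
      have e : 2 * (4 * q / (5 * p)) * p = 8 * q / 5 := by field_simp; norm_num
      rw [e]
      simp
      linarith
  · rw [him]; linarith
  · rw [him]; linarith
  · show a / -(κ * a) ∈ strip _ _
    rw [show a / -(κ * a) = ((-1 / κ : ℝ) : ℂ) by push_cast; field_simp]
    constructor <;> rw [ofReal_im] <;> linarith

/-! ### The exceptional set -/

lemma im_mul_nonneg_of_nat (n : ℕ) {z : ℂ} (hz : 0 < z.im) : 0 ≤ ((n : ℂ) * z).im := by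
  rw [← ofReal_natCast, im_ofReal_mul]; positivity

/-- Off the values of `a` with `j τ + 2 a ∈ ℤ`, the kernel has no pinched poles. -/
lemma notMem_polA_iff_of_im_neg {κ : ℤ} (hκ : 4 ≤ κ) {τ a : ℂ} (hτ : 0 < τ.im) (ha : a.im < 0) :
    a ∉ polA τ (-(κ * a)) ↔ ∀ j : ℕ, 1 ≤ j → ∀ m : ℤ, j * τ + 2 * a ≠ m := by
  have hσ := im_neg_mul_pos hκ ha
  constructor
  · intro h j _ m hm
    refine h ⟨-m, j, 0, ?_⟩
    push_cast
    linear_combination hm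
  · rintro h ⟨l, m, n, hl⟩
    rcases Nat.eq_zero_or_pos n with rfl | hn
    · rcases Nat.eq_zero_or_pos m with rfl | hm
      · have := congrArg Complex.im hl
        simp at this
        linarith
      · refine h m hm (-l) ?_
        push_cast at hl ⊢
        linear_combination hl
    · have h1 := congrArg Complex.im hl
      rw [show 2 * a + l + m * τ + n * -(κ * a) = l + m * τ + ((κ * n - 2 : ℝ) : ℂ) * -a by
        push_cast; ring, add_im, add_im, im_ofReal_mul, intCast_im, neg_im, zero_im] at h1
      have h2 := im_mul_nonneg_of_nat m hτ
      have hn1 : (1 : ℝ) ≤ n := by exact_mod_cast hn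
      have hκ1 : (4 : ℝ) ≤ κ := by exact_mod_cast hκ
      have h3 : (0 : ℝ) < κ * n - 2 := by nlinarith
      have := mul_pos h3 (neg_pos.2 ha)
      linarith

lemma notMem_polA_div {κ : ℤ} (hκ : 4 ≤ κ) {τ a : ℂ} (hτ : 0 < τ.im) (ha : a.im < 0)
    (haτ : (a / τ).im < 0) (hp : a ∉ polA τ (-(κ * a))) :
    a / τ ∉ polA (-1 / τ) (-(κ * a) / τ) := by
  have hτ0 : τ ≠ 0 := by rintro rfl; simp at hτ
  rw [notMem_polA_iff_of_im_neg hκ hτ ha] at hp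
  rintro ⟨l, m, n, hl⟩
  rcases Nat.eq_zero_or_pos n with rfl | hn
  · have hl' : l * τ + 2 * a = (m : ℤ) := by
      push_cast at hl ⊢
      field_simp at hl
      linear_combination hl
    rcases le_or_gt l 0 with h0 | h0
    · have h1 := congrArg Complex.im hl'
      rw [← ofReal_intCast, add_im, im_ofReal_mul, intCast_im] at h1
      have : (2 * a).im = 2 * a.im := by simp
      have h2 : (l : ℝ) ≤ 0 := by exact_mod_cast h0
      nlinarith
    · refine hp l.toNat (by omega) m ?_
      rw [← hl', ← Int.cast_natCast, Int.toNat_of_nonneg h0.le]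
  · have h1 := congrArg Complex.im hl
    rw [show 2 * (a / τ) + l + m * (-1 / τ) + n * (-(κ * a) / τ) =
      l + m * (-1 / τ) + ((κ * n - 2 : ℝ) : ℂ) * -(a / τ) by
      push_cast; ring, add_im, add_im, im_ofReal_mul, intCast_im, neg_im, zero_im] at h1
    have h2 := im_mul_nonneg_of_nat m (im_neg_one_div_pos hτ)
    have hn1 : (1 : ℝ) ≤ n := by exact_mod_cast hn
    have hκ1 : (4 : ℝ) ≤ κ := by exact_mod_cast hκ
    have h3 : (0 : ℝ) < κ * n - 2 := by nlinarith
    have := mul_pos h3 (neg_pos.2 haτ)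
    linarith

/-- The values of `a` at which one of the kernels has pinched poles. -/
def excA (κ : ℤ) (τ : ℂ) : Set ℂ := {a | a ∈ polA τ (-(κ * a))}

lemma excA_countable {κ : ℤ} (hκ : 4 ≤ κ) (τ : ℂ) : (excA κ τ).Countable := by
  refine (Set.countable_range fun p : ℤ × ℕ × ℕ =>
    -((p.1 : ℂ) + p.2.1 * τ) / (2 - κ * p.2.2)).mono ?_
  rintro a ⟨l, m, n, h⟩
  refine ⟨(l, m, n), ?_⟩
  have h0 : (2 - κ * n : ℂ) ≠ 0 := by
    have : (2 - κ * n : ℤ) ≠ 0 := by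
      intro h
      rcases Nat.eq_zero_or_pos n with rfl | hn
      · simp at h
      · have : (1 : ℤ) ≤ n := by exact_mod_cast hn
        nlinarith
    exact_mod_cast this
  simp only
  rw [div_eq_iff h0]
  linear_combination -h

/-- The cone of `a` in which the transformation formula for `Im(a / τ) < 0` holds. -/
def coneA (τ : ℂ) : Set ℂ := {a | a.im < 0} ∩ {a | (a / τ).im < 0}

lemma neg_mul_ne_zero {κ : ℤ} (hκ : 4 ≤ κ) {a : ℂ} (ha : a.im < 0) : -(κ * a) ≠ 0 := fun h => by
  have := im_neg_mul_pos hκ ha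
  simp [h] at this

lemma isOpen_coneA (τ : ℂ) : IsOpen (coneA τ) :=
  (isOpen_lt continuous_im continuous_const).inter (isOpen_lt (by fun_prop) continuous_const)

lemma convex_coneA (τ : ℂ) : Convex ℝ (coneA τ) := by
  refine (convex_halfSpace_im_lt 0).inter (Convex.is_linear_preimage (f := fun y : ℂ => y / τ)
    (convex_halfSpace_im_lt 0) ⟨fun x y => add_div x y τ, fun c x => by simp [mul_div_assoc]⟩)

/-- The lower half plane without the exceptional set. -/
def lowA (κ : ℤ) (τ : ℂ) : Set ℂ := {a | a.im < 0} \ excA κ τ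

lemma isOpen_lowA {κ : ℤ} (hκ : 4 ≤ κ) {τ : ℂ} (hτ : 0 < τ.im) : IsOpen (lowA κ τ) := by
  have hc : ContinuousOn (fun a => P (2 * a) τ (-(κ * a))) {a | a.im < 0} :=
    contOn_P (by fun_prop) (by fun_prop) (by fun_prop) (fun _ _ => hτ)
      fun a ha => im_neg_mul_pos hκ ha
  have h := hc.isOpen_inter_preimage (isOpen_lt continuous_im continuous_const)
    (isOpen_compl_singleton (x := (0 : ℂ)))
  convert h using 1
  ext a
  simp only [lowA, Set.mem_sdiff, mem_inter_iff, mem_preimage, mem_compl_iff, mem_singleton_iff]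
  exact and_congr_right fun ha => notMem_polA_iff hτ (im_neg_mul_pos hκ ha) a

lemma isOpen_coneA_diff {κ : ℤ} (hκ : 4 ≤ κ) {τ : ℂ} (hτ : 0 < τ.im) :
    IsOpen (coneA τ \ excA κ τ) := by
  have h := (isOpen_coneA τ).inter (isOpen_lowA hκ hτ)
  convert h using 1
  ext a
  exact ⟨fun h => ⟨h.1, h.1.1, h.2⟩, fun h => ⟨h.1, h.2.2⟩⟩

/-! ### Dependence on `η` and the transformation formula on the cone `Im (η / τ) < 0` -/

lemma diffOn_thC {V : Set ℂ} (hV : IsOpen V) {τ : ℂ → ℂ}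
    (hτ : HolOn τ V) (h : ∀ x ∈ V, 0 < (τ x).im) :
    HolOn (fun w => thC (τ w)) V :=
  DifferentiableOn.fun_div ((diffOn_theta hV (differentiableOn_const _) hτ h).const_mul I)
    ((diffOn_P1 hV (differentiableOn_const _) hτ h).fun_mul
      (diffOn_P1 hV (hτ.sub_const _) hτ h)) fun w hw => th0_half_ne_zero (h w hw)

lemma diffOn_Q {V : Set ℂ} (hV : IsOpen V) {z σ η : ℂ → ℂ}
    (hz : HolOn z V) (hσ : HolOn σ V) (hη : HolOn η V)
    (h : ∀ x ∈ V, 0 < (σ x).im) (h1 : ∀ x ∈ V, theta (z x - 2 * η x) (σ x) ≠ 0)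
    (h2 : ∀ x ∈ V, theta (z x + 2 * η x) (σ x) ≠ 0) :
    HolOn (fun w => Q (z w) (σ w) (η w)) V := by
  have hd : HolOn (fun w => deriv (fun z => theta z (σ w)) 0) V :=
    (((diffOn_thC hV hσ h).const_mul (-(2 * π * I))).fun_mul
      ((diffOn_P1 hV hσ hσ h).fun_pow 2)).congr fun w hw => deriv_theta_zero (h w hw)
  exact ((diffOn_theta hV (hη.const_mul 4) hσ h).fun_mul hd).fun_div
    ((diffOn_theta hV (hz.fun_sub (hη.const_mul 2)) hσ h).fun_mul
      (diffOn_theta hV (hz.fun_add (hη.const_mul 2)) hσ h))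
    fun w hw => mul_ne_zero (h1 w hw) (h2 w hw)

section Fixed

variable {κ : ℤ} (hκ : 4 ≤ κ) {l : ℤ} (hl : 2 ≤ l ∧ l ≤ κ - 2) {τ : ℂ} (hτ : 0 < τ.im)

include hκ hl

lemma theta_int_add_ne_zero {e : ℤ} (he : e = 1 ∨ e = -1) {a : ℂ} (ha : a.im < 0) :
    theta (l * a + e * a) (-(κ * a)) ≠ 0 := by
  rw [← add_mul, ← Int.cast_add]
  refine theta_mul_ne_zero (by omega) ha fun h => ?_
  have := Int.le_of_dvd (by omega) h
  omega

include hτ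

lemma differentiableOn_DeltaTilde (lam : ℂ) :
    HolOn (fun a => DeltaTilde l κ lam τ (a / 2)) (lowA κ τ) := by
  have hO := isOpen_lowA hκ hτ
  have hi : ∀ a ∈ lowA κ τ, 0 < (-(κ * a)).im := fun a ha => im_neg_mul_pos hκ ha.1
  have hid : HolOn (fun a : ℂ => a) (lowA κ τ) := differentiableOn_id
  have hσ : HolOn (fun a : ℂ => -(κ * a)) (lowA κ τ) := by fun_prop
  have hS : IsOpen (lowA κ τ ×ˢ (univ : Set ℂ)) := hO.prod isOpen_univ
  have hmem : ∀ q ∈ lowA κ τ ×ˢ (univ : Set ℂ), q.1 ∈ lowA κ τ := fun q hq => hq.1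
  refine DifferentiableOn.congr (f := fun a => -1 / (thC τ * thC (-(κ * a))) *
    (Q (l * a) (-(κ * a)) (a / 2) * (expπ ((τ + 2 * a) / (2 * κ) * l ^ 2 - lam * l) *
      regInt τ (-(κ * a)) a fun t => thF lam (l * a) τ (-(κ * a)) t *
        jacobiTheta₂ (2 * t + l * τ - κ * lam) (2 * κ * τ)))) ?_
    fun a ha => (hasSum_term (by omega) l lam hτ (hi a ha) ha.2).tsum_eq
  refine (((differentiableOn_const _).fun_div ((diffOn_thC hO hσ hi).const_mul _)
    fun a ha => mul_ne_zero (thC_ne_zero hτ) (thC_ne_zero (hi a ha)))).fun_mul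
    ((diffOn_Q hO (by fun_prop) hσ (by fun_prop) hi (fun a ha => ?_)
      fun a ha => ?_).fun_mul (DifferentiableOn.fun_mul (by fun_prop) ?_))
  · have := theta_int_add_ne_zero hκ hl (e := -1) (by simp) ha.1
    rwa [show (l * a - 2 * (a / 2) : ℂ) = l * a + (-1 : ℤ) * a by push_cast; ring]
  · have := theta_int_add_ne_zero hκ hl (e := 1) (by simp) ha.1
    rwa [show (l * a + 2 * (a / 2) : ℂ) = l * a + (1 : ℤ) * a by push_cast; ring]
  · have hκτ : 0 < (2 * κ * τ : ℂ).im := by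
      rw [show (2 * κ * τ : ℂ) = ((2 * κ : ℝ) : ℂ) * τ by push_cast; ring, im_ofReal_mul]
      have : (0 : ℝ) < κ := by exact_mod_cast (by omega : 0 < κ)
      positivity
    refine differentiableOn_regInt hO (differentiableOn_const _) hσ hid (fun _ _ => hτ) hi
      (fun a ha => ha.2) (F := fun q => thF lam (l * q.1) τ (-(κ * q.1)) q.2 *
        jacobiTheta₂ (2 * q.2 + l * τ - κ * lam) (2 * κ * τ)) ?_ fun a ha t => ?_
    · have hv := NiceOn.var (S := lowA κ τ ×ˢ (univ : Set ℂ))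
      refine NiceOn.mul (NiceOn.mul (NiceOn.theta hS ((NiceOn.const lam).add hv) (NiceOn.const τ)
        fun _ _ => hτ) (NiceOn.theta hS (NiceOn.add
          (NiceOn.ofParam (a := fun a => l * a) (V := lowA κ τ) (by fun_prop) hmem) hv)
          (NiceOn.ofParam hσ hmem) fun q hq => hi _ hq.1)) (NiceOn.jacobi hS
          (((NiceOn.const 2).mul hv).add (NiceOn.const _) |>.sub (NiceOn.const _))
          (NiceOn.const _) fun _ _ => hκτ)
    · rw [(perEntire_thF lam (l * a) hτ (hi a ha)).2 t,
        show 2 * (t + 1) + l * τ - κ * lam = 2 * t + l * τ - κ * lam + 1 + 1 by ring,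
        jacobiTheta₂_add_left, jacobiTheta₂_add_left]

lemma differentiableOn_Delta (lam : ℂ) : HolOn (fun a => Delta l κ lam τ (a / 2)) (lowA κ τ) :=
  (differentiableOn_DeltaTilde hκ hl hτ lam).fun_sub (differentiableOn_DeltaTilde hκ hl hτ (-lam))

omit hl hτ in
lemma differentiableOn_uDiff (x : ℂ) : HolOn
    (fun a => uDiff κ l (-1 / -(κ * a)) (-τ / -(κ * a)) x) (coneA τ) := by
  have hO := isOpen_coneA τ
  have hσ0 : ∀ a ∈ coneA τ, 0 < (-(κ * a)).im := fun a ha => im_neg_mul_pos hκ ha.1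
  have hne : ∀ a ∈ coneA τ, -(κ * a) ≠ 0 := fun a ha => neg_mul_ne_zero hκ ha.1
  have h1 : ∀ a ∈ coneA τ, 0 < (-1 / -(κ * a)).im := fun a ha => im_neg_one_div_pos (hσ0 a ha)
  have h2 : ∀ a ∈ coneA τ, 0 < (-τ / -(κ * a)).im := fun a ha => im_neg_div_pos (by
    rw [neg_div, mul_div_assoc]
    exact im_neg_mul_pos hκ ha.2)
  have d1 : HolOn (fun a : ℂ => -1 / -(κ * a)) (coneA τ) :=
    (differentiableOn_const _).fun_div (by fun_prop) hne
  have d2 : HolOn (fun a : ℂ => -τ / -(κ * a)) (coneA τ) :=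
    (differentiableOn_const _).fun_div (by fun_prop) hne
  have key : ∀ mu : ℂ, HolOn
      (fun a => u (x / κ) mu (-1 / -(κ * a)) (-τ / -(κ * a)) (-1 / (2 * κ))) (coneA τ) := fun mu => by
    refine DifferentiableOn.congr ?_ fun a ha => u_neg_inv hκ (h1 a ha) (h2 a ha) (x / κ) mu
    refine ((((differentiableOn_const _).fun_div ((diffOn_thC hO d1 h1).fun_mul
      (diffOn_thC hO d2 h2)) fun a ha =>
      mul_ne_zero (thC_ne_zero (h1 a ha)) (thC_ne_zero (h2 a ha)))).fun_mul ?_).const_mul _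
    have hS : IsOpen (coneA τ ×ˢ (univ : Set ℂ)) := hO.prod isOpen_univ
    have hv := NiceOn.var (S := coneA τ ×ˢ (univ : Set ℂ))
    exact differentiableOn_regInt hO d1 d2 (differentiableOn_const _) h1 h2
      (fun a ha => notMem_polA_neg_inv hκ (h1 a ha) (h2 a ha))
      (F := fun q => thF (x / κ) mu (-1 / -(κ * q.1)) (-τ / -(κ * q.1)) q.2)
      (NiceOn.mul (NiceOn.theta hS ((NiceOn.const _).add hv)
        (NiceOn.ofParam d1 fun q hq => hq.1) fun q hq => h1 _ hq.1)
        (NiceOn.theta hS ((NiceOn.const _).add hv)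
        (NiceOn.ofParam d2 fun q hq => hq.1) fun q hq => h2 _ hq.1))
      fun a ha => (perEntire_thF (x / κ) mu (h1 a ha) (h2 a ha)).2
  exact (key _).fun_sub (key _)

omit hτ in
lemma differentiableOn_SMinus (j : ℤ) : HolOn (fun a => SMinus κ j l τ (a / 2)) (coneA τ) := by
  have hO := isOpen_coneA τ
  have hne : ∀ a ∈ coneA τ, -(κ * a) ≠ 0 := fun a ha => neg_mul_ne_zero hκ ha.1
  have h2 : ∀ a ∈ coneA τ, 0 < (-τ / -(κ * a)).im := fun a ha => im_neg_div_pos (by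
    rw [neg_div, mul_div_assoc]
    exact im_neg_mul_pos hκ ha.2)
  have hκ0 : (κ : ℂ) ≠ 0 := by exact_mod_cast (by omega : κ ≠ 0)
  have hth : ∀ e : ℤ, e = 1 ∨ e = -1 → ∀ a ∈ coneA τ,
      theta (l / κ + e / κ) (-τ / -(κ * a)) ≠ 0 := fun e he a ha => by
    refine theta_ne_zero (h2 a ha) fun m n h => ?_
    have hi := congrArg Complex.im h
    rw [show (l / κ + e / κ : ℂ) = ((l / κ + e / κ : ℝ) : ℂ) by push_cast; ring, ofReal_im, add_im,
      intCast_im, ← ofReal_intCast n, im_ofReal_mul, zero_add] at hi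
    have hn : n = 0 := by
      have := (mul_eq_zero.1 hi.symm).resolve_right (h2 a ha).ne'
      exact_mod_cast this
    rw [hn] at h
    field_simp at h
    have h' : l + e = κ * m := by
      have : ((l + e : ℤ) : ℂ) = ((κ * m : ℤ) : ℂ) := by
        push_cast
        linear_combination h
      exact_mod_cast this
    have := Int.le_of_dvd (by omega) (Dvd.intro m h'.symm)
    omega
  refine DifferentiableOn.congr (DifferentiableOn.fun_mul ?_ (differentiableOn_uDiff hκ (l := l) j))
    fun a ha => SMinus_eq hκ j l fun h => by
      have := ha.1
      rw [h] at this
      simp at this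
  refine diffOn_Q hO (differentiableOn_const _)
    ((differentiableOn_const _).fun_div (by fun_prop) hne) (differentiableOn_const _) h2
    (fun a ha => ?_) fun a ha => ?_
  · have := hth 1 (by simp) a ha
    rwa [show (l / κ - 2 * (-1 / (2 * κ)) : ℂ) = l / κ + (1 : ℤ) / κ by field_simp; push_cast; ring]
  · have := hth (-1) (by simp) a ha
    rwa [show (l / κ + 2 * (-1 / (2 * κ)) : ℂ) = l / κ + (-1 : ℤ) / κ by
      field_simp; push_cast; ring]

/-- The transformation formula under `τ ↦ -1/τ`, for `Im (η / τ) < 0`. -/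
lemma transformation_minus (lam : ℂ) {a : ℂ} (ha : a ∈ coneA τ \ excA κ τ) :
    CMinus κ τ (a / 2) * exp (-(π * I / (2 * τ)) * (κ + 2) * lam ^ 2) *
      Delta l κ (lam / τ) (-1 / τ) (a / 2 / τ) =
    ∑ j ∈ Finset.Icc (2 : ℤ) (κ - 2), Delta j κ lam τ (a / 2) * SMinus κ j l τ (a / 2) := by
  have hτ0 : τ ≠ 0 := by rintro rfl; simp at hτ
  have hO := isOpen_coneA_diff hκ hτ
  have hsub : coneA τ \ excA κ τ ⊆ lowA κ τ := fun b hb => ⟨hb.1.1, hb.2⟩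
  set V : Set ℂ := {b | ((b / τ).re < 0 ∧ (b / τ).im < 0) ∧ -(b / τ).re < 1 / 16 ∧
    12 * -(b / τ).im * |τ.re| < 5 * -(b / τ).re * τ.im ∧ 16 * -(b / τ).im < 5 * (-1 / τ).im} with hV
  have hVo : IsOpen V :=
    (IsOpen.and (isOpen_lt (by fun_prop) (by fun_prop)) (isOpen_lt (by fun_prop) (by fun_prop))).and
      ((isOpen_lt (by fun_prop) (by fun_prop)).and
        ((isOpen_lt (by fun_prop) (by fun_prop)).and (isOpen_lt (by fun_prop) (by fun_prop))))
  have hVne : (V ∩ coneA τ).Nonempty := by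
    -- `a / τ = -1 / 32 - q i` with `q` small
    have t0 : Tendsto (fun q : ℝ => 12 * q * |τ.re|) (𝓝[>] 0) (𝓝 0) :=
      (Continuous.tendsto' (by fun_prop) 0 0 (by simp)).mono_left nhdsWithin_le_nhds
    have t1 : Tendsto (fun q : ℝ => 16 * q) (𝓝[>] 0) (𝓝 0) :=
      (Continuous.tendsto' (by fun_prop) 0 0 (by simp)).mono_left nhdsWithin_le_nhds
    have hi := im_neg_one_div_pos hτ
    obtain ⟨q, ⟨hq1, hq2⟩, hq0⟩ := ((t0.eventually_lt_const
      (by positivity : 0 < 5 * (1 / 32) * τ.im)).and (t1.eventually_lt_const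
      (by positivity : 0 < 5 * (-1 / τ).im)) |>.and self_mem_nhdsWithin).exists
    have hq0 : 0 < q := hq0
    have e : τ * (-((1 / 32 : ℝ) : ℂ) - q * I) / τ = -((1 / 32 : ℝ) : ℂ) - q * I :=
      mul_div_cancel_left₀ _ hτ0
    have er : (-((1 / 32 : ℝ) : ℂ) - q * I).re = -(1 / 32) := by simp
    have ei : (-((1 / 32 : ℝ) : ℂ) - q * I).im = -q := by simp
    refine ⟨τ * (-((1 / 32 : ℝ) : ℂ) - q * I), ?_, ?_, ?_⟩
    · rw [hV, Set.mem_ofPred_eq, e, er, ei, neg_neg, neg_neg]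
      exact ⟨⟨by norm_num, by linarith⟩, by norm_num, hq1, hq2⟩
    · show (τ * _).im < 0
      rw [mul_im, er, ei]
      have := mul_le_mul_of_nonneg_left (neg_abs_le τ.re) hq0.le
      linarith
    · show (τ * _ / τ).im < 0
      rw [e, ei]; linarith
  refine eqOn_diff_countable (isOpen_coneA τ) (convex_coneA τ) (excA_countable hκ τ) hO
    (f := fun a => CMinus κ τ (a / 2) * exp (-(π * I / (2 * τ)) * (κ + 2) * lam ^ 2) *
      Delta l κ (lam / τ) (-1 / τ) (a / 2 / τ))
    (g := fun a => ∑ j ∈ Finset.Icc (2 : ℤ) (κ - 2), Delta j κ lam τ (a / 2) * SMinus κ j l τ (a / 2))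
    ?_ ?_ hVo hVne (fun b hb => ?_) ha
  · have hC : HolOn (fun a => CMinus κ τ (a / 2)) (coneA τ \ excA κ τ) := by
      refine DifferentiableOn.const_mul (DifferentiableOn.cexp ?_) _
      have hne : ∀ b ∈ coneA τ \ excA κ τ, 2 * (b / 2) * κ ≠ 0 := fun b hb h =>
        neg_mul_ne_zero hκ hb.1.1 (by linear_combination -h)
      have h1 : HolOn (fun b : ℂ => 1 / (2 * (b / 2) * κ)) (coneA τ \ excA κ τ) :=
        (differentiableOn_const _).fun_div (by fun_prop) hne
      unfold psi
      fun_prop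
    refine (hC.mul_const _).fun_mul ?_
    have hD := (differentiableOn_Delta hκ hl (im_neg_one_div_pos hτ) (lam / τ)).comp
      (s := coneA τ \ excA κ τ) (f := fun a => a / τ) (by fun_prop) fun b hb => ⟨hb.1.2, by
        have := notMem_polA_div hκ hτ hb.1.1 hb.1.2 hb.2
        show b / τ ∉ polA (-1 / τ) (-(κ * (b / τ)))
        rwa [← mul_div_assoc, ← neg_div]⟩
    exact hD.congr fun b _ => by rw [Function.comp_apply, div_right_comm]
  · refine DifferentiableOn.fun_sum fun j hj => ?_
    exact ((differentiableOn_Delta hκ (Finset.mem_Icc.1 hj) hτ lam).mono hsub).fun_mul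
      ((differentiableOn_SMinus hκ hl j).mono sdiff_subset)
  · obtain ⟨⟨⟨h0, h1⟩, h2, h3, h4⟩, hb⟩ := hb
    have e : b = τ * (-(-(b / τ).re : ℝ) - (-(b / τ).im : ℝ) * I) := by
      have := re_add_im (b / τ)
      push_cast
      rw [show -(-((b / τ).re : ℂ)) - -((b / τ).im : ℂ) * I = b / τ by linear_combination this]
      field_simp
    exact transformation_of_sumRegion (sumRegion_of_small hκ hτ hb.2 e (by linarith) (by linarith)
      h2 h3 h4) (notMem_polA_div hκ hτ hb.1.1 hb.1.2 hb.2) l lam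

end Fixed

local notation "conj" => starRingEnd ℂ

/-! ### The translation `τ ↦ τ + 1` -/

lemma theta_tau_add_one (z τ : ℂ) : theta z (τ + 1) = exp (π * I / 4) * theta z τ := by
  rw [theta, theta, mul_neg, ← tsum_mul_left]
  refine congrArg _ (tsum_congr fun n => ?_)
  obtain ⟨k, hk⟩ := Int.even_mul_succ_self n
  have hk' : (n : ℂ) * (n + 1) = k + k := by exact_mod_cast hk
  rw [← exp_add, exp_eq_exp_iff_exists_int]
  exact ⟨k, by linear_combination (π * I) * hk'⟩

lemma Omega_tau_add_one (a t τ σ : ℂ) : Omega a t (τ + 1) σ = Omega a t τ σ := by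
  have h : ∀ (z : ℂ) (n : ℕ), exp (2 * π * I * (z + n)) = exp (2 * π * I * z) :=
    fun z n => exp_eq_exp_iff_exists_int.2 ⟨n, by push_cast; ring⟩
  refine tprod_congr fun p => ?_
  have e1 : ∀ z : ℂ, z + p.1 * (τ + 1) + p.2 * σ = z + p.1 * τ + p.2 * σ + p.1 := fun z => by ring
  have e2 : ∀ z : ℂ, z + (p.1 + 1) * (τ + 1) + (p.2 + 1) * σ =
      z + (p.1 + 1) * τ + (p.2 + 1) * σ + (p.1 + 1 : ℕ) := fun z => by push_cast; ring
  rw [e1, e1, e2, e2, h, h, h, h]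

lemma polarSet_tau_add_one (τ σ : ℂ) : polarSet (τ + 1) σ = polarSet τ σ := by
  ext η
  constructor
  · rintro ⟨l, m, n, h⟩
    exact ⟨l + m, m, n, by push_cast; linear_combination h⟩
  · rintro ⟨l, m, n, h⟩
    exact ⟨l - m, m, n, by push_cast; linear_combination h⟩

lemma u_tau_add_one (lam mu : ℂ) {τ σ η : ℂ} (hτ : 0 < τ.im) (hσ : 0 < σ.im)
    (h : η ∉ polarSet τ σ) : u lam mu (τ + 1) σ η = u lam mu τ σ η := by
  have h1 := isContinuation_u lam mu (τ := τ + 1) (by simpa using hτ) hσ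
  refine IsContinuation.eqOn hτ hσ ⟨?_, fun η hη => ?_⟩ (isContinuation_u lam mu hτ hσ) h
  · have := h1.1
    rwa [polarSet_tau_add_one] at this
  · rw [h1.2 η hη, uUpper, uUpper]
    congr 2
    funext t
    rw [integrand, integrand, Omega_tau_add_one, theta_tau_add_one, theta_tau_add_one]
    have := exp_ne_zero (π * I / 4)
    generalize exp (π * I / 4) = e at *
    rw [mul_assoc e, mul_assoc e, mul_left_comm _ e, mul_div_mul_left _ _ this]

lemma Delta_tau_add_one {κ : ℤ} (hκ : κ ≠ 0) (l : ℤ) (lam : ℂ) {τ η : ℂ} (hτ : 0 < τ.im)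
    (hσ : 0 < (-2 * η * κ).im) (h : η ∉ polarSet τ (-2 * η * κ)) :
    Delta l κ lam (τ + 1) η = exp (π * I / (2 * κ) * (l : ℂ) ^ 2) * Delta l κ lam τ η := by
  have hκ0 : (κ : ℂ) ≠ 0 := by exact_mod_cast hκ
  have key : ∀ lam, DeltaTilde l κ lam (τ + 1) η =
      exp (π * I / (2 * κ) * (l : ℂ) ^ 2) * DeltaTilde l κ lam τ η := fun lam => by
    rw [DeltaTilde, DeltaTilde, ← tsum_mul_left]
    refine tsum_congr fun m => ?_
    rw [term, term, u_tau_add_one _ _ hτ hσ h, mul_left_comm, ← exp_add]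
    refine congrArg _ (exp_eq_exp_iff_exists_int.2 ⟨κ * m ^ 2 + m * l, ?_⟩)
    push_cast
    field_simp
    ring
  rw [Delta, Delta, key, key, mul_sub]

/-! ### Complex conjugation -/

lemma conj_theta (z τ : ℂ) : conj (theta z τ) = theta (conj z) (-conj τ) := by
  rw [theta, theta, map_neg, conj_tsum, ← (Equiv.subLeft (-1 : ℤ)).tsum_eq]
  refine congrArg _ (tsum_congr fun n => ?_)
  rw [← exp_conj]
  congr 1
  simp [map_ofNat]
  ring

lemma conj_deriv_theta (τ : ℂ) :
    conj (deriv (fun z => theta z τ) 0) = deriv (fun z => theta z (-conj τ)) 0 := by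
  have h : (fun z => theta z (-conj τ)) = conj ∘ (fun z => theta z τ) ∘ conj := by
    funext z
    simp [conj_theta]
  rw [h, deriv_conj_conj]
  simp

lemma conj_Q (mu σ η : ℂ) : conj (Q mu σ η) = -Q (-conj mu) (-conj σ) (-conj η) := by
  have e1 : conj (4 * η) = -(4 * -conj η) := by simp [map_ofNat]
  have e2 : conj (mu - 2 * η) = -(-conj mu - 2 * -conj η) := by simp [map_ofNat]; ring
  have e3 : conj (mu + 2 * η) = -(-conj mu + 2 * -conj η) := by simp [map_ofNat]; ring
  rw [Q, Q, map_div₀, map_mul, map_mul, conj_theta, conj_theta, conj_theta, conj_deriv_theta, e1, e2,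
    e3, theta_neg, theta_neg, theta_neg]
  ring

lemma conj_Omega (a t τ σ : ℂ) :
    conj (Omega a t τ σ) = Omega (-conj a) (-conj t) (-conj τ) (-conj σ) := by
  rw [Omega, Omega, Function.LeftInverse.map_tprod (g := conj) (g' := conj) _ continuous_conj
    continuous_conj fun z => conj_conj z]
  refine tprod_congr fun p => ?_
  simp only [map_div₀, map_mul, map_sub, map_one, ← exp_conj, map_add, map_neg, conj_I, conj_ofReal,
    map_natCast, map_ofNat]
  ring_nf

lemma integrand_add_one (lam mu τ σ η t : ℂ) :
    integrand lam mu τ σ η (t + 1) = integrand lam mu τ σ η t := by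
  have h : ∀ z : ℂ, exp (2 * π * I * (z + 1)) = exp (2 * π * I * z) :=
    fun z => exp_eq_exp_iff_exists_int.2 ⟨1, by push_cast; ring⟩
  have h' : ∀ z : ℂ, exp (2 * π * I * (z - 1)) = exp (2 * π * I * z) :=
    fun z => exp_eq_exp_iff_exists_int.2 ⟨-1, by push_cast; ring⟩
  have hΩ : Omega (2 * η) (t + 1) τ σ = Omega (2 * η) t τ σ := by
    refine tprod_congr fun p => ?_
    rw [← h (t - 2 * η + p.1 * τ + p.2 * σ), ← h (t + 2 * η + p.1 * τ + p.2 * σ),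
      ← h' (-t - 2 * η + (p.1 + 1) * τ + (p.2 + 1) * σ),
      ← h' (-t + 2 * η + (p.1 + 1) * τ + (p.2 + 1) * σ)]
    ring_nf
  rw [integrand, integrand, hΩ, ← add_assoc, ← add_assoc, add_sub_right_comm, theta_add_one,
    theta_add_one, theta_add_one, theta_add_one, neg_mul_neg, neg_mul_neg]

lemma conj_uUpper (lam mu τ σ η : ℂ) : conj (uUpper lam mu τ σ η) =
    uUpper (-conj lam) (-conj mu) (-conj τ) (-conj σ) (-conj η) := by
  have h : ∀ t : ℝ, conj (integrand lam mu τ σ η t) =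
      integrand (-conj lam) (-conj mu) (-conj τ) (-conj σ) (-conj η) ((-t : ℝ) : ℂ) := fun t => by
    have e : ∀ x y : ℂ, theta (conj (x + t)) (-conj y) = -theta (-conj x + -t) (-conj y) :=
      fun x y => by rw [← theta_neg]; simp [add_comm]
    have e' : ∀ y : ℂ, theta (conj (t - 2 * η)) (-conj y) =
        -theta (-t - 2 * -conj η) (-conj y) := fun y => by
      rw [← theta_neg]; simp [sub_eq_add_neg, add_comm, map_ofNat]
    rw [integrand, integrand, map_div₀, map_mul, map_mul, map_mul, conj_Omega]
    simp only [conj_theta, e, e', neg_mul_neg]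
    simp [map_ofNat]
  rw [uUpper, uUpper, map_mul, ← intervalIntegral.intervalIntegral_conj, ← exp_conj]
  simp only [h]
  rw [intervalIntegral.integral_comp_neg fun t : ℝ =>
    integrand (-conj lam) (-conj mu) (-conj τ) (-conj σ) (-conj η) t]
  have hper : Function.Periodic (fun t : ℝ =>
      integrand (-conj lam) (-conj mu) (-conj τ) (-conj σ) (-conj η) t) 1 := fun t => by
    beta_reduce
    rw [ofReal_add, ofReal_one, integrand_add_one]
  have := hper.intervalIntegral_add_eq (-1) 0
  norm_num [map_ofNat] at this ⊢
  rw [this]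

lemma neg_conj_mem_polarSet {τ σ η : ℂ} (h : -conj η ∈ polarSet τ σ) :
    η ∈ polarSet (-conj τ) (-conj σ) := by
  obtain ⟨l, m, n, h⟩ := h
  have := congrArg conj h
  simp [map_ofNat] at this
  exact ⟨-l, m, n, by push_cast; linear_combination -this⟩

/-- By uniqueness of the analytic continuation. -/
lemma conj_u (lam mu : ℂ) {τ σ η : ℂ} (hτ : 0 < τ.im) (hσ : 0 < σ.im) (h : η ∉ polarSet τ σ) :
    conj (u lam mu τ σ η) = u (-conj lam) (-conj mu) (-conj τ) (-conj σ) (-conj η) := by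
  have hτ' : 0 < (-conj τ).im := by simpa using hτ
  have hσ' : 0 < (-conj σ).im := by simpa using hσ
  have hu := isContinuation_u lam mu hτ hσ
  have hc : IsContinuation (-conj lam) (-conj mu) (-conj τ) (-conj σ)
      fun η => conj (u lam mu τ σ (-conj η)) := by
    refine ⟨DifferentiableOn.analyticOnNhd (fun η hη => ?_) (isOpen_compl_polarSet hτ' hσ'), fun η hη => ?_⟩
    · have h1 := (hu.1 (-conj η) fun hm => hη (neg_conj_mem_polarSet hm)).differentiableAt
      have h2 : DifferentiableAt ℂ (fun z => u lam mu τ σ (-z)) (conj η) :=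
        DifferentiableAt.comp (g := u lam mu τ σ) (f := fun z => -z) (conj η) h1 differentiableAt_id.neg
      have h3 := h2.conj_conj
      rw [conj_conj] at h3
      exact h3.differentiableWithinAt
    · beta_reduce
      rw [hu.2 _ (by simpa using hη), conj_uUpper, map_neg, conj_conj, neg_neg]
  have := IsContinuation.eqOn hτ' hσ' hc (isContinuation_u _ _ hτ' hσ') (x := -conj η)
    fun hm => h (by simpa using neg_conj_mem_polarSet hm)
  simpa using this

lemma conj_Delta (l κ : ℤ) (lam : ℂ) {τ η : ℂ} (hτ : 0 < τ.im) (hσ : 0 < (-2 * η * κ).im)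
    (h : η ∉ polarSet τ (-2 * η * κ)) :
    conj (Delta l κ lam τ η) = -Delta l κ (-conj lam) (-conj τ) (-conj η) := by
  have key : ∀ lam, conj (DeltaTilde l κ lam τ η) =
      -DeltaTilde l κ (-conj lam) (-conj τ) (-conj η) := fun lam => by
    rw [DeltaTilde, DeltaTilde, conj_tsum, ← tsum_neg]
    refine tsum_congr fun m => ?_
    rw [term, term, map_mul, map_mul, conj_u _ _ hτ hσ h, conj_Q, ← exp_conj]
    simp only [map_mul, map_add, map_div₀, map_pow, map_neg, conj_I, conj_ofReal, map_intCast,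
      map_ofNat, neg_mul, mul_neg, neg_neg]
    congr 2
    ring_nf
  rw [Delta, Delta, map_sub, key, key, map_neg]
  ring

lemma conj_SMinus {κ : ℤ} (hκ : 4 ≤ κ) (j l : ℤ) {τ η : ℂ} (h1 : 0 < (1 / (2 * η * κ)).im)
    (h2 : 0 < (τ / (2 * η * κ)).im) :
    conj (SMinus κ j l τ η) = -SPlus κ j l (-conj τ) (-conj η) := by
  have hp := notMem_polA_neg_inv hκ h1 h2
  have hκ0 : (κ : ℂ) ≠ 0 := by exact_mod_cast (by omega : κ ≠ 0)
  have e : (-1 / κ / 2 : ℂ) = -1 / (2 * κ) := by field_simp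
  have hp' := hp
  rw [mem_polA_iff, e] at hp'
  have hn : ∀ mu : ℂ, conj (u (j / κ) mu (1 / (2 * η * κ)) (τ / (2 * η * κ)) (-1 / (2 * κ))) =
      u (j / κ) (conj mu) (1 / (2 * -conj η * κ)) (-(-conj τ / (2 * -conj η * κ))) (1 / (2 * κ)) :=
    fun mu => by
    rw [← e, ← u_neg_neg _ _ h1 h2 hp, e, conj_u _ _ h1 h2 hp']
    simp [map_ofNat]
    ring_nf
  rw [SMinus, SPlus, map_mul, map_sub, conj_Q, hn, hn]
  have e1 : -conj (l / κ : ℂ) = -(l / κ) := by simp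
  rw [e1, Q_neg]
  simp [map_ofNat]
  refine Or.inl ?_
  ring_nf

lemma conj_CMinus {κ : ℤ} (hκ : 4 ≤ κ) {τ : ℂ} (hτ : 0 < τ.im) (η : ℂ) :
    conj (CMinus κ τ η) = CPlus κ (-conj τ) (-conj η) := by
  have harg : (2 * κ * I / τ).arg ≠ π := by
    have hτ0 : τ ≠ 0 := by rintro rfl; simp at hτ
    have hκ1 : (0 : ℝ) < κ := by exact_mod_cast (by omega : 0 < κ)
    have hn := normSq_pos.2 hτ0
    have hre : 0 < (2 * κ * I / τ).re := by
      rw [div_eq_mul_inv, inv_def, show 2 * κ * I * (conj τ * ((normSq τ)⁻¹ : ℝ)) =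
        ((2 * κ * (normSq τ)⁻¹ : ℝ) : ℂ) * (I * conj τ) by push_cast; ring, re_ofReal_mul, I_mul_re,
        conj_im, neg_neg]
      positivity
    intro h
    have := abs_arg_lt_pi_div_two_iff.2 (Or.inl hre)
    rw [h, abs_of_pos Real.pi_pos] at this
    linarith [Real.pi_pos]
  rw [CMinus, CPlus, map_mul, map_mul, ← exp_conj,
    show (2 * κ * I / -conj τ : ℂ) = conj (2 * κ * I / τ) by simp [map_ofNat, neg_div, div_neg],
    conj_cpow _ _ harg]
  simp [psi, map_ofNat]
  refine Or.inl ?_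
  ring_nf

/-- The transformation formula under `τ ↦ -1/τ`, for `Im (η / τ) > 0`. -/
lemma transformation_plus {κ : ℤ} (hκ : 4 ≤ κ) {l : ℤ} (hl : 2 ≤ l ∧ l ≤ κ - 2) {τ a : ℂ}
    (hτ : 0 < τ.im) (ha : a.im < 0) (haτ : 0 < (a / τ).im) (hp : a ∉ polA τ (-(κ * a))) (lam : ℂ) :
    CPlus κ τ (a / 2) * exp (-(π * I / (2 * τ)) * (κ + 2) * lam ^ 2) *
      Delta l κ (lam / τ) (-1 / τ) (-(a / 2 / τ)) =
    ∑ j ∈ Finset.Icc (2 : ℤ) (κ - 2), Delta j κ lam τ (a / 2) * SPlus κ j l τ (a / 2) := by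
  have hτ' : 0 < (-conj τ).im := by simpa using hτ
  have ha' : (-conj a).im < 0 := by simpa using ha
  have haτ' : (-conj a / -conj τ).im < 0 := by
    rw [neg_div_neg_eq, ← map_div₀, conj_im]
    linarith
  have hp' : -conj a ∉ polA (-conj τ) (-(κ * -conj a)) := by
    rw [notMem_polA_iff_of_im_neg hκ hτ ha] at hp
    rw [notMem_polA_iff_of_im_neg hκ hτ' ha']
    intro j hj m hm
    have := congrArg conj hm
    simp [map_ofNat] at this
    exact hp j hj (-m) (by push_cast; linear_combination -this)
  have main := congrArg conj
    (transformation_minus hκ hl hτ' (-conj lam) (a := -conj a) ⟨⟨ha', haτ'⟩, hp'⟩)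
  have eσ : ∀ b : ℂ, -2 * (b / 2) * κ = -(κ * b) := fun b => by ring
  have hD : ∀ {j : ℤ} {lam τ b : ℂ}, 0 < τ.im → b.im < 0 → b ∉ polA τ (-(κ * b)) →
      conj (Delta j κ lam τ (b / 2)) = -Delta j κ (-conj lam) (-conj τ) (-conj b / 2) :=
    fun {j lam τ b} h1 h2 h3 => by
    rw [conj_Delta _ _ _ h1 (by rw [eσ]; exact im_neg_mul_pos hκ h2)
      (by rw [eσ, ← mem_polA_iff]; exact h3)]
    simp [map_ofNat, neg_div]
  have h3 : -conj a / -conj τ ∉ polA (-1 / -conj τ) (-(κ * (-conj a / -conj τ))) := by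
    rw [← mul_div_assoc, ← neg_div (-conj τ) (κ * -conj a)]
    exact notMem_polA_div hκ hτ' ha' haτ' hp'
  have hσ := im_neg_mul_pos hκ ha'
  have hE1 : 0 < (1 / (2 * (-conj a / 2) * κ)).im := by
    have := im_neg_one_div_pos hσ
    rwa [show (1 / (2 * (-conj a / 2) * κ) : ℂ) = -1 / -(κ * -conj a) by
      rw [neg_div_neg_eq]; congr 1; ring]
  have hE2 : 0 < (-conj τ / (2 * (-conj a / 2) * κ)).im := by
    have : 0 < (-(-conj τ) / -(κ * -conj a)).im := im_neg_div_pos (by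
      rw [neg_div, mul_div_assoc]
      exact im_neg_mul_pos hκ haτ')
    rwa [show (-conj τ / (2 * (-conj a / 2) * κ) : ℂ) = -(-conj τ) / -(κ * -conj a) by
      rw [neg_div_neg_eq]; ring]
  rw [map_mul, map_mul, conj_CMinus hκ hτ', ← exp_conj, div_right_comm,
    hD (im_neg_one_div_pos hτ') haτ' h3, map_sum] at main
  simp only [map_mul, hD hτ' ha' hp', conj_SMinus hκ _ l hE1 hE2, neg_mul_neg] at main
  have e1 : -conj (-conj τ) = τ := by simp
  have e2 : -conj (-conj a / 2) = a / 2 := by simp [map_ofNat, neg_div]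
  have e3 : -conj (-conj a) / 2 = a / 2 := by simp
  have e4 : -conj (-conj lam) = lam := by simp
  have e5 : -conj (-conj a / -conj τ) / 2 = -(a / 2 / τ) := by simp; ring
  have e6 : -conj (-1 / -conj τ) = -1 / τ := by simp [neg_div]
  have e7 : -conj (-conj lam / -conj τ) = -(lam / τ) := by simp
  rw [e1, e2, e3, e4, e5, e6, e7] at main
  rw [← main, Delta, Delta, neg_neg, neg_sub]
  congr 2
  simp [map_ofNat, neg_div, div_neg]

end

end HypTheta

theorem theorem4p1 (κ : ℤ) (hκ : 4 ≤ κ) (τ η : ℂ) (hτ : 0 < τ.im) (hη : η.im < 0)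
    (hgen : ∀ (j : ℕ), 1 ≤ j → ∀ m : ℤ, (j : ℂ) * τ + 4 * η ≠ m)
    (l : ℤ) (hl : 2 ≤ l ∧ l ≤ κ - 2) :
    -- the defining series converges absolutely
    (∀ lam : ℂ, Summable fun m : ℤ => HypTheta.term κ (2 * κ * m + l) lam τ η) ∧
    -- (i)
    (∀ lam : ℂ, HypTheta.Delta l κ lam (τ + 1) η =
      Complex.exp (Real.pi * Complex.I / (2 * κ) * (l : ℂ) ^ 2) * HypTheta.Delta l κ lam τ η) ∧
    -- (ii)
    ((η / τ).im < 0 → ∀ lam : ℂ, HypTheta.CMinus κ τ η *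
          Complex.exp (-(Real.pi * Complex.I / (2 * τ)) * (κ + 2) * lam ^ 2) *
          HypTheta.Delta l κ (lam / τ) (-1 / τ) (η / τ) =
        ∑ j ∈ Finset.Icc (2 : ℤ) (κ - 2), HypTheta.Delta j κ lam τ η * HypTheta.SMinus κ j l τ η) ∧
    -- (iii)
    (0 < (η / τ).im → ∀ lam : ℂ, HypTheta.CPlus κ τ η *
          Complex.exp (-(Real.pi * Complex.I / (2 * τ)) * (κ + 2) * lam ^ 2) *
          HypTheta.Delta l κ (lam / τ) (-1 / τ) (-(η / τ)) =
        ∑ j ∈ Finset.Icc (2 : ℤ) (κ - 2),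
          HypTheta.Delta j κ lam τ η * HypTheta.SPlus κ j l τ η) := by
  have hκ0 : κ ≠ 0 := by omega
  obtain ⟨a, rfl⟩ : ∃ a, η = a / 2 := ⟨2 * η, by ring⟩
  have e4 : 4 * (a / 2) = 2 * a := by ring
  have eσ : -2 * (a / 2) * κ = -(κ * a) := by ring
  have ha : a.im < 0 := by
    rw [show a / 2 = ((1 / 2 : ℝ) : ℂ) * a by push_cast; ring, Complex.im_ofReal_mul] at hη
    linarith
  have hdiv : (a / 2 / τ).im = 1 / 2 * (a / τ).im := by
    rw [← Complex.im_ofReal_mul]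
    push_cast
    ring_nf
  have hσ := HypTheta.im_neg_mul_pos hκ ha
  have hp : a ∉ HypTheta.polA τ (-(κ * a)) :=
    (HypTheta.notMem_polA_iff_of_im_neg hκ hτ ha).2 (by rwa [e4] at hgen)
  refine ⟨fun lam => (HypTheta.hasSum_term (by omega) l lam hτ hσ hp).summable,
    fun lam => HypTheta.Delta_tau_add_one hκ0 l lam hτ (by rwa [eσ])
      (by rwa [eσ, ← HypTheta.mem_polA_iff]), fun h lam => ?_, fun h lam => ?_⟩
  · exact HypTheta.transformation_minus hκ hl hτ lam ⟨⟨ha, show (a / τ).im < 0 by linarith⟩, hp⟩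
  · exact HypTheta.transformation_plus hκ hl hτ ha (by linarith) hp lam
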